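/- Let $F$ be a non-archimedean local field with residue field of size $q$ and normalized absolute value $|\cdot|$, let $D$ be a central division algebra of degree $n$ over $F$ (so $\dim_F D=n^2$) with reduced norm $\mathrm{Nrd}$, ring of integers $\mathcal O_D$, maximal ideal $\mathfrak p$, and valuation $v$ normalized by $|\mathrm{Nrd}\,g|=q^{-v(g)}$. Put $U_0=\mathcal O_D^*$ and $U_m=1+\mathfrak p^m$ for $m\ge1$. Let $d^*x$ be the Haar measure on $D^*$ with $\mathrm{vol}(\mathcal O_D^*)=1$ and let $d^+x=|\mathrm{Nrd}\,x|^n\,d^*x$, a Haar measure on $D$. Let $\pi_1,\pi_2$ be irreducible (finite-dimensional, smooth) unitary representations of $D^*$, with characters $\chi_{\pi_i}$ and dimensions $d_{\pi_i}$. Define: * $\mathrm{dist}_{\pi_1,\pi_2}$, the smallest integer $m\ge0$ with $\mathrm{Hom}_{U_m}(\pi_1,\pi_2)\ne0$; * $\iota_{\pi_1,\pi_2}=\int_{D^*}\max(v(g-1),0)\,\chi_{\pi_1}(g)\chi_{\pi_2}(g^{-1})\,d^*g$ (an absolutely convergent integral), and $\iota_\pi=\iota_{\pi,\pi}$; * $t=t(\pi)$,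 the number of unramified characters $\omega$ of $D^*$ (characters trivial on $\mathcal O_D^*$) such that $\pi\otimes\omega\simeq\pi$. Let $P$ (resp. $\bar P$) be the group of upper (resp. lower) triangular matrices in $\mathrm{GL}_2(D)$. For $s\in\mathbb C$ let $I_P(\pi_1\otimes\pi_2,s)$ (resp. $I_{\bar P}(\pi_1\otimes\pi_2,s)$) be the normalized parabolic induction to $\mathrm{GL}_2(D)$ of $\pi_1|\mathrm{Nrd}|^{s/2}\otimes\pi_2|\mathrm{Nrd}|^{-s/2}$ from $P$ (resp. of $\pi_1|\mathrm{Nrd}|^{-s/2}\otimes\pi_2|\mathrm{Nrd}|^{s/2}$ from $\bar P$). Let $$M_P(s):I_P(\pi_1\otimes\pi_2,s)\to I_{\bar P}(\pi_1\otimes\pi_2,-s),\qquad M_{\bar P}(s):I_{\bar P}(\pi_1\otimes\pi_2,s)\to I_P(\pi_1\otimes\pi_2,-s)$$ be the intertwining operators $$M_P(s)\varphi(g)=\int_D\varphi\left(\begin{pmatrix}1&0\\x&1\end{pmatrix}g\right)d^+x,\qquad M_{\bar P}(s)\varphi(g)=\int_D\varphi\left(\begin{pmatrix}1&x\\0&1\end{pmatrix}g\right)d^+x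 .$$ These integrals converge absolutely for $\mathrm{Re}\,s>0$, and the operators are defined for all $s$, outside the poles, by meromorphic continuation along flat sections (families $\varphi_s$ whose restriction to $\mathrm{GL}_2(\mathcal O_D)$ does not depend on $s$). Then $M_{\bar P}(-s)M_P(s)$ acts on $I_P(\pi_1\otimes\pi_2,s)$ by a scalar, denoted $\mu_{\pi_1,\pi_2}(s)^{-1}$ (and $\mu_\pi=\mu_{\pi,\pi}$), which is given as follows. 1. If $\mathrm{dist}_{\pi_1,\pi_2}>0$, then for all $s\in\mathbb C$ $$\mu_{\pi_1,\pi_2}(s)^{-1}=\frac{\iota_{\pi_1,\pi_2}}{d_{\pi_1}d_{\pi_2}}.$$ 2. If $\pi_1=\pi_2=\pi$, then for all $s\in\mathbb C$ with $q^{ts}\ne1$ $$\mu_\pi(s)^{-1}=\frac1{d_\pi^2}\left(\iota_\pi+\frac{t^2}{(1-q^{ts})(1-q^{-ts})}\right).$$ -/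

import Mathlib

open MeasureTheory
open scoped TensorProduct

noncomputable section

namespace DivAlg

/-! ### The local field `F` and the division algebra `D` -/

section Basic

variable (F : Type*) [Field F] [ValuativeRel F] [TopologicalSpace F]
  [IsNonarchimedeanLocalField F]

open ValuativeRel Valued.integer in
/-- The cardinality `q` of the residue field of `F`. -/
def resCard : ℕ := Nat.card 𝓀[F]

open Classical in
/-- The normalized absolute value of `F`: it sends a uniformizer to `q⁻¹`. -/
def normAbs (x : F) : ℝ :=
  if x = 0 then 0
  else (resCard F : ℝ) ^
    (WithZero.log (IsNonarchimedeanLocalField.valueGroupWithZeroIsoInt F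
      (ValuativeRel.valuation F x)))

variable {D : Type*} [DivisionRing D] [Algebra F D]

/-- `|Nrd x|` for `x` in a central division algebra `D` of degree `n` over `F`. As
`N_{D/F} = Nrd ^ n`, where `N_{D/F}(x)` is the determinant of left multiplication by `x`,
this is the `n`-th root of `|N_{D/F}(x)|`. -/
def absNrd (n : ℕ) (x : D) : ℝ := normAbs F (Algebra.norm F x) ^ ((n : ℝ)⁻¹)

/-- The normalized valuation `v` of `D`: `|Nrd x| = q ^ (-v x)` for `x ≠ 0`. -/
def val (n : ℕ) (x : D) : ℝ := -Real.logb (resCard F) (absNrd F n x)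

/-- `U 0` is the group of units `O_D^*`; for `m ≥ 1`, `U m = 1 + 𝔭 ^ m` is the `m`-th principal
congruence subgroup. -/
def U (n m : ℕ) : Set Dˣ :=
  {g | absNrd F n (g : D) = 1 ∧
    absNrd F n ((g : D) - 1) ≤ ((resCard F : ℝ) ^ m)⁻¹}

end Basic

/-! ### Irreducible unitary representations of `D^*` and their invariants -/

section Reps

variable {D : Type*} [DivisionRing D]
variable {V V₁ V₂ : Type*}
  [NormedAddCommGroup V] [InnerProductSpace ℂ V]
  [NormedAddCommGroup V₁] [InnerProductSpace ℂ V₁]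
  [NormedAddCommGroup V₂] [InnerProductSpace ℂ V₂]

/-- `π` is a smooth irreducible unitary representation. -/
structure IsIrredUnitary [TopologicalSpace D] (π : Representation ℂ Dˣ V) : Prop where
  irreducible : π.IsIrreducible
  unitary : ∀ g v, ‖π g v‖ = ‖v‖
  smooth : ∀ v, ∃ H : OpenSubgroup Dˣ, ∀ h ∈ H, π h v = v

variable (F : Type*) [Field F] [ValuativeRel F] [TopologicalSpace F]
  [IsNonarchimedeanLocalField F] [Algebra F D]

/-- `dist(π₁, π₂)`: the smallest `m ≥ 0` such that `Hom_{U m}(π₁, π₂) ≠ 0`. -/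
def distRep (n : ℕ) (π₁ : Representation ℂ Dˣ V₁) (π₂ : Representation ℂ Dˣ V₂) : ℕ :=
  sInf {m | ∃ T : V₁ →ₗ[ℂ] V₂, T ≠ 0 ∧ ∀ g ∈ U (D := D) F n m, ∀ v, T (π₁ g v) = π₂ g (T v)}

/-- The integrand `max(v(g - 1), 0) χ₁(g) χ₂(g⁻¹)` in the definition of `ι`. -/
def iotaIntegrand (n : ℕ) (π₁ : Representation ℂ Dˣ V₁) (π₂ : Representation ℂ Dˣ V₂)
    (g : Dˣ) : ℂ :=
  ((max (val F n ((g : D) - 1)) 0 : ℝ) : ℂ) *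
    (LinearMap.trace ℂ V₁ (π₁ g) * LinearMap.trace ℂ V₂ (π₂ g⁻¹))

/-- `ι_{π₁, π₂}`, with respect to the measure `μ` on `D^*`. -/
def iota [MeasurableSpace D] (n : ℕ) (μ : Measure Dˣ)
    (π₁ : Representation ℂ Dˣ V₁) (π₂ : Representation ℂ Dˣ V₂) : ℂ :=
  ∫ g, iotaIntegrand F n π₁ π₂ g ∂μ

/-- The number `t(π)` of unramified characters `ω` of `D^*` (characters trivial on `O_D^*`) such
that `π ⊗ ω ≃ π`. -/
def twistNumber (n : ℕ) (π : Representation ℂ Dˣ V) : ℕ :=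
  Nat.card {ω : Dˣ →* ℂˣ // (∀ u ∈ U (D := D) F n 0, ω u = 1) ∧
    ∃ T : V ≃ₗ[ℂ] V, ∀ g v, T ((ω g : ℂ) • π g v) = π g (T v)}

/-- The additive measure `d⁺x = |Nrd x| ^ n d^*x` on `D`. -/
def addMeasure [MeasurableSpace D] (n : ℕ) (μ : Measure Dˣ) : Measure D :=
  (μ.withDensity fun x : Dˣ => ENNReal.ofReal (absNrd F n (x : D) ^ n)).map Units.val

end Reps

/-! ### Meromorphic continuation -/

section Mero

variable {E : Type*} [NormedAddCommGroup E] [NormedSpace ℂ E]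

/-- `h` is the meromorphic continuation to `ℂ` of the restriction of `f` to `Re s > 0`,
normalized to be `0` at its poles and to have no removable singularities. Such an `h` is unique. -/
def IsMeroCont (f h : ℂ → E) : Prop :=
  MeromorphicNFOn h Set.univ ∧ ∀ s : ℂ, 0 < s.re → h s = f s

/-- The meromorphic continuation to `ℂ` of the restriction of `f` to `Re s > 0`. -/
def meroCont (f : ℂ → E) : ℂ → E := Classical.epsilon (IsMeroCont f)

end Mero

/-! ### Induced representations and intertwining operators -/

section Induced

variable (D : Type*) [DivisionRing D]

/-- `GL_2(D)`. -/
abbrev GL2 : Type _ := (Matrix (Fin 2) (Fin 2) D)ˣ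

variable {D}

/-- The upper triangular unipotent matrix with entry `x`. -/
def upperUnip (x : D) : GL2 D where
  val := !![1, x; 0, 1]
  inv := !![1, -x; 0, 1]
  val_inv := by simp [Matrix.one_fin_two]
  inv_val := by simp [Matrix.one_fin_two]

/-- The lower triangular unipotent matrix with entry `x`. -/
def lowerUnip (x : D) : GL2 D where
  val := !![1, 0; x, 1]
  inv := !![1, 0; -x, 1]
  val_inv := by simp [Matrix.one_fin_two]
  inv_val := by simp [Matrix.one_fin_two]

variable (F : Type*) [Field F] [ValuativeRel F] [TopologicalSpace F]
  [IsNonarchimedeanLocalField F] [Algebra F D]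

/-- The maximal compact subgroup `GL_2(O_D)`: the entries of `g` and of `g⁻¹` are in `O_D`. -/
def maxCompact (n : ℕ) : Set (GL2 D) :=
  {g | (∀ i j, absNrd F n ((g : Matrix (Fin 2) (Fin 2) D) i j) ≤ 1) ∧
    ∀ i j, absNrd F n (((g⁻¹ : GL2 D) : Matrix (Fin 2) (Fin 2) D) i j) ≤ 1}

variable {V₁ V₂ : Type*}
  [NormedAddCommGroup V₁] [InnerProductSpace ℂ V₁]
  [NormedAddCommGroup V₂] [InnerProductSpace ℂ V₂]
  [TopologicalSpace D]

/-- The space of `I_P(π₁ ⊗ π₂, s)`, the normalized induction of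
`π₁|Nrd|^{s/2} ⊗ π₂|Nrd|^{-s/2}` from the upper triangular parabolic `P` (the modulus character
of `P` is `|Nrd a / Nrd b| ^ n`). -/
def indP (n : ℕ) (π₁ : Representation ℂ Dˣ V₁) (π₂ : Representation ℂ Dˣ V₂) (s : ℂ) :
    Set (GL2 D → V₁ ⊗[ℂ] V₂) :=
  {φ | (∃ H : OpenSubgroup (GL2 D), ∀ g, ∀ k ∈ H, φ (g * k) = φ g) ∧
    ∀ (p : GL2 D) (a b : Dˣ) (x : D),
      (p : Matrix (Fin 2) (Fin 2) D) = !![(a : D), x; 0, (b : D)] → ∀ g,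
      φ (p * g) = ((absNrd F n (a : D) / absNrd F n (b : D) : ℝ) : ℂ) ^ ((s + n) / 2) •
        TensorProduct.map (π₁ a) (π₂ b) (φ g)}

/-- The space of `I_P̄(π₁ ⊗ π₂, s)`, the normalized induction of
`π₁|Nrd|^{-s/2} ⊗ π₂|Nrd|^{s/2}` from the lower triangular parabolic `P̄`. -/
def indPbar (n : ℕ) (π₁ : Representation ℂ Dˣ V₁) (π₂ : Representation ℂ Dˣ V₂) (s : ℂ) :
    Set (GL2 D → V₁ ⊗[ℂ] V₂) :=
  {φ | (∃ H : OpenSubgroup (GL2 D), ∀ g, ∀ k ∈ H, φ (g * k) = φ g) ∧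
    ∀ (p : GL2 D) (a b : Dˣ) (x : D),
      (p : Matrix (Fin 2) (Fin 2) D) = !![(a : D), 0; x, (b : D)] → ∀ g,
      φ (p * g) = ((absNrd F n (b : D) / absNrd F n (a : D) : ℝ) : ℂ) ^ ((s + n) / 2) •
        TensorProduct.map (π₁ a) (π₂ b) (φ g)}

/-- The value at `z` of the flat section through `φ` (an element of some `I_P(s)`): the element
of `I_P(z)` with the same restriction to `GL_2(O_D)` as `φ`. -/
def flatP (n : ℕ) (π₁ : Representation ℂ Dˣ V₁) (π₂ : Representation ℂ Dˣ V₂) (z : ℂ)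
    (φ : GL2 D → V₁ ⊗[ℂ] V₂) : GL2 D → V₁ ⊗[ℂ] V₂ :=
  Classical.epsilon fun ψ => ψ ∈ indP F n π₁ π₂ z ∧ ∀ k ∈ maxCompact F n, ψ k = φ k

/-- The same for `P̄`. -/
def flatPbar (n : ℕ) (π₁ : Representation ℂ Dˣ V₁) (π₂ : Representation ℂ Dˣ V₂) (z : ℂ)
    (φ : GL2 D → V₁ ⊗[ℂ] V₂) : GL2 D → V₁ ⊗[ℂ] V₂ :=
  Classical.epsilon fun ψ => ψ ∈ indPbar F n π₁ π₂ z ∧ ∀ k ∈ maxCompact F n, ψ k = φ k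

variable [MeasurableSpace D]

/-- The intertwining integral `z ↦ ∫_D φ_z(lower(x) g) d⁺x` along the flat section `φ_z`
through `φ`. -/
def integralP (n : ℕ) (μ : Measure Dˣ) (π₁ : Representation ℂ Dˣ V₁)
    (π₂ : Representation ℂ Dˣ V₂) (φ : GL2 D → V₁ ⊗[ℂ] V₂) (g : GL2 D) (z : ℂ) : V₁ ⊗[ℂ] V₂ :=
  ∫ x : D, flatP F n π₁ π₂ z φ (lowerUnip x * g) ∂(addMeasure F n μ)

/-- The intertwining integral `z ↦ ∫_D φ_z(upper(x) g) d⁺x` along the flat section `φ_z`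
through `φ`. -/
def integralPbar (n : ℕ) (μ : Measure Dˣ) (π₁ : Representation ℂ Dˣ V₁)
    (π₂ : Representation ℂ Dˣ V₂) (φ : GL2 D → V₁ ⊗[ℂ] V₂) (g : GL2 D) (z : ℂ) : V₁ ⊗[ℂ] V₂ :=
  ∫ x : D, flatPbar F n π₁ π₂ z φ (upperUnip x * g) ∂(addMeasure F n μ)

/-- The intertwining operator `M_P(s) : I_P(π₁ ⊗ π₂, s) → I_P̄(π₁ ⊗ π₂, -s)`, defined for all `s`
by meromorphic continuation from `Re s > 0` along flat sections. -/
def MP (n : ℕ) (μ : Measure Dˣ) (π₁ : Representation ℂ Dˣ V₁) (π₂ : Representation ℂ Dˣ V₂)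
    (s : ℂ) (φ : GL2 D → V₁ ⊗[ℂ] V₂) : GL2 D → V₁ ⊗[ℂ] V₂ :=
  fun g => meroCont (integralP F n μ π₁ π₂ φ g) s

/-- The intertwining operator `M_P̄(s) : I_P̄(π₁ ⊗ π₂, s) → I_P(π₁ ⊗ π₂, -s)`. -/
def MPbar (n : ℕ) (μ : Measure Dˣ) (π₁ : Representation ℂ Dˣ V₁) (π₂ : Representation ℂ Dˣ V₂)
    (s : ℂ) (φ : GL2 D → V₁ ⊗[ℂ] V₂) : GL2 D → V₁ ⊗[ℂ] V₂ :=
  fun g => meroCont (integralPbar F n μ π₁ π₂ φ g) s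

/-- `c` is the scalar `μ_{π₁, π₂}(s)⁻¹` by which `M_P̄(-s) M_P(s)` acts on `I_P(π₁ ⊗ π₂, s)`
(with `M_P(s)` taking values in `I_P̄(π₁ ⊗ π₂, -s)`). -/
def IsInvMu (n : ℕ) (μ : Measure Dˣ) (π₁ : Representation ℂ Dˣ V₁)
    (π₂ : Representation ℂ Dˣ V₂) (s c : ℂ) : Prop :=
  ∀ φ ∈ indP F n π₁ π₂ s,
    MP F n μ π₁ π₂ s φ ∈ indPbar F n π₁ π₂ (-s) ∧
    MPbar F n μ π₁ π₂ (-s) (MP F n μ π₁ π₂ s φ) = c • φ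

/-- The operators `M_P(s)` and `M_P̄(s)` are well defined: the integrals converge absolutely for
`Re s > 0` and have meromorphic continuations to `ℂ`. -/
structure IntertwiningWellDefined (n : ℕ) (μ : Measure Dˣ) (π₁ : Representation ℂ Dˣ V₁)
    (π₂ : Representation ℂ Dˣ V₂) : Prop where
  integrableP : ∀ s : ℂ, 0 < s.re → ∀ φ ∈ indP F n π₁ π₂ s, ∀ g,
    Integrable (fun x : D => φ (lowerUnip x * g)) (addMeasure F n μ)
  integrablePbar : ∀ s : ℂ, 0 < s.re → ∀ φ ∈ indPbar F n π₁ π₂ s, ∀ g,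
    Integrable (fun x : D => φ (upperUnip x * g)) (addMeasure F n μ)
  continuationP : ∀ s : ℂ, ∀ φ ∈ indP F n π₁ π₂ s, ∀ g,
    ∃ h, IsMeroCont (integralP F n μ π₁ π₂ φ g) h
  continuationPbar : ∀ s : ℂ, ∀ φ ∈ indPbar F n π₁ π₂ s, ∀ g,
    ∃ h, IsMeroCont (integralPbar F n μ π₁ π₂ φ g) h

end Induced

end DivAlg

end

set_option linter.unusedSectionVars false
set_option linter.style.haveILetI false

noncomputable section

namespace DivAlg

/-! ### The normalized absolute value of a local field -/

section LocalField

variable (F : Type*) [Field F] [ValuativeRel F] [TopologicalSpace F]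
  [IsNonarchimedeanLocalField F]

/-! Let σ = π₁ ⊗ π₂ on D^* × D^*, and let A_j (`sphereOp`) be the integral of σ(w, w⁻¹) over the
units of valuation j.

Continuation. On the big cell, the lower unipotent with entry x is an upper triangular matrix with
diagonal (x⁻¹, x), times a Weyl element w, times the upper unipotent with entry x⁻¹. For |x| large
that last factor does not matter, so the shell |x| = q^j contributes q^(-js) A_j φ(wg) to
M_P(s)φ(g). A central element of valuation n acts by scalars, so A_(j+n) is a multiple of A_j, and
the tail over j ≥ k sums to a rational function of q^(-s). "Ball plus summed tail" (`regInt`,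
`regOp`) is an explicit form of the continued operator. The opposite parabolic reduces to P by the
permutation matrix, which exchanges the two factors of σ.

Composition. For Re z > 0, truncate the second operator at level k. Substituting u = x⁻¹ in the
first operator gives a double integral over u in D^* and |x| < q^k (`hasSum_composition`). The part
|u| < q^k is a tail applied to a vector g₀; it cancels against the same vector in the tail of the
second operator, because the two halves of a periodic two-sided series are opposite rational
functions (`tailSum_neg`). The part |u| = q^(k+L) gives conjugates by σ(u, 1) of the integral of
σ(w, w⁻¹) over U_(L+1) (`shell_value`). What remains is the product of two tails, and A_i A_j is an
average of conjugates of A_(i+j) (`sphereOp_mul_sphereOp`).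

Scalars. The value does not depend on k. Averaging over n consecutive k integrates the conjugations
over D^* modulo a central element of valuation n, and Schur's lemma makes every term scalar
(`hasAverages`, `regInt_composition`). As max(v(g-1), 0) counts the L ≥ 0 with g in U_(L+1), the
first part sums to ι/(d₁d₂). The product of tails gives the sum over m ≥ 1 of m q^(-mz) a_m, where
d₁d₂a_m is the integral of χ₁(w)χ₂(w⁻¹) over the units of valuation m; this is subtracted.

The two cases. If Hom over O_D^* vanishes, all A_j and a_m are zero (`coefOp_eq_zero`). If π₁ = π₂,
the sequence A_j has period t and d²a_m is t or 0 according to whether t divides m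
(`coefOp_add_card_twists`, `sphereChi_eq`), and the series is elementary. The identity theorem
carries the equality to all regular s (`regOp_regOp`).

All this uses only the properties of |Nrd| collected in `IsNormalizedAbs`. To obtain them, |N_(D/F)|
is shown to be ultrametric, to be the modulus of Haar measure, and to have value group q^(nℤ). -/

lemma one_lt_resCard : 1 < (resCard F : ℝ) := by
  have : 1 < resCard F := Finite.one_lt_card
  exact_mod_cast this

lemma resCard_pos : 0 < (resCard F : ℝ) := zero_lt_one.trans (one_lt_resCard F)

variable {F}

open WithZero in
lemma normAbs_of_ne_zero {x : F} (hx : x ≠ 0) : normAbs F x = (resCard F : ℝ) ^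
    (WithZero.log (IsNonarchimedeanLocalField.valueGroupWithZeroIsoInt F
      (ValuativeRel.valuation F x))) := by
  simp [normAbs, hx]

@[simp] lemma normAbs_zero : normAbs F 0 = 0 := by simp [normAbs]

lemma normAbs_pos {x : F} (hx : x ≠ 0) : 0 < normAbs F x := by
  rw [normAbs_of_ne_zero hx]
  exact zpow_pos (resCard_pos F) _

lemma normAbs_nonneg (x : F) : 0 ≤ normAbs F x := by
  by_cases hx : x = 0
  · simp [hx]
  · exact (normAbs_pos hx).le

lemma normAbs_mul (x y : F) : normAbs F (x * y) = normAbs F x * normAbs F y := by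
  by_cases hx : x = 0
  · simp [hx]
  by_cases hy : y = 0
  · simp [hy]
  rw [normAbs_of_ne_zero hx, normAbs_of_ne_zero hy, normAbs_of_ne_zero (mul_ne_zero hx hy),
    map_mul, map_mul, WithZero.log_mul (by simpa using hx) (by simpa using hy),
    zpow_add₀ (resCard_pos F).ne']

@[simp] lemma normAbs_one : normAbs F 1 = 1 := by
  rw [normAbs_of_ne_zero one_ne_zero]; simp

lemma normAbs_le_normAbs {x y : F} : normAbs F x ≤ normAbs F y ↔
    ValuativeRel.valuation F x ≤ ValuativeRel.valuation F y := by
  by_cases hx : x = 0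
  · simp [hx, normAbs_nonneg]
  by_cases hy : y = 0
  · simp only [hy, normAbs_zero, map_zero, le_zero_iff, map_eq_zero, hx, iff_false, not_le]
    exact normAbs_pos hx
  rw [normAbs_of_ne_zero hx, normAbs_of_ne_zero hy, zpow_le_zpow_iff_right₀ (one_lt_resCard F),
    WithZero.log_le_log (by simpa using hx) (by simpa using hy), OrderIsoClass.map_le_map_iff]

lemma normAbs_le_one {x : F} : normAbs F x ≤ 1 ↔ ValuativeRel.valuation F x ≤ 1 := by
  rw [← normAbs_one (F := F), normAbs_le_normAbs, map_one]

lemma normAbs_add_le (x y : F) : normAbs F (x + y) ≤ max (normAbs F x) (normAbs F y) := by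
  rcases le_total (normAbs F x) (normAbs F y) with h | h
  · rw [max_eq_right h, normAbs_le_normAbs]
    exact (Valuation.map_add _ x y).trans (max_le (normAbs_le_normAbs.1 h) le_rfl)
  · rw [max_eq_left h, normAbs_le_normAbs]
    exact (Valuation.map_add _ x y).trans (max_le le_rfl (normAbs_le_normAbs.1 h))

variable (F) in
/-- The normalized absolute value as a multiplicative map. -/
def normAbsHom : F →*₀ ℝ where
  toFun := normAbs F
  map_zero' := normAbs_zero
  map_one' := normAbs_one
  map_mul' := normAbs_mul

@[simp] lemma normAbsHom_apply (x : F) : normAbsHom F x = normAbs F x := rfl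

lemma exists_normAbs_zpow {x : F} (hx : x ≠ 0) : ∃ k : ℤ, normAbs F x = (resCard F : ℝ) ^ k :=
  ⟨_, normAbs_of_ne_zero hx⟩

variable (F) in
lemma exists_normAbs_eq_inv : ∃ x : F, x ≠ 0 ∧ normAbs F x = (resCard F : ℝ)⁻¹ := by
  obtain ⟨x, hx⟩ := ValuativeRel.valuation_surjective
    ((IsNonarchimedeanLocalField.valueGroupWithZeroIsoInt F).symm (WithZero.exp (-1)))
  have h0 : x ≠ 0 := by
    rintro rfl
    rw [map_zero] at hx
    have := congrArg (IsNonarchimedeanLocalField.valueGroupWithZeroIsoInt F) hx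
    simp only [map_zero, OrderMonoidIso.apply_symm_apply] at this
    exact WithZero.exp_ne_zero this.symm
  refine ⟨x, h0, ?_⟩
  rw [normAbs_of_ne_zero h0, hx]
  simp

lemma normAbs_lt_one {x : F} : normAbs F x < 1 ↔ ValuativeRel.valuation F x < 1 := by
  rw [← not_iff_not, not_lt, not_lt, ← normAbs_one (F := F), normAbs_le_normAbs, map_one]

variable (F) in
lemma isCompact_normAbs_le_one : IsCompact {x : F | normAbs F x ≤ 1} := by
  simp_rw [normAbs_le_one]
  exact IsNonarchimedeanLocalField.isCompact_closedBall F 1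

lemma normAbs_le_mul_mem_nhds {c : F} (hc : c ≠ 0) :
    {x : F | normAbs F x ≤ normAbs F c} ∈ nhds (0 : F) := by
  refine (IsValuativeTopology.hasBasis_nhds_zero' F).mem_iff.2
    ⟨ValuativeRel.valuation F c, by simpa using hc, fun x hx => ?_⟩
  exact normAbs_le_normAbs.2 (le_of_lt hx)

lemma normAbs_natCast_le_one (m : ℕ) : normAbs F (m : F) ≤ 1 := by
  induction m with
  | zero => simp
  | succ k ih =>
    push_cast
    exact (normAbs_add_le _ _).trans (max_le ih (by simp))

instance : T2Space F := by
  refine IsTopologicalAddGroup.t2Space_of_zero_sep fun x hx => ?_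
  obtain ⟨p, hp0, hp⟩ := exists_normAbs_eq_inv F
  refine ⟨_, normAbs_le_mul_mem_nhds (mul_ne_zero hx hp0), fun h => ?_⟩
  have h1 : normAbs F p < 1 := by rw [hp]; exact inv_lt_one_of_one_lt₀ (one_lt_resCard F)
  have h2 : normAbs F x ≤ normAbs F (x * p) := h
  rw [normAbs_mul] at h2
  nlinarith [normAbs_pos hx]

lemma isClosed_normAbs_le (c : F) : IsClosed {x : F | normAbs F x ≤ normAbs F c} := by
  by_cases hc : c = 0
  · subst hc
    have : {x : F | normAbs F x ≤ normAbs F 0} = {0} := by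
      ext x
      simp only [normAbs_zero, Set.mem_ofPred_eq, Set.mem_singleton_iff]
      refine ⟨fun h => by_contra fun h0 => absurd (normAbs_pos h0) (not_lt.2 h), ?_⟩
      rintro rfl; simp
    rw [this]
    exact isClosed_singleton
  · simp_rw [normAbs_le_normAbs]
    exact (IsNonarchimedeanLocalField.isCompact_closedBall F _).isClosed

lemma isOpen_normAbs_le {c : F} (hc : c ≠ 0) : IsOpen {x : F | normAbs F x ≤ normAbs F c} := by
  rw [isOpen_iff_mem_nhds]
  intro x hx
  have := (continuous_id.sub (continuous_const (y := x))).continuousAt (x := x)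
    |>.preimage_mem_nhds (t := {x : F | normAbs F x ≤ normAbs F c})
      (by simpa using normAbs_le_mul_mem_nhds hc)
  refine Filter.mem_of_superset this fun y hy => ?_
  have : y = (y - x) + x := by ring
  change normAbs F y ≤ _
  rw [this]
  exact (normAbs_add_le _ _).trans (max_le hy hx)

end LocalField

/-! ### The degree of an element of a central division algebra -/

section Degree

variable {F D : Type*} [Field F] [DivisionRing D] [Algebra F D] [Algebra.IsCentral F D]

/-- Centrality makes left and right multiplications independent. The argument shortens a relation,
as for independence of characters. -/
lemma eq_zero_of_forall_sum_mul_mul_eq_zero {ι : Type*} [DecidableEq ι] (l : ι → D)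
    (hl : LinearIndependent F l) (s : Finset ι) (d : ι → D)
    (h : ∀ y, ∑ i ∈ s, l i * y * d i = 0) : ∀ i ∈ s, d i = 0 := by
  induction s using Finset.induction_on generalizing d with
  | empty => simp
  | insert j s hj ih =>
    by_cases hdj : d j = 0
    · have := ih d (fun y => by simpa [Finset.sum_insert hj, hdj] using h y)
      intro i hi
      rcases Finset.mem_insert.1 hi with rfl | hi
      · exact hdj
      · exact this i hi
    exfalso
    -- The relation at y z minus the relation at y multiplied on the right by d_j⁻¹ z d_j has no
    -- j-term. By induction d_i d_j⁻¹ commutes with every z, hence lies in F.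
    have key : ∀ z, ∀ i ∈ s, z * d i - d i * (d j)⁻¹ * z * d j = 0 := by
      intro z
      refine ih (fun i => z * d i - d i * (d j)⁻¹ * z * d j) fun y => ?_
      have h1 := h (y * z)
      have h2 := congrArg (· * ((d j)⁻¹ * z * d j)) (h y)
      simp only [Finset.sum_insert hj, zero_mul, add_mul, Finset.sum_mul] at h1 h2
      have h3 : l j * y * d j * ((d j)⁻¹ * z * d j) = l j * (y * z) * d j := by
        simp only [mul_assoc]; rw [mul_inv_cancel_left₀ hdj]
      rw [h3] at h2
      have h4 := sub_eq_zero.2 (h1.trans h2.symm)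
      rw [add_sub_add_left_eq_sub, ← Finset.sum_sub_distrib] at h4
      rw [← h4]
      exact Finset.sum_congr rfl fun i _ => by simp only [mul_sub, mul_assoc]
    have hc : ∀ i ∈ s, ∃ c : F, algebraMap F D c = d i * (d j)⁻¹ := by
      intro i hi
      have : d i * (d j)⁻¹ ∈ Subalgebra.center F D := by
        rw [Subalgebra.mem_center_iff]
        intro z
        have := sub_eq_zero.1 (key z i hi)
        rw [← mul_assoc, this, mul_assoc _ (d j), mul_inv_cancel₀ hdj, mul_one]
      rw [Algebra.IsCentral.center_eq_bot, Algebra.mem_bot] at this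
      exact this
    choose! c hc using hc
    -- The relation at y = 1 divided by d_j is an F-linear dependence with coefficient 1 at j, a
    -- contradiction.
    have h5 : ∑ i ∈ insert j s, (if i = j then 1 else c i) • l i = 0 := by
      have := congrArg (· * (d j)⁻¹) (h 1)
      simp only [mul_one, zero_mul, Finset.sum_mul] at this
      rw [← this]
      refine Finset.sum_congr rfl fun i hi => ?_
      split_ifs with hij
      · subst hij; rw [one_smul, mul_assoc, mul_inv_cancel₀ hdj, mul_one]
      · have his := (Finset.mem_insert.1 hi).resolve_left hij
        rw [Algebra.smul_def, Algebra.commutes, hc i his, mul_assoc]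
    have := (linearIndependent_iff'.1 hl) (insert j s) _ h5 j (Finset.mem_insert_self _ _)
    simp at this

variable [FiniteDimensional F D]

/-- With K = F(x) of degree r acting on D from the left and m = dim_K D, the maps y ↦ Σ xⁱ y dᵢ
embed D^r in End_K(D). Counting F-dimensions gives r n² ≤ r m², and r m = n² then forces r ≤ n. -/
lemma natDegree_minpoly_le {n : ℕ} (hn : Module.finrank F D = n ^ 2) (x : D) :
    (minpoly F x).natDegree ≤ n := by
  classical
  have hx : IsIntegral F x := Algebra.IsIntegral.isIntegral x
  set p := minpoly F x with hp
  have : Fact (Irreducible p) := ⟨minpoly.irreducible hx⟩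
  let φ : AdjoinRoot p →ₐ[F] D := Ideal.Quotient.liftₐ _ (Polynomial.aeval x) fun a ha => by
    obtain ⟨b, rfl⟩ := Ideal.mem_span_singleton'.1 ha
    rw [map_mul, hp, minpoly.aeval, mul_zero]
  have hφ : φ (AdjoinRoot.root p) = x := by
    change Polynomial.aeval x Polynomial.X = x
    simp
  have hp0 : p ≠ 0 := minpoly.ne_zero hx
  let K := AdjoinRoot p
  let instK : Module K D := Module.compHom D φ.toRingHom
  have hsm : ∀ (k : K) (y : D), k • y = φ k * y := fun _ _ => rfl
  have inst1 : IsScalarTower F K D := ⟨fun a k y => by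
    rw [hsm, hsm, map_smul, smul_mul_assoc]⟩
  have inst2 : SMulCommClass K F D := ⟨fun k a y => by
    rw [hsm, hsm, mul_smul_comm]⟩
  set r := p.natDegree with hr
  have hrK : Module.finrank F K = r := by
    rw [(AdjoinRoot.powerBasis hp0).finrank, AdjoinRoot.powerBasis_dim]
  have inst3 : FiniteDimensional F K := (AdjoinRoot.powerBasis hp0).finite
  have inst4 : Module.Finite K D := Module.Finite.of_restrictScalars_finite F K D
  let Ψ : (Fin r → D) →ₗ[F] (D →ₗ[K] D) :=
    { toFun := fun d =>
        { toFun := fun y => ∑ i : Fin r, x ^ (i : ℕ) * y * d i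
          map_add' := fun y z => by
            rw [← Finset.sum_add_distrib]
            exact Finset.sum_congr rfl fun i _ => by rw [mul_add, add_mul]
          map_smul' := fun k y => by
            simp_rw [RingHom.id_apply, hsm, Finset.mul_sum]
            refine Finset.sum_congr rfl fun i _ => ?_
            rw [← hφ, ← map_pow, ← mul_assoc, ← map_mul, mul_comm, map_mul]
            simp only [mul_assoc] }
      map_add' := fun d e => by
        ext y
        simp [mul_add, Finset.sum_add_distrib]
      map_smul' := fun a d => by
        ext y
        simp [Finset.smul_sum] }
  have hΨ : Function.Injective Ψ := by
    rw [← LinearMap.ker_eq_bot, LinearMap.ker_eq_bot']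
    intro d hd
    have hl : LinearIndependent F fun i : Fin r => x ^ (i : ℕ) := linearIndependent_pow x
    funext i
    refine eq_zero_of_forall_sum_mul_mul_eq_zero _ hl Finset.univ d (fun y => ?_) i
      (Finset.mem_univ _)
    exact LinearMap.congr_fun hd y
  have inst5 : FiniteDimensional F (D →ₗ[K] D) := Module.Finite.trans K _
  have h1 := LinearMap.finrank_le_finrank_of_injective hΨ
  rw [Module.finrank_pi_fintype, Finset.sum_const, Finset.card_univ, Fintype.card_fin,
    ← Module.finrank_mul_finrank F K (D →ₗ[K] D), Module.finrank_linearMap, hrK,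
    smul_eq_mul] at h1
  have h2 : r * Module.finrank K D = n ^ 2 := by
    rw [← hn, ← hrK, Module.finrank_mul_finrank]
  have hn0 : 0 < n ^ 2 := by rw [← hn]; exact Module.finrank_pos
  rw [hn] at h1
  set m := Module.finrank K D
  have h3 : r * (r * n ^ 2) ≤ n ^ 2 * n ^ 2 := by
    calc r * (r * n ^ 2) ≤ r * (r * (m * m)) := Nat.mul_le_mul_left _ h1
      _ = (r * m) * (r * m) := by ring
      _ = _ := by rw [h2]
  have h4 : r * r ≤ n * n := by
    have : (r * r) * n ^ 2 ≤ (n * n) * n ^ 2 := by linarith [h3, sq n, mul_assoc r r (n ^ 2)]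
    exact Nat.le_of_mul_le_mul_right this hn0
  exact Nat.mul_self_le_mul_self_iff.1 h4

end Degree

/-! ### The absolute value of the norm from a division algebra -/

section NormDivision

variable (F : Type*) [Field F] [ValuativeRel F] [TopologicalSpace F]
  [IsNonarchimedeanLocalField F]
variable {D : Type*} [DivisionRing D] [Algebra F D]

/-- The normalized absolute value of the norm `N_{D/F}`. -/
def absNorm (x : D) : ℝ := normAbs F (Algebra.norm F x)

lemma absNorm_mul (x y : D) : absNorm F (x * y) = absNorm F x * absNorm F y := by
  simp [absNorm, normAbs_mul]

@[simp] lemma absNorm_one : absNorm F (1 : D) = 1 := by simp [absNorm]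

lemma absNorm_nonneg (x : D) : 0 ≤ absNorm F x := normAbs_nonneg _

lemma absNorm_pow (x : D) (k : ℕ) : absNorm F (x ^ k) = absNorm F x ^ k := by
  induction k with
  | zero => simp
  | succ k ih => rw [pow_succ, absNorm_mul, ih, pow_succ]

lemma absNorm_algebraMap (c : F) :
    absNorm F (algebraMap F D c) = normAbs F c ^ Module.finrank F D := by
  rw [absNorm, Algebra.norm_algebraMap]
  exact map_pow (normAbsHom F) _ _

lemma absNorm_smul (c : F) (x : D) :
    absNorm F (c • x) = normAbs F c ^ Module.finrank F D * absNorm F x := by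
  rw [Algebra.smul_def, absNorm_mul, absNorm_algebraMap]

lemma absNorm_pos {x : D} (hx : x ≠ 0) : 0 < absNorm F x := by
  refine lt_of_le_of_ne (absNorm_nonneg F x) fun h => ?_
  have := absNorm_mul F x x⁻¹
  rw [mul_inv_cancel₀ hx, absNorm_one, ← h, zero_mul] at this
  exact one_ne_zero this

variable [FiniteDimensional F D]

@[simp] lemma absNorm_zero : absNorm F (0 : D) = 0 := by
  rw [absNorm, Algebra.norm_zero, normAbs_zero]

lemma absNorm_natCast_le_one (m : ℕ) : absNorm F (m : D) ≤ 1 := by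
  rw [← map_natCast (algebraMap F D), absNorm_algebraMap]
  exact pow_le_one₀ (normAbs_nonneg _) (normAbs_natCast_le_one m)

variable [TopologicalSpace D] [IsModuleTopology F D]

lemma absNorm_eq_zpow {x : D} (hx : x ≠ 0) : ∃ k : ℤ, absNorm F x = (resCard F : ℝ) ^ k := by
  refine exists_normAbs_zpow fun h => ?_
  have := absNorm_pos F hx
  rw [absNorm, h, normAbs_zero] at this
  exact lt_irrefl _ this

/-- The coordinates of `D` as a topological vector space over `F`. -/
def coordEquiv : D ≃L[F] (Fin (Module.finrank F D) → F) :=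
  have : IsTopologicalRing D := IsModuleTopology.isTopologicalRing F D
  { (Module.finBasis F D).equivFun with
    continuous_toFun := IsModuleTopology.continuous_of_linearMap
      ((Module.finBasis F D).equivFun.toLinearMap)
    continuous_invFun := IsModuleTopology.continuous_of_linearMap
      ((Module.finBasis F D).equivFun.symm.toLinearMap) }

variable (D) in
/-- A lattice in `D`. -/
def lattice : Set D := {x | ∀ i, normAbs F (coordEquiv F x i) ≤ 1}

variable (D) in
lemma isCompact_lattice : IsCompact (lattice F D) := by
  have h : IsCompact (Set.univ.pi fun _ : Fin (Module.finrank F D) => {x : F | normAbs F x ≤ 1}) :=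
    isCompact_univ_pi fun _ => isCompact_normAbs_le_one F
  convert (coordEquiv F (D := D)).symm.toHomeomorph.isCompact_image.2 h using 1
  ext x
  constructor
  · intro hx
    exact ⟨coordEquiv F x, fun i _ => hx i, (coordEquiv F).symm_apply_apply x⟩
  · rintro ⟨y, hy, rfl⟩ i
    have : coordEquiv F ((coordEquiv F (D := D)).symm.toHomeomorph y) = y :=
      (coordEquiv F).apply_symm_apply y
    rw [this]
    exact hy i trivial

variable (D) in
lemma isOpen_lattice : IsOpen (lattice F D) := by
  have h : IsOpen (Set.univ.pi fun _ : Fin (Module.finrank F D) => {x : F | normAbs F x ≤ 1}) :=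
    isOpen_set_pi Set.finite_univ fun _ _ => by
      simpa using isOpen_normAbs_le (F := F) one_ne_zero
  convert h.preimage (coordEquiv F (D := D)).continuous using 1
  ext x
  simp [lattice]

lemma zero_mem_lattice : (0 : D) ∈ lattice F D := by
  intro i; simp

lemma continuous_algebraNorm : Continuous fun x : D => Algebra.norm F x := by
  have : IsTopologicalRing D := IsModuleTopology.isTopologicalRing F D
  simp_rw [Algebra.norm_eq_matrix_det (Module.finBasis F D)]
  refine Continuous.matrix_det ?_
  exact IsModuleTopology.continuous_of_linearMap
    (Algebra.leftMulMatrix (Module.finBasis F D)).toLinearMap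

lemma isClosed_absNorm_le (c : F) : IsClosed {x : D | absNorm F x ≤ normAbs F c} :=
  (isClosed_normAbs_le c).preimage (continuous_algebraNorm F)

lemma isOpen_absNorm_le {c : F} (hc : c ≠ 0) : IsOpen {x : D | absNorm F x ≤ normAbs F c} :=
  (isOpen_normAbs_le hc).preimage (continuous_algebraNorm F)

include F in
lemma t2Space : T2Space D :=
  (coordEquiv F (D := D)).toHomeomorph.symm.t2Space

lemma normAbs_zpow (c : F) (k : ℤ) : normAbs F (c ^ k) = normAbs F c ^ k :=
  map_zpow₀ (normAbsHom F) c k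

/-- Every nonzero element can be scaled into the lattice, but not into a smaller one. -/
lemma exists_smul_mem_lattice {p : F} (hp : normAbs F p = (resCard F : ℝ)⁻¹) {x : D} (hx : x ≠ 0) :
    ∃ j : ℤ, p ^ j • x ∈ lattice F D ∧ ∀ y ∈ lattice F D, p ^ j • x ≠ p • y := by
  have hp0 : p ≠ 0 := by
    rintro rfl
    rw [normAbs_zero] at hp
    exact (inv_pos.2 (resCard_pos F)).ne hp
  have hne : coordEquiv F x ≠ 0 := by simpa using hx
  obtain ⟨i1, hi1⟩ := Function.ne_iff.1 hne
  have : Nonempty (Fin (Module.finrank F D)) := ⟨i1⟩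
  obtain ⟨i0, hi0⟩ := Finite.exists_max fun i => normAbs F (coordEquiv F x i)
  have h0 : coordEquiv F x i0 ≠ 0 := by
    intro h
    have := hi0 i1
    simp only [h, normAbs_zero] at this
    exact absurd (normAbs_pos hi1) (not_lt.2 this)
  obtain ⟨k, hk⟩ := exists_normAbs_zpow h0
  have hq := resCard_pos F
  refine ⟨k, fun i => ?_, fun y hy h => ?_⟩
  · rw [map_smul, Pi.smul_apply, smul_eq_mul, normAbs_mul, normAbs_zpow, hp]
    calc _ ≤ ((resCard F : ℝ)⁻¹) ^ k * (resCard F : ℝ) ^ k := by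
          rw [← hk]; exact mul_le_mul_of_nonneg_left (hi0 i) (by positivity)
      _ = 1 := by rw [inv_zpow, inv_mul_cancel₀ (zpow_pos hq k).ne']
  · have h1 := congrArg (fun z => normAbs F (coordEquiv F z i0)) h
    simp only [map_smul, Pi.smul_apply, smul_eq_mul, normAbs_mul, normAbs_zpow, hp, hk] at h1
    rw [inv_zpow, inv_mul_cancel₀ (zpow_pos hq k).ne'] at h1
    have h2 := hy i0
    have h3 := inv_lt_one_of_one_lt₀ (one_lt_resCard F)
    have h4 := inv_pos.2 hq
    nlinarith

variable (D) in
-- A power of p makes any nonzero vector primitive, that is, in the lattice but not in p times it.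
-- Primitive vectors form a compact set without 0, so their norm exceeds some |p|^k. A vector of
-- norm at most 1 is therefore brought into the lattice by p^k.
lemma exists_absNorm_le_one_subset : ∃ c : F, c ≠ 0 ∧
    {x : D | absNorm F x ≤ 1} ⊆ (fun x => c • x) '' lattice F D := by
  have : IsTopologicalRing D := IsModuleTopology.isTopologicalRing F D
  have := t2Space F (D := D)
  obtain ⟨p, hp0, hp⟩ := exists_normAbs_eq_inv F
  have hq := resCard_pos F
  have hq1 := one_lt_resCard F
  set m := Module.finrank F D
  have hm : 0 < m := Module.finrank_pos
  -- lower bound for the norm on primitive vectors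
  obtain ⟨k, hk⟩ : ∃ k : ℕ, ∀ x ∈ lattice F D, (∀ y ∈ lattice F D, x ≠ p • y) →
      normAbs F (p ^ k) < absNorm F x := by
    have hcl : IsOpen ((fun x : D => p • x) '' lattice F D) :=
      (Homeomorph.smulOfNeZero p hp0).isOpen_image.2 (isOpen_lattice F D)
    have hcpt : IsCompact (lattice F D \ ((fun x : D => p • x) '' lattice F D)) :=
      (isCompact_lattice F D).diff hcl
    have hcov := hcpt.elim_directed_cover
      (fun k : ℕ => {x : D | absNorm F x ≤ normAbs F (p ^ k)}ᶜ)
      (fun k => (isClosed_absNorm_le F _).isOpen_compl) ?_ ?_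
    · obtain ⟨k, hk⟩ := hcov
      refine ⟨k, fun x hx hxy => ?_⟩
      have := hk ⟨hx, fun ⟨y, hy, h⟩ => hxy y hy h.symm⟩
      simpa using this
    · rintro x ⟨hx, hxp⟩
      have hx0 : x ≠ 0 := by
        rintro rfl
        exact hxp ⟨0, zero_mem_lattice F, by simp⟩
      obtain ⟨k, hk⟩ := exists_pow_lt_of_lt_one (absNorm_pos F hx0)
        (inv_lt_one_of_one_lt₀ hq1)
      refine Set.mem_iUnion.2 ⟨k, ?_⟩
      have : normAbs F (p ^ k) = ((resCard F : ℝ)⁻¹) ^ k := by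
        rw [← hp]; exact map_pow (normAbsHom F) _ _
      simpa [this] using hk
    · refine directed_of_isDirected_le fun i j hij x hx => ?_
      simp only [Set.mem_compl_iff, Set.mem_ofPred_eq, not_le] at hx ⊢
      refine lt_of_le_of_lt ?_ hx
      rw [← normAbsHom_apply, ← normAbsHom_apply, map_pow, map_pow, normAbsHom_apply, hp]
      exact pow_le_pow_of_le_one (by positivity) (inv_le_one_of_one_le₀ hq1.le) hij
  refine ⟨(p ^ k)⁻¹, inv_ne_zero (pow_ne_zero _ hp0), fun x hx => ?_⟩
  by_cases hx0 : x = 0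
  · exact ⟨0, zero_mem_lattice F, by simp [hx0]⟩
  obtain ⟨j, hj, hj'⟩ := exists_smul_mem_lattice F hp hx0
  have h1 := hk _ hj hj'
  rw [absNorm_smul, normAbs_zpow, ← zpow_natCast, normAbs_zpow, hp] at h1
  have h2 : ((resCard F : ℝ)⁻¹) ^ (k : ℤ) < ((resCard F : ℝ)⁻¹) ^ (j * m) := by
    refine h1.trans_le ?_
    rw [zpow_mul, zpow_natCast]
    exact mul_le_of_le_one_right (by positivity) hx
  rw [inv_zpow', inv_zpow', zpow_lt_zpow_iff_right₀ hq1] at h2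
  have h3 : j ≤ k := by
    by_contra h
    push Not at h
    have : (1 : ℤ) ≤ m := by exact_mod_cast hm
    nlinarith [Int.natCast_nonneg k]
  refine ⟨p ^ k • x, fun i => ?_, ?_⟩
  · have := hj i
    simp only [map_smul, Pi.smul_apply, smul_eq_mul, normAbs_mul, normAbs_zpow, hp] at this ⊢
    rw [← zpow_natCast, normAbs_zpow, hp]
    refine le_trans (mul_le_mul_of_nonneg_right ?_ (normAbs_nonneg _)) this
    rw [inv_zpow', inv_zpow', zpow_le_zpow_iff_right₀ hq1]
    omega
  · simp [inv_smul_smul₀ (pow_ne_zero k hp0)]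

variable (D) in
lemma isCompact_absNorm_le_one : IsCompact {x : D | absNorm F x ≤ 1} := by
  have : IsTopologicalRing D := IsModuleTopology.isTopologicalRing F D
  obtain ⟨c, hc, h⟩ := exists_absNorm_le_one_subset F D
  refine ((isCompact_lattice F D).image (continuous_const_smul c)).of_isClosed_subset ?_ h
  simpa using isClosed_absNorm_le F (D := D) 1

/-- Compactness of the unit ball gives a weak ultrametric inequality, with a constant that
`absNorm_one_add_le` removes. -/
lemma exists_absNorm_one_add_le : ∃ A : ℝ, 1 ≤ A ∧
    ∀ x : D, absNorm F x ≤ 1 → absNorm F (1 + x) ≤ A := by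
  have : IsTopologicalRing D := IsModuleTopology.isTopologicalRing F D
  obtain ⟨p, hp0, hp⟩ := exists_normAbs_eq_inv F
  have hq1 := one_lt_resCard F
  have hpk (k : ℕ) : normAbs F ((p ^ k)⁻¹) = (resCard F : ℝ) ^ k := by
    rw [← normAbsHom_apply, map_inv₀, map_pow, normAbsHom_apply, hp, inv_pow, inv_inv]
  have hcov := (isCompact_absNorm_le_one F D).elim_directed_cover
    (fun k : ℕ => {x : D | absNorm F (1 + x) ≤ normAbs F ((p ^ k)⁻¹)})
    (fun k => (isOpen_absNorm_le F (inv_ne_zero (pow_ne_zero k hp0))).preimage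
      (continuous_const.add continuous_id)) ?_ ?_
  · obtain ⟨k, hk⟩ := hcov
    exact ⟨_, by rw [hpk k]; exact one_le_pow₀ hq1.le, fun x hx => hk hx⟩
  · intro x _
    obtain ⟨k, hk⟩ := pow_unbounded_of_one_lt (absNorm F (1 + x)) hq1
    refine Set.mem_iUnion.2 ⟨k, ?_⟩
    simpa [hpk] using hk.le
  · refine directed_of_isDirected_le fun i j hij x hx => ?_
    simp only [Set.mem_ofPred_eq, hpk] at hx ⊢
    exact hx.trans (pow_le_pow_right₀ hq1.le hij)

/-- Artin's trick: with a weak constant A, a sum of 2^r terms of norm at most 1 has norm at most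
A^r. Expanding (1 + x)^(2^r - 1) by the binomial theorem gives 2^r such terms, so |1 + x|^(2^r - 1)
≤ A^r for all r. -/
lemma absNorm_one_add_le {x : D} (hx : absNorm F x ≤ 1) : absNorm F (1 + x) ≤ 1 := by
  obtain ⟨A, hA1, hA⟩ := exists_absNorm_one_add_le F (D := D)
  have hadd : ∀ y z : D, ∀ B : ℝ, absNorm F y ≤ B → absNorm F z ≤ B →
      absNorm F (y + z) ≤ A * B := by
    have key : ∀ y z : D, absNorm F z ≤ absNorm F y → absNorm F (y + z) ≤ A * absNorm F y := by
      intro y z h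
      by_cases hy : y = 0
      · subst hy
        rw [absNorm_zero] at h ⊢
        have : z = 0 := by_contra fun h0 => absurd (absNorm_pos F h0) (not_lt.2 h)
        simp [this]
      · have : y + z = y * (1 + y⁻¹ * z) := by rw [mul_add, mul_one, mul_inv_cancel_left₀ hy]
        rw [this, absNorm_mul, mul_comm]
        refine mul_le_mul_of_nonneg_right (hA _ ?_) (absNorm_nonneg F y)
        have h1 : absNorm F (y * (y⁻¹ * z)) ≤ absNorm F y := by rwa [mul_inv_cancel_left₀ hy]
        rw [absNorm_mul] at h1
        exact le_of_mul_le_mul_left (by linarith) (absNorm_pos F hy)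
    intro y z B hy hz
    rcases le_total (absNorm F z) (absNorm F y) with h | h
    · exact (key y z h).trans (mul_le_mul_of_nonneg_left hy (by linarith))
    · rw [add_comm]
      exact (key z y h).trans (mul_le_mul_of_nonneg_left hz (by linarith))
  have hsum : ∀ r : ℕ, ∀ f : ℕ → D, (∀ i, absNorm F (f i) ≤ 1) →
      absNorm F (∑ i ∈ Finset.range (2 ^ r), f i) ≤ A ^ r := by
    intro r
    induction r with
    | zero => intro f hf; simpa using hf 0
    | succ r ih =>
      intro f hf
      rw [pow_succ, mul_two, Finset.sum_range_add, pow_succ, mul_comm]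
      exact hadd _ _ _ (ih f hf) (ih _ fun i => hf _)
  have hpow : ∀ r : ℕ, absNorm F (1 + x) ^ (2 ^ r - 1) ≤ A ^ r := by
    intro r
    have hN : 2 ^ r - 1 + 1 = 2 ^ r := Nat.sub_add_cancel Nat.one_le_two_pow
    have hc : Commute x (1 : D) := Commute.one_right x
    rw [← absNorm_pow, add_comm, hc.add_pow, hN]
    refine hsum r _ fun i => ?_
    rw [one_pow, mul_one, absNorm_mul, absNorm_pow]
    exact mul_le_one₀ (pow_le_one₀ (absNorm_nonneg F x) hx) (absNorm_nonneg F _)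
      (absNorm_natCast_le_one F _)
  -- If |1 + x| > 1, some power |1 + x|^k exceeds A, so |1 + x|^(kr) exceeds A^r. This contradicts
  -- the bound as soon as kr ≤ 2^r - 1.
  by_contra! h
  obtain ⟨k, hk⟩ := pow_unbounded_of_one_lt A h
  -- choose `r` with `k * r ≤ 2 ^ r - 1` and `1 ≤ r`
  obtain ⟨r, hr1, hr⟩ : ∃ r : ℕ, 1 ≤ r ∧ k * r ≤ 2 ^ r - 1 := by
    refine ⟨2 * (k + 1), by omega, ?_⟩
    have h1 : k + 1 < 2 ^ (k + 1) := Nat.lt_two_pow_self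
    have h2 : 2 ^ (2 * (k + 1)) = 2 ^ (k + 1) * 2 ^ (k + 1) := by rw [two_mul, pow_add]
    have h3 : (k + 2) * (k + 2) ≤ 2 ^ (k + 1) * 2 ^ (k + 1) := Nat.mul_le_mul h1 h1
    rw [h2]
    have h4 : k * (2 * (k + 1)) + 1 ≤ 2 ^ (k + 1) * 2 ^ (k + 1) := by
      rcases Nat.lt_or_ge k 3 with h5 | h5
      · interval_cases k <;> norm_num
      · have h6 : 2 * (k + 1) ≤ 2 ^ (k + 1) := by
          have : k + 1 ≤ 2 ^ k := Nat.lt_two_pow_self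
          rw [pow_succ]; omega
        nlinarith
    omega
  have h1 : A ^ r < absNorm F (1 + x) ^ (k * r) := by
    rw [pow_mul]
    exact pow_lt_pow_left₀ hk (by linarith) (by omega)
  have h2 := h1.trans_le ((pow_le_pow_right₀ h.le hr).trans (hpow r))
  exact lt_irrefl _ h2

lemma absNorm_add_le (x y : D) : absNorm F (x + y) ≤ max (absNorm F x) (absNorm F y) := by
  have key : ∀ y z : D, absNorm F z ≤ absNorm F y → absNorm F (y + z) ≤ absNorm F y := by
    intro y z h
    by_cases hy : y = 0
    · subst hy
      rw [absNorm_zero] at h ⊢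
      have : z = 0 := by_contra fun h0 => absurd (absNorm_pos F h0) (not_lt.2 h)
      simp [this]
    · have : y + z = y * (1 + y⁻¹ * z) := by rw [mul_add, mul_one, mul_inv_cancel_left₀ hy]
      rw [this, absNorm_mul]
      refine mul_le_of_le_one_right (absNorm_nonneg F y) (absNorm_one_add_le F ?_)
      have h1 : absNorm F (y * (y⁻¹ * z)) ≤ absNorm F y := by rwa [mul_inv_cancel_left₀ hy]
      rw [absNorm_mul] at h1
      exact le_of_mul_le_mul_left (by linarith) (absNorm_pos F hy)
  rcases le_total (absNorm F y) (absNorm F x) with h | h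
  · exact (key x y h).trans (le_max_left _ _)
  · rw [add_comm]
    exact (key y x h).trans (le_max_right _ _)

end NormDivision

/-! ### The modulus of multiplication in a division algebra -/

section Index

open scoped Pointwise

variable {G A : Type*} [AddCommGroup G] [AddCommGroup A]

/-- K is the disjoint union of translates of H, one for each value of f. -/
lemma measure_eq_card_mul_of_surjective [MeasurableSpace G] [MeasurableAdd G]
    (ν : Measure G) [ν.IsAddLeftInvariant] [Fintype A]
    (K : AddSubgroup G) (H : Set G) (hH : MeasurableSet H) (f : K →+ A)
    (hf : Function.Surjective f) (hHK : H ⊆ K) (hker : ∀ x : K, f x = 0 ↔ (x : G) ∈ H) :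
    ν K = Fintype.card A * ν H := by
  choose s hs using hf
  have hK : (K : Set G) = ⋃ a, (fun x => (-(s a : G)) + x) ⁻¹' H := by
    ext x
    simp only [SetLike.mem_coe, Set.mem_iUnion, Set.mem_preimage]
    constructor
    · intro hx
      refine ⟨f ⟨x, hx⟩, (hker (-(s (f ⟨x, hx⟩)) + ⟨x, hx⟩)).1 ?_⟩
      rw [map_add, map_neg, hs, neg_add_cancel]
    · rintro ⟨a, ha⟩
      have := K.add_mem (s a).2 (hHK ha)
      simpa using this
  rw [hK, measure_iUnion, tsum_fintype]
  · simp_rw [measure_preimage_add]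
    simp
  · intro a b hab
    refine Set.disjoint_left.2 fun x hxa hxb => hab ?_
    have hxK : x ∈ K := by simpa using K.add_mem (s a).2 (hHK hxa)
    have h1 := (hker (-(s a) + ⟨x, hxK⟩)).2 (by simpa using hxa)
    have h2 := (hker (-(s b) + ⟨x, hxK⟩)).2 (by simpa using hxb)
    rw [map_add, map_neg, hs] at h1 h2
    rw [neg_add_eq_zero] at h1 h2
    rw [h1, h2]
  · exact fun a => measurable_const_add _ hH

lemma finite_of_compact_of_isOpen [TopologicalSpace G] [ContinuousAdd G]
    (K : AddSubgroup G) (hKc : IsCompact (K : Set G)) (H : Set G) (hH : IsOpen H) (f : K →+ A)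
    (hf : Function.Surjective f) (hker : ∀ x : K, f x = 0 ↔ (x : G) ∈ H) : Finite A := by
  choose s hs using hf
  obtain ⟨t, ht⟩ := hKc.elim_finite_subcover (fun a => (fun x => (-(s a : G)) + x) ⁻¹' H)
    (fun a => hH.preimage (continuous_const.add continuous_id)) (by
      intro x hx
      have h0 : f (-(s (f ⟨x, hx⟩)) + ⟨x, hx⟩) = 0 := by
        rw [map_add, map_neg, hs, neg_add_cancel]
      exact Set.mem_iUnion.2 ⟨f ⟨x, hx⟩, by simpa using (hker _).1 h0⟩)
  refine Set.finite_univ_iff.1 (t.finite_toSet.subset fun a _ => ?_)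
  obtain ⟨b, hb, hb'⟩ := Set.mem_iUnion₂.1 (ht (s a).2)
  have := (hker (-(s b) + s a)).2 (by simpa using hb')
  rw [map_add, map_neg, hs, hs, neg_add_eq_zero] at this
  exact this ▸ hb

end Index

section Modulus

open scoped Pointwise NNReal ENNReal
open ValuativeRel

variable (F : Type*) [Field F] [ValuativeRel F] [TopologicalSpace F]
  [IsNonarchimedeanLocalField F]

lemma residue_eq_zero_iff (a : 𝒪[F]) :
    IsLocalRing.residue 𝒪[F] a = 0 ↔ normAbs F a < 1 := by
  rw [IsLocalRing.residue_eq_zero_iff, IsLocalRing.mem_maximalIdeal, mem_nonunits_iff,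
    normAbs_lt_one]
  rw [(Valuation.integer.integers (ValuativeRel.valuation F)).isUnit_iff_valuation_eq_one]
  exact ⟨fun h => lt_of_le_of_ne a.2 h, fun h => h.ne⟩

variable {F} in
lemma normAbs_lt_one_iff_exists {p : F} (hp : normAbs F p = (resCard F : ℝ)⁻¹) (x : F) :
    normAbs F x < 1 ↔ ∃ y, normAbs F y ≤ 1 ∧ x = p * y := by
  have hp0 : p ≠ 0 := by
    rintro rfl
    rw [normAbs_zero] at hp
    exact (inv_pos.2 (resCard_pos F)).ne hp
  have hq := resCard_pos F
  have hq1 := one_lt_resCard F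
  constructor
  · intro h
    refine ⟨p⁻¹ * x, ?_, by rw [mul_inv_cancel_left₀ hp0]⟩
    by_cases hx : x = 0
    · simp [hx]
    obtain ⟨k, hk⟩ := exists_normAbs_zpow hx
    rw [normAbs_mul, ← zpow_neg_one, normAbs_zpow, hp, hk, inv_zpow', ← zpow_add₀ hq.ne']
    rw [hk, ← zpow_zero (resCard F : ℝ), zpow_lt_zpow_iff_right₀ hq1] at h
    rw [← zpow_zero (resCard F : ℝ), zpow_le_zpow_iff_right₀ hq1]
    omega
  · rintro ⟨y, hy, rfl⟩
    rw [normAbs_mul, hp]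
    have := inv_lt_one_of_one_lt₀ hq1
    have := inv_pos.2 hq
    nlinarith [normAbs_nonneg y]

variable {D : Type*} [DivisionRing D] [Algebra F D] [FiniteDimensional F D]
  [TopologicalSpace D] [IsModuleTopology F D]

variable (D) in
include F in
lemma locallyCompactSpace : LocallyCompactSpace D :=
  (coordEquiv F (D := D)).toHomeomorph.isClosedEmbedding.locallyCompactSpace

variable [MeasurableSpace D] [BorelSpace D]

variable (D) in
/-- The lattice as a subgroup. -/
def latticeSubgroup : AddSubgroup D where
  carrier := lattice F D
  zero_mem' := zero_mem_lattice F
  add_mem' := fun {x y} hx hy i => by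
    rw [map_add, Pi.add_apply]
    exact (normAbs_add_le _ _).trans (max_le (hx i) (hy i))
  neg_mem' := fun {x} hx i => by
    rw [map_neg, Pi.neg_apply, ← neg_one_mul, normAbs_mul]
    refine mul_le_one₀ ?_ (normAbs_nonneg _) (hx i)
    rw [normAbs_le_one, Valuation.map_neg, map_one]

/-- Reduction of the lattice modulo the maximal ideal of `F`. -/
def latticeReduction : latticeSubgroup F D →+ (Fin (Module.finrank F D) →
    𝓀[F]) where
  toFun x i := IsLocalRing.residue _ ⟨coordEquiv F (x : D) i, normAbs_le_one.1 (x.2 i)⟩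
  map_zero' := by
    funext i
    rw [Pi.zero_apply, residue_eq_zero_iff]
    simp
  map_add' x y := by
    funext i
    rw [Pi.add_apply, ← map_add]
    congr 1
    ext
    simp

/-- Reducing the coordinates modulo the maximal ideal of F has kernel p times the lattice, which
thus has index q^(dim D). -/
lemma measure_smul_lattice (ν : Measure D) [ν.IsAddLeftInvariant] {p : F}
    (hp : normAbs F p = (resCard F : ℝ)⁻¹) :
    ν (lattice F D) = (resCard F : ℝ≥0∞) ^ Module.finrank F D *
      ν ((fun x => p • x) '' lattice F D) := by
  have : IsTopologicalRing D := IsModuleTopology.isTopologicalRing F D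
  have hp0 : p ≠ 0 := by
    rintro rfl
    rw [normAbs_zero] at hp
    exact (inv_pos.2 (resCard_pos F)).ne hp
  let _ := Fintype.ofFinite 𝓀[F]
  have hcl : IsOpen ((fun x : D => p • x) '' lattice F D) :=
    (Homeomorph.smulOfNeZero p hp0).isOpen_image.2 (isOpen_lattice F D)
  have key := measure_eq_card_mul_of_surjective ν (latticeSubgroup F D) _ hcl.measurableSet
    (latticeReduction F) ?_ ?_ ?_
  · have h1 : (Fintype.card (Fin (Module.finrank F D) → 𝓀[F]) : ℝ≥0∞) =
        (resCard F : ℝ≥0∞) ^ Module.finrank F D := by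
      rw [Fintype.card_pi_const, Nat.cast_pow, resCard, Nat.card_eq_fintype_card]
    rw [h1] at key
    exact key
  · intro c
    choose l hl using fun i => IsLocalRing.residue_surjective (c i)
    refine ⟨⟨(coordEquiv F).symm fun i => (l i : F), fun i => ?_⟩, ?_⟩
    · rw [ContinuousLinearEquiv.apply_symm_apply]
      exact normAbs_le_one.2 (l i).2
    · funext i
      rw [← hl i]
      change IsLocalRing.residue _ _ = _
      congr 1
      ext
      simp
  · rintro _ ⟨y, hy, rfl⟩ i
    change normAbs F (coordEquiv F (p • y) i) ≤ 1
    rw [map_smul, Pi.smul_apply, smul_eq_mul]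
    exact ((normAbs_lt_one_iff_exists hp _).2 ⟨_, hy i, rfl⟩).le
  · intro x
    rw [funext_iff]
    have : ∀ i, latticeReduction F x i = 0 ↔ normAbs F (coordEquiv F (x : D) i) < 1 :=
      fun i => residue_eq_zero_iff F _
    simp only [Pi.zero_apply, this, normAbs_lt_one_iff_exists hp]
    constructor
    · intro h
      choose y hy hy' using h
      refine ⟨(coordEquiv F).symm y, fun i => ?_, ?_⟩
      · rw [ContinuousLinearEquiv.apply_symm_apply]; exact hy i
      · apply (coordEquiv F).injective
        funext i
        simp [hy']
    · rintro ⟨y, hy, h⟩ i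
      exact ⟨coordEquiv F y i, hy i, by rw [← h]; simp⟩

lemma absNorm_le_one_mem_nhds : {x : D | absNorm F x ≤ 1} ∈ nhds (0 : D) := by
  have h : IsOpen {x : D | absNorm F x ≤ 1} := by
    simpa using isOpen_absNorm_le F (D := D) one_ne_zero
  exact h.mem_nhds (by simp)

/-- Both sides are nonnegative characters of D^*. They agree on elements of norm 1, which preserve
the compact open unit ball, and on a uniformizer of F, by the index of lattices. A power of any unit
is a product of such elements, and nonnegative roots are unique. -/
lemma distribHaarChar_eq_absNorm [IsTopologicalRing D] [LocallyCompactSpace D] (u : Dˣ) :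
    (distribHaarChar D u : ℝ) = absNorm F (u : D) := by
  have := t2Space F (D := D)
  set lam : Measure D := Measure.addHaar
  have key1 : ∀ u : Dˣ, absNorm F (u : D) = 1 → distribHaarChar D u = 1 := by
    intro u hu
    refine distribHaarChar_eq_of_measure_smul_eq_mul (μ := lam) (s := {x | absNorm F x ≤ 1})
      ((Measure.measure_pos_of_mem_nhds lam (absNorm_le_one_mem_nhds F)).ne')
      (isCompact_absNorm_le_one F D).measure_lt_top.ne ?_
    rw [ENNReal.coe_one, one_mul]
    congr 1
    ext x
    rw [Set.mem_smul_set_iff_inv_smul_mem]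
    have h1 : absNorm F ((u⁻¹ : Dˣ) : D) = 1 := by
      have := absNorm_mul F (u : D) ((u⁻¹ : Dˣ) : D)
      rw [Units.mul_inv, hu, absNorm_one, one_mul] at this
      exact this.symm
    rw [Set.mem_ofPred_eq, Set.mem_ofPred_eq, Units.smul_def, smul_eq_mul, absNorm_mul, h1, one_mul]
  obtain ⟨p, hp0, hp⟩ := exists_normAbs_eq_inv F
  set m := Module.finrank F D with hm
  have hm0 : 0 < m := Module.finrank_pos
  have hq := resCard_pos F
  let P : Dˣ := Units.map (algebraMap F D).toMonoidHom (Units.mk0 p hp0)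
  have hPn : absNorm F (P : D) = ((resCard F : ℝ) ^ m)⁻¹ := by
    change absNorm F (algebraMap F D p) = _
    rw [absNorm_algebraMap, hp, inv_pow]
  have hP : (distribHaarChar D P : ℝ) = absNorm F (P : D) := by
    have h1 := measure_smul_lattice F (D := D) lam hp
    have h2 : (fun x : D => p • x) '' lattice F D = P • lattice F D := by
      change _ = (fun x : D => P • x) '' lattice F D
      refine Set.image_congr fun x _ => ?_
      rw [Units.smul_def, smul_eq_mul, Algebra.smul_def]
      rfl
    have h3 : distribHaarChar D P = ((resCard F : ℝ≥0) ^ m)⁻¹ := by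
      refine distribHaarChar_eq_of_measure_smul_eq_mul (μ := lam) (s := lattice F D)
        ((Measure.measure_pos_of_mem_nhds lam ((isOpen_lattice F D).mem_nhds (zero_mem_lattice F))).ne')
        (isCompact_lattice F D).measure_lt_top.ne ?_
      have hq' : (resCard F : ℝ≥0) ^ m ≠ 0 := pow_ne_zero _ (by exact_mod_cast hq.ne')
      rw [h1, h2, ENNReal.coe_inv hq', ENNReal.coe_pow, ENNReal.coe_natCast, ← mul_assoc,
        ENNReal.inv_mul_cancel, one_mul]
      · exact_mod_cast hq'
      · exact ENNReal.pow_ne_top (ENNReal.natCast_ne_top _)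
    rw [h3, hPn]
    simp
  obtain ⟨k, hk⟩ := absNorm_eq_zpow F u.ne_zero
  let φ : Dˣ →* ℝ := { toFun := fun u => absNorm F (u : D), map_one' := by simp,
                       map_mul' := fun a b => by simp [absNorm_mul] }
  let ψ : Dˣ →* ℝ := NNReal.toRealHom.toMonoidHom.comp (distribHaarChar D)
  have hφ : ∀ u : Dˣ, φ u = absNorm F (u : D) := fun _ => rfl
  have hφz : ∀ (u : Dˣ) (k : ℤ), φ (u ^ k) = φ u ^ k := fun u k => by
    exact map_zpow' φ (fun x => eq_inv_of_mul_eq_one_left (by rw [← map_mul]; simp)) u k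
  have hψz : ∀ (u : Dˣ) (k : ℤ), ψ (u ^ k) = ψ u ^ k := fun u k => by
    exact map_zpow' ψ (fun x => eq_inv_of_mul_eq_one_left (by rw [← map_mul]; simp)) u k
  -- The exponents are chosen so that |u|^m = q^(km) cancels |P|^k = q^(-mk).
  have h1 : φ (u ^ m * P ^ k) = 1 := by
    rw [map_mul, map_pow, hφz, hφ, hφ, hk, hPn, inv_zpow', ← zpow_natCast, ← zpow_natCast,
      ← zpow_mul, ← zpow_mul, ← zpow_add₀ hq.ne']
    convert zpow_zero _ using 2
    ring
  have h2 : ψ (u ^ m * P ^ k) = 1 := by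
    change ((distribHaarChar D (u ^ m * P ^ k) : ℝ≥0) : ℝ) = 1
    rw [key1 _ h1, NNReal.coe_one]
  have h3 : ψ P = φ P := hP
  have h4 : φ P ^ k ≠ 0 := zpow_ne_zero _ (by rw [hφ, hPn]; positivity)
  have h5 : ψ u ^ m = φ u ^ m := by
    rw [map_mul, map_pow, hφz] at h1
    rw [map_mul, map_pow, hψz, h3] at h2
    exact mul_right_cancel₀ h4 (h2.trans h1.symm)
  exact (pow_left_inj₀ (NNReal.coe_nonneg _) (absNorm_nonneg F _) hm0.ne').1 h5

end Modulus

/-! ### Ramification in a central division algebra -/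

section Ramification

open scoped Pointwise NNReal ENNReal
open ValuativeRel

variable (F : Type*) [Field F] [ValuativeRel F] [TopologicalSpace F]
  [IsNonarchimedeanLocalField F]
variable {D : Type*} [DivisionRing D] [Algebra F D] [FiniteDimensional F D]
  [TopologicalSpace D] [IsModuleTopology F D]

lemma absNorm_neg (x : D) : absNorm F (-x) = absNorm F x := by
  have h : absNorm F (-1 : D) * absNorm F (-1 : D) = 1 := by rw [← absNorm_mul]; simp
  have h1 : absNorm F (-1 : D) = 1 := by nlinarith [absNorm_nonneg F (-1 : D)]
  rw [← neg_one_mul, absNorm_mul, h1, one_mul]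

lemma absNorm_sum_lt {ι : Type*} (s : Finset ι) (f : ι → D) {B : ℝ} (hB : 0 < B)
    (h : ∀ i ∈ s, absNorm F (f i) < B) : absNorm F (∑ i ∈ s, f i) < B := by
  classical
  induction s using Finset.induction_on with
  | empty => simpa using hB
  | insert j s hj ih =>
    rw [Finset.sum_insert hj]
    exact (absNorm_add_le F _ _).trans_lt (max_lt (h j (Finset.mem_insert_self _ _))
      (ih fun i hi => h i (Finset.mem_insert_of_mem hi)))

/-- A term of largest norm is strictly larger than all the others, so the ultrametric inequality
prevents cancellation. -/
lemma sum_ne_zero_of_absNorm_injOn {ι : Type*} (s : Finset ι) (f : ι → D)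
    (hne : ∃ i ∈ s, f i ≠ 0)
    (hinj : ∀ i ∈ s, ∀ j ∈ s, f i ≠ 0 → absNorm F (f i) = absNorm F (f j) → i = j) :
    ∑ i ∈ s, f i ≠ 0 := by
  classical
  obtain ⟨i1, hi1s, hi1⟩ := hne
  obtain ⟨i0, hi0s, hi0⟩ := Finset.exists_max_image s (fun i => absNorm F (f i)) ⟨i1, hi1s⟩
  have h0 : f i0 ≠ 0 := by
    intro h
    have := hi0 i1 hi1s
    rw [h, absNorm_zero] at this
    exact absurd (absNorm_pos F hi1) (not_lt.2 this)
  intro hsum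
  rw [← Finset.add_sum_erase s f hi0s] at hsum
  have h1 : absNorm F (∑ i ∈ s.erase i0, f i) < absNorm F (f i0) := by
    refine absNorm_sum_lt F _ _ (absNorm_pos F h0) fun i hi => ?_
    obtain ⟨hi1, hi2⟩ := Finset.mem_erase.1 hi
    exact lt_of_le_of_ne (hi0 i hi2) fun h => hi1 (hinj i0 hi0s i hi2 h0 h.symm).symm
  rw [← neg_eq_of_add_eq_zero_right hsum, absNorm_neg] at h1
  exact lt_irrefl _ h1

variable (D) in
/-- The ring of integers of `D`. -/
def integers : Subring D where
  carrier := {x | absNorm F x ≤ 1}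
  zero_mem' := by simp
  one_mem' := by simp
  add_mem' := fun ha hb => (absNorm_add_le F _ _).trans (max_le ha hb)
  mul_mem' := fun ha hb => by
    rw [Set.mem_ofPred_eq, absNorm_mul]
    exact mul_le_one₀ ha (absNorm_nonneg F _) hb
  neg_mem' := fun ha => by rwa [Set.mem_ofPred_eq, absNorm_neg]

variable (D) in
/-- The maximal ideal of the ring of integers of `D`. -/
def maxIdeal : Ideal (integers F D) where
  carrier := {x | absNorm F (x : D) < 1}
  zero_mem' := by simp
  add_mem' := fun ha hb => (absNorm_add_le F _ _).trans_lt (max_lt ha hb)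
  smul_mem' := fun c x hx => by
    rw [Set.mem_ofPred_eq, smul_eq_mul, Subring.coe_mul, absNorm_mul]
    have h1 : absNorm F (c : D) ≤ 1 := c.2
    have h2 : absNorm F (x : D) < 1 := hx
    nlinarith [absNorm_nonneg F (c : D), absNorm_nonneg F (x : D)]

lemma mem_maxIdeal {x : integers F D} : x ∈ maxIdeal F D ↔ absNorm F (x : D) < 1 := Iff.rfl

instance : (maxIdeal F D).IsTwoSided where
  mul_mem_of_left {x} c hx := by
    rw [mem_maxIdeal] at hx ⊢
    rw [Subring.coe_mul, absNorm_mul]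
    have h1 : absNorm F (c : D) ≤ 1 := c.2
    nlinarith [absNorm_nonneg F (c : D), absNorm_nonneg F (x : D)]

variable (D) in
/-- The residue division ring of `D`. -/
abbrev ResidueRing : Type _ := integers F D ⧸ maxIdeal F D

variable (D) in
/-- Reduction modulo the maximal ideal, as an additive map. -/
def residueAddHom : (integers F D).toAddSubgroup →+ ResidueRing F D where
  toFun x := Ideal.Quotient.mk (maxIdeal F D) ⟨x.1, x.2⟩
  map_zero' := map_zero (Ideal.Quotient.mk (maxIdeal F D))
  map_add' x y := map_add (Ideal.Quotient.mk (maxIdeal F D)) ⟨x.1, x.2⟩ ⟨y.1, y.2⟩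

variable (D) in
lemma residueAddHom_surjective : Function.Surjective (residueAddHom F D) := fun a => by
  obtain ⟨x, rfl⟩ := Ideal.Quotient.mk_surjective a
  exact ⟨⟨x.1, x.2⟩, rfl⟩

lemma residueRing_mk_eq_zero {x : integers F D} :
    (Ideal.Quotient.mk (maxIdeal F D) x = 0) ↔ absNorm F (x : D) < 1 :=
  Ideal.Quotient.eq_zero_iff_mem

instance : IsDomain (ResidueRing F D) := by
  have : Nontrivial (ResidueRing F D) := by
    refine ⟨1, 0, fun h => ?_⟩
    rw [← map_one (Ideal.Quotient.mk (maxIdeal F D)), residueRing_mk_eq_zero] at h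
    simp at h
  have : NoZeroDivisors (ResidueRing F D) := by
    refine ⟨fun {a b} h => ?_⟩
    obtain ⟨a, rfl⟩ := Ideal.Quotient.mk_surjective a
    obtain ⟨b, rfl⟩ := Ideal.Quotient.mk_surjective b
    rw [← map_mul, residueRing_mk_eq_zero, Subring.coe_mul, absNorm_mul] at h
    rw [residueRing_mk_eq_zero, residueRing_mk_eq_zero]
    by_contra! hc
    nlinarith [hc.1, hc.2]
  exact NoZeroDivisors.to_isDomain _

variable (D) in
/-- The inclusion of the ring of integers of `F`. -/
def integersMap : 𝒪[F] →+* integers F D :=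
  ((algebraMap F D).comp 𝒪[F].subtype).codRestrict (integers F D) fun x => by
    change absNorm F (algebraMap F D x) ≤ 1
    rw [absNorm_algebraMap]
    exact pow_le_one₀ (normAbs_nonneg _) (normAbs_le_one.2 x.2)

variable (D) in
/-- The inclusion of residue fields. -/
def residueMap : 𝓀[F] →+* ResidueRing F D :=
  Ideal.Quotient.lift _ ((Ideal.Quotient.mk (maxIdeal F D)).comp (integersMap F D)) fun a ha => by
    rw [RingHom.comp_apply, residueRing_mk_eq_zero]
    change absNorm F (algebraMap F D a) < 1
    rw [absNorm_algebraMap]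
    exact pow_lt_one₀ (normAbs_nonneg _) ((residue_eq_zero_iff F a).1
      (Ideal.Quotient.eq_zero_iff_mem.2 ha)) Module.finrank_pos.ne'

lemma isOpen_absNorm_lt_one : IsOpen {x : D | absNorm F x < 1} := by
  have : IsTopologicalRing D := IsModuleTopology.isTopologicalRing F D
  have h : IsOpen {x : D | absNorm F x ≤ 1} := by
    simpa using isOpen_absNorm_le F (D := D) one_ne_zero
  obtain ⟨p, hp0, hp⟩ := exists_normAbs_eq_inv F
  have hq1 := one_lt_resCard F
  have hpp : absNorm F (algebraMap F D p) < 1 := by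
    rw [absNorm_algebraMap, hp]
    exact pow_lt_one₀ (inv_pos.2 (resCard_pos F)).le (inv_lt_one_of_one_lt₀ hq1)
      Module.finrank_pos.ne'
  have hp' : algebraMap F D p ≠ 0 := by simpa using hp0
  rw [isOpen_iff_mem_nhds]
  intro x hx
  have h1 : {y : D | absNorm F ((algebraMap F D p)⁻¹ * (y - x)) ≤ 1} ∈ nhds x := by
    refine (h.preimage (continuous_const.mul (continuous_id.sub continuous_const))).mem_nhds ?_
    simp
  refine Filter.mem_of_superset h1 fun y hy => ?_
  have h2 : y = x + algebraMap F D p * ((algebraMap F D p)⁻¹ * (y - x)) := by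
    rw [mul_inv_cancel_left₀ hp', add_sub_cancel]
  rw [h2]
  refine (absNorm_add_le F _ _).trans_lt (max_lt hx ?_)
  rw [absNorm_mul]
  have h3 : absNorm F ((algebraMap F D p)⁻¹ * (y - x)) ≤ 1 := hy
  exact mul_lt_one_of_nonneg_of_lt_one_left (absNorm_nonneg F _) hpp h3

instance : Finite (ResidueRing F D) := by
  have : IsTopologicalRing D := IsModuleTopology.isTopologicalRing F D
  exact finite_of_compact_of_isOpen (integers F D).toAddSubgroup (isCompact_absNorm_le_one F D) _
    (isOpen_absNorm_lt_one F)
    (residueAddHom F D)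
    (residueAddHom_surjective F D) fun x => residueRing_mk_eq_zero F

/-- The degree of the residue division ring over `F` is at most `n`: lift a generator. -/
lemma card_residueRing_le [Algebra.IsCentral F D] {n : ℕ} (hn : Module.finrank F D = n ^ 2) :
    Nat.card (ResidueRing F D) ≤ resCard F ^ n := by
  -- A finite domain is commutative by Wedderburn, so the residue extension is generated by a single
  -- ζ, whose lift has degree at most n over F.
  let instF : Field (ResidueRing F D) := (Finite.isDomain_to_isField (ResidueRing F D)).toField
  let instA : Algebra 𝓀[F] (ResidueRing F D) := (residueMap F D).toAlgebra
  obtain ⟨ζ, hζ⟩ := Field.exists_primitive_element_of_finite_top 𝓀[F] (ResidueRing F D)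
  have hfin : FiniteDimensional 𝓀[F] (ResidueRing F D) := Module.Finite.of_finite
  have hint : IsIntegral 𝓀[F] ζ := Algebra.IsIntegral.isIntegral ζ
  have hdeg : Module.finrank 𝓀[F] (ResidueRing F D) = (minpoly 𝓀[F] ζ).natDegree := by
    rw [← IntermediateField.finrank_top', ← hζ, IntermediateField.adjoin.finrank hint]
  have hcard : Nat.card (ResidueRing F D) =
      resCard F ^ Module.finrank 𝓀[F] (ResidueRing F D) :=
    Module.natCard_eq_pow_finrank
  rw [hcard]
  have hq : 1 < resCard F := by exact_mod_cast one_lt_resCard F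
  refine Nat.pow_le_pow_right (by omega) ?_
  rw [hdeg]
  obtain ⟨x, hx⟩ := Ideal.Quotient.mk_surjective ζ
  refine le_trans ?_ (natDegree_minpoly_le hn (x : D))
  -- normalize the minimal polynomial of the lift
  set P := minpoly F (x : D) with hP
  have hP0 : P ≠ 0 := minpoly.ne_zero (Algebra.IsIntegral.isIntegral _)
  obtain ⟨i0, hi0s, hi0⟩ := Finset.exists_max_image (Finset.range (P.natDegree + 1))
    (fun i => normAbs F (P.coeff i)) ⟨0, by simp⟩
  have hc0 : P.coeff i0 ≠ 0 := by
    intro h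
    have := hi0 P.natDegree (by simp)
    rw [h, normAbs_zero] at this
    exact absurd (normAbs_pos (by simpa using hP0)) (not_lt.2 this)
  have hdiv : ∀ i, i ∈ Finset.range (P.natDegree + 1) →
      normAbs F ((P.coeff i0)⁻¹ * P.coeff i) ≤ 1 := by
    intro i hi
    have h1 := hi0 i hi
    have h2 : normAbs F (P.coeff i0 * ((P.coeff i0)⁻¹ * P.coeff i)) ≤ normAbs F (P.coeff i0) := by
      rwa [mul_inv_cancel_left₀ hc0]
    rw [normAbs_mul] at h2
    exact le_of_mul_le_mul_left (by linarith) (normAbs_pos hc0)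
  classical
  let a : ℕ → 𝒪[F] := fun i => if h : i ∈ Finset.range (P.natDegree + 1) then
    ⟨(P.coeff i0)⁻¹ * P.coeff i, normAbs_le_one.1 (hdiv i h)⟩ else 0
  have ha : ∀ i ∈ Finset.range (P.natDegree + 1), (a i : F) = (P.coeff i0)⁻¹ * P.coeff i := by
    intro i hi
    simp only [a, dif_pos hi]
  have hrel : ∑ i ∈ Finset.range (P.natDegree + 1), integersMap F D (a i) * x ^ i = 0 := by
    apply Subtype.ext
    have h1 : Polynomial.aeval (x : D) P = 0 := minpoly.aeval F _
    rw [Polynomial.aeval_eq_sum_range] at h1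
    have h2 : ((∑ i ∈ Finset.range (P.natDegree + 1), integersMap F D (a i) * x ^ i :
        integers F D) : D) = ∑ i ∈ Finset.range (P.natDegree + 1),
          (P.coeff i0)⁻¹ • (P.coeff i • (x : D) ^ i) := by
      rw [AddSubmonoidClass.coe_finsetSum]
      refine Finset.sum_congr rfl fun i hi => ?_
      rw [smul_smul, ← ha i hi, Algebra.smul_def]
      rfl
    rw [h2, ← Finset.smul_sum, h1, smul_zero]
    rfl
  let Q : Polynomial 𝓀[F] := ∑ i ∈ Finset.range (P.natDegree + 1),
    Polynomial.monomial i (IsLocalRing.residue 𝒪[F] (a i))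
  have hQ : Polynomial.aeval ζ Q = 0 := by
    have h1 := congrArg (Ideal.Quotient.mk (maxIdeal F D)) hrel
    rw [map_zero, map_sum] at h1
    rw [map_sum, ← h1]
    refine Finset.sum_congr rfl fun i _ => ?_
    rw [Polynomial.aeval_monomial, map_mul, map_pow, hx]
    rfl
  -- Dividing by a coefficient of largest absolute value makes that coefficient 1, and it survives
  -- reduction.
  have hQ0 : Q ≠ 0 := by
    intro h
    have h1 := congrArg (fun R => Polynomial.coeff R i0) h
    simp only [Q, Polynomial.finsetSum_coeff, Polynomial.coeff_monomial, Polynomial.coeff_zero,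
      Finset.sum_ite_eq', if_pos hi0s] at h1
    rw [residue_eq_zero_iff, ha i0 hi0s, inv_mul_cancel₀ hc0, normAbs_one] at h1
    exact lt_irrefl _ h1
  refine (Polynomial.natDegree_le_natDegree (minpoly.degree_le_of_ne_zero _ _ hQ0 hQ)).trans ?_
  refine Polynomial.natDegree_sum_le_of_forall_le _ _ fun i hi => ?_
  exact (Polynomial.natDegree_monomial_le _).trans (Nat.lt_succ_iff.1 (Finset.mem_range.1 hi))

/-- The maximal ideal is u times the ring of integers. Its Haar measure is computed once from the
index and once from the modulus of u. -/
lemma card_residueRing_mul_absNorm [MeasurableSpace D] [BorelSpace D] [IsTopologicalRing D] [LocallyCompactSpace D] (u : Dˣ)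
    (hu : ∀ x : D, absNorm F x < 1 ↔ absNorm F x ≤ absNorm F (u : D)) :
    Nat.card (ResidueRing F D) * absNorm F (u : D) = 1 := by
  have := t2Space F (D := D)
  set lam : Measure D := Measure.addHaar
  let _ := Fintype.ofFinite (ResidueRing F D)
  have h1 := measure_eq_card_mul_of_surjective lam (integers F D).toAddSubgroup _
    (isOpen_absNorm_lt_one F).measurableSet
    (residueAddHom F D)
    (residueAddHom_surjective F D)
    (fun x (hx : absNorm F x < 1) => (hx.le : absNorm F x ≤ 1)) fun x => residueRing_mk_eq_zero F
  have h2 : {x : D | absNorm F x < 1} = u • ((integers F D).toAddSubgroup : Set D) := by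
    ext x
    rw [Set.mem_smul_set_iff_inv_smul_mem, Set.mem_ofPred_eq, hu]
    change _ ↔ absNorm F (u⁻¹ • x) ≤ 1
    have h3 : absNorm F x = absNorm F (u : D) * absNorm F (u⁻¹ • x) := by
      rw [← absNorm_mul, ← smul_eq_mul, ← Units.smul_def, smul_inv_smul]
    have h4 := absNorm_pos F u.ne_zero
    rw [h3]
    constructor
    · intro h; exact le_of_mul_le_mul_left (by linarith) h4
    · intro h; nlinarith
  rw [h2, ← distribHaarChar_mul] at h1
  have h5 : lam ((integers F D).toAddSubgroup : Set D) ≠ 0 :=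
    (Measure.measure_pos_of_mem_nhds lam (absNorm_le_one_mem_nhds F)).ne'
  have h6 : lam ((integers F D).toAddSubgroup : Set D) ≠ ∞ :=
    (isCompact_absNorm_le_one F D).measure_lt_top.ne
  rw [← mul_assoc] at h1
  have h7 : ((Fintype.card (ResidueRing F D) : ℝ≥0∞) * distribHaarChar D u) = 1 := by
    refine (ENNReal.mul_left_inj h5 h6).1 ?_
    rw [one_mul, ← h1]
  have h8 := congrArg ENNReal.toReal h7
  rw [ENNReal.toReal_mul, ENNReal.toReal_natCast, ENNReal.coe_toReal,
    distribHaarChar_eq_absNorm F u, ENNReal.toReal_one] at h8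
  rw [Nat.card_eq_fintype_card, h8]

/-- The norm of a uniformizer of `D` has absolute value `q⁻ⁿ`, and the norms of all elements have
absolute values in `qⁿᶻ`. -/
lemma exists_absNorm_eq [Algebra.IsCentral F D] {n : ℕ} (hn : Module.finrank F D = n ^ 2) :
    (∃ u : Dˣ, absNorm F (u : D) = (resCard F : ℝ) ^ (-(n : ℤ))) ∧
    ∀ x : D, x ≠ 0 → ∃ k : ℤ, absNorm F x = (resCard F : ℝ) ^ (n * k) := by
  have : IsTopologicalRing D := IsModuleTopology.isTopologicalRing F D
  have := locallyCompactSpace F D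
  borelize D
  have hq := resCard_pos F
  have hq1 := one_lt_resCard F
  have hqn : 1 < resCard F := by exact_mod_cast hq1
  -- The exponents of values of the norm form fℤ, and a uniformizer of F gives n² = fe. Here f is
  -- the residue degree and e the ramification index; both turn out to equal n.
  let Γ : AddSubgroup ℤ :=
    { carrier := {k | ∃ u : Dˣ, absNorm F (u : D) = (resCard F : ℝ) ^ k}
      zero_mem' := ⟨1, by simp⟩
      add_mem' := by
        rintro a b ⟨u, hu⟩ ⟨v, hv⟩
        exact ⟨u * v, by rw [Units.val_mul, absNorm_mul, hu, hv, zpow_add₀ hq.ne']⟩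
      neg_mem' := by
        rintro a ⟨u, hu⟩
        refine ⟨u⁻¹, ?_⟩
        have h1 : absNorm F (u : D) * absNorm F ((u⁻¹ : Dˣ) : D) = 1 := by
          rw [← absNorm_mul, Units.mul_inv, absNorm_one]
        rw [hu] at h1
        rw [zpow_neg, eq_inv_of_mul_eq_one_right h1] }
  have hΓ : ∀ k, k ∈ Γ ↔ ∃ u : Dˣ, absNorm F (u : D) = (resCard F : ℝ) ^ k := fun _ => Iff.rfl
  obtain ⟨f', hf'⟩ := Int.subgroup_cyclic Γ
  set f := f'.natAbs
  have hf : ∀ k, k ∈ Γ ↔ (f : ℤ) ∣ k := by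
    intro k
    rw [hf', ← AddSubgroup.zmultiples_eq_closure, Int.mem_zmultiples_iff, Int.natAbs_dvd]
  obtain ⟨p, hp0, hp⟩ := exists_normAbs_eq_inv F
  have hn2 : (-(n ^ 2 : ℕ) : ℤ) ∈ Γ := by
    refine (hΓ _).2 ⟨Units.map (algebraMap F D).toMonoidHom (Units.mk0 p hp0), ?_⟩
    change absNorm F (algebraMap F D p) = _
    rw [absNorm_algebraMap, hp, hn, inv_pow, zpow_neg, zpow_natCast]
  have hnpos : 0 < n ^ 2 := by rw [← hn]; exact Module.finrank_pos
  rw [hf, Int.dvd_neg, Int.natCast_dvd_natCast] at hn2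
  obtain ⟨e, he⟩ := hn2
  have hfpos : 0 < f := Nat.pos_of_ne_zero fun h => by rw [he, h, zero_mul] at hnpos; omega
  have hepos : 0 < e := Nat.pos_of_ne_zero fun h => by rw [he, h, mul_zero] at hnpos; omega
  obtain ⟨u, hu⟩ := (hΓ (-(f : ℤ))).1 ((hf _).2 (Int.dvd_neg.2 dvd_rfl))
  have hval : ∀ x : D, x ≠ 0 → ∃ k : ℤ, absNorm F x = (resCard F : ℝ) ^ (f * k) := by
    intro x hx
    obtain ⟨k, hk⟩ := absNorm_eq_zpow F hx
    obtain ⟨j, rfl⟩ := (hf k).1 ((hΓ k).2 ⟨Units.mk0 x hx, hk⟩)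
    exact ⟨j, hk⟩
  -- An element of norm q^(-f) generates the maximal ideal, so the residue ring has q^f elements,
  -- and there are at most qⁿ.
  have hf1 : f ≤ n := by
    have h1 := card_residueRing_mul_absNorm F u fun x => by
      by_cases hx : x = 0
      · simp [hx, absNorm_nonneg]
      obtain ⟨k, hk⟩ := hval x hx
      rw [hk, hu, zpow_le_zpow_iff_right₀ hq1, ← zpow_zero (resCard F : ℝ),
        zpow_lt_zpow_iff_right₀ hq1]
      have : (0 : ℤ) < f := by exact_mod_cast hfpos
      constructor
      · intro h
        have : k < 0 := by nlinarith
        nlinarith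
      · intro h; omega
    rw [hu, zpow_neg, zpow_natCast, mul_inv_eq_one₀ (by positivity)] at h1
    have h2 : Nat.card (ResidueRing F D) = resCard F ^ f := by exact_mod_cast h1
    have h3 := card_residueRing_le F hn (D := D)
    rw [h2] at h3
    exact (Nat.pow_le_pow_iff_right hqn).1 h3
  -- If the minimal polynomial of u had degree less than e, its nonzero terms c_i uⁱ would have
  -- norms q^(f(ea - i)) with i distinct modulo e, and could not sum to 0.
  have he1 : e ≤ n := by
    refine le_trans ?_ (natDegree_minpoly_le hn (u : D))
    by_contra! hlt
    set P := minpoly F (u : D) with hP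
    have hP0 : P ≠ 0 := minpoly.ne_zero (Algebra.IsIntegral.isIntegral _)
    have h1 : Polynomial.aeval (u : D) P = 0 := minpoly.aeval F _
    rw [Polynomial.aeval_eq_sum_range] at h1
    have hterm : ∀ i, P.coeff i • (u : D) ^ i ≠ 0 → ∃ a : ℤ,
        absNorm F (P.coeff i • (u : D) ^ i) = (resCard F : ℝ) ^ (f * (e * a - i)) := by
      intro i hi
      have hc : P.coeff i ≠ 0 := fun h => hi (by rw [h, zero_smul])
      obtain ⟨a, ha⟩ := exists_normAbs_zpow hc
      refine ⟨a, ?_⟩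
      rw [absNorm_smul, absNorm_pow, hu, ha, hn, ← zpow_natCast, ← zpow_natCast, ← zpow_mul,
        ← zpow_mul, ← zpow_add₀ hq.ne', he]
      congr 1
      push_cast
      ring
    refine sum_ne_zero_of_absNorm_injOn F (Finset.range (P.natDegree + 1))
      (fun i => P.coeff i • (u : D) ^ i) ⟨P.natDegree, by simp, ?_⟩ ?_ h1
    · exact smul_ne_zero (by simpa using hP0) (pow_ne_zero _ u.ne_zero)
    · intro i hi j hj hi0 hij
      have hj0 : P.coeff j • (u : D) ^ j ≠ 0 := by
        intro h
        have h2 := absNorm_pos F hi0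
        rw [hij, h, absNorm_zero] at h2
        exact lt_irrefl _ h2
      obtain ⟨a, ha⟩ := hterm i hi0
      obtain ⟨b, hb⟩ := hterm j hj0
      rw [ha, hb] at hij
      have h3 := zpow_right_injective₀ hq hq1.ne' hij
      have h4 : (e : ℤ) * a - i = e * b - j :=
        mul_left_cancel₀ (by exact_mod_cast hfpos.ne') h3
      have hi' := Finset.mem_range.1 hi
      have hj' := Finset.mem_range.1 hj
      have h5 : (i : ℤ) - j = e * (a - b) := by linarith
      have h6 : (e : ℤ) ∣ (i : ℤ) - j := ⟨_, h5⟩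
      have h7 : |(i : ℤ) - j| < e := by rw [abs_lt]; omega
      have h8 := Int.eq_zero_of_abs_lt_dvd h6 h7
      omega
  have hfn : f = n := by
    refine le_antisymm hf1 ?_
    by_contra! h
    have : f * e < n * n := by
      calc f * e ≤ f * n := Nat.mul_le_mul_left _ he1
        _ < n * n := Nat.mul_lt_mul_of_pos_right h (by omega)
    rw [← he, sq] at this
    exact lt_irrefl _ this
  rw [← hfn]
  exact ⟨⟨u, hu⟩, hval⟩

end Ramification

/-! ### Normalized absolute values on locally compact division rings -/

section Setup

variable {D : Type*} [DivisionRing D] [TopologicalSpace D] [MeasurableSpace D]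

/-- The additive measure `N x ^ n d^*x`. -/
def unitsAddMeasure (n : ℕ) (N : D → ℝ) (μ : Measure Dˣ) : Measure D :=
  (μ.withDensity fun x : Dˣ => ENNReal.ofReal (N (x : D) ^ n)).map Units.val

/-- `N` is a normalized ultrametric absolute value on the locally compact division ring `D` with
value group `qᶻ`, for which the bi-invariant measure `μ` on `Dˣ` gives `N xⁿ μ` as additive
Haar measure. -/
structure IsNormalizedAbs (q : ℝ) (n : ℕ) (N : D → ℝ) (μ : Measure Dˣ) : Prop where
  one_lt_q : 1 < q
  n_pos : 0 < n
  map_mul : ∀ x y, N (x * y) = N x * N y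
  map_zero : N 0 = 0
  add_le : ∀ x y, N (x + y) ≤ max (N x) (N y)
  exists_zpow : ∀ x ≠ 0, ∃ k : ℤ, N x = q ^ k
  exists_unif : ∃ u : Dˣ, N (u : D) = q⁻¹
  exists_central : ∃ u : Dˣ, (∀ x : Dˣ, u * x = x * u) ∧ N (u : D) = q ^ (-(n : ℤ))
  hasBasis : (nhds (0 : D)).HasBasis (fun _ : ℤ => True) (fun k => {x | N x ≤ q ^ k})
  isCompact : ∀ k : ℤ, IsCompact {x | N x ≤ q ^ k}
  leftInvariant : μ.IsMulLeftInvariant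
  rightInvariant : μ.IsMulRightInvariant
  invInvariant : μ.IsInvInvariant
  measure_units : μ {w : Dˣ | N (w : D) = 1} = 1
  addInvariant : (unitsAddMeasure n N μ).IsAddLeftInvariant
  finiteOnCompacts : IsFiniteMeasureOnCompacts (unitsAddMeasure n N μ)

end Setup

/-! ### Topology of D in terms of |Nrd| -/

section AbsNrd

open scoped Pointwise NNReal ENNReal

variable (F : Type*) [Field F] [ValuativeRel F] [TopologicalSpace F]
  [IsNonarchimedeanLocalField F]
variable {D : Type*} [DivisionRing D] [Algebra F D] [Algebra.IsCentral F D] [FiniteDimensional F D]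
  [TopologicalSpace D] [IsModuleTopology F D]
variable {n : ℕ}

lemma absNrd_eq_rpow (x : D) : absNrd F n x = absNorm F x ^ ((n : ℝ)⁻¹) := rfl

lemma absNrd_pow (hn : 0 < n) (x : D) : absNrd F n x ^ n = absNorm F x := by
  rw [absNrd_eq_rpow, ← Real.rpow_natCast, ← Real.rpow_mul (absNorm_nonneg F x),
    inv_mul_cancel₀ (by exact_mod_cast hn.ne'), Real.rpow_one]

lemma absNrd_nonneg (x : D) : 0 ≤ absNrd F n x := Real.rpow_nonneg (absNorm_nonneg F x) _

lemma absNrd_mul (x y : D) : absNrd F n (x * y) = absNrd F n x * absNrd F n y := by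
  rw [absNrd_eq_rpow, absNorm_mul, Real.mul_rpow (absNorm_nonneg F x) (absNorm_nonneg F y)]
  rfl

lemma absNrd_zero (hn : 0 < n) : absNrd F n (0 : D) = 0 := by
  rw [absNrd_eq_rpow, absNorm_zero, Real.zero_rpow (by positivity)]

lemma absNrd_add_le (x y : D) : absNrd F n (x + y) ≤ max (absNrd F n x) (absNrd F n y) := by
  have h : (0 : ℝ) ≤ (n : ℝ)⁻¹ := by positivity
  rcases le_total (absNorm F x) (absNorm F y) with hxy | hxy
  · refine le_trans (Real.rpow_le_rpow (absNorm_nonneg F _) (absNorm_add_le F x y) h) ?_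
    rw [max_eq_right hxy]
    exact le_max_right _ _
  · refine le_trans (Real.rpow_le_rpow (absNorm_nonneg F _) (absNorm_add_le F x y) h) ?_
    rw [max_eq_left hxy]
    exact le_max_left _ _

lemma absNrd_eq_zpow_iff (hn : 0 < n) (x : D) (k : ℤ) :
    absNrd F n x = (resCard F : ℝ) ^ k ↔ absNorm F x = (resCard F : ℝ) ^ (n * k) := by
  have hq := resCard_pos F
  rw [← absNrd_pow F hn x, mul_comm, zpow_mul, zpow_natCast,
    pow_left_inj₀ (absNrd_nonneg F x) (by positivity) hn.ne']

lemma absNrd_le_zpow_iff (hn : 0 < n) (x : D) (k : ℤ) :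
    absNrd F n x ≤ (resCard F : ℝ) ^ k ↔ absNorm F x ≤ (resCard F : ℝ) ^ (n * k) := by
  have hq := resCard_pos F
  rw [← absNrd_pow F hn x, mul_comm, zpow_mul, zpow_natCast,
    pow_le_pow_iff_left₀ (absNrd_nonneg F x) (by positivity) hn.ne']

lemma exists_normAbs_eq_zpow (k : ℤ) : ∃ c : F, c ≠ 0 ∧ normAbs F c = (resCard F : ℝ) ^ k := by
  obtain ⟨p, hp0, hp⟩ := exists_normAbs_eq_inv F
  exact ⟨p ^ (-k), zpow_ne_zero _ hp0, by rw [normAbs_zpow, hp, inv_zpow', neg_neg]⟩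

lemma isOpen_absNrd_le (hn : 0 < n) (k : ℤ) :
    IsOpen {x : D | absNrd F n x ≤ (resCard F : ℝ) ^ k} := by
  simp_rw [absNrd_le_zpow_iff F hn]
  obtain ⟨c, hc0, hc⟩ := exists_normAbs_eq_zpow F (n * k)
  rw [← hc]
  exact isOpen_absNorm_le F hc0

lemma isClosed_absNrd_le (hn : 0 < n) (k : ℤ) :
    IsClosed {x : D | absNrd F n x ≤ (resCard F : ℝ) ^ k} := by
  simp_rw [absNrd_le_zpow_iff F hn]
  obtain ⟨c, hc0, hc⟩ := exists_normAbs_eq_zpow F (n * k)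
  rw [← hc]
  exact isClosed_absNorm_le F c

lemma pos_of_finrank_eq_sq (hn : Module.finrank F D = n ^ 2) : 0 < n := by
  have : 0 < n ^ 2 := by rw [← hn]; exact Module.finrank_pos
  exact Nat.pos_of_ne_zero fun h => by simp [h] at this

lemma isCompact_absNrd_le (hn : Module.finrank F D = n ^ 2) (k : ℤ) :
    IsCompact {x : D | absNrd F n x ≤ (resCard F : ℝ) ^ k} := by
  have hn0 := pos_of_finrank_eq_sq F hn
  have : IsTopologicalRing D := IsModuleTopology.isTopologicalRing F D
  have hq := resCard_pos F
  obtain ⟨⟨u, hu⟩, -⟩ := exists_absNorm_eq F hn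
  have h1 := (isCompact_absNorm_le_one F D).image
    (continuous_const_smul (u ^ (-k)) : Continuous fun x : D => u ^ (-k) • x)
  convert h1 using 1
  have hu1 : absNrd F n (u : D) = (resCard F : ℝ) ^ (-1 : ℤ) := by
    rw [absNrd_eq_zpow_iff F hn0, hu]; simp
  have hk : ∀ j : ℤ, absNrd F n ((u ^ j : Dˣ) : D) = (resCard F : ℝ) ^ (-j) := by
    intro j
    let φ : Dˣ →* ℝ := { toFun := fun u => absNrd F n (u : D),
                         map_one' := by simp [absNrd_eq_rpow],
                         map_mul' := fun a b => by simp [absNrd_mul] }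
    have : φ (u ^ j) = φ u ^ j :=
      map_zpow' φ (fun x => eq_inv_of_mul_eq_one_left (by rw [← map_mul]; simp)) u j
    change φ (u ^ j) = _
    rw [this]
    change absNrd F n (u : D) ^ j = _
    rw [hu1, ← zpow_mul, neg_one_mul]
  have h1' : ∀ y : D, absNorm F y ≤ 1 ↔ absNrd F n y ≤ 1 := by
    intro y
    have := absNrd_le_zpow_iff F hn0 y 0
    simpa using this.symm
  ext x
  constructor
  · intro hx
    refine ⟨u ^ k • x, ?_, by rw [zpow_neg]; exact inv_smul_smul _ _⟩
    rw [Set.mem_ofPred_eq, h1', Units.smul_def, smul_eq_mul, absNrd_mul, hk]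
    have hx' : absNrd F n x ≤ (resCard F : ℝ) ^ k := hx
    calc _ ≤ (resCard F : ℝ) ^ (-k) * (resCard F : ℝ) ^ k :=
          mul_le_mul_of_nonneg_left hx' (by positivity)
      _ = 1 := by rw [← zpow_add₀ hq.ne', neg_add_cancel, zpow_zero]
  · rintro ⟨y, hy, rfl⟩
    rw [Set.mem_ofPred_eq, h1'] at hy
    change absNrd F n (u ^ (-k) • y) ≤ _
    rw [Units.smul_def, smul_eq_mul, absNrd_mul, hk, neg_neg]
    exact mul_le_of_le_one_right (by positivity) hy

lemma absNrd_pos {x : D} (hx : x ≠ 0) : 0 < absNrd F n x := Real.rpow_pos_of_pos (absNorm_pos F hx) _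

/-- The part of the unit ball outside a neighbourhood of 0 is compact and avoids 0, hence avoids a
small ball. -/
lemma hasBasis_absNrd (hn : Module.finrank F D = n ^ 2) :
    (nhds (0 : D)).HasBasis (fun _ : ℤ => True)
      (fun k => {x | absNrd F n x ≤ (resCard F : ℝ) ^ k}) := by
  have hn0 := pos_of_finrank_eq_sq F hn
  have hq := resCard_pos F
  have hq1 := one_lt_resCard F
  have := t2Space F (D := D)
  refine ⟨fun s => ⟨fun hs => ?_, fun ⟨k, _, hk⟩ => ?_⟩⟩
  · obtain ⟨t, hts, ht, h0t⟩ := mem_nhds_iff.1 hs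
    have hcpt : IsCompact ({x : D | absNrd F n x ≤ (resCard F : ℝ) ^ (0 : ℤ)} \ t) :=
      (isCompact_absNrd_le F hn 0).diff ht
    have hcov := hcpt.elim_directed_cover
      (fun k : ℕ => {x : D | absNrd F n x ≤ (resCard F : ℝ) ^ (-(k : ℤ))}ᶜ)
      (fun k => (isClosed_absNrd_le F hn0 _).isOpen_compl) ?_ ?_
    · obtain ⟨k, hk⟩ := hcov
      refine ⟨-(k : ℤ), trivial, fun x hx => hts ?_⟩
      by_contra hxt
      refine hk ⟨?_, hxt⟩ hx
      exact (show absNrd F n x ≤ _ from hx).trans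
        (zpow_le_zpow_right₀ hq1.le (by omega))
    · rintro x ⟨hx, hxt⟩
      have hx0 : x ≠ 0 := by rintro rfl; exact hxt h0t
      obtain ⟨k, hk⟩ := exists_pow_lt_of_lt_one (absNrd_pos F (n := n) hx0)
        (inv_lt_one_of_one_lt₀ hq1)
      refine Set.mem_iUnion.2 ⟨k, ?_⟩
      simpa using hk
    · refine directed_of_isDirected_le fun i j hij x hx => ?_
      simp only [Set.mem_compl_iff, Set.mem_ofPred_eq, not_le] at hx ⊢
      refine lt_of_le_of_lt (zpow_le_zpow_right₀ hq1.le (by omega)) hx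
  · refine Filter.mem_of_superset ((isOpen_absNrd_le F hn0 k).mem_nhds ?_) hk
    rw [Set.mem_ofPred_eq, absNrd_zero F hn0]
    positivity

lemma absNrd_eq_of_sub_lt {x y : D} (h : absNrd F n (y - x) < absNrd F n x) :
    absNrd F n y = absNrd F n x := by
  have hneg : ∀ z : D, absNrd F n (-z) = absNrd F n z := fun z => by
    rw [absNrd_eq_rpow, absNorm_neg]; rfl
  refine le_antisymm ?_ ?_
  · have := absNrd_add_le F (n := n) (y - x) x
    rw [sub_add_cancel, max_eq_right h.le] at this
    exact this
  · have := absNrd_add_le F (n := n) (-(y - x)) y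
    rw [neg_sub, sub_add_cancel, ← neg_sub y x, hneg] at this
    rcases le_max_iff.1 this with h1 | h1
    · exact absurd h (not_lt.2 h1)
    · exact h1

lemma continuousInv₀ (hn : Module.finrank F D = n ^ 2) : ContinuousInv₀ D := by
  have hn0 := pos_of_finrank_eq_sq F hn
  have hq := resCard_pos F
  have hq1 := one_lt_resCard F
  have : IsTopologicalRing D := IsModuleTopology.isTopologicalRing F D
  refine ⟨fun {x} hx => ?_⟩
  have hxp := absNrd_pos F (n := n) hx
  obtain ⟨j, hj⟩ : ∃ j : ℤ, absNrd F n x = (resCard F : ℝ) ^ j := by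
    obtain ⟨k, hk⟩ := (exists_absNorm_eq F hn).2 x hx
    exact ⟨k, (absNrd_eq_zpow_iff F hn0 _ _).2 hk⟩
  rw [ContinuousAt, tendsto_sub_nhds_zero_iff.symm, (hasBasis_absNrd F hn).tendsto_right_iff]
  intro k _
  -- The exponent j - 1 forces |y| = |x| = q^j. The exponent k + 2j absorbs the two factors q^(-j)
  -- in y⁻¹ - x⁻¹ = -y⁻¹(y - x)x⁻¹.
  have h1 : {y : D | absNrd F n (y - x) ≤ (resCard F : ℝ) ^ (min (j - 1) (k + 2 * j))} ∈ nhds x := by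
    refine ((isOpen_absNrd_le F hn0 _).preimage
      (continuous_id.sub (continuous_const (y := x)))).mem_nhds ?_
    change absNrd F n (x - x) ≤ _
    rw [sub_self, absNrd_zero F hn0]
    positivity
  filter_upwards [h1] with y hy
  have hy1 : absNrd F n (y - x) ≤ (resCard F : ℝ) ^ (min (j - 1) (k + 2 * j)) := hy
  have hy2 : absNrd F n (y - x) < absNrd F n x := by
    rw [hj]
    exact hy1.trans_lt (zpow_lt_zpow_right₀ hq1 (by omega))
  have hyx := absNrd_eq_of_sub_lt F hy2
  have hy0 : y ≠ 0 := by
    rintro rfl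
    rw [absNrd_zero F hn0] at hyx
    exact hxp.ne hyx
  have h3 : y⁻¹ - x⁻¹ = y⁻¹ * (-(y - x)) * x⁻¹ := by
    rw [neg_sub, mul_sub, sub_mul, inv_mul_cancel₀ hy0, one_mul, mul_assoc, mul_inv_cancel₀ hx,
      mul_one]
  have hneg : ∀ z : D, absNrd F n (-z) = absNrd F n z := fun z => by
    rw [absNrd_eq_rpow, absNorm_neg]; rfl
  have hinv : ∀ z : D, z ≠ 0 → absNrd F n z⁻¹ = (absNrd F n z)⁻¹ := fun z hz => by
    refine eq_inv_of_mul_eq_one_left ?_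
    rw [← absNrd_mul, inv_mul_cancel₀ hz]; simp [absNrd_eq_rpow]
  rw [h3, absNrd_mul, absNrd_mul, hneg, hinv y hy0, hinv x hx, hyx, hj, ← zpow_neg]
  calc _ ≤ (resCard F : ℝ) ^ (-j) * (resCard F : ℝ) ^ (k + 2 * j) * (resCard F : ℝ) ^ (-j) := by
        refine mul_le_mul_of_nonneg_right (mul_le_mul_of_nonneg_left (hy1.trans ?_) ?_) ?_
        · exact zpow_le_zpow_right₀ hq1.le (min_le_right _ _)
        · positivity
        · positivity
    _ = (resCard F : ℝ) ^ k := by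
        rw [← zpow_add₀ hq.ne', ← zpow_add₀ hq.ne']; congr 1; ring

variable (D) in
lemma sigmaCompactSpace (hn : Module.finrank F D = n ^ 2) : SigmaCompactSpace D := by
  refine ⟨⟨fun k : ℕ => {x : D | absNrd F n x ≤ (resCard F : ℝ) ^ (k : ℤ)},
    fun k => isCompact_absNrd_le F hn k, ?_⟩⟩
  refine Set.eq_univ_of_forall fun x => ?_
  obtain ⟨k, hk⟩ := pow_unbounded_of_one_lt (absNrd F n x) (one_lt_resCard F)
  exact Set.mem_iUnion.2 ⟨k, by simpa using hk.le⟩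

variable (D) in
lemma secondCountableTopology (hn : Module.finrank F D = n ^ 2) : SecondCountableTopology D := by
  have : IsTopologicalRing D := IsModuleTopology.isTopologicalRing F D
  let _ := IsTopologicalAddGroup.rightUniformSpace D
  have := isUniformAddGroup_of_addCommGroup (G := D)
  have : (nhds (0 : D)).IsCountablyGenerated := (hasBasis_absNrd F hn).isCountablyGenerated
  have : (uniformity D).IsCountablyGenerated := IsUniformAddGroup.uniformity_countably_generated
  let _ := UniformSpace.pseudoMetricSpace D
  have := sigmaCompactSpace F D hn
  exact EMetric.secondCountable_of_sigmaCompact D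

end AbsNrd

/-! ### The Haar measures of a central division algebra and of its unit group -/

section UnitsTopology

variable {D : Type*} [DivisionRing D] [TopologicalSpace D] [IsTopologicalRing D] [T2Space D]
  [ContinuousInv₀ D]

variable (D) in
lemma isOpenEmbedding_unitsVal : Topology.IsOpenEmbedding (Units.val : Dˣ → D) := by
  refine ⟨Units.isEmbedding_val₀, ?_⟩
  have : Set.range (Units.val : Dˣ → D) = {0}ᶜ := by
    ext x
    simp only [Set.mem_range, Set.mem_compl_iff, Set.mem_singleton_iff]
    exact ⟨fun ⟨u, hu⟩ => hu ▸ u.ne_zero, fun h => ⟨Units.mk0 x h, rfl⟩⟩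
  rw [this]
  exact isOpen_compl_singleton

lemma borelSpace_units [MeasurableSpace D] [BorelSpace D] : BorelSpace Dˣ := by
  refine ⟨?_⟩
  change MeasurableSpace.comap Units.val _ = _
  rw [(isOpenEmbedding_unitsVal D).eq_induced, borel_comap, ← BorelSpace.measurable_eq (α := D)]

end UnitsTopology

section Measures

open scoped Pointwise NNReal ENNReal

variable (F : Type*) [Field F] [ValuativeRel F] [TopologicalSpace F]
  [IsNonarchimedeanLocalField F]
variable {D : Type*} [DivisionRing D] [Algebra F D] [Algebra.IsCentral F D] [FiniteDimensional F D]
  [TopologicalSpace D] [IsModuleTopology F D] [MeasurableSpace D] [BorelSpace D]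
variable {n : ℕ}

lemma mem_U_zero (g : Dˣ) :
    g ∈ U F n 0 ↔ absNrd F n (g : D) = 1 := by
  refine ⟨fun h => h.1, fun h => ⟨h, ?_⟩⟩
  rw [pow_zero, inv_one, sub_eq_add_neg]
  refine (absNrd_add_le F _ _).trans (max_le h.le ?_)
  rw [absNrd_eq_rpow, absNorm_neg, absNorm_one, Real.one_rpow]

lemma isOpen_absNorm_eq (hn : Module.finrank F D = n ^ 2) {x : D} (hx : x ≠ 0) :
    IsOpen {y : D | absNorm F y = absNorm F x} := by
  have hn0 := pos_of_finrank_eq_sq F hn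
  have hq1 := one_lt_resCard F
  obtain ⟨k, hk⟩ := absNorm_eq_zpow F hx
  obtain ⟨c, hc0, hc⟩ := exists_normAbs_eq_zpow F k
  obtain ⟨d, hd0, hd⟩ := exists_normAbs_eq_zpow F (k - 1)
  convert (isOpen_absNorm_le F (D := D) hc0).sdiff (isClosed_absNorm_le F (D := D) d) using 1
  ext y
  simp only [Set.mem_ofPred_eq, Set.mem_sdiff, not_le, hk, hc, hd]
  refine ⟨fun h => ?_, fun ⟨h1, h2⟩ => ?_⟩
  · rw [h]; exact ⟨le_rfl, zpow_lt_zpow_right₀ hq1 (by omega)⟩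
  · have hy : y ≠ 0 := by
      rintro rfl
      rw [absNorm_zero] at h2
      exact absurd h2 (not_lt.2 (zpow_nonneg (resCard_pos F).le _))
    obtain ⟨j, hj⟩ := absNorm_eq_zpow F hy
    rw [hj] at h1 h2 ⊢
    rw [zpow_le_zpow_iff_right₀ hq1] at h1
    rw [zpow_lt_zpow_iff_right₀ hq1] at h2
    congr 1; omega

lemma measurable_absNrd (hn : Module.finrank F D = n ^ 2) :
    Measurable fun x : D => absNrd F n x := by
  have : Measurable fun x : D => absNorm F x := by
    refine measurable_of_Iio fun r => ?_
    -- The norm is locally constant away from 0, and adding one point does not affect measurability.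
    have : IsOpen ((fun x : D => absNorm F x) ⁻¹' Set.Iio r \ {0}) := by
      rw [isOpen_iff_mem_nhds]
      rintro x ⟨hx, hx0⟩
      refine Filter.mem_of_superset ((isOpen_absNorm_eq F hn hx0).mem_nhds rfl) fun y hy => ?_
      have hy' : absNorm F y = absNorm F x := hy
      refine ⟨?_, ?_⟩
      · rw [Set.mem_preimage, hy']; exact hx
      · rintro rfl
        rw [absNorm_zero] at hy'
        exact (absNorm_pos F hx0).ne hy'
    have := t2Space F (D := D)
    by_cases h0 : (0 : D) ∈ (fun x : D => absNorm F x) ⁻¹' Set.Iio r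
    · rw [← Set.insert_eq_of_mem h0, ← Set.insert_sdiff_singleton]
      exact (‹IsOpen _›.measurableSet).insert 0
    · rw [← Set.sdiff_singleton_eq_self h0]
      exact ‹IsOpen _›.measurableSet
  exact this.pow_const _

variable [IsTopologicalRing D] [LocallyCompactSpace D] [T2Space D] [ContinuousInv₀ D]

/-- The Haar measure on the unit group, in terms of the additive Haar measure. -/
def haarUnits : Measure Dˣ :=
  ((Measure.addHaar : Measure D).comap Units.val).withDensity
    fun x => (ENNReal.ofReal (absNorm F (x : D)))⁻¹

lemma comap_addHaar_preimage (g : Dˣ) (A : Set Dˣ) :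
    (Measure.addHaar : Measure D).comap Units.val ((g * ·) ⁻¹' A) =
      (ENNReal.ofReal (absNorm F (g : D)))⁻¹ * (Measure.addHaar : Measure D).comap Units.val A := by
  have := borelSpace_units (D := D)
  have he := (isOpenEmbedding_unitsVal D).measurableEmbedding
  rw [he.comap_apply, he.comap_apply]
  have h1 : Units.val '' A = g • (Units.val '' ((g * ·) ⁻¹' A)) := by
    ext x
    constructor
    · rintro ⟨a, ha, rfl⟩
      refine ⟨(g⁻¹ * a : Dˣ), ⟨g⁻¹ * a, by simpa using ha, rfl⟩, ?_⟩
      simp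
    · rintro ⟨_, ⟨a, ha, rfl⟩, rfl⟩
      exact ⟨g * a, ha, by simp⟩
  have hg := absNorm_pos F g.ne_zero
  rw [h1, ← distribHaarChar_mul, ← mul_assoc]
  have h2 : ENNReal.ofReal (absNorm F (g : D)) = distribHaarChar D g := by
    rw [← distribHaarChar_eq_absNorm F g, ENNReal.ofReal_coe_nnreal]
  have h3 : ENNReal.ofReal (absNorm F (g : D)) ≠ 0 := by simpa using hg
  rw [← h2, ENNReal.inv_mul_cancel h3 ENNReal.ofReal_ne_top, one_mul]

lemma measurable_absNorm_units (hn : Module.finrank F D = n ^ 2) :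
    Measurable fun x : Dˣ => absNorm F (x : D) := by
  have h : (fun x : D => absNorm F x) = fun x => absNrd F n x ^ n := by
    funext x; rw [absNrd_pow F (pos_of_finrank_eq_sq F hn)]
  have h2 : Measurable fun x : D => absNorm F x := by
    rw [h]; exact (measurable_absNrd F hn).pow_const _
  exact h2.comp (comap_measurable _)

lemma haarUnits_isMulLeftInvariant (hn : Module.finrank F D = n ^ 2) :
    (haarUnits F (D := D)).IsMulLeftInvariant := by
  have := borelSpace_units (D := D)
  refine ⟨fun g => ?_⟩
  set lam := (Measure.addHaar : Measure D).comap Units.val with hlam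
  have hg := absNorm_pos F g.ne_zero
  have h3 : ENNReal.ofReal (absNorm F (g : D)) ≠ 0 := by simpa using hg
  have hmg : Measurable fun x : Dˣ => g * x := measurable_const_mul g
  have hmap : lam.map (g * ·) = (ENNReal.ofReal (absNorm F (g : D)))⁻¹ • lam := by
    ext A hA
    rw [Measure.map_apply hmg hA, Measure.smul_apply, smul_eq_mul, comap_addHaar_preimage F g A]
  have hmeas : Measurable fun x : Dˣ => (ENNReal.ofReal (absNorm F (x : D)))⁻¹ :=
    (ENNReal.measurable_ofReal.comp (measurable_absNorm_units F hn)).inv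
  ext A hA
  rw [Measure.map_apply hmg hA, haarUnits, withDensity_apply _ (hmg hA), withDensity_apply _ hA]
  have h1 : ∀ x : Dˣ, (ENNReal.ofReal (absNorm F (x : D)))⁻¹ =
      ENNReal.ofReal (absNorm F (g : D)) * (ENNReal.ofReal (absNorm F ((g * x : Dˣ) : D)))⁻¹ := by
    intro x
    rw [Units.val_mul, absNorm_mul, ENNReal.ofReal_mul hg.le, ENNReal.mul_inv (Or.inl h3)
      (Or.inl ENNReal.ofReal_ne_top), ← mul_assoc, ENNReal.mul_inv_cancel h3 ENNReal.ofReal_ne_top,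
      one_mul]
  have h2 : ∫⁻ x in (g * ·) ⁻¹' A, (ENNReal.ofReal (absNorm F ((g * x : Dˣ) : D)))⁻¹ ∂lam =
      ∫⁻ x in A, (ENNReal.ofReal (absNorm F (x : D)))⁻¹ ∂(lam.map (g * ·)) :=
    (setLIntegral_map hA hmeas hmg).symm
  rw [lintegral_congr h1, lintegral_const_mul' _ _ ENNReal.ofReal_ne_top, h2, hmap, Measure.restrict_smul,
    lintegral_smul_measure, smul_eq_mul, ← mul_assoc,
    ENNReal.mul_inv_cancel h3 ENNReal.ofReal_ne_top, one_mul]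

lemma haarUnits_isFiniteMeasureOnCompacts (hn : Module.finrank F D = n ^ 2) :
    IsFiniteMeasureOnCompacts (haarUnits F (D := D)) := by
  have := borelSpace_units (D := D)
  have : IsLocallyFiniteMeasure (haarUnits F (D := D)) := by
    refine ⟨fun w => ?_⟩
    have hw := absNorm_pos F w.ne_zero
    have hopen : IsOpen {y : Dˣ | absNorm F (y : D) = absNorm F (w : D)} :=
      (isOpen_absNorm_eq F hn w.ne_zero).preimage Units.continuous_val
    refine ⟨_, hopen.mem_nhds rfl, ?_⟩
    rw [haarUnits, withDensity_apply _ hopen.measurableSet]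
    have he := (isOpenEmbedding_unitsVal D).measurableEmbedding
    calc _ = ∫⁻ x in {y : Dˣ | absNorm F (y : D) = absNorm F (w : D)},
          (ENNReal.ofReal (absNorm F (w : D)))⁻¹
            ∂((Measure.addHaar : Measure D).comap Units.val) :=
          setLIntegral_congr_fun hopen.measurableSet fun x hx => by
            rw [show absNorm F (x : D) = absNorm F (w : D) from hx]
      _ < ∞ := by
          rw [setLIntegral_const, he.comap_apply]
          refine ENNReal.mul_lt_top (ENNReal.inv_lt_top.2 (by simpa using hw)) ?_
          obtain ⟨k, hk⟩ := (exists_absNorm_eq F hn).2 w w.ne_zero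
          refine lt_of_le_of_lt (measure_mono ?_) (isCompact_absNrd_le F hn k).measure_lt_top
          rintro _ ⟨x, hx, rfl⟩
          rw [Set.mem_ofPred_eq, absNrd_le_zpow_iff F (pos_of_finrank_eq_sq F hn), ← hk]
          exact le_of_eq hx
  exact isFiniteMeasureOnCompacts_of_isLocallyFiniteMeasure

lemma addMeasure_haarUnits (hn : Module.finrank F D = n ^ 2) :
    unitsAddMeasure n (absNrd F n) (haarUnits F (D := D)) = Measure.addHaar := by
  have := borelSpace_units (D := D)
  have hn0 := pos_of_finrank_eq_sq F hn
  have he := (isOpenEmbedding_unitsVal D).measurableEmbedding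
  have hm := ENNReal.measurable_ofReal.comp (measurable_absNorm_units F (D := D) hn)
  rw [unitsAddMeasure, haarUnits]
  simp_rw [absNrd_pow F hn0]
  have h1 : ((fun x : Dˣ => (ENNReal.ofReal (absNorm F (x : D)))⁻¹) *
      fun x : Dˣ => ENNReal.ofReal (absNorm F (x : D))) = 1 := by
    funext x
    have hx := absNorm_pos F x.ne_zero
    exact ENNReal.inv_mul_cancel (by simpa using hx) ENNReal.ofReal_ne_top
  have h2 := withDensity_mul ((Measure.addHaar : Measure D).comap Units.val) hm.inv hm
  have h3 : (((Measure.addHaar : Measure D).comap Units.val).withDensity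
      fun x : Dˣ => (ENNReal.ofReal (absNorm F (x : D)))⁻¹).withDensity
      (fun x : Dˣ => ENNReal.ofReal (absNorm F (x : D))) =
      (Measure.addHaar : Measure D).comap Units.val := by
    refine Eq.trans h2.symm ?_
    refine Eq.trans ?_ (withDensity_one)
    congr 1
  rw [h3, he.map_comap]
  have hr : Set.range (Units.val : Dˣ → D) = {0}ᶜ := by
    ext x
    simp only [Set.mem_range, Set.mem_compl_iff, Set.mem_singleton_iff]
    exact ⟨fun ⟨u, hu⟩ => hu ▸ u.ne_zero, fun h => ⟨Units.mk0 x h, rfl⟩⟩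
  rw [hr]
  have hq1 := one_lt_resCard F
  -- D is not discrete, so 0 is a null set and restricting additive Haar measure to the units loses
  -- nothing.
  have : (nhdsWithin (0 : D) {0}ᶜ).NeBot := by
    rw [← mem_closure_iff_nhdsWithin_neBot, mem_closure_iff_nhds]
    intro t ht
    obtain ⟨k, -, hk⟩ := (hasBasis_absNrd F hn).mem_iff.1 ht
    obtain ⟨p, hp0, hp⟩ := exists_normAbs_eq_zpow F (k / n)
    refine ⟨algebraMap F D p, hk ?_, by simpa using hp0⟩
    rw [Set.mem_ofPred_eq, absNrd_le_zpow_iff F hn0, absNorm_algebraMap, hp, hn, ← zpow_natCast,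
      ← zpow_mul, zpow_le_zpow_iff_right₀ hq1]
    have : (n : ℤ) * (k / n) ≤ k := Int.mul_ediv_self_le (by exact_mod_cast hn0.ne')
    push_cast
    nlinarith [(by exact_mod_cast hn0 : (0 : ℤ) < n)]
  rw [Measure.restrict_eq_self_of_ae_mem]
  exact compl_mem_ae_iff.2 (measure_singleton 0)

/-- This is the bridge from the local field to the axioms; the analysis up to the final translation
mentions only `IsNormalizedAbs`. -/
lemma isNormalizedAbs [SecondCountableTopology Dˣ] (hn : Module.finrank F D = n ^ 2)
    (μ : Measure Dˣ) [μ.IsHaarMeasure] (hμ : μ (U F n 0) = 1) :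
    IsNormalizedAbs (resCard F) n (absNrd F n (D := D)) μ := by
  have hn0 := pos_of_finrank_eq_sq F hn
  have := borelSpace_units (D := D)
  have : LocallyCompactSpace Dˣ := (isOpenEmbedding_unitsVal D).locallyCompactSpace
  have hunit : μ {w : Dˣ | absNrd F n (w : D) = 1} = 1 := by
    rw [← hμ]; congr 1; ext g; exact (mem_U_zero F g).symm
  have hopen : IsOpen {w : Dˣ | absNrd F n (w : D) = 1} := by
    have := (isOpen_absNorm_eq F hn (one_ne_zero (α := D))).preimage Units.continuous_val
    convert this using 1
    ext w
    have := absNrd_eq_zpow_iff F hn0 (w : D) 0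
    simpa using this
  -- Uniqueness of Haar measure with a given volume of O_D^*. Applied to right translates and to the
  -- inverse of μ, it yields unimodularity.
  have key : ∀ μ' : Measure Dˣ, IsFiniteMeasureOnCompacts μ' → μ'.IsMulLeftInvariant →
      μ' {w : Dˣ | absNrd F n (w : D) = 1} = 1 → μ' = μ := by
    intro μ' _ _ h
    have h1 := Measure.isMulLeftInvariant_eq_smul μ' μ
    have h2 := congrArg (fun m => m {w : Dˣ | absNrd F n (w : D) = 1}) h1
    simp only [Measure.smul_apply, hunit, h] at h2
    rw [ENNReal.smul_def, smul_eq_mul, mul_one] at h2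
    rw [h1, show Measure.haarScalarFactor μ' μ = 1 by exact_mod_cast h2.symm, one_smul]
  have hright : μ.IsMulRightInvariant := by
    refine ⟨fun g => key _ (Measure.IsFiniteMeasureOnCompacts.map μ (Homeomorph.mulRight g))
      inferInstance ?_⟩
    rw [Measure.map_apply (measurable_mul_const g) hopen.measurableSet]
    have hgg : absNrd F n ((g⁻¹ : Dˣ) : D) * absNrd F n (g : D) = 1 := by
      rw [← absNrd_mul, Units.inv_mul, absNrd_eq_rpow, absNorm_one, Real.one_rpow]
    have h3 : (· * g) ⁻¹' {w : Dˣ | absNrd F n (w : D) = 1} =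
        (g * ·) ⁻¹' {w : Dˣ | absNrd F n (w : D) = 1} := by
      ext w
      simp [absNrd_mul, mul_comm]
    rw [h3, measure_preimage_mul, hunit]
  have hinv : μ.IsInvInvariant := by
    refine ⟨key _ inferInstance inferInstance ?_⟩
    rw [Measure.inv_apply, ← hunit]
    congr 1
    ext w
    have hw : absNrd F n ((w⁻¹ : Dˣ) : D) * absNrd F n (w : D) = 1 := by
      rw [← absNrd_mul, Units.inv_mul, absNrd_eq_rpow, absNorm_one, Real.one_rpow]
    rw [Set.mem_inv, Set.mem_ofPred_eq, Set.mem_ofPred_eq]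
    constructor
    · intro h; rwa [h, one_mul] at hw
    · intro h; rwa [h, mul_one] at hw
  have := haarUnits_isFiniteMeasureOnCompacts F (D := D) hn
  have := haarUnits_isMulLeftInvariant F (D := D) hn
  -- The measure |N x|⁻¹dx is also left invariant, so it is a multiple of μ. This transfers the
  -- additive invariance of dx to `unitsAddMeasure`.
  obtain ⟨c, hc⟩ : ∃ c : ℝ≥0, haarUnits F (D := D) = c • μ :=
    ⟨_, Measure.isMulLeftInvariant_eq_smul (haarUnits F (D := D)) μ⟩
  have hadd : c • unitsAddMeasure n (absNrd F n) μ = (Measure.addHaar : Measure D) := by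
    have h1 : haarUnits F (D := D) = (c : ℝ≥0∞) • μ := hc
    rw [← addMeasure_haarUnits F hn, h1, unitsAddMeasure, unitsAddMeasure,
      withDensity_smul_measure, Measure.map_smul]
    rfl
  have hc0 : c ≠ 0 := by
    rintro rfl
    rw [zero_smul] at hadd
    exact (NeZero.ne (Measure.addHaar : Measure D)) hadd.symm
  have hadd' : unitsAddMeasure n (absNrd F n) μ = c⁻¹ • (Measure.addHaar : Measure D) := by
    rw [← hadd, smul_smul, inv_mul_cancel₀ hc0, one_smul]
  obtain ⟨⟨u, hu⟩, hval⟩ := exists_absNorm_eq F hn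
  refine ⟨one_lt_resCard F, hn0, absNrd_mul F, absNrd_zero F hn0, absNrd_add_le F, fun x hx => ?_,
    ⟨u, ?_⟩, ?_, hasBasis_absNrd F hn, isCompact_absNrd_le F hn, inferInstance, hright, hinv, hunit,
    ?_, ?_⟩
  · obtain ⟨k, hk⟩ := hval x hx
    exact ⟨k, (absNrd_eq_zpow_iff F hn0 _ _).2 hk⟩
  · rw [← zpow_neg_one, absNrd_eq_zpow_iff F hn0, hu, mul_neg_one]
  · obtain ⟨p, hp0, hp⟩ := exists_normAbs_eq_inv F
    refine ⟨Units.map (algebraMap F D).toMonoidHom (Units.mk0 p hp0), fun x => ?_, ?_⟩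
    · ext
      exact Algebra.commutes p (x : D)
    · change absNrd F n (algebraMap F D p) = _
      rw [absNrd_eq_zpow_iff F hn0, absNorm_algebraMap, hp, hn, inv_pow, ← zpow_natCast,
        ← zpow_neg]
      congr 1
      push_cast
      ring
  · rw [hadd']
    infer_instance
  · rw [hadd']
    infer_instance

end Measures

/-- The units of normalized absolute value `q⁻ᵏ`. -/
def sphere {D : Type*} [DivisionRing D] (q : ℝ) (N : D → ℝ) (k : ℤ) : Set Dˣ :=
  {w | N (w : D) = q ^ (-k)}

/-! ### Spheres, balls and changes of variables for a normalized absolute value -/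

namespace IsNormalizedAbs

section Elementary

variable {D : Type*} [DivisionRing D] [TopologicalSpace D] [MeasurableSpace D]
  {q : ℝ} {n : ℕ} {N : D → ℝ} {μ : Measure Dˣ} (h : IsNormalizedAbs q n N μ)
include h

lemma q_pos : 0 < q := zero_lt_one.trans h.one_lt_q

lemma pos {x : D} (hx : x ≠ 0) : 0 < N x := by
  obtain ⟨k, hk⟩ := h.exists_zpow x hx
  rw [hk]; exact zpow_pos h.q_pos k

lemma units_pos (w : Dˣ) : 0 < N (w : D) := h.pos w.ne_zero

lemma nonneg (x : D) : 0 ≤ N x := by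
  by_cases hx : x = 0
  · rw [hx, h.map_zero]
  · exact (h.pos hx).le

lemma map_one : N 1 = 1 := by
  have h1 := h.map_mul 1 1
  rw [one_mul] at h1
  have h2 := h.pos (one_ne_zero (α := D))
  nlinarith

lemma map_neg (x : D) : N (-x) = N x := by
  have h1 : N (-1) = 1 := by
    have h1 := h.map_mul (-1) (-1)
    rw [neg_mul_neg, one_mul, h.map_one] at h1
    have h2 := h.nonneg (-1)
    nlinarith
  rw [← neg_one_mul, h.map_mul, h1, one_mul]

lemma map_sub_comm (x y : D) : N (x - y) = N (y - x) := by rw [← neg_sub, h.map_neg]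

lemma map_inv (w : Dˣ) : N ((w⁻¹ : Dˣ) : D) = (N (w : D))⁻¹ := by
  refine eq_inv_of_mul_eq_one_left ?_
  rw [← h.map_mul, Units.inv_mul, h.map_one]

lemma map_inv₀ (x : D) (hx : x ≠ 0) : N x⁻¹ = (N x)⁻¹ := h.map_inv (Units.mk0 x hx)

lemma sub_le (x y : D) : N (x - y) ≤ max (N x) (N y) := by
  rw [sub_eq_add_neg, ← h.map_neg y]; exact h.add_le _ _

lemma add_eq_of_lt {x e : D} (he : N e < N x) : N (x + e) = N x := by
  refine le_antisymm ((h.add_le x e).trans (max_le le_rfl he.le)) ?_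
  have := h.sub_le (x + e) e
  rw [add_sub_cancel_right] at this
  exact (le_max_iff.1 this).resolve_right (not_le.2 he)

lemma lt_zpow_iff (x : D) (k : ℤ) : N x < q ^ k ↔ N x ≤ q ^ (k - 1) := by
  by_cases hx : x = 0
  · rw [hx, h.map_zero]; exact iff_of_true (zpow_pos h.q_pos _) (zpow_pos h.q_pos _).le
  obtain ⟨j, hj⟩ := h.exists_zpow x hx
  rw [hj, zpow_lt_zpow_iff_right₀ h.one_lt_q, zpow_le_zpow_iff_right₀ h.one_lt_q]
  omega

lemma exists_mem_sphere (w : Dˣ) : ∃ k, w ∈ sphere q N k := by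
  obtain ⟨j, hj⟩ := h.exists_zpow w w.ne_zero
  exact ⟨-j, by rw [sphere, Set.mem_ofPred_eq, neg_neg]; exact hj⟩

lemma sphere_index_inj {w : Dˣ} {j k : ℤ} (hj : w ∈ sphere q N j) (hk : w ∈ sphere q N k) :
    j = k := by
  have := (hj : N (w : D) = _).symm.trans hk
  have := zpow_right_injective₀ h.q_pos h.one_lt_q.ne' this
  omega

lemma mul_mem_sphere {a b : Dˣ} {j k : ℤ} (ha : a ∈ sphere q N j) (hb : b ∈ sphere q N k) :
    a * b ∈ sphere q N (j + k) := by
  change N _ = _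
  rw [Units.val_mul, h.map_mul, show N (a : D) = _ from ha, show N (b : D) = _ from hb,
    ← zpow_add₀ h.q_pos.ne']
  congr 1; ring

lemma inv_mem_sphere {a : Dˣ} {j : ℤ} (ha : a ∈ sphere q N j) : a⁻¹ ∈ sphere q N (-j) := by
  change N _ = _
  rw [h.map_inv, show N (a : D) = _ from ha, ← zpow_neg]

lemma one_mem_sphere : (1 : Dˣ) ∈ sphere q N 0 := by
  change N ((1 : Dˣ) : D) = _
  rw [Units.val_one, h.map_one, neg_zero, zpow_zero]

lemma zpow_mem_sphere {a : Dˣ} {j : ℤ} (ha : a ∈ sphere q N j) (k : ℤ) :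
    a ^ k ∈ sphere q N (k * j) := by
  induction k using Int.induction_on with
  | zero => simpa using h.one_mem_sphere
  | succ k ih =>
    rw [zpow_add_one, add_mul, one_mul]; exact h.mul_mem_sphere ih ha
  | pred k ih =>
    rw [zpow_sub_one, sub_mul, one_mul, sub_eq_add_neg]
    exact h.mul_mem_sphere ih (h.inv_mem_sphere ha)

lemma mul_mem_sphere_iff {a b : Dˣ} {j k : ℤ} (ha : a ∈ sphere q N j) :
    a * b ∈ sphere q N k ↔ b ∈ sphere q N (k - j) := by
  refine ⟨fun hb => ?_, fun hb => ?_⟩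
  · have := h.mul_mem_sphere (h.inv_mem_sphere ha) hb
    rwa [inv_mul_cancel_left, neg_add_eq_sub] at this
  · have := h.mul_mem_sphere ha hb
    rwa [add_sub_cancel] at this

lemma mul_mem_sphere_iff' {a b : Dˣ} {j k : ℤ} (ha : a ∈ sphere q N j) :
    b * a ∈ sphere q N k ↔ b ∈ sphere q N (k - j) := by
  refine ⟨fun hb => ?_, fun hb => ?_⟩
  · have := h.mul_mem_sphere hb (h.inv_mem_sphere ha)
    rwa [mul_inv_cancel_right, ← sub_eq_add_neg] at this
  · have := h.mul_mem_sphere hb ha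
    rwa [sub_add_cancel] at this

lemma exists_mem_sphere_index (k : ℤ) : ∃ u : Dˣ, u ∈ sphere q N k := by
  obtain ⟨u, hu⟩ := h.exists_unif
  have hu1 : u ∈ sphere q N 1 := by change N (u : D) = _; rw [hu, zpow_neg_one]
  exact ⟨u ^ k, by simpa using h.zpow_mem_sphere hu1 k⟩

end Elementary

section Topology

variable {D : Type*} [DivisionRing D] [TopologicalSpace D] [IsTopologicalRing D] [T2Space D]
  [ContinuousInv₀ D] [MeasurableSpace D]
  {q : ℝ} {n : ℕ} {N : D → ℝ} {μ : Measure Dˣ} (h : IsNormalizedAbs q n N μ)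
include h

lemma ball_mem_nhds (x : D) (k : ℤ) : {y | N (y - x) ≤ q ^ k} ∈ nhds x := by
  have h1 : Filter.Tendsto (fun y => y - x) (nhds x) (nhds 0) := by
    have : Filter.Tendsto (fun y : D => y - x) (nhds x) (nhds (x - x)) :=
      (continuous_id.sub continuous_const).tendsto x
    rwa [sub_self] at this
  exact h1 (h.hasBasis.mem_of_mem (i := k) trivial)

lemma isOpen_le (k : ℤ) : IsOpen {x | N x ≤ q ^ k} := by
  rw [isOpen_iff_mem_nhds]
  intro x hx
  filter_upwards [h.ball_mem_nhds x k] with y hy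
  have := h.add_le (y - x) x
  rw [sub_add_cancel] at this
  exact this.trans (max_le hy hx)

lemma isClosed_le (k : ℤ) : IsClosed {x | N x ≤ q ^ k} := (h.isCompact k).isClosed

lemma isOpen_lt (k : ℤ) : IsOpen {x | N x < q ^ k} := by
  simp_rw [h.lt_zpow_iff]; exact h.isOpen_le _

lemma isClosed_lt (k : ℤ) : IsClosed {x | N x < q ^ k} := by
  simp_rw [h.lt_zpow_iff]; exact h.isClosed_le _

lemma isCompact_lt (k : ℤ) : IsCompact {x | N x < q ^ k} := by
  simp_rw [h.lt_zpow_iff]; exact h.isCompact _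

lemma isClopen_sphere (k : ℤ) : IsClopen (sphere q N k) := by
  have : sphere q N k = Units.val ⁻¹' ({x | N x ≤ q ^ (-k)} \ {x | N x < q ^ (-k)}) := by
    ext w
    simp only [sphere, Set.mem_preimage, Set.mem_sdiff, Set.mem_ofPred_eq, not_lt]
    exact ⟨fun hw => ⟨hw.le, hw.ge⟩, fun hw => le_antisymm hw.1 hw.2⟩
  rw [this]
  exact IsClopen.preimage (IsClopen.diff ⟨h.isClosed_le _, h.isOpen_le _⟩
    ⟨h.isClosed_lt _, h.isOpen_lt _⟩) Units.continuous_val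

lemma isCompact_sphere (k : ℤ) : IsCompact (sphere q N k) := by
  have : sphere q N k = Units.val ⁻¹' ({x | N x ≤ q ^ (-k)} \ {x | N x < q ^ (-k)}) := by
    ext w
    simp only [sphere, Set.mem_preimage, Set.mem_sdiff, Set.mem_ofPred_eq, not_lt]
    exact ⟨fun hw => ⟨hw.le, hw.ge⟩, fun hw => le_antisymm hw.1 hw.2⟩
  rw [this]
  refine (isOpenEmbedding_unitsVal D).isInducing.isCompact_preimage'
    ((h.isCompact _).diff (h.isOpen_lt _)) ?_
  rintro x ⟨-, hx⟩
  have hx0 : x ≠ 0 := by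
    rintro rfl
    exact hx (by rw [Set.mem_ofPred_eq, h.map_zero]; exact zpow_pos h.q_pos _)
  exact ⟨Units.mk0 x hx0, rfl⟩

lemma continuous_units : Continuous fun w : Dˣ => N (w : D) := by
  refine IsLocallyConstant.continuous ((IsLocallyConstant.iff_eventually_eq _).2 fun w => ?_)
  obtain ⟨k, hk⟩ := h.exists_mem_sphere w
  filter_upwards [(h.isClopen_sphere k).2.mem_nhds hk] with y hy
  exact (hy : N (y : D) = _).trans (hk : N (w : D) = _).symm

lemma measurable [BorelSpace D] : Measurable N := by
  refine measurable_of_Iio fun r => ?_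
  have ho : IsOpen (N ⁻¹' Set.Iio r \ {0}) := by
    rw [isOpen_iff_mem_nhds]
    rintro x ⟨hx, hx0⟩
    have hx0 : x ≠ 0 := hx0
    obtain ⟨k, hk⟩ := h.exists_zpow x hx0
    filter_upwards [h.ball_mem_nhds x (k - 1)] with y hy
    have h1 : N y = N x := by
      have := h.add_eq_of_lt (x := x) (e := y - x) (by rwa [hk, h.lt_zpow_iff])
      rwa [add_sub_cancel] at this
    refine ⟨by rw [Set.mem_preimage, h1]; exact hx, ?_⟩
    rintro rfl
    rw [h.map_zero] at h1
    exact (h.pos hx0).ne h1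
  by_cases h0 : (0 : D) ∈ N ⁻¹' Set.Iio r
  · rw [← Set.insert_eq_of_mem h0, ← Set.insert_sdiff_singleton]
    exact ho.measurableSet.insert 0
  · rw [← Set.sdiff_singleton_eq_self h0]
    exact ho.measurableSet

end Topology

section Integrals

variable {D : Type*} [DivisionRing D] [TopologicalSpace D] [IsTopologicalRing D] [T2Space D]
  [ContinuousInv₀ D] [MeasurableSpace D] [BorelSpace D] [BorelSpace Dˣ]
  [SecondCountableTopology D] [SecondCountableTopology Dˣ]
  {q : ℝ} {n : ℕ} {N : D → ℝ} {μ : Measure Dˣ} (h : IsNormalizedAbs q n N μ)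
  {E : Type*} [NormedAddCommGroup E] [NormedSpace ℝ E]
include h

lemma measurableSet_sphere (k : ℤ) : MeasurableSet (sphere q N k) :=
  (h.isClopen_sphere k).2.measurableSet

lemma setIntegral_mul_left (f : Dˣ → E) (g : Dˣ) (s : Set Dˣ) :
    ∫ w in (g * ·) ⁻¹' s, f (g * w) ∂μ = ∫ w in s, f w ∂μ := by
  have := h.leftInvariant
  exact (measurePreserving_mul_left μ g).setIntegral_preimage_emb
    (measurableEmbedding_mulLeft g) f s

lemma setIntegral_mul_right (f : Dˣ → E) (g : Dˣ) (s : Set Dˣ) :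
    ∫ w in (· * g) ⁻¹' s, f (w * g) ∂μ = ∫ w in s, f w ∂μ := by
  have := h.rightInvariant
  exact (measurePreserving_mul_right μ g).setIntegral_preimage_emb
    (measurableEmbedding_mulRight g) f s

lemma setIntegral_inv (f : Dˣ → E) (s : Set Dˣ) :
    ∫ w in s⁻¹, f w⁻¹ ∂μ = ∫ w in s, f w ∂μ := by
  have := h.invInvariant
  exact (Measure.measurePreserving_inv μ).setIntegral_preimage_emb
    (MeasurableEquiv.inv Dˣ).measurableEmbedding f s

lemma integral_sphere_mul_left (f : Dˣ → E) {g : Dˣ} {j : ℤ} (hg : g ∈ sphere q N j) (k : ℤ) :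
    ∫ w in sphere q N k, f (g * w) ∂μ = ∫ w in sphere q N (j + k), f w ∂μ := by
  rw [← h.setIntegral_mul_left f g]
  congr 2
  ext w
  rw [Set.mem_preimage, h.mul_mem_sphere_iff hg, add_sub_cancel_left]

lemma integral_sphere_mul_right (f : Dˣ → E) {g : Dˣ} {j : ℤ} (hg : g ∈ sphere q N j) (k : ℤ) :
    ∫ w in sphere q N k, f (w * g) ∂μ = ∫ w in sphere q N (k + j), f w ∂μ := by
  rw [← h.setIntegral_mul_right f g]
  congr 2
  ext w
  rw [Set.mem_preimage, h.mul_mem_sphere_iff' hg, add_sub_cancel_right]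

lemma integral_sphere_inv (f : Dˣ → E) (k : ℤ) :
    ∫ w in sphere q N k, f w⁻¹ ∂μ = ∫ w in sphere q N (-k), f w ∂μ := by
  rw [← h.setIntegral_inv f]
  congr 2
  ext w
  rw [Set.mem_inv]
  exact ⟨fun hw => h.inv_mem_sphere hw, fun hw => by simpa using h.inv_mem_sphere hw⟩

lemma measure_sphere (k : ℤ) : μ (sphere q N k) = 1 := by
  have := h.leftInvariant
  obtain ⟨u, hu⟩ := h.exists_mem_sphere_index k
  rw [← measure_preimage_mul μ u, ← h.measure_units]
  congr 1
  ext w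
  rw [Set.mem_preimage, h.mul_mem_sphere_iff hu, sub_self]
  simp [sphere]

lemma isFiniteMeasureOnCompacts_units : IsFiniteMeasureOnCompacts μ := by
  have : IsLocallyFiniteMeasure μ := ⟨fun w => by
    obtain ⟨k, hk⟩ := h.exists_mem_sphere w
    exact ⟨_, (h.isClopen_sphere k).2.mem_nhds hk, by rw [h.measure_sphere]; exact ENNReal.one_lt_top⟩⟩
  exact isFiniteMeasureOnCompacts_of_isLocallyFiniteMeasure

lemma integrableOn_of_continuous {f : Dˣ → E} (hf : Continuous f) {s : Set Dˣ} {k : ℤ}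
    (hs : s ⊆ sphere q N k) : IntegrableOn f s μ := by
  have := h.isFiniteMeasureOnCompacts_units
  exact (hf.continuousOn.integrableOn_compact (h.isCompact_sphere k)).mono_set hs

/-! #### The additive measure -/

omit [SecondCountableTopology D] [SecondCountableTopology Dˣ] in
lemma measurable_density :
    Measurable fun x : Dˣ => ENNReal.ofReal (N (x : D) ^ n) :=
  ENNReal.measurable_ofReal.comp ((h.continuous_units.measurable).pow_const _)

lemma integral_unitsAddMeasure (f : D → E) :
    ∫ x, f x ∂(unitsAddMeasure n N μ) = ∫ w : Dˣ, N (w : D) ^ n • f w ∂μ := by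
  rw [unitsAddMeasure, (isOpenEmbedding_unitsVal D).measurableEmbedding.integral_map,
    integral_withDensity_eq_integral_toReal_smul h.measurable_density
      (Filter.Eventually.of_forall fun x => ENNReal.ofReal_lt_top)]
  refine integral_congr_ae (Filter.Eventually.of_forall fun w => ?_)
  change ENNReal.toReal _ • _ = _
  rw [ENNReal.toReal_ofReal (pow_nonneg (h.nonneg _) _)]

lemma integrable_unitsAddMeasure (f : D → E) :
    Integrable f (unitsAddMeasure n N μ) ↔ Integrable (fun w : Dˣ => N (w : D) ^ n • f w) μ := by
  rw [unitsAddMeasure, (isOpenEmbedding_unitsVal D).measurableEmbedding.integrable_map_iff,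
    integrable_withDensity_iff_integrable_smul' h.measurable_density
      (Filter.Eventually.of_forall fun x => ENNReal.ofReal_lt_top)]
  refine integrable_congr (Filter.Eventually.of_forall fun w => ?_)
  change ENNReal.toReal _ • _ = _
  rw [ENNReal.toReal_ofReal (pow_nonneg (h.nonneg _) _)]
  rfl

lemma setIntegral_unitsAddMeasure (f : D → E) {s : Set D} (hs : MeasurableSet s) :
    ∫ x in s, f x ∂(unitsAddMeasure n N μ) = ∫ w in Units.val ⁻¹' s, N (w : D) ^ n • f w ∂μ := by
  rw [← integral_indicator hs, h.integral_unitsAddMeasure,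
    ← integral_indicator (hs.preimage Units.continuous_val.measurable)]
  congr 1
  ext w
  by_cases hw : (w : D) ∈ s
  · rw [Set.indicator_of_mem hw, Set.indicator_of_mem (show w ∈ Units.val ⁻¹' s from hw)]
  · rw [Set.indicator_of_notMem hw, smul_zero,
      Set.indicator_of_notMem (show w ∉ Units.val ⁻¹' s from hw)]

lemma setIntegral_unit_mul (f : D → E) (a : Dˣ) {s : Set D} (hs : MeasurableSet s) :
    ∫ x in (fun x => (a : D) * x) ⁻¹' s, f (a * x) ∂(unitsAddMeasure n N μ) =
      (N (a : D) ^ n)⁻¹ • ∫ x in s, f x ∂(unitsAddMeasure n N μ) := by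
  have hm : Measurable fun x : D => (a : D) * x := measurable_const_mul _
  rw [h.setIntegral_unitsAddMeasure _ hs, h.setIntegral_unitsAddMeasure _ (hs.preimage hm),
    ← h.setIntegral_mul_left (fun w : Dˣ => N (w : D) ^ n • f w) a (Units.val ⁻¹' s), ← integral_smul]
  refine setIntegral_congr_fun ?_ fun w _ => ?_
  · exact (hs.preimage hm).preimage Units.continuous_val.measurable
  rw [Units.val_mul, h.map_mul, mul_pow, mul_smul, smul_smul, inv_mul_cancel₀, one_smul]
  exact pow_ne_zero _ (h.units_pos a).ne'

lemma setIntegral_mul_unit (f : D → E) (a : Dˣ) {s : Set D} (hs : MeasurableSet s) :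
    ∫ x in (fun x => x * (a : D)) ⁻¹' s, f (x * a) ∂(unitsAddMeasure n N μ) =
      (N (a : D) ^ n)⁻¹ • ∫ x in s, f x ∂(unitsAddMeasure n N μ) := by
  have hm : Measurable fun x : D => x * (a : D) := measurable_mul_const _
  rw [h.setIntegral_unitsAddMeasure _ hs, h.setIntegral_unitsAddMeasure _ (hs.preimage hm),
    ← h.setIntegral_mul_right (fun w : Dˣ => N (w : D) ^ n • f w) a (Units.val ⁻¹' s), ← integral_smul]
  refine setIntegral_congr_fun ?_ fun w _ => ?_
  · exact (hs.preimage hm).preimage Units.continuous_val.measurable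
  rw [Units.val_mul, h.map_mul, mul_comm (N (w : D)), mul_pow, mul_smul, smul_smul,
    inv_mul_cancel₀, one_smul]
  exact pow_ne_zero _ (h.units_pos a).ne'

lemma setIntegral_add_left (f : D → E) (a : D) (s : Set D) :
    ∫ x in (a + ·) ⁻¹' s, f (a + x) ∂(unitsAddMeasure n N μ) =
      ∫ x in s, f x ∂(unitsAddMeasure n N μ) := by
  have := h.addInvariant
  exact (measurePreserving_add_left _ a).setIntegral_preimage_emb
    (measurableEmbedding_addLeft a) f s

lemma integrableOn_lt_of_continuous {f : D → E} (hf : Continuous f) (k : ℤ) :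
    IntegrableOn f {x | N x < q ^ k} (unitsAddMeasure n N μ) := by
  have := h.finiteOnCompacts
  exact hf.continuousOn.integrableOn_compact (h.isCompact_lt k)

/-- Integrals over a ball of functions that are constant modulo a smaller ball are finite sums. -/
lemma exists_setIntegral_eq_sum [CompleteSpace E] (k j : ℤ) :
    ∃ (s : Finset D) (c : D → ℝ), ∀ f : D → E,
      (∀ x e, N e ≤ q ^ j → f (x + e) = f x) →
      ∫ x in {x | N x < q ^ k}, f x ∂(unitsAddMeasure n N μ) = ∑ y ∈ s, c y • f y := by
  classical
  have := h.finiteOnCompacts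
  obtain ⟨t, -, ht⟩ := (h.isCompact_lt k).elim_nhds_subcover
    (fun x => {y | N (y - x) ≤ q ^ j}) (fun x _ => h.ball_mem_nhds x j)
  have hopen : ∀ x, IsOpen {y | N (y - x) ≤ q ^ j} := fun x =>
    (h.isOpen_le j).preimage (continuous_id.sub (continuous_const (y := x)))
  have hclosed : ∀ x, IsClosed {y | N (y - x) ≤ q ^ j} := fun x =>
    (h.isClosed_le j).preimage (continuous_id.sub (continuous_const (y := x)))
  have main : ∀ (t : Finset D) (B : Set D), MeasurableSet B → B ⊆ {x | N x < q ^ k} →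
      B ⊆ (⋃ x ∈ t, {y | N (y - x) ≤ q ^ j}) →
      ∃ (c : D → ℝ), ∀ f : D → E, (∀ x e, N e ≤ q ^ j → f (x + e) = f x) →
      ∫ x in B, f x ∂(unitsAddMeasure n N μ) = ∑ y ∈ t, c y • f y := by
    intro t
    induction t using Finset.induction_on with
    | empty =>
      intro B _ _ hB
      refine ⟨0, fun f _ => ?_⟩
      have : B = ∅ := by simpa using hB
      simp [this]
    | insert a t ha ih =>
      intro B hBm hBk hB
      have hcl : MeasurableSet {y | N (y - a) ≤ q ^ j} := (hopen a).measurableSet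
      obtain ⟨c, hc⟩ := ih (B \ {y | N (y - a) ≤ q ^ j}) (hBm.diff hcl)
        (Set.sdiff_subset.trans hBk) (fun x ⟨hx, hx'⟩ => by
          have := hB hx
          simp only [Finset.mem_insert, Set.iUnion_iUnion_eq_or_left, Set.mem_union] at this
          exact this.resolve_left hx')
      refine ⟨fun y => if y = a then
        (unitsAddMeasure n N μ).real (B ∩ {y | N (y - a) ≤ q ^ j}) else c y, fun f hf => ?_⟩
      have hcont : Continuous f := by
        refine IsLocallyConstant.continuous ((IsLocallyConstant.iff_eventually_eq _).2 fun x => ?_)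
        filter_upwards [h.ball_mem_nhds x j] with y hy
        rw [← hf x (y - x) hy, add_sub_cancel]
      have hint : IntegrableOn f B (unitsAddMeasure n N μ) :=
        (h.integrableOn_lt_of_continuous hcont k).mono_set hBk
      rw [← integral_inter_add_sdiff hcl hint, hc f hf, Finset.sum_insert ha]
      beta_reduce
      rw [if_pos rfl]
      congr 1
      · rw [setIntegral_congr_fun (g := fun _ => f a) (hBm.inter hcl) (fun x hx => ?_),
          setIntegral_const]
        have := hf a (x - a) hx.2
        rwa [add_sub_cancel] at this
      · refine Finset.sum_congr rfl fun y hy => ?_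
        rw [if_neg (by rintro rfl; exact ha hy)]
  obtain ⟨c, hc⟩ := main t _ (h.isOpen_lt k).measurableSet le_rfl ht
  exact ⟨t, c, hc⟩

end Integrals

end IsNormalizedAbs

/-! ### Matrices -/

section Matrices

variable {D : Type*} [DivisionRing D]

/-- The diagonal matrix with entries `a` and `b`. -/
def diagGL (a b : Dˣ) : GL2 D where
  val := !![(a : D), 0; 0, (b : D)]
  inv := !![((a⁻¹ : Dˣ) : D), 0; 0, ((b⁻¹ : Dˣ) : D)]
  val_inv := by simp [Matrix.one_fin_two]
  inv_val := by simp [Matrix.one_fin_two]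

variable (D) in
/-- The Weyl element with rows `(0, -1)` and `(1, 0)`. -/
def weylNeg : GL2 D where
  val := !![0, -1; 1, 0]
  inv := !![0, 1; -1, 0]
  val_inv := by simp [Matrix.one_fin_two]
  inv_val := by simp [Matrix.one_fin_two]

variable (D) in
/-- The permutation matrix with rows `(0, 1)` and `(1, 0)`. -/
def weylSwap : GL2 D where
  val := !![0, 1; 1, 0]
  inv := !![0, 1; 1, 0]
  val_inv := by simp [Matrix.one_fin_two]
  inv_val := by simp [Matrix.one_fin_two]

@[simp] lemma coe_diagGL (a b : Dˣ) :
    (diagGL a b : Matrix (Fin 2) (Fin 2) D) = !![(a : D), 0; 0, (b : D)] := rfl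

@[simp] lemma coe_weylNeg : (weylNeg D : Matrix (Fin 2) (Fin 2) D) = !![0, -1; 1, 0] := rfl

@[simp] lemma coe_weylSwap : (weylSwap D : Matrix (Fin 2) (Fin 2) D) = !![0, 1; 1, 0] := rfl

@[simp] lemma coe_upperUnip (x : D) :
    (upperUnip x : Matrix (Fin 2) (Fin 2) D) = !![1, x; 0, 1] := rfl

@[simp] lemma coe_lowerUnip (x : D) :
    (lowerUnip x : Matrix (Fin 2) (Fin 2) D) = !![1, 0; x, 1] := rfl

@[simp] lemma coe_inv_upperUnip (x : D) :
    ((upperUnip x)⁻¹ : GL2 D) = upperUnip (-x) := Units.ext rfl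

@[simp] lemma coe_inv_lowerUnip (x : D) :
    ((lowerUnip x)⁻¹ : GL2 D) = lowerUnip (-x) := Units.ext rfl

lemma lowerUnip_zero : lowerUnip (0 : D) = 1 := Units.ext (by simp [Matrix.one_fin_two])

lemma upperUnip_zero : upperUnip (0 : D) = 1 := Units.ext (by simp [Matrix.one_fin_two])

lemma lowerUnip_add (x y : D) : lowerUnip (x + y) = lowerUnip x * lowerUnip y :=
  Units.ext (by simp)

lemma upperUnip_add (x y : D) : upperUnip (x + y) = upperUnip x * upperUnip y :=
  Units.ext (by simp [add_comm])

lemma weylNeg_mul_lowerUnip (y : D) : weylNeg D * lowerUnip y = upperUnip (-y) * weylNeg D :=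
  Units.ext (by simp)

lemma lowerUnip_mul_diagGL (x : D) (a b : Dˣ) :
    lowerUnip x * diagGL a b = diagGL a b * lowerUnip ((b⁻¹ : Dˣ) * x * a) :=
  Units.ext (by simp [mul_assoc])

lemma weylNeg_mul_diagGL (a b : Dˣ) : weylNeg D * diagGL a b = diagGL b a * weylNeg D :=
  Units.ext (by simp)

lemma weylSwap_mul_self : weylSwap D * weylSwap D = 1 :=
  Units.ext (by simp [Matrix.one_fin_two])

lemma weylSwap_mul_lowerUnip (x : D) : weylSwap D * lowerUnip x = upperUnip x * weylSwap D :=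
  Units.ext (by simp)

lemma weylSwap_mul_upperUnip (x : D) : weylSwap D * upperUnip x = lowerUnip x * weylSwap D :=
  Units.ext (by simp)

/-- The factorization of a lower unipotent matrix along the big cell of the upper triangular
group. -/
lemma lowerUnip_unit (y : Dˣ) :
    ((lowerUnip (y : D) : GL2 D)) =
      (upperUnip ((y⁻¹ : Dˣ) : D) * diagGL y⁻¹ y) * (weylNeg D * upperUnip ((y⁻¹ : Dˣ) : D)) :=
  Units.ext (by simp)

lemma coe_upperUnip_mul_diagGL (x : D) (a b : Dˣ) :
    ((upperUnip x * diagGL a b : GL2 D) : Matrix (Fin 2) (Fin 2) D) =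
      !![(a : D), x * b; 0, (b : D)] := by simp

section Topology

variable [TopologicalSpace D] [IsTopologicalRing D]

lemma continuous_lowerUnip : Continuous (lowerUnip : D → GL2 D) := by
  refine Units.continuous_iff.2 ⟨?_, ?_⟩
  · refine continuous_matrix fun i j => ?_
    fin_cases i <;> fin_cases j <;> simp <;> fun_prop
  · refine continuous_matrix fun i j => ?_
    fin_cases i <;> fin_cases j <;> simp <;> fun_prop

lemma continuous_upperUnip : Continuous (upperUnip : D → GL2 D) := by
  refine Units.continuous_iff.2 ⟨?_, ?_⟩
  · refine continuous_matrix fun i j => ?_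
    fin_cases i <;> fin_cases j <;> simp <;> fun_prop
  · refine continuous_matrix fun i j => ?_
    fin_cases i <;> fin_cases j <;> simp <;> fun_prop

variable [MeasurableSpace D] {q : ℝ} {n : ℕ} {N : D → ℝ} {μ : Measure Dˣ}

lemma IsNormalizedAbs.exists_lowerUnip_mem (h : IsNormalizedAbs q n N μ)
    (H : OpenSubgroup (GL2 D)) (g : GL2 D) :
    ∃ k : ℤ, ∀ e, N e ≤ q ^ k → g⁻¹ * lowerUnip e * g ∈ H := by
  have hc : Continuous fun e : D => g⁻¹ * lowerUnip e * g :=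
    (continuous_const.mul continuous_lowerUnip).mul continuous_const
  have h1 : (fun e : D => g⁻¹ * lowerUnip e * g) ⁻¹' (H : Set (GL2 D)) ∈ nhds (0 : D) := by
    refine hc.continuousAt.preimage_mem_nhds (H.isOpen.mem_nhds ?_)
    simp [lowerUnip_zero]
  obtain ⟨k, -, hk⟩ := h.hasBasis.mem_iff.1 h1
  exact ⟨k, fun e he => hk he⟩

lemma IsNormalizedAbs.exists_upperUnip_mem (h : IsNormalizedAbs q n N μ)
    (H : OpenSubgroup (GL2 D)) (g : GL2 D) :
    ∃ k : ℤ, ∀ e, N e ≤ q ^ k → g⁻¹ * upperUnip e * g ∈ H := by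
  have hc : Continuous fun e : D => g⁻¹ * upperUnip e * g :=
    (continuous_const.mul continuous_upperUnip).mul continuous_const
  have h1 : (fun e : D => g⁻¹ * upperUnip e * g) ⁻¹' (H : Set (GL2 D)) ∈ nhds (0 : D) := by
    refine hc.continuousAt.preimage_mem_nhds (H.isOpen.mem_nhds ?_)
    simp [upperUnip_zero]
  obtain ⟨k, -, hk⟩ := h.hasBasis.mem_iff.1 h1
  exact ⟨k, fun e he => hk he⟩

end Topology

end Matrices

/-! ### Complex powers -/

section Powers

lemma ofReal_zpow_cpow {q : ℝ} (hq : 0 < q) (k : ℤ) (z : ℂ) :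
    (((q ^ k : ℝ)) : ℂ) ^ z = (q : ℂ) ^ ((k : ℂ) * z) := by
  have hq' : (q : ℂ) ≠ 0 := by exact_mod_cast hq.ne'
  have h1 : ((q ^ k : ℝ) : ℂ) ≠ 0 := by exact_mod_cast (zpow_pos hq k).ne'
  rw [Complex.cpow_def_of_ne_zero h1, Complex.cpow_def_of_ne_zero hq', ← Complex.ofReal_log
    (zpow_pos hq k).le, Real.log_zpow, ← Complex.ofReal_log hq.le]
  push_cast
  ring_nf

lemma norm_cpow_ofReal {q : ℝ} (hq : 0 < q) (z : ℂ) : ‖(q : ℂ) ^ z‖ = q ^ z.re := by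
  rw [Complex.norm_cpow_eq_rpow_re_of_pos hq]

end Powers

/-! ### Sums of eventually periodic Laurent tails -/

section Tail

variable {E : Type*} [NormedAddCommGroup E] [NormedSpace ℂ E]

/-- The analytic continuation of `∑_{k ≥ N} q ^ (-k z) a k` for a sequence `a` with
`a (k + p) = ω a k`. -/
def tailSum (q : ℝ) (p : ℕ) (ω : ℂ) (a : ℤ → E) (N : ℤ) (z : ℂ) : E :=
  (1 - ω * (q : ℂ) ^ (-(p * z)))⁻¹ •
    ∑ j ∈ Finset.range p, (q : ℂ) ^ (-((N + j : ℤ) * z)) • a (N + j)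

variable {q : ℝ} (hq : 1 < q) {p : ℕ} {ω : ℂ} {a : ℤ → E}

include hq in
-- Shifting the window of p terms by one replaces the first term by its multiple by ω q^(-pz), which
-- the prefactor compensates. The identity holds at every regular z, also where the series diverges.
lemma tailSum_eq_add (ha : ∀ k, a (k + p) = ω • a k) {z : ℂ}
    (hz : ω * (q : ℂ) ^ (-(p * z)) ≠ 1) (N : ℤ) :
    tailSum q p ω a N z = (q : ℂ) ^ (-(N * z)) • a N + tailSum q p ω a (N + 1) z := by
  have hq' : (q : ℂ) ≠ 0 := by exact_mod_cast (zero_lt_one.trans hq).ne'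
  have hz' : 1 - ω * (q : ℂ) ^ (-(p * z)) ≠ 0 := sub_ne_zero.2 hz.symm
  have h1 : ∑ j ∈ Finset.range p, (q : ℂ) ^ (-((N + 1 + j : ℤ) * z)) • a (N + 1 + j) +
      (q : ℂ) ^ (-(N * z)) • a N =
      ∑ j ∈ Finset.range p, (q : ℂ) ^ (-((N + j : ℤ) * z)) • a (N + j) +
      (ω * (q : ℂ) ^ (-(p * z))) • ((q : ℂ) ^ (-(N * z)) • a N) := by
    have h2 := Finset.sum_range_succ' (fun j : ℕ => (q : ℂ) ^ (-((N + j : ℤ) * z)) • a (N + j)) p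
    have h3 := Finset.sum_range_succ (fun j : ℕ => (q : ℂ) ^ (-((N + j : ℤ) * z)) • a (N + j)) p
    rw [h3] at h2
    have h4 : ∀ j : ℕ, N + ((j + 1 : ℕ) : ℤ) = N + 1 + j := fun j => by push_cast; ring
    simp only [h4] at h2
    rw [Nat.cast_zero, add_zero] at h2
    rw [← h2, ha, smul_smul, smul_smul]
    congr 2
    rw [mul_assoc, ← Complex.cpow_add _ _ hq', mul_comm _ ω]
    congr 2
    push_cast
    ring
  rw [tailSum, tailSum, eq_sub_of_add_eq h1.symm, smul_sub, smul_add]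
  have h5 : (q : ℂ) ^ (-(N * z)) • a N = (1 - ω * (q : ℂ) ^ (-(p * z)))⁻¹ •
      ((q : ℂ) ^ (-(N * z)) • a N) - (1 - ω * (q : ℂ) ^ (-(p * z)))⁻¹ •
      (ω * (q : ℂ) ^ (-(p * z))) • ((q : ℂ) ^ (-(N * z)) • a N) := by
    rw [smul_smul _ (ω * (q : ℂ) ^ (-(p * z))), ← sub_smul, ← mul_one_sub, inv_mul_cancel₀ hz', one_smul]
  rw [add_sub_assoc, ← h5, add_comm]

include hq in
lemma norm_cpow_lt_one {z : ℂ} (hz : 0 < z.re) (hp : 0 < p) (hω : ‖ω‖ ≤ 1) :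
    ‖ω * (q : ℂ) ^ (-(p * z))‖ < 1 := by
  rw [norm_mul, norm_cpow_ofReal (zero_lt_one.trans hq)]
  have h1 : q ^ (-(p * z)).re < 1 := by
    refine Real.rpow_lt_one_of_one_lt_of_neg hq ?_
    simp only [Complex.neg_re, Complex.mul_re, Complex.natCast_re, Complex.natCast_im, zero_mul,
      sub_zero, Left.neg_neg_iff]
    positivity
  have h2 : 0 ≤ q ^ (-(p * z)).re := Real.rpow_nonneg (zero_lt_one.trans hq).le _
  nlinarith [norm_nonneg ω]

include hq in
lemma mul_cpow_ne_one {z : ℂ} (hz : 0 < z.re) (hp : 0 < p) (hω : ‖ω‖ ≤ 1) :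
    ω * (q : ℂ) ^ (-(p * z)) ≠ 1 := fun h1 => by
  have := norm_cpow_lt_one hq hz hp hω
  rw [h1, norm_one] at this
  exact lt_irrefl _ this

lemma exists_norm_le (hp : 0 < p) (hω : ‖ω‖ ≤ 1) (ha : ∀ k, a (k + p) = ω • a k) (N : ℤ) :
    ∃ B, ∀ j : ℕ, ‖a (N + j)‖ ≤ B := by
  refine ⟨∑ j ∈ Finset.range p, ‖a (N + j)‖, fun j => ?_⟩
  induction j using Nat.strong_induction_on with
  | _ j ih =>
    by_cases hj : j < p
    · exact Finset.single_le_sum (f := fun j : ℕ => ‖a (N + j)‖) (fun _ _ => norm_nonneg _)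
        (Finset.mem_range.2 hj)
    · have h1 := ha (N + (j - p : ℕ))
      have h2 : N + ((j - p : ℕ) : ℤ) + p = N + j := by omega
      rw [h2] at h1
      rw [h1, norm_smul]
      exact (mul_le_of_le_one_left (norm_nonneg _) hω).trans (ih _ (by omega))

include hq in
lemma summable_norm_tail (hp : 0 < p) (hω : ‖ω‖ ≤ 1) (ha : ∀ k, a (k + p) = ω • a k) {z : ℂ}
    (hz : 0 < z.re) (N : ℤ) :
    Summable fun j : ℕ => ‖(q : ℂ) ^ (-((N + j : ℤ) * z)) • a (N + j)‖ := by
  obtain ⟨B, hB⟩ := exists_norm_le hp hω ha N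
  have hq0 := zero_lt_one.trans hq
  have h1 : ∀ j : ℕ, ‖(q : ℂ) ^ (-((N + j : ℤ) * z))‖ = q ^ (-(N * z.re)) * (q ^ (-z.re)) ^ j := by
    intro j
    rw [norm_cpow_ofReal hq0, ← Real.rpow_natCast, ← Real.rpow_mul hq0.le, ← Real.rpow_add hq0]
    congr 1
    rw [← Complex.ofReal_intCast]
    simp only [Complex.neg_re, Complex.re_ofReal_mul]
    push_cast; ring
  refine Summable.of_nonneg_of_le (fun _ => norm_nonneg _) (fun j => ?_)
    (((summable_geometric_of_lt_one (Real.rpow_nonneg hq0.le _)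
      (Real.rpow_lt_one_of_one_lt_of_neg hq (neg_lt_zero.2 hz))).mul_left
        (q ^ (-(N * z.re)))).mul_right B)
  rw [norm_smul, h1]
  gcongr
  exact hB j

include hq in
-- The sum S of the series equals its first p terms plus ω q^(-pz) S.
lemma hasSum_tailSum [CompleteSpace E] (hp : 0 < p) (hω : ‖ω‖ ≤ 1)
    (ha : ∀ k, a (k + p) = ω • a k) {z : ℂ} (hz : 0 < z.re) (N : ℤ) :
    HasSum (fun j : ℕ => (q : ℂ) ^ (-((N + j : ℤ) * z)) • a (N + j)) (tailSum q p ω a N z) := by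
  have hs := summable_norm_tail hq hp hω ha hz N
  have hne := mul_cpow_ne_one hq hz hp hω
  have hq' : (q : ℂ) ≠ 0 := by exact_mod_cast (zero_lt_one.trans hq).ne'
  have h1 := hs.of_norm.hasSum
  set S := ∑' j : ℕ, (q : ℂ) ^ (-((N + j : ℤ) * z)) • a (N + j) with hS
  have h2 := (hs.of_norm).sum_add_tsum_nat_add p
  have h3 : ∑' j : ℕ, (q : ℂ) ^ (-((N + (j + p : ℕ) : ℤ) * z)) • a (N + (j + p : ℕ)) =
      (ω * (q : ℂ) ^ (-(p * z))) • S := by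
    rw [hS, ← hs.of_norm.tsum_const_smul]
    refine tsum_congr fun j => ?_
    have : N + ((j + p : ℕ) : ℤ) = N + j + p := by push_cast; ring
    rw [this, ha, smul_smul, smul_smul]
    congr 1
    rw [mul_assoc, ← Complex.cpow_add _ _ hq', mul_comm _ ω]
    congr 2
    push_cast
    ring
  rw [h3, ← hS] at h2
  have h4 : tailSum q p ω a N z = S := by
    rw [tailSum, eq_sub_of_add_eq h2]
    conv_lhs => rw [← one_smul ℂ S]
    rw [smul_smul, mul_one, ← sub_smul, smul_smul, inv_mul_cancel₀ (sub_ne_zero.2 hne.symm),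
      one_smul]
  rw [h4]
  exact h1

include hq in
lemma tailSum_shift (N i : ℤ) (z : ℂ) :
    tailSum q p ω (fun k => a (k + i)) N z = (q : ℂ) ^ (i * z) • tailSum q p ω a (N + i) z := by
  have hq' : (q : ℂ) ≠ 0 := by exact_mod_cast (zero_lt_one.trans hq).ne'
  rw [tailSum, tailSum, smul_comm ((q : ℂ) ^ (i * z)), Finset.smul_sum (r := (q : ℂ) ^ (i * z))]
  congr 1
  refine Finset.sum_congr rfl fun j _ => ?_
  rw [smul_smul, ← Complex.cpow_add _ _ hq', add_right_comm]
  congr 2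
  push_cast
  ring

include hq in
-- The two halves of the two-sided series Σ q^(-kz) a_k of a periodic sequence continue to rational
-- functions that add up to zero. This is the functional equation behind the cancellation in the
-- composition.
lemma tailSum_neg (ha : ∀ k, a (k + p) = a k) (N : ℤ) (z : ℂ) :
    tailSum q p 1 (fun k => a (-k)) N (-z) = -tailSum q p 1 a (1 - N) z := by
  have hq' : (q : ℂ) ≠ 0 := by exact_mod_cast (zero_lt_one.trans hq).ne'
  rw [tailSum, tailSum, ← Finset.sum_range_reflect]
  have h1 : ∀ j ∈ Finset.range p, (q : ℂ) ^ (-((N + (p - 1 - j : ℕ) : ℤ) * -z)) •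
      a (-(N + (p - 1 - j : ℕ))) =
      (q : ℂ) ^ (p * z) • ((q : ℂ) ^ (-((1 - N + j : ℤ) * z)) • a (1 - N + j)) := by
    intro j hj
    have hj := Finset.mem_range.1 hj
    have h2 : ((p - 1 - j : ℕ) : ℤ) = p - 1 - j := by omega
    rw [h2, smul_smul, ← Complex.cpow_add _ _ hq', ← ha]
    congr 2
    · push_cast; ring
    · ring
  rw [Finset.sum_congr rfl h1, ← Finset.smul_sum, smul_smul, ← neg_smul]
  congr 1
  rw [one_mul, one_mul, mul_neg, neg_neg, Complex.cpow_neg]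
  have h3 : (q : ℂ) ^ (p * z) ≠ 0 := by simp [Complex.cpow_eq_zero_iff, hq']
  -- At a pole both prefactors are inverses of 0, hence 0 by convention, so the identity persists
  -- there.
  by_cases h4 : (q : ℂ) ^ (p * z) = 1
  · simp [h4]
  · field_simp [sub_ne_zero.2 h4, sub_ne_zero.2 (Ne.symm h4)]
    ring

end Tail

/-! ### Induced representations and the regularized intertwining integral -/

section Defs

variable {D : Type*} [DivisionRing D]
  {V : Type*} [NormedAddCommGroup V] [NormedSpace ℂ V]

/-- `σ` is an isometric representation of `Dˣ × Dˣ`, trivial near the identity. -/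
structure IsSmoothIsometric (q : ℝ) (N : D → ℝ) (σ : Dˣ × Dˣ →* (V →L[ℂ] V)) : Prop where
  norm_map : ∀ g v, ‖σ g v‖ = ‖v‖
  exists_level : ∃ m : ℕ, ∀ a b : Dˣ, N ((a : D) - 1) ≤ q ^ (-(m : ℤ)) →
    N ((b : D) - 1) ≤ q ^ (-(m : ℤ)) → σ (a, b) = 1

/-- The representation `(a, b) ↦ σ (b, a)`. -/
def swapRep (σ : Dˣ × Dˣ →* (V →L[ℂ] V)) : Dˣ × Dˣ →* (V →L[ℂ] V) :=
  σ.comp (MulEquiv.prodComm : Dˣ × Dˣ ≃* Dˣ × Dˣ).toMonoidHom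

@[simp] lemma swapRep_apply (σ : Dˣ × Dˣ →* (V →L[ℂ] V)) (a b : Dˣ) :
    swapRep σ (a, b) = σ (b, a) := rfl

lemma IsSmoothIsometric.swap {q : ℝ} {N : D → ℝ} {σ : Dˣ × Dˣ →* (V →L[ℂ] V)}
    (hσ : IsSmoothIsometric q N σ) : IsSmoothIsometric q N (swapRep σ) := by
  refine ⟨fun ⟨a, b⟩ v => hσ.norm_map (b, a) v, ?_⟩
  obtain ⟨m, hm⟩ := hσ.exists_level
  exact ⟨m, fun a b ha hb => hm b a hb ha⟩

/-- The twisted diagonal operator `σ(w, w⁻¹)`. -/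
def tau (σ : Dˣ × Dˣ →* (V →L[ℂ] V)) (w : Dˣ) : V →L[ℂ] V := σ (w, w⁻¹)

variable [TopologicalSpace D]

/-- The normalized induction of `σ |a|^{s/2} |b|^{-s/2}` from the upper triangular group. -/
def ind (n : ℕ) (N : D → ℝ) (σ : Dˣ × Dˣ →* (V →L[ℂ] V)) (s : ℂ) : Set (GL2 D → V) :=
  {φ | (∃ H : OpenSubgroup (GL2 D), ∀ g, ∀ k ∈ H, φ (g * k) = φ g) ∧
    ∀ (p : GL2 D) (a b : Dˣ) (x : D),
      (p : Matrix (Fin 2) (Fin 2) D) = !![(a : D), x; 0, (b : D)] → ∀ g,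
      φ (p * g) = ((N (a : D) / N (b : D) : ℝ) : ℂ) ^ ((s + n) / 2) • σ (a, b) (φ g)}

/-- The normalized induction of `σ |a|^{-s/2} |b|^{s/2}` from the lower triangular group. -/
def indBar (n : ℕ) (N : D → ℝ) (σ : Dˣ × Dˣ →* (V →L[ℂ] V)) (s : ℂ) : Set (GL2 D → V) :=
  {φ | (∃ H : OpenSubgroup (GL2 D), ∀ g, ∀ k ∈ H, φ (g * k) = φ g) ∧
    ∀ (p : GL2 D) (a b : Dˣ) (x : D),
      (p : Matrix (Fin 2) (Fin 2) D) = !![(a : D), 0; x, (b : D)] → ∀ g,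
      φ (p * g) = ((N (b : D) / N (a : D) : ℝ) : ℂ) ^ ((s + n) / 2) • σ (a, b) (φ g)}

variable [MeasurableSpace D]

/-- The integral of `σ(w, w⁻¹)` over a sphere. -/
def sphereOp (q : ℝ) (N : D → ℝ) (μ : Measure Dˣ) (σ : Dˣ × Dˣ →* (V →L[ℂ] V)) (k : ℤ) :
    V →L[ℂ] V :=
  ∫ w in sphere q N k, tau σ w ∂μ

/-- The intertwining integral with its tail `q ^ k ≤ N x` replaced by its analytic continuation. -/
def regInt (q : ℝ) (p : ℕ) (ω : ℂ) (n : ℕ) (N : D → ℝ) (μ : Measure Dˣ)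
    (σ : Dˣ × Dˣ →* (V →L[ℂ] V)) (k : ℤ) (z : ℂ) (φ : GL2 D → V) (g : GL2 D) : V :=
  ∫ x in {x | N x < q ^ k}, φ (lowerUnip x * g) ∂(unitsAddMeasure n N μ) +
    tailSum q p ω (sphereOp q N μ σ) k z (φ (weylNeg D * g))

/-- The function `φ` is constant near infinity on the big cell through `g`. -/
def IsTailConst (q : ℝ) (N : D → ℝ) (φ : GL2 D → V) (g : GL2 D) (k : ℤ) : Prop :=
  ∀ x : Dˣ, q ^ k ≤ N (x : D) →
    φ (weylNeg D * upperUnip ((x⁻¹ : Dˣ) : D) * g) = φ (weylNeg D * g)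

end Defs

/-! ### The intertwining integral on the big cell: ball and tail -/

section Basic

variable {D : Type*} [DivisionRing D] [TopologicalSpace D] [IsTopologicalRing D] [T2Space D]
  [ContinuousInv₀ D] [MeasurableSpace D] [BorelSpace D] [BorelSpace Dˣ]
  [SecondCountableTopology D] [SecondCountableTopology Dˣ]
  {q : ℝ} {n : ℕ} {N : D → ℝ} {μ : Measure Dˣ} (h : IsNormalizedAbs q n N μ)
  {V : Type*} [NormedAddCommGroup V] [NormedSpace ℂ V] [CompleteSpace V]
  {σ : Dˣ × Dˣ →* (V →L[ℂ] V)} (hσ : IsSmoothIsometric q N σ)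

lemma rep_mul_apply (σ : Dˣ × Dˣ →* (V →L[ℂ] V)) (a b c d : Dˣ) (v : V) :
    σ (a, b) (σ (c, d) v) = σ (a * c, b * d) v := by
  rw [← Prod.mk_mul_mk, map_mul]; rfl

lemma rep_mul (σ : Dˣ × Dˣ →* (V →L[ℂ] V)) (a b c d : Dˣ) :
    σ (a, b) * σ (c, d) = σ (a * c, b * d) := by
  rw [← map_mul, Prod.mk_mul_mk]

include h hσ in
lemma continuous_rep : Continuous σ := by
  obtain ⟨m, hm⟩ := hσ.exists_level
  refine IsLocallyConstant.continuous ((IsLocallyConstant.iff_eventually_eq _).2 fun ⟨a, b⟩ => ?_)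
  have h1 : ∀ c : Dˣ, {x : Dˣ | N ((c⁻¹ * x : Dˣ) - 1 : D) ≤ q ^ (-(m : ℤ))} ∈ nhds c := by
    intro c
    have h2 : Continuous fun x : Dˣ => ((c⁻¹ * x : Dˣ) - 1 : D) :=
      (Units.continuous_val.comp (continuous_const.mul continuous_id)).sub continuous_const
    refine ((h.isOpen_le _).preimage h2).mem_nhds ?_
    simp [h.map_zero, (pow_pos h.q_pos _).le]
  rw [nhds_prod_eq]
  filter_upwards [Filter.prod_mem_prod (h1 a) (h1 b)] with ⟨x, y⟩ ⟨hx, hy⟩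
  have h3 := rep_mul σ a b (a⁻¹ * x) (b⁻¹ * y)
  rw [hm _ _ hx hy, mul_one, mul_inv_cancel_left, mul_inv_cancel_left] at h3
  exact h3.symm

include h hσ in
lemma continuous_tau : Continuous (tau σ) :=
  (continuous_rep h hσ).comp (continuous_id.prodMk continuous_inv)

include h hσ in
lemma integrableOn_tau (k : ℤ) : IntegrableOn (tau σ) (sphere q N k) μ :=
  h.integrableOn_of_continuous (continuous_tau h hσ) le_rfl

include h hσ in
lemma sphereOp_apply (k : ℤ) (v : V) :
    sphereOp q N μ σ k v = ∫ w in sphere q N k, tau σ w v ∂μ := by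
  rw [sphereOp, ContinuousLinearMap.integral_apply (integrableOn_tau h hσ k)]

include h hσ in
-- Substitute w' = a w b⁻¹ in σ(a, b)σ(w, w⁻¹) = σ(w', w'⁻¹)σ(b, a).
lemma rep_mul_sphereOp {a b : Dˣ} {i j : ℤ} (ha : a ∈ sphere q N i) (hb : b ∈ sphere q N j)
    (k : ℤ) : σ (a, b) * sphereOp q N μ σ k = sphereOp q N μ σ (k + (i - j)) * σ (b, a) := by
  have h1 : sphereOp q N μ σ (k + (i - j)) * σ (b, a) =
      ∫ w in sphere q N (k + (i - j)), tau σ w * σ (b, a) ∂μ := by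
    rw [sphereOp]
    have hint : IntegrableOn (tau σ) (sphere q N (k + (i - j))) μ := integrableOn_tau h hσ _
    exact (((ContinuousLinearMap.mul ℂ (V →L[ℂ] V)).flip (σ (b, a))).integral_comp_comm hint).symm
  have h2 : σ (a, b) * sphereOp q N μ σ k = ∫ w in sphere q N k, σ (a, b) * tau σ w ∂μ := by
    rw [sphereOp]
    exact ((ContinuousLinearMap.mul ℂ (V →L[ℂ] V) (σ (a, b))).integral_comp_comm
      (integrableOn_tau h hσ k)).symm
  have h3 := h.integral_sphere_mul_left (fun w => tau σ (w * b⁻¹) * σ (b, a)) ha k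
  have h4 := h.integral_sphere_mul_right (fun w => tau σ w * σ (b, a)) (h.inv_mem_sphere hb) (i + k)
  rw [h1, h2, show k + (i - j) = i + k + -j by ring, ← h4, ← h3]
  refine setIntegral_congr_fun (h.measurableSet_sphere k) fun w _ => ?_
  dsimp only [tau]
  rw [rep_mul, rep_mul]
  simp [mul_assoc]

include h hσ in
lemma sphereOp_swapRep (k : ℤ) : sphereOp q N μ (swapRep σ) k = sphereOp q N μ σ (-k) := by
  rw [sphereOp, sphereOp, ← h.integral_sphere_inv]
  refine setIntegral_congr_fun (h.measurableSet_sphere k) fun w _ => ?_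
  simp [tau]

include h hσ in
-- The substitution w ↦ -w absorbs σ(-1, -1), so the sign in `weylNeg` plays no role in the tails.
lemma sphereOp_mul_neg_one (k : ℤ) :
    sphereOp q N μ σ k * σ (-1, -1) = sphereOp q N μ σ k := by
  have hm : (-1 : Dˣ) ∈ sphere q N 0 := by
    change N ((-1 : Dˣ) : D) = _
    rw [Units.val_neg, Units.val_one, h.map_neg, h.map_one, neg_zero, zpow_zero]
  have h1 : sphereOp q N μ σ k * σ (-1, -1) =
      ∫ w in sphere q N k, tau σ w * σ (-1, -1) ∂μ := by
    rw [sphereOp]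
    have hint : IntegrableOn (tau σ) (sphere q N k) μ := integrableOn_tau h hσ _
    exact (((ContinuousLinearMap.mul ℂ (V →L[ℂ] V)).flip (σ (-1, -1))).integral_comp_comm
      hint).symm
  have h4 := h.integral_sphere_mul_right (fun w => tau σ w) hm k
  rw [add_zero] at h4
  rw [h1, sphereOp, ← h4]
  refine setIntegral_congr_fun (h.measurableSet_sphere k) fun w _ => ?_
  dsimp only [tau]
  rw [rep_mul]
  simp

include h in
-- The factorization `lowerUnip_unit` has diagonal (y⁻¹, y), and |y⁻¹|/|y| = q^(2j), which cancels
-- the 2 in the exponent (s + n)/2.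
lemma ind_lowerUnip {s : ℂ} {φ : GL2 D → V} (hφ : φ ∈ ind n N σ s) {y : Dˣ} {j : ℤ}
    (hy : y ∈ sphere q N j) (g : GL2 D) :
    φ (lowerUnip (y : D) * g) = (q : ℂ) ^ (j * (s + n)) •
      tau σ y⁻¹ (φ (weylNeg D * upperUnip ((y⁻¹ : Dˣ) : D) * g)) := by
  rw [lowerUnip_unit, mul_assoc, hφ.2 _ _ _ _ (coe_upperUnip_mul_diagGL _ _ _), h.map_inv,
    show N (y : D) = _ from hy]
  rw [tau, inv_inv]
  congr 1
  have : (q ^ (-j))⁻¹ / q ^ (-j) = q ^ (2 * j) := by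
    rw [← zpow_neg, ← zpow_sub₀ h.q_pos.ne']; congr 1; ring
  rw [this, ofReal_zpow_cpow h.q_pos]
  congr 1
  push_cast
  ring

include h in
lemma IsTailConst.lowerUnip {s : ℂ} {φ : GL2 D → V} (hφ : φ ∈ ind n N σ s) {g : GL2 D} {k : ℤ}
    (hk : IsTailConst q N φ g k) {y : Dˣ} {j : ℤ} (hy : y ∈ sphere q N (-j)) (hj : k ≤ j) :
    N (y : D) ^ n • φ (lowerUnip (y : D) * g) = (q : ℂ) ^ (-(j * s)) •
      tau σ y⁻¹ (φ (weylNeg D * g)) := by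
  have hN : N (y : D) = q ^ j := by rw [← neg_neg j]; exact hy
  have hq' : (q : ℂ) ≠ 0 := by exact_mod_cast h.q_pos.ne'
  rw [ind_lowerUnip h hφ hy, hk y (by rw [hN]; exact zpow_le_zpow_right₀ h.one_lt_q.le hj),
    ← Complex.coe_smul, smul_smul, hN]
  congr 1
  have h1 : (((q ^ j) ^ n : ℝ) : ℂ) = (q : ℂ) ^ ((j : ℂ) * n) := by
    rw [← ofReal_zpow_cpow h.q_pos, Complex.cpow_natCast]
    push_cast; rfl
  rw [h1, ← Complex.cpow_add _ _ hq']
  congr 1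
  push_cast
  ring

include h in
lemma continuous_comp_lowerUnip {φ : GL2 D → V}
    (hφ : ∃ H : OpenSubgroup (GL2 D), ∀ g, ∀ k ∈ H, φ (g * k) = φ g) (g : GL2 D) :
    Continuous fun x => φ (lowerUnip x * g) := by
  obtain ⟨H, hH⟩ := hφ
  obtain ⟨k, hk⟩ := h.exists_lowerUnip_mem H g
  refine IsLocallyConstant.continuous ((IsLocallyConstant.iff_eventually_eq _).2 fun x => ?_)
  filter_upwards [h.ball_mem_nhds x k] with y hy
  have h1 := hH (lowerUnip x * g) _ (hk _ hy)
  rw [← h1, ← add_sub_cancel x y, lowerUnip_add]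
  congr 1
  group
  simp

include h hσ in
lemma setIntegral_shell {s : ℂ} {φ : GL2 D → V} (hφ : φ ∈ ind n N σ s) {g : GL2 D} {k j : ℤ}
    (hk : IsTailConst q N φ g k) (hj : k ≤ j) :
    ∫ y in sphere q N (-j), N (y : D) ^ n • φ (lowerUnip (y : D) * g) ∂μ =
      (q : ℂ) ^ (-(j * s)) • sphereOp q N μ σ j (φ (weylNeg D * g)) := by
  rw [setIntegral_congr_fun (h.measurableSet_sphere _) fun y hy => hk.lowerUnip h hφ hy hj,
    integral_smul, sphereOp_apply h hσ,
    h.integral_sphere_inv (fun w => tau σ w (φ (weylNeg D * g))), neg_neg]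

include h in
lemma IsTailConst.mono {φ : GL2 D → V} {g : GL2 D} {k l : ℤ} (hk : IsTailConst q N φ g k)
    (hkl : k ≤ l) : IsTailConst q N φ g l := fun x hx =>
  hk x ((zpow_le_zpow_right₀ h.one_lt_q.le hkl).trans hx)

include h in
-- The level depends on H and g but not on φ, so a single truncation serves a whole flat section.
lemma exists_isTailConst (H : OpenSubgroup (GL2 D)) (g : GL2 D) :
    ∃ k, ∀ φ : GL2 D → V, (∀ g, ∀ k ∈ H, φ (g * k) = φ g) → IsTailConst q N φ g k := by
  obtain ⟨k, hk⟩ := h.exists_upperUnip_mem H g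
  refine ⟨-k, fun φ hφ x hx => ?_⟩
  rw [← hφ (weylNeg D * g) _ (hk ((x⁻¹ : Dˣ) : D) ?_)]
  · congr 1
    group
  · rw [h.map_inv, ← inv_inv (q ^ k), ← zpow_neg]
    exact inv_anti₀ (zpow_pos h.q_pos _) hx

include h hσ in
-- Raising the level by one moves the shell |x| = q^k from the tail into the ball, without changing
-- its contribution.
lemma regInt_succ {p : ℕ} {ω : ℂ} (hA : ∀ k, sphereOp q N μ σ (k + p) = ω • sphereOp q N μ σ k)
    {s : ℂ} (hs : ω * (q : ℂ) ^ (-(p * s)) ≠ 1) {φ : GL2 D → V} (hφ : φ ∈ ind n N σ s)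
    {g : GL2 D} {k : ℤ} (hk : IsTailConst q N φ g k) :
    regInt q p ω n N μ σ k s φ g = regInt q p ω n N μ σ (k + 1) s φ g := by
  have h1 : {x | N x < q ^ (k + 1)} = {x | N x < q ^ k} ∪ {x | N x = q ^ k} := by
    ext x
    simp only [Set.mem_ofPred_eq, Set.mem_union, h.lt_zpow_iff, add_sub_cancel_right]
    rw [← h.lt_zpow_iff, ← le_iff_lt_or_eq]
  have hc := continuous_comp_lowerUnip h hφ.1 g
  have hm : MeasurableSet {x | N x = q ^ k} := h.measurable (measurableSet_singleton _)
  have hd : Disjoint {x | N x < q ^ k} {x | N x = q ^ k} :=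
    Set.disjoint_left.2 fun x hx hx' => (show N x < q ^ k from hx).ne hx'
  have hi := h.integrableOn_lt_of_continuous hc (k + 1)
  have h2 : Units.val ⁻¹' {x : D | N x = q ^ k} = sphere q N (-k) := by
    ext w; simp [sphere]
  rw [regInt, regInt, h1, setIntegral_union hd hm (hi.mono_set (by rw [h1]; exact Set.subset_union_left))
    (hi.mono_set (by rw [h1]; exact Set.subset_union_right)), h.setIntegral_unitsAddMeasure _ hm,
    h2, setIntegral_shell h hσ hφ hk le_rfl, tailSum_eq_add h.one_lt_q hA hs k, add_assoc]
  rfl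

include h hσ in
lemma regInt_eq {p : ℕ} {ω : ℂ} (hA : ∀ k, sphereOp q N μ σ (k + p) = ω • sphereOp q N μ σ k)
    {s : ℂ} (hs : ω * (q : ℂ) ^ (-(p * s)) ≠ 1) {φ : GL2 D → V} (hφ : φ ∈ ind n N σ s)
    {g : GL2 D} {k l : ℤ} (hk : IsTailConst q N φ g k) (hl : IsTailConst q N φ g l) :
    regInt q p ω n N μ σ k s φ g = regInt q p ω n N μ σ l s φ g := by
  have main : ∀ (j : ℕ) (k : ℤ), IsTailConst q N φ g k →
      regInt q p ω n N μ σ k s φ g = regInt q p ω n N μ σ (k + j) s φ g := by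
    intro j
    induction j with
    | zero => intro k _; simp
    | succ j ih =>
      intro k hk
      rw [ih k hk, regInt_succ h hσ hA hs hφ (hk.mono h (by omega : k ≤ k + j))]
      push_cast
      rw [add_assoc]
  rcases le_total k l with hkl | hkl
  · obtain ⟨j, rfl⟩ := Int.le.dest hkl
    exact main j k hk
  · obtain ⟨j, rfl⟩ := Int.le.dest hkl
    exact (main j l hl).symm

/-- On the half-plane of convergence the regularized integral is the intertwining integral. -/
theorem integrable_and_integral_eq_regInt (h : IsNormalizedAbs q n N μ)
    (hσ : IsSmoothIsometric q N σ) {p : ℕ} (hp : 0 < p) {ω : ℂ} (hω : ‖ω‖ ≤ 1)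
    (hA : ∀ k, sphereOp q N μ σ (k + p) = ω • sphereOp q N μ σ k)
    {s : ℂ} (hs : 0 < s.re) {φ : GL2 D → V} (hφ : φ ∈ ind n N σ s)
    {g : GL2 D} {k : ℤ} (hk : IsTailConst q N φ g k) :
    Integrable (fun x => φ (lowerUnip x * g)) (unitsAddMeasure n N μ) ∧
    ∫ x, φ (lowerUnip x * g) ∂(unitsAddMeasure n N μ) = regInt q p ω n N μ σ k s φ g := by
  have hc := continuous_comp_lowerUnip h hφ.1 g
  have hm : MeasurableSet {x | N x < q ^ k} := (h.isOpen_lt k).measurableSet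
  have hU : Units.val ⁻¹' {x | N x < q ^ k}ᶜ = ⋃ j : ℕ, sphere q N (-(k + j : ℤ)) := by
    ext w
    simp only [Set.mem_preimage, Set.mem_compl_iff, Set.mem_ofPred_eq, not_lt, Set.mem_iUnion,
      sphere, neg_neg]
    constructor
    · intro hw
      obtain ⟨i, hi⟩ := h.exists_zpow w w.ne_zero
      rw [hi, zpow_le_zpow_iff_right₀ h.one_lt_q] at hw
      obtain ⟨j, rfl⟩ := Int.le.dest hw
      exact ⟨j, hi⟩
    · rintro ⟨j, hj⟩
      rw [hj]
      exact zpow_le_zpow_right₀ h.one_lt_q.le (by omega)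
  set f : Dˣ → V := fun w => N (w : D) ^ n • φ (lowerUnip (w : D) * g) with hf
  have hfc : Continuous f := by
    have h1 : Continuous fun w : Dˣ => N (w : D) ^ n := h.continuous_units.pow n
    exact h1.smul (hc.comp Units.continuous_val)
  have hdisj : Pairwise (Function.onFun Disjoint fun j : ℕ => sphere q N (-(k + j : ℤ))) := by
    intro i j hij
    refine Set.disjoint_left.2 fun w hi hj => hij ?_
    have := h.sphere_index_inj hi hj
    omega
  -- Since σ is isometric, the norm of the integrand is constant on a shell of volume 1. The series
  -- is the norm series of a tail with constant coefficients, whence p = 1 and ω = 1.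
  have hsum : Summable fun j : ℕ => ∫ w in sphere q N (-(k + j : ℤ)), ‖f w‖ ∂μ := by
    have h1 := summable_norm_tail h.one_lt_q (a := fun _ => φ (weylNeg D * g)) (p := 1) (ω := 1)
      one_pos (by simp) (by simp) hs k
    refine h1.congr fun j => ?_
    have h2 : ∀ w ∈ sphere q N (-(k + j : ℤ)),
        ‖f w‖ = ‖(q : ℂ) ^ (-((k + j : ℤ) * s)) • φ (weylNeg D * g)‖ := by
      intro w hw
      rw [hf]
      dsimp only
      rw [hk.lowerUnip h hφ hw (by omega), norm_smul, norm_smul, tau, hσ.norm_map]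
    rw [setIntegral_congr_fun (h.measurableSet_sphere _) h2, setIntegral_const]
    rw [measureReal_def, h.measure_sphere]
    simp
  have hint : IntegrableOn f (⋃ j : ℕ, sphere q N (-(k + j : ℤ))) μ :=
    integrableOn_iUnion_of_summable_integral_norm
      (fun j => h.integrableOn_of_continuous hfc le_rfl) hsum
  have hintball := h.integrableOn_lt_of_continuous hc k
  have hI : Integrable (fun x => φ (lowerUnip x * g)) (unitsAddMeasure n N μ) := by
    rw [h.integrable_unitsAddMeasure, ← integrableOn_univ,
      ← Set.union_compl_self (Units.val ⁻¹' {x | N x < q ^ k})]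
    refine IntegrableOn.union ?_ ?_
    · rw [← integrable_indicator_iff (hm.preimage Units.continuous_val.measurable)]
      rw [← integrable_indicator_iff hm, h.integrable_unitsAddMeasure] at hintball
      refine hintball.congr (Filter.Eventually.of_forall fun w => ?_)
      by_cases hw : (w : D) ∈ {x | N x < q ^ k}
      · dsimp only
        rw [Set.indicator_of_mem hw,
          Set.indicator_of_mem (show w ∈ Units.val ⁻¹' {x | N x < q ^ k} from hw)]
      · dsimp only
        rw [Set.indicator_of_notMem hw, smul_zero,
          Set.indicator_of_notMem (show w ∉ Units.val ⁻¹' {x | N x < q ^ k} from hw)]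
    · rw [← Set.preimage_compl, hU]
      exact hint
  refine ⟨hI, ?_⟩
  rw [← integral_add_compl hm hI, h.setIntegral_unitsAddMeasure _ hm.compl, hU, regInt]
  congr 1
  have h3 := hasSum_integral_iUnion (fun j : ℕ => h.measurableSet_sphere (-(k + j : ℤ))) hdisj hint
  have h4 := (ContinuousLinearMap.apply ℂ V (φ (weylNeg D * g))).hasSum
    (hasSum_tailSum h.one_lt_q hp hω hA hs k)
  refine h3.unique (h4.congr_fun fun j => ?_)
  rw [hf, setIntegral_shell h hσ hφ hk (by omega)]
  rfl

end Basic

/-! ### The regularized intertwining operator -/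

section RegOp

variable {D : Type*} [DivisionRing D] [TopologicalSpace D] [IsTopologicalRing D] [T2Space D]
  [ContinuousInv₀ D] [MeasurableSpace D] [BorelSpace D] [BorelSpace Dˣ]
  [SecondCountableTopology D] [SecondCountableTopology Dˣ]
  {q : ℝ} {n : ℕ} {N : D → ℝ} {μ : Measure Dˣ}
  {V : Type*} [NormedAddCommGroup V] [NormedSpace ℂ V] [CompleteSpace V]
  {σ : Dˣ × Dˣ →* (V →L[ℂ] V)} {p : ℕ} {ω : ℂ}

/-- The regularized intertwining operator. -/
def regOp (q : ℝ) (p : ℕ) (ω : ℂ) (n : ℕ) (N : D → ℝ) (μ : Measure Dˣ)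
    (σ : Dˣ × Dˣ →* (V →L[ℂ] V)) (z : ℂ) (φ : GL2 D → V) (g : GL2 D) : V :=
  regInt q p ω n N μ σ (Classical.epsilon (IsTailConst q N φ g)) z φ g

/-- The hypotheses under which the regularized intertwining operator is defined. -/
structure RegHyp (q : ℝ) (p : ℕ) (ω : ℂ) (n : ℕ) (N : D → ℝ) (μ : Measure Dˣ)
    (σ : Dˣ × Dˣ →* (V →L[ℂ] V)) : Prop where
  abs : IsNormalizedAbs q n N μ
  rep : IsSmoothIsometric q N σ
  pos : 0 < p
  norm_le : ‖ω‖ ≤ 1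
  periodic : ∀ k, sphereOp q N μ σ (k + p) = ω • sphereOp q N μ σ k

variable (H : RegHyp q p ω n N μ σ)
include H

lemma regOp_eq {z : ℂ} (hz : ω * (q : ℂ) ^ (-(p * z)) ≠ 1) {φ : GL2 D → V}
    (hφ : φ ∈ ind n N σ z) {g : GL2 D} {k : ℤ} (hk : IsTailConst q N φ g k) :
    regOp q p ω n N μ σ z φ g = regInt q p ω n N μ σ k z φ g :=
  regInt_eq H.abs H.rep H.periodic hz hφ (Classical.epsilon_spec ⟨k, hk⟩) hk

lemma regOp_eq_integral {z : ℂ} (hz : 0 < z.re) {φ : GL2 D → V}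
    (hφ : φ ∈ ind n N σ z) (g : GL2 D) :
    Integrable (fun x => φ (lowerUnip x * g)) (unitsAddMeasure n N μ) ∧
    regOp q p ω n N μ σ z φ g = ∫ x, φ (lowerUnip x * g) ∂(unitsAddMeasure n N μ) := by
  obtain ⟨K, hK⟩ := hφ.1
  obtain ⟨k, hk⟩ := exists_isTailConst (V := V) H.abs K g
  obtain ⟨h1, h2⟩ := integrable_and_integral_eq_regInt H.abs H.rep H.pos H.norm_le H.periodic hz hφ
    (hk φ hK)
  exact ⟨h1, by rw [h2, regOp_eq H (mul_cpow_ne_one H.abs.one_lt_q hz H.pos H.norm_le) hφ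
    (hk φ hK)]⟩

lemma regOp_mul_of_invariant {z : ℂ} {φ : GL2 D → V} {u : GL2 D}
    (hu : ∀ g, φ (g * u) = φ g) (g : GL2 D) :
    regOp q p ω n N μ σ z φ (g * u) = regOp q p ω n N μ σ z φ g := by
  have h1 : IsTailConst q N φ (g * u) = IsTailConst q N φ g := by
    funext k
    simp only [IsTailConst, ← mul_assoc, hu]
  simp only [regOp, h1, regInt, ← mul_assoc, hu]

/-- At a level whose ball contains y, translation by y preserves the ball. In the tail it becomes an
upper unipotent on the left, under which φ is invariant. -/
lemma regOp_lowerUnip_mul {z : ℂ} (hz : ω * (q : ℂ) ^ (-(p * z)) ≠ 1) {φ : GL2 D → V}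
    (hφ : φ ∈ ind n N σ z) (y : D) (g : GL2 D) :
    regOp q p ω n N μ σ z φ (lowerUnip y * g) = regOp q p ω n N μ σ z φ g := by
  obtain ⟨K, hK⟩ := hφ.1
  obtain ⟨k, hk⟩ := exists_isTailConst (V := V) H.abs K g
  obtain ⟨l, hl⟩ := exists_isTailConst (V := V) H.abs K (lowerUnip y * g)
  obtain ⟨i, hi⟩ : ∃ i : ℤ, N y < q ^ i := by
    by_cases hy : y = 0
    · exact ⟨0, by rw [hy, H.abs.map_zero]; exact zpow_pos H.abs.q_pos _⟩
    · obtain ⟨i, hi⟩ := H.abs.exists_zpow y hy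
      exact ⟨i + 1, by rw [hi]; exact zpow_lt_zpow_right₀ H.abs.one_lt_q (by omega)⟩
  set m := max i (max k l)
  have hy : N y < q ^ m := hi.trans_le (zpow_le_zpow_right₀ H.abs.one_lt_q.le (le_max_left _ _))
  rw [regOp_eq H hz hφ ((hk φ hK).mono H.abs (by omega : k ≤ m)),
    regOp_eq H hz hφ ((hl φ hK).mono H.abs (by omega : l ≤ m)), regInt, regInt]
  congr 1
  · have h1 := H.abs.setIntegral_add_left (fun x => φ (lowerUnip x * g)) y {x | N x < q ^ m}
    have h2 : (y + ·) ⁻¹' {x | N x < q ^ m} = {x | N x < q ^ m} := by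
      ext x
      simp only [Set.mem_preimage, Set.mem_ofPred_eq]
      refine ⟨fun hx => ?_, fun hx => (H.abs.add_le y x).trans_lt (max_lt hy hx)⟩
      have := (H.abs.sub_le (y + x) y).trans_lt (max_lt hx hy)
      rwa [add_sub_cancel_left] at this
    rw [← h1, h2]
    simp only [← mul_assoc, ← lowerUnip_add, add_comm y]
  · rw [← mul_assoc, weylNeg_mul_lowerUnip, mul_assoc,
      hφ.2 (upperUnip (-y)) 1 1 (-y) (by simp)]
    simp [H.abs.map_one, ← Prod.one_eq_mk]

/-- The substitution x ↦ b⁻¹xa turns the ball of level m into that of level m + (j - i), and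
`rep_mul_sphereOp` shifts the tail equally. As the value does not depend on the level, the two sides
match. -/
lemma regOp_diagGL_mul {z : ℂ} (hz : ω * (q : ℂ) ^ (-(p * z)) ≠ 1) {φ : GL2 D → V}
    (hφ : φ ∈ ind n N σ z) (a b : Dˣ) (g : GL2 D) :
    regOp q p ω n N μ σ z φ (diagGL a b * g) =
      ((N (b : D) / N (a : D) : ℝ) : ℂ) ^ ((-z + n) / 2) •
        σ (a, b) (regOp q p ω n N μ σ z φ g) := by
  obtain ⟨K, hK⟩ := hφ.1
  obtain ⟨k, hk⟩ := exists_isTailConst (V := V) H.abs K (diagGL a b * g)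
  obtain ⟨l, hl⟩ := exists_isTailConst (V := V) H.abs K g
  obtain ⟨i, hi⟩ := H.abs.exists_mem_sphere a
  obtain ⟨j, hj⟩ := H.abs.exists_mem_sphere b
  have hNa : N (a : D) = q ^ (-i) := hi
  have hNb : N (b : D) = q ^ (-j) := hj
  have hq0 := H.abs.q_pos
  have hq' : (q : ℂ) ≠ 0 := by exact_mod_cast hq0.ne'
  set m := max k (l - (j - i))
  rw [regOp_eq H hz hφ ((hk φ hK).mono H.abs (by omega : k ≤ m)),
    regOp_eq H hz hφ ((hl φ hK).mono H.abs (by omega : l ≤ m + (j - i))), regInt, regInt, map_add,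
    smul_add]
  have hab : N (b : D) / N (a : D) = q ^ (i - j) := by
    rw [hNa, hNb, ← zpow_sub₀ hq0.ne']; congr 1; ring
  have hba : N (a : D) / N (b : D) = q ^ (j - i) := by
    rw [hNa, hNb, ← zpow_sub₀ hq0.ne']; congr 1; ring
  rw [hab, ofReal_zpow_cpow hq0]
  congr 1
  · have h1 : ∀ x : D, φ (lowerUnip x * (diagGL a b * g)) =
        (q : ℂ) ^ (((j - i : ℤ) : ℂ) * ((z + n) / 2)) •
          σ (a, b) (φ (lowerUnip (((b⁻¹ : Dˣ) : D) * x * a) * g)) := by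
      intro x
      rw [← mul_assoc, lowerUnip_mul_diagGL, mul_assoc, hφ.2 (diagGL a b) a b 0 (by simp), hba,
        ofReal_zpow_cpow hq0]
    simp_rw [h1]
    have hcont := continuous_comp_lowerUnip H.abs hφ.1 g
    have hcont' : Continuous fun x : D => φ (lowerUnip (((b⁻¹ : Dˣ) : D) * x * a) * g) :=
      hcont.comp ((continuous_const.mul continuous_id).mul continuous_const)
    rw [integral_smul, ContinuousLinearMap.integral_comp_comm _
      (H.abs.integrableOn_lt_of_continuous hcont' m)]
    have hms : MeasurableSet {x : D | N x < q ^ (m + (j - i))} := (H.abs.isOpen_lt _).measurableSet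
    have h2 := H.abs.setIntegral_mul_unit (fun x => φ (lowerUnip x * g)) a hms
    have hms' : MeasurableSet ((fun x : D => x * (a : D)) ⁻¹' {x | N x < q ^ (m + (j - i))}) :=
      hms.preimage (measurable_mul_const _)
    have h3 := H.abs.setIntegral_unit_mul (fun x => φ (lowerUnip (x * a) * g)) b⁻¹ hms'
    have h4 : (fun x : D => ((b⁻¹ : Dˣ) : D) * x) ⁻¹' ((fun x : D => x * (a : D)) ⁻¹'
        {x | N x < q ^ (m + (j - i))}) = {x | N x < q ^ m} := by
      ext x
      simp only [Set.mem_preimage, Set.mem_ofPred_eq, H.abs.map_mul, H.abs.map_inv, hNa, hNb]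
      have : q ^ (m + (j - i)) = (q ^ (-j))⁻¹ * q ^ m * q ^ (-i) := by
        rw [← zpow_neg, ← zpow_add₀ hq0.ne', ← zpow_add₀ hq0.ne']; congr 1; ring
      rw [this, mul_lt_mul_iff_left₀ (zpow_pos hq0 _), mul_lt_mul_iff_right₀ (inv_pos.2 (zpow_pos hq0 _))]
    rw [h4, h2] at h3
    rw [h3, smul_smul, ← Complex.coe_smul, map_smul, smul_smul]
    congr 1
    have h5 : (N ((b⁻¹ : Dˣ) : D) ^ n)⁻¹ * (N (a : D) ^ n)⁻¹ = (q ^ (i - j)) ^ n := by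
      rw [H.abs.map_inv, inv_pow, inv_inv, ← inv_pow, ← mul_pow, ← hab, div_eq_mul_inv]
    have h6 : (((q ^ (i - j)) ^ n : ℝ) : ℂ) = (q : ℂ) ^ (((i - j : ℤ) : ℂ) * n) := by
      rw [← ofReal_zpow_cpow hq0, Complex.cpow_natCast]
      push_cast; rfl
    rw [h5, h6, ← Complex.cpow_add _ _ hq']
    congr 1
    push_cast
    ring
  · rw [← mul_assoc, weylNeg_mul_diagGL, mul_assoc, hφ.2 (diagGL b a) b a 0 (by simp), hab,
      ofReal_zpow_cpow hq0, map_smul]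
    have h1 : tailSum q p ω (sphereOp q N μ σ) m z * σ (b, a) =
        (q : ℂ) ^ (((j - i : ℤ) : ℂ) * z) •
          (σ (a, b) * tailSum q p ω (sphereOp q N μ σ) (m + (j - i)) z) := by
      have h2 := tailSum_shift (p := p) (ω := ω) (a := sphereOp q N μ σ) H.abs.one_lt_q m (j - i) z
      rw [← mul_smul_comm, ← h2, tailSum, tailSum, smul_mul_assoc, mul_smul_comm, Finset.sum_mul,
        Finset.mul_sum]
      congr 1
      refine Finset.sum_congr rfl fun r _ => ?_
      rw [smul_mul_assoc, mul_smul_comm, rep_mul_sphereOp H.abs H.rep hi hj, add_assoc _ (j - i),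
        show j - i + (i - j) = 0 by ring, add_zero]
    have h3 := congrArg (fun T : V →L[ℂ] V => T (φ (weylNeg D * g))) h1
    change tailSum q p ω (sphereOp q N μ σ) m z (σ (b, a) (φ (weylNeg D * g))) =
      (q : ℂ) ^ (((j - i : ℤ) : ℂ) * z) •
        σ (a, b) (tailSum q p ω (sphereOp q N μ σ) (m + (j - i)) z (φ (weylNeg D * g))) at h3
    rw [h3, smul_smul, ← Complex.cpow_add _ _ hq']
    congr 2
    push_cast
    ring

theorem regOp_mem_indBar {z : ℂ} (hz : ω * (q : ℂ) ^ (-(p * z)) ≠ 1) {φ : GL2 D → V}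
    (hφ : φ ∈ ind n N σ z) : regOp q p ω n N μ σ z φ ∈ indBar n N σ (-z) := by
  refine ⟨?_, fun P a b x hP g => ?_⟩
  · obtain ⟨K, hK⟩ := hφ.1
    exact ⟨K, fun g k hk => regOp_mul_of_invariant H (fun g => hK g k hk) g⟩
  · have h1 : P = diagGL a b * lowerUnip (((b⁻¹ : Dˣ) : D) * x) := by
      refine Units.ext ?_
      rw [hP]
      simp
    rw [h1, mul_assoc, regOp_diagGL_mul H hz hφ, regOp_lowerUnip_mul H hz hφ]

end RegOp

/-! ### Exchange of the two parabolic subgroups -/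

section Swap

variable {D : Type*} [DivisionRing D] [TopologicalSpace D] [IsTopologicalRing D]
  {n : ℕ} {N : D → ℝ}
  {V : Type*} [NormedAddCommGroup V] [NormedSpace ℂ V] {σ : Dˣ × Dˣ →* (V →L[ℂ] V)}

lemma weylSwap_conj_upper {p : GL2 D} {a b x : D}
    (hp : (p : Matrix (Fin 2) (Fin 2) D) = !![a, x; 0, b]) :
    ((weylSwap D * p * weylSwap D : GL2 D) : Matrix (Fin 2) (Fin 2) D) = !![b, 0; x, a] := by
  rw [Units.val_mul, Units.val_mul, hp]
  simp

lemma weylSwap_conj_lower {p : GL2 D} {a b x : D}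
    (hp : (p : Matrix (Fin 2) (Fin 2) D) = !![a, 0; x, b]) :
    ((weylSwap D * p * weylSwap D : GL2 D) : Matrix (Fin 2) (Fin 2) D) = !![b, x; 0, a] := by
  rw [Units.val_mul, Units.val_mul, hp]
  simp

lemma weylSwap_mul_cancel (g : GL2 D) : weylSwap D * (weylSwap D * g) = g := by
  rw [← mul_assoc, weylSwap_mul_self, one_mul]

/-- Conjugation by the permutation matrix exchanges P and P̄ and the two diagonal entries, so
everything about P̄ and σ is a statement about P and `swapRep σ`. -/
lemma comp_weylSwap_mem_ind {s : ℂ} {φ : GL2 D → V} :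
    (fun g => φ (weylSwap D * g)) ∈ ind n N (swapRep σ) s ↔ φ ∈ indBar n N σ s := by
  refine ⟨fun hφ => ⟨?_, fun p a b x hp g => ?_⟩, fun hφ => ⟨?_, fun p a b x hp g => ?_⟩⟩
  · obtain ⟨K, hK⟩ := hφ.1
    refine ⟨K, fun g k hk => ?_⟩
    have := hK (weylSwap D * g) k hk
    simpa only [← mul_assoc, weylSwap_mul_self, one_mul] using this
  · have := hφ.2 _ b a x (weylSwap_conj_lower hp) (weylSwap D * g)
    simpa only [mul_assoc, weylSwap_mul_cancel, swapRep_apply] using this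
  · obtain ⟨K, hK⟩ := hφ.1
    exact ⟨K, fun g k hk => by simp only [← mul_assoc]; exact hK _ k hk⟩
  · have := hφ.2 _ b a x (weylSwap_conj_upper hp) (weylSwap D * g)
    simpa only [mul_assoc, weylSwap_mul_cancel, swapRep_apply] using this

end Swap

/-! ### The composition of the two intertwining operators -/

section Defs

variable {D : Type*} [DivisionRing D]
  {V : Type*} [NormedAddCommGroup V] [NormedSpace ℂ V]

/-- The units with `N (w - 1) < q ^ (-L)`. -/
def congrBall (q : ℝ) (N : D → ℝ) (L : ℕ) : Set Dˣ :=
  {w | N ((w : D) - 1) < q ^ (-(L : ℤ))}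

variable [TopologicalSpace D] [MeasurableSpace D]

/-- The integral of `σ(w, w⁻¹)` over a congruence subgroup. -/
def ballOp (q : ℝ) (N : D → ℝ) (μ : Measure Dˣ) (σ : Dˣ × Dˣ →* (V →L[ℂ] V)) (L : ℕ) :
    V →L[ℂ] V :=
  ∫ w in congrBall q N L, tau σ w ∂μ

/-- The average of the conjugates of an operator by `σ(u, 1)` over a sphere. -/
def conjOp (q : ℝ) (N : D → ℝ) (μ : Measure Dˣ) (σ : Dˣ × Dˣ →* (V →L[ℂ] V)) (k : ℤ)
    (X : V →L[ℂ] V) : V →L[ℂ] V :=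
  ∫ u in sphere q N k, σ (u, 1) * X * σ (u⁻¹, 1) ∂μ

end Defs

section Composition

variable {D : Type*} [DivisionRing D] [TopologicalSpace D] [IsTopologicalRing D] [T2Space D]
  [ContinuousInv₀ D] [MeasurableSpace D] [BorelSpace D] [BorelSpace Dˣ]
  [SecondCountableTopology D] [SecondCountableTopology Dˣ]
  {q : ℝ} {n : ℕ} {N : D → ℝ} {μ : Measure Dˣ}
  {V : Type*} [NormedAddCommGroup V] [NormedSpace ℂ V] [CompleteSpace V]
  {σ : Dˣ × Dˣ →* (V →L[ℂ] V)} {p : ℕ} {ω : ℂ}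

section Ball

variable (h : IsNormalizedAbs q n N μ) (hσ : IsSmoothIsometric q N σ)

include h in
lemma congrBall_subset_sphere (L : ℕ) : congrBall q N L ⊆ sphere q N 0 := by
  intro w hw
  have h1 : N ((w : D) - 1) < 1 :=
    (show N ((w : D) - 1) < q ^ (-(L : ℤ)) from hw).trans_le
      (zpow_le_one_of_nonpos₀ h.one_lt_q.le (by omega))
  have h2 := h.add_eq_of_lt (x := 1) (e := (w : D) - 1) (by rwa [h.map_one])
  rw [add_sub_cancel, h.map_one] at h2
  simpa [sphere] using h2

include h in
lemma inv_mem_congrBall {L : ℕ} {w : Dˣ} (hw : w ∈ congrBall q N L) :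
    w⁻¹ ∈ congrBall q N L := by
  have h1 : N (w : D) = 1 := by simpa [sphere] using congrBall_subset_sphere h L hw
  have h2 : ((w⁻¹ : Dˣ) : D) - 1 = (w⁻¹ : Dˣ) * (1 - (w : D)) := by
    rw [mul_sub, mul_one, Units.inv_mul]
  change N _ < _
  rw [h2, h.map_mul, h.map_inv, h1, inv_one, one_mul, h.map_sub_comm]
  exact hw

include h in
lemma isOpen_congrBall (L : ℕ) : IsOpen (congrBall q N L) :=
  (h.isOpen_lt (-(L : ℤ))).preimage (Units.continuous_val.sub continuous_const)

include h in
lemma measurableSet_congrBall (L : ℕ) : MeasurableSet (congrBall q N L) :=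
  (isOpen_congrBall h L).measurableSet

include h hσ in
lemma integrableOn_ball {E : Type*} [NormedAddCommGroup E] {f : Dˣ → E} (hf : Continuous f)
    (L : ℕ) : IntegrableOn f (congrBall q N L) μ := by
  have := h.isFiniteMeasureOnCompacts_units
  exact (hf.continuousOn.integrableOn_compact (h.isCompact_sphere 0)).mono_set
    (congrBall_subset_sphere h L)

include h hσ in
lemma ballOp_apply (L : ℕ) (v : V) :
    ballOp q N μ σ L v = ∫ w in congrBall q N L, tau σ w⁻¹ v ∂μ := by
  rw [ballOp, ContinuousLinearMap.integral_apply (integrableOn_ball h hσ (continuous_tau h hσ) L),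
    ← h.setIntegral_inv]
  congr 2
  ext w
  exact ⟨fun hw => by simpa using inv_mem_congrBall h hw, fun hw => inv_mem_congrBall h hw⟩

include h hσ in
lemma continuous_conj (X : V →L[ℂ] V) : Continuous fun u => σ (u, 1) * X * σ (u⁻¹, 1) := by
  have h1 := continuous_rep h hσ
  exact ((h1.comp (continuous_id.prodMk continuous_const)).mul continuous_const).mul
    (h1.comp (continuous_inv.prodMk continuous_const))

include h hσ in
lemma conjOp_apply (k : ℤ) (X : V →L[ℂ] V) (v : V) :
    conjOp q N μ σ k X v = ∫ u in sphere q N k, σ (u, 1) (X (σ (u⁻¹, 1) v)) ∂μ := by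
  rw [conjOp, ContinuousLinearMap.integral_apply
    (h.integrableOn_of_continuous (continuous_conj h hσ X) le_rfl)]
  rfl

lemma weylSwap_weylNeg (g : GL2 D) :
    weylSwap D * (weylNeg D * (weylSwap D * g)) = diagGL (-1) (-1) * (weylNeg D * g) := by
  rw [← mul_assoc, ← mul_assoc, ← mul_assoc]
  congr 1
  exact Units.ext (by simp)

lemma weylNeg_weylNeg (g : GL2 D) :
    weylNeg D * (weylNeg D * g) = diagGL (-1) (-1) * g := by
  rw [← mul_assoc]
  congr 1
  exact Units.ext (by simp)

lemma lowerUnip_mul_weylNeg (x : D) (g : GL2 D) :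
    lowerUnip x * (weylNeg D * g) = weylNeg D * upperUnip (-x) * g := by
  rw [← mul_assoc]
  congr 1
  exact Units.ext (by simp)

include h in
lemma ind_diagGL_neg_one {s : ℂ} {φ : GL2 D → V} (hφ : φ ∈ ind n N σ s) (g : GL2 D) :
    φ (diagGL (-1) (-1) * g) = σ (-1, -1) (φ g) := by
  rw [hφ.2 (diagGL (-1) (-1)) (-1) (-1) 0 (by simp), div_self (h.units_pos _).ne']
  simp

include h in
/-- The values on the big cell near infinity. -/
lemma ind_weylNeg_upperUnip {s : ℂ} {φ : GL2 D → V} (hφ : φ ∈ ind n N σ s) {g : GL2 D}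
    {t : Dˣ} {i : ℤ} (ht : t ∈ sphere q N (-i))
    (hg : φ (lowerUnip ((t⁻¹ : Dˣ) : D) * g) = φ g) :
    φ (weylNeg D * upperUnip (t : D) * g) = (q : ℂ) ^ (-(i * (s + n))) • tau σ t⁻¹ (φ g) := by
  have h1 := ind_lowerUnip h hφ (h.inv_mem_sphere ht) g
  rw [hg, inv_inv, neg_neg] at h1
  have hq' : (q : ℂ) ≠ 0 := by exact_mod_cast h.q_pos.ne'
  rw [h1, map_smul, smul_smul, ← Complex.cpow_add _ _ hq', neg_add_cancel, Complex.cpow_zero,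
    one_smul]
  simp only [tau]
  rw [rep_mul_apply]
  simp [← Prod.one_eq_mk]

end Ball

variable (H : RegHyp q p ω n N μ σ)
include H

/-- The intertwining integral as an integral over the unit group. -/
lemma regOp_upperUnip {z : ℂ} (hz : 0 < z.re) {φ : GL2 D → V} (hφ : φ ∈ ind n N σ z)
    (x : D) (g : GL2 D) :
    Integrable (fun u : Dˣ => ((N (u : D) : ℝ) : ℂ) ^ z •
      tau σ u (φ (weylNeg D * upperUnip ((u : D) + x) * g))) μ ∧
    regOp q p ω n N μ σ z φ (upperUnip x * g) = ∫ u : Dˣ, ((N (u : D) : ℝ) : ℂ) ^ z •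
      tau σ u (φ (weylNeg D * upperUnip ((u : D) + x) * g)) ∂μ := by
  obtain ⟨h1, h2⟩ := regOp_eq_integral H hz hφ (upperUnip x * g)
  have hq' : (q : ℂ) ≠ 0 := by exact_mod_cast H.abs.q_pos.ne'
  have h3 : ∀ u : Dˣ, N ((u⁻¹ : Dˣ) : D) ^ n •
      φ (lowerUnip ((u⁻¹ : Dˣ) : D) * (upperUnip x * g)) = ((N (u : D) : ℝ) : ℂ) ^ z •
      tau σ u (φ (weylNeg D * upperUnip ((u : D) + x) * g)) := by
    intro u
    obtain ⟨j, hj⟩ := H.abs.exists_mem_sphere u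
    have hN : N (u : D) = q ^ (-j) := hj
    rw [ind_lowerUnip H.abs hφ (H.abs.inv_mem_sphere hj), inv_inv, H.abs.map_inv, hN,
      ofReal_zpow_cpow H.abs.q_pos, upperUnip_add, ← Complex.coe_smul, smul_smul, ← zpow_neg,
      neg_neg]
    have h6 : (((q ^ j) ^ n : ℝ) : ℂ) = (q : ℂ) ^ ((j : ℂ) * n) := by
      rw [← ofReal_zpow_cpow H.abs.q_pos, Complex.cpow_natCast]
      push_cast; rfl
    rw [h6, ← Complex.cpow_add _ _ hq']
    congr 2
    · push_cast; ring
    · simp only [mul_assoc]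
  have := H.abs.invInvariant
  rw [H.abs.integrable_unitsAddMeasure] at h1
  refine ⟨?_, ?_⟩
  · simp_rw [← h3]
    exact h1.comp_inv
  · rw [h2, H.abs.integral_unitsAddMeasure]
    simp_rw [← h3]
    exact (integral_inv_eq_self (fun u : Dˣ => N (u : D) ^ n •
      φ (lowerUnip (u : D) * (upperUnip x * g))) μ).symm

/-- The contribution of a point far from the origin. -/
lemma shell_value {z : ℂ} {φ : GL2 D → V} (hφ : φ ∈ ind n N σ z)
    {g : GL2 D} {k : ℤ} (hk : ∀ e, N e ≤ q ^ (-k) → φ (lowerUnip e * g) = φ g)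
    {u : Dˣ} {L : ℕ} (hu : u ∈ sphere q N (-k - L)) :
    ((N (u : D) : ℝ) : ℂ) ^ z • tau σ u (∫ x in {x | N x < q ^ k},
      φ (weylNeg D * upperUnip ((u : D) + x) * g) ∂(unitsAddMeasure n N μ)) =
    σ (u, 1) (ballOp q N μ σ L (σ (u⁻¹, 1) (φ g))) := by
  have hq0 := H.abs.q_pos
  have hq' : (q : ℂ) ≠ 0 := by exact_mod_cast hq0.ne'
  have hN : N (u : D) = q ^ (k + L) := by rw [show k + L = -(-k - L) by ring]; exact hu
  have hms : MeasurableSet {x : D | N x < q ^ k} := (H.abs.isOpen_lt _).measurableSet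
  -- Put x = u(t - 1). Then u + x = ut, and since |u| = q^(k+L) the condition |x| < q^k becomes t ∈
  -- `congrBall q N L`.
  have h1 := H.abs.setIntegral_unit_mul
    (fun x => φ (weylNeg D * upperUnip ((u : D) + x) * g)) u hms
  have h2 := H.abs.setIntegral_add_left
    (fun x => φ (weylNeg D * upperUnip ((u : D) + u * x) * g)) (-1)
    ((fun x : D => (u : D) * x) ⁻¹' {x | N x < q ^ k})
  have hms' : MeasurableSet ((-1 + ·) ⁻¹' ((fun x : D => (u : D) * x) ⁻¹' {x | N x < q ^ k})) :=
    (hms.preimage (measurable_const_mul _)).preimage (measurable_const_add _)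
  have h3 : Units.val ⁻¹' ((-1 + ·) ⁻¹' ((fun x : D => (u : D) * x) ⁻¹' {x | N x < q ^ k})) =
      congrBall q N L := by
    ext t
    simp only [Set.mem_preimage, Set.mem_ofPred_eq, congrBall, H.abs.map_mul, hN]
    rw [show (q : ℝ) ^ k = q ^ (k + L) * q ^ (-(L : ℤ)) by
      rw [← zpow_add₀ hq0.ne']; congr 1; ring, mul_lt_mul_iff_right₀ (zpow_pos hq0 _),
      neg_add_eq_sub]
  rw [H.abs.setIntegral_unitsAddMeasure _ hms', h3] at h2
  have h4 : ∀ t ∈ congrBall q N L, N (t : D) ^ n •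
      φ (weylNeg D * upperUnip ((u : D) + u * (-1 + t)) * g) =
      (q : ℂ) ^ (-(((k + L : ℤ) : ℂ) * (z + n))) • tau σ (u * t)⁻¹ (φ g) := by
    intro t ht
    have ht1 : N (t : D) = 1 := by simpa [sphere] using congrBall_subset_sphere H.abs L ht
    have h5 : (u : D) + u * (-1 + t) = ((u * t : Dˣ) : D) := by
      rw [Units.val_mul, mul_add, mul_neg_one, add_neg_cancel_left]
    have h6 : u * t ∈ sphere q N (-(k + L : ℤ)) := by
      change N _ = _
      rw [Units.val_mul, H.abs.map_mul, hN, ht1, mul_one, neg_neg]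
    rw [ht1, one_pow, one_smul, h5, ind_weylNeg_upperUnip H.abs hφ h6]
    refine hk _ ?_
    rw [H.abs.map_inv, show N ((u * t : Dˣ) : D) = _ from h6, neg_neg, ← zpow_neg]
    exact zpow_le_zpow_right₀ H.abs.one_lt_q.le (by omega)
  rw [setIntegral_congr_fun (measurableSet_congrBall H.abs L) h4, integral_smul] at h2
  have h7 : ∫ x in {x | N x < q ^ k}, φ (weylNeg D * upperUnip ((u : D) + x) * g)
      ∂(unitsAddMeasure n N μ) = (N (u : D) ^ n) •
      (q : ℂ) ^ (-(((k + L : ℤ) : ℂ) * (z + n))) •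
        ∫ t in congrBall q N L, tau σ (u * t)⁻¹ (φ g) ∂μ := by
    rw [h2, h1, smul_smul, mul_inv_cancel₀ (pow_ne_zero _ (H.abs.units_pos u).ne'), one_smul]
  have hcont : Continuous fun t : Dˣ => tau σ (u * t)⁻¹ (φ g) :=
    ((continuous_tau H.abs H.rep).comp (continuous_const.mul continuous_id).inv).clm_apply
      continuous_const
  have hcont2 : Continuous fun t : Dˣ => tau σ t⁻¹ (σ (u⁻¹, 1) (φ g)) :=
    ((continuous_tau H.abs H.rep).comp continuous_inv).clm_apply continuous_const
  rw [h7, ballOp_apply H.abs H.rep, ← ContinuousLinearMap.integral_comp_comm _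
    (integrableOn_ball H.abs H.rep hcont2 L), ← Complex.coe_smul, map_smul, map_smul,
    ← ContinuousLinearMap.integral_comp_comm _ (integrableOn_ball H.abs H.rep hcont L),
    smul_smul, smul_smul, hN, ofReal_zpow_cpow hq0]
  have h6 : (((q ^ (k + L)) ^ n : ℝ) : ℂ) = (q : ℂ) ^ (((k + L : ℤ) : ℂ) * n) := by
    rw [← ofReal_zpow_cpow hq0, Complex.cpow_natCast]
    push_cast; rfl
  rw [h6, ← Complex.cpow_add _ _ hq', ← Complex.cpow_add _ _ hq']
  have h8 : ((k + L : ℤ) : ℂ) * z + ((k + L : ℤ) : ℂ) * n + -(((k + L : ℤ) : ℂ) * (z + n)) = 0 := by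
    ring
  rw [h8, Complex.cpow_zero, one_smul]
  refine setIntegral_congr_fun (measurableSet_congrBall H.abs L) fun t _ => ?_
  simp only [tau]
  rw [rep_mul_apply, rep_mul_apply, rep_mul_apply]
  simp [mul_assoc]

/-- The composition of the two intertwining integrals in the half-plane of convergence. -/
theorem hasSum_composition (K : OpenSubgroup (GL2 D)) (g : GL2 D) :
    ∃ k₀ : ℤ, ∀ k ≥ k₀, ∀ (z : ℂ) (φ : GL2 D → V), 0 < z.re → φ ∈ ind n N σ z →
      (∀ g, ∀ k ∈ K, φ (g * k) = φ g) →
      (tailSum q p ω (sphereOp q N μ (swapRep σ)) k (-z) =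
        -tailSum q p ω (sphereOp q N μ σ) (1 - k) z) →
      HasSum (fun L : ℕ => conjOp q N μ σ (-k - L) (ballOp q N μ σ L) (φ g))
        (regInt q p ω n N μ (swapRep σ) k (-z)
          (fun g => regOp q p ω n N μ σ z φ (weylSwap D * g)) (weylSwap D * g) +
          tailSum q p ω (sphereOp q N μ σ) (1 - k) z
            (tailSum q p ω (sphereOp q N μ σ) k z (φ g))) := by
  obtain ⟨j, hj⟩ := H.abs.exists_upperUnip_mem K g
  obtain ⟨j₂, hj₂⟩ := H.abs.exists_lowerUnip_mem K g
  obtain ⟨k₃, hk₃⟩ := exists_isTailConst (V := V) H.abs K (weylNeg D * g)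
  refine ⟨max (-j₂) k₃, fun k hk z φ hz hφ hK hrefl => ?_⟩
  have hreg := mul_cpow_ne_one H.abs.one_lt_q hz H.pos H.norm_le
  have hq0 := H.abs.q_pos
  have hlow : ∀ e, N e ≤ q ^ (-k) → φ (lowerUnip e * g) = φ g := by
    intro e he
    rw [← hK g _ (hj₂ e (he.trans (zpow_le_zpow_right₀ H.abs.one_lt_q.le (by omega))))]
    congr 1
    group
  set G : D → V := fun t => φ (weylNeg D * upperUnip t * g) with hG
  have hGlevel : ∀ t e, N e ≤ q ^ j → G (t + e) = G t := by
    intro t e he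
    simp only [hG]
    rw [← hK (weylNeg D * upperUnip t * g) _ (hj e he), upperUnip_add]
    congr 1
    group
  have hMlevel : ∀ x e, N e ≤ q ^ j → regOp q p ω n N μ σ z φ (upperUnip (x + e) * g) =
      regOp q p ω n N μ σ z φ (upperUnip x * g) := by
    intro x e he
    rw [← regOp_mul_of_invariant H (fun g => hK g _ (hj e he)) (upperUnip x * g), upperUnip_add]
    congr 1
    group
  -- By smoothness the integral over the ball is a finite sum whose nodes and weights do not depend
  -- on u. This exchanges the two integrations.
  obtain ⟨s, c, hsc⟩ := H.abs.exists_setIntegral_eq_sum (E := V) k j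
  set F : Dˣ → V := fun u => ((N (u : D) : ℝ) : ℂ) ^ z •
    tau σ u (∫ x in {x | N x < q ^ k}, G ((u : D) + x) ∂(unitsAddMeasure n N μ)) with hF
  have hFsum : ∀ u, F u = ∑ y ∈ s, c y • (((N (u : D) : ℝ) : ℂ) ^ z • tau σ u (G (u + y))) := by
    intro u
    simp only [hF]
    rw [hsc (fun x => G (u + x)) (fun x e he => by rw [← add_assoc]; exact hGlevel _ _ he), map_sum,
      Finset.smul_sum]
    refine Finset.sum_congr rfl fun y _ => ?_
    rw [← Complex.coe_smul, map_smul, smul_comm, Complex.coe_smul]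
  have hyint : ∀ y, Integrable (fun u : Dˣ => c y • (((N (u : D) : ℝ) : ℂ) ^ z •
      tau σ u (G (u + y)))) μ := fun y => (regOp_upperUnip H hz hφ y g).1.smul (c y)
  have hFint : Integrable F μ := by
    rw [show F = fun u : Dˣ => ∑ y ∈ s, c y • (((N (u : D) : ℝ) : ℂ) ^ z • tau σ u (G (u + y))) from
      funext hFsum]
    exact integrable_finsetSum _ fun y _ => hyint y
  have hball : ∫ x in {x | N x < q ^ k}, regOp q p ω n N μ σ z φ (upperUnip x * g)
      ∂(unitsAddMeasure n N μ) = ∫ u, F u ∂μ := by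
    rw [hsc _ hMlevel, integral_congr_ae (Filter.Eventually.of_forall hFsum),
      integral_finsetSum _ fun y _ => hyint y]
    refine Finset.sum_congr rfl fun y _ => ?_
    rw [integral_smul, (regOp_upperUnip H hz hφ y g).2]
  set g₀ := ∫ x in {x | N x < q ^ k}, G x ∂(unitsAddMeasure n N μ) with hg₀
  have hms : MeasurableSet {x : D | N x < q ^ k} := (H.abs.isOpen_lt _).measurableSet
  have hmsu : MeasurableSet (Units.val ⁻¹' {x : D | N x < q ^ k}) :=
    hms.preimage Units.continuous_val.measurable
  have hU1 : Units.val ⁻¹' {x : D | N x < q ^ k} = ⋃ i : ℕ, sphere q N (1 - k + i : ℤ) := by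
    ext w
    simp only [Set.mem_preimage, Set.mem_ofPred_eq, Set.mem_iUnion, H.abs.lt_zpow_iff]
    constructor
    · intro hw
      obtain ⟨i, hi⟩ := H.abs.exists_mem_sphere w
      rw [show N (w : D) = _ from hi, zpow_le_zpow_iff_right₀ H.abs.one_lt_q] at hw
      refine ⟨(i - (1 - k)).toNat, ?_⟩
      rwa [Int.toNat_of_nonneg (by omega), add_sub_cancel]
    · rintro ⟨i, hi⟩
      rw [show N (w : D) = _ from hi]
      exact zpow_le_zpow_right₀ H.abs.one_lt_q.le (by omega)
  have hU2 : (Units.val ⁻¹' {x : D | N x < q ^ k})ᶜ = ⋃ L : ℕ, sphere q N (-k - L : ℤ) := by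
    ext w
    simp only [Set.mem_compl_iff, Set.mem_preimage, Set.mem_ofPred_eq, Set.mem_iUnion, not_lt]
    constructor
    · intro hw
      obtain ⟨i, hi⟩ := H.abs.exists_mem_sphere w
      rw [show N (w : D) = _ from hi, zpow_le_zpow_iff_right₀ H.abs.one_lt_q] at hw
      refine ⟨(-k - i).toNat, ?_⟩
      rwa [Int.toNat_of_nonneg (by omega), sub_sub_cancel]
    · rintro ⟨i, hi⟩
      rw [show N (w : D) = _ from hi]
      exact zpow_le_zpow_right₀ H.abs.one_lt_q.le (by omega)
  -- For |u| < q^k translation by u preserves the ball, so the inner integral is g₀ on each such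
  -- shell; these shells have valuation at least 1 - k.
  have hball1 : ∫ u in Units.val ⁻¹' {x : D | N x < q ^ k}, F u ∂μ =
      tailSum q p ω (sphereOp q N μ σ) (1 - k) z g₀ := by
    have h1 : ∀ i : ℕ, ∫ u in sphere q N (1 - k + i : ℤ), F u ∂μ =
        (q : ℂ) ^ (-((1 - k + i : ℤ) * z)) • sphereOp q N μ σ (1 - k + i) g₀ := by
      intro i
      rw [sphereOp_apply H.abs H.rep, ← integral_smul]
      refine setIntegral_congr_fun (H.abs.measurableSet_sphere _) fun u hu => ?_
      have hN : N (u : D) = _ := hu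
      have hu' : u ∈ Units.val ⁻¹' {x : D | N x < q ^ k} := by
        rw [hU1]; exact Set.mem_iUnion.2 ⟨i, hu⟩
      have hu'' : N (u : D) < q ^ k := hu'
      have h2 := H.abs.setIntegral_add_left G u {x | N x < q ^ k}
      have h3 : ((u : D) + ·) ⁻¹' {x | N x < q ^ k} = {x | N x < q ^ k} := by
        ext x
        simp only [Set.mem_preimage, Set.mem_ofPred_eq]
        refine ⟨fun hx => ?_, fun hx => (H.abs.add_le u x).trans_lt (max_lt hu'' hx)⟩
        have := (H.abs.sub_le (u + x) u).trans_lt (max_lt hx hu'')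
        rwa [add_sub_cancel_left] at this
      rw [h3] at h2
      simp only [hF]
      rw [h2, hN, ofReal_zpow_cpow hq0]
      congr 2
      push_cast
      ring
    rw [hU1]
    have h4 := hasSum_integral_iUnion (fun i : ℕ => H.abs.measurableSet_sphere (1 - k + i : ℤ))
      (fun i j hij => Set.disjoint_left.2 fun w hi hj => hij (by
        have := H.abs.sphere_index_inj hi hj; omega)) hFint.integrableOn
    have h5 := (ContinuousLinearMap.apply ℂ V g₀).hasSum
      (hasSum_tailSum H.abs.one_lt_q H.pos H.norm_le H.periodic hz (1 - k))
    refine h4.unique (h5.congr_fun fun i => ?_)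
    rw [h1]
    rfl
  -- The remaining shells are |u| = q^(k+L) with L ≥ 0, evaluated by `shell_value`.
  have hball2 : HasSum (fun L : ℕ => conjOp q N μ σ (-k - L) (ballOp q N μ σ L) (φ g))
      (∫ u in (Units.val ⁻¹' {x : D | N x < q ^ k})ᶜ, F u ∂μ) := by
    rw [hU2]
    refine (hasSum_integral_iUnion (fun L : ℕ => H.abs.measurableSet_sphere (-k - L : ℤ))
      (fun i j hij => Set.disjoint_left.2 fun w hi hj => hij (by
        have := H.abs.sphere_index_inj hi hj; omega)) hFint.integrableOn).congr_fun fun L => ?_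
    rw [conjOp_apply H.abs H.rep]
    exact setIntegral_congr_fun (H.abs.measurableSet_sphere _) fun u hu =>
      (shell_value H hφ hlow hu).symm
  -- This is the vector to which the tail of the second operator is applied. Its ball part is again
  -- g₀, after x ↦ -x.
  have hweyl : regOp q p ω n N μ σ z φ (weylSwap D * (weylNeg D * (weylSwap D * g))) =
      σ (-1, -1) (g₀ + tailSum q p ω (sphereOp q N μ σ) k z (φ g)) := by
    rw [weylSwap_weylNeg, regOp_diagGL_mul H hreg hφ, div_self (H.abs.units_pos _).ne',
      regOp_eq H hreg hφ ((hk₃ φ hK).mono H.abs (by omega : k₃ ≤ k)), regInt]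
    rw [Complex.ofReal_one, Complex.one_cpow, one_smul]
    congr 2
    · have h1 := H.abs.setIntegral_unit_mul G (-1) hms
      have h2 : (fun x : D => ((-1 : Dˣ) : D) * x) ⁻¹' {x | N x < q ^ k} = {x | N x < q ^ k} := by
        ext x; simp [H.abs.map_neg]
      rw [h2] at h1
      simp only [Units.val_neg, Units.val_one, H.abs.map_neg, H.abs.map_one, one_pow, inv_one,
        one_smul, neg_mul, one_mul] at h1
      rw [hg₀, ← h1]
      simp only [hG, lowerUnip_mul_weylNeg]
    · rw [weylNeg_weylNeg, ind_diagGL_neg_one H.abs hφ]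
      have h1 : tailSum q p ω (sphereOp q N μ σ) k z * σ (-1, -1) =
          tailSum q p ω (sphereOp q N μ σ) k z := by
        rw [tailSum, smul_mul_assoc, Finset.sum_mul]
        simp only [smul_mul_assoc, sphereOp_mul_neg_one H.abs H.rep]
      exact congrArg (fun T : V →L[ℂ] V => T (φ g)) h1
  have htail : tailSum q p ω (sphereOp q N μ σ) (1 - k) z * σ (-1, -1) =
      tailSum q p ω (sphereOp q N μ σ) (1 - k) z := by
    rw [tailSum, smul_mul_assoc, Finset.sum_mul]
    simp only [smul_mul_assoc, sphereOp_mul_neg_one H.abs H.rep]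
  have htail' : ∀ v, tailSum q p ω (sphereOp q N μ σ) (1 - k) z (σ (-1, -1) v) =
      tailSum q p ω (sphereOp q N μ σ) (1 - k) z v := fun v =>
    congrArg (fun T : V →L[ℂ] V => T v) htail
  convert hball2 using 1
  have h9 : ∀ x : D, weylSwap D * (lowerUnip x * (weylSwap D * g)) = upperUnip x * g := by
    intro x
    rw [← mul_assoc, weylSwap_mul_lowerUnip, mul_assoc, weylSwap_mul_cancel]
  rw [regInt, hrefl]
  simp only [h9]
  -- The tail applied to g₀ occurs with both signs and cancels; only the product of two tails and
  -- the far shells remain.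
  rw [hweyl, hball, ← integral_add_compl hmsu hFint, hball1, neg_apply, htail',
    map_add]
  abel

end Composition

/-! ### The scalar by which the composition acts, in the half-plane of convergence -/

section Scalar

variable {D : Type*} [DivisionRing D] [TopologicalSpace D] [IsTopologicalRing D] [T2Space D]
  [ContinuousInv₀ D] [MeasurableSpace D] [BorelSpace D] [BorelSpace Dˣ]
  [SecondCountableTopology D] [SecondCountableTopology Dˣ]
  {q : ℝ} {n : ℕ} {N : D → ℝ} {μ : Measure Dˣ}
  {V : Type*} [NormedAddCommGroup V] [NormedSpace ℂ V] [CompleteSpace V]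
  {σ : Dˣ × Dˣ →* (V →L[ℂ] V)} {p : ℕ} {ω : ℂ}

/-- Write σ(u, u⁻¹) = σ(u, 1)σ(1, u⁻¹). Moving σ(1, u⁻¹) through the second operator turns it into
σ(u⁻¹, 1) and shifts the sphere by i. -/
lemma sphereOp_mul_sphereOp (h : IsNormalizedAbs q n N μ) (hσ : IsSmoothIsometric q N σ)
    (i j : ℤ) : sphereOp q N μ σ i * sphereOp q N μ σ j =
      conjOp q N μ σ i (sphereOp q N μ σ (i + j)) := by
  ext v
  rw [conjOp_apply h hσ]
  change sphereOp q N μ σ i (sphereOp q N μ σ j v) = _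
  rw [sphereOp_apply h hσ]
  refine setIntegral_congr_fun (h.measurableSet_sphere _) fun u hu => ?_
  have h1 := rep_mul_sphereOp h hσ h.one_mem_sphere (h.inv_mem_sphere hu) j
  have h2 := congrArg (fun T : V →L[ℂ] V => σ (u, 1) (T v)) h1
  change σ (u, 1) (σ (1, u⁻¹) (sphereOp q N μ σ j v)) =
    σ (u, 1) (sphereOp q N μ σ (j + (0 - -i)) (σ (u⁻¹, 1) v)) at h2
  rw [rep_mul_apply, mul_one, one_mul, show j + (0 - -i) = i + j by ring] at h2
  exact h2

/-- The averages over `n` consecutive spheres of the conjugates of the operators `sphereOp` and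
`ballOp` are scalar. -/
structure HasAverages (q : ℝ) (n : ℕ) (N : D → ℝ) (μ : Measure Dˣ)
    (σ : Dˣ × Dˣ →* (V →L[ℂ] V)) (a b : ℕ → ℂ) : Prop where
  sphere : ∀ (k : ℤ) (m : ℕ), ∑ i ∈ Finset.range n, conjOp q N μ σ (k + i) (sphereOp q N μ σ m) =
    ((n : ℂ) * a m) • (1 : V →L[ℂ] V)
  ball : ∀ (k : ℤ) (L : ℕ), ∑ i ∈ Finset.range n, conjOp q N μ σ (k + i) (ballOp q N μ σ L) =
    ((n : ℂ) * b L) • (1 : V →L[ℂ] V)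

variable {a b : ℕ → ℂ}

lemma HasAverages.ball_neg (hav : HasAverages q n N μ σ a b) (k : ℤ) (L : ℕ) :
    ∑ i ∈ Finset.range n, conjOp q N μ σ (-(k + i) - L) (ballOp q N μ σ L) =
      ((n : ℂ) * b L) • (1 : V →L[ℂ] V) := by
  rw [← hav.ball (-(k + n - 1) - L) L, ← Finset.sum_range_reflect]
  refine Finset.sum_congr rfl fun i hi => ?_
  have := Finset.mem_range.1 hi
  congr 1
  omega

variable (H : RegHyp q p ω n N μ σ)
include H

/-- A Cauchy product. The tails start at 1 - k and k, so total degree M + 1 occurs M + 1 times; this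
multiplicity becomes the factor m in the final series. -/
lemma hasSum_tail_mul_tail {z : ℂ} (hz : 0 < z.re) (k : ℤ) :
    HasSum (fun M : ℕ => (q : ℂ) ^ (-((M + 1 : ℂ) * z)) •
      ∑ i ∈ Finset.range (M + 1), conjOp q N μ σ (1 - k + i) (sphereOp q N μ σ (M + 1 : ℕ)))
      (tailSum q p ω (sphereOp q N μ σ) (1 - k) z * tailSum q p ω (sphereOp q N μ σ) k z) := by
  have hq' : (q : ℂ) ≠ 0 := by exact_mod_cast H.abs.q_pos.ne'
  have s1 := summable_norm_tail (a := sphereOp q N μ σ) H.abs.one_lt_q H.pos H.norm_le H.periodic hz (1 - k)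
  have s2 := summable_norm_tail (a := sphereOp q N μ σ) H.abs.one_lt_q H.pos H.norm_le H.periodic hz k
  have h1 := hasSum_tailSum (a := sphereOp q N μ σ) H.abs.one_lt_q H.pos H.norm_le H.periodic hz (1 - k)
  have h2 := hasSum_tailSum (a := sphereOp q N μ σ) H.abs.one_lt_q H.pos H.norm_le H.periodic hz k
  have h3 := tsum_mul_tsum_eq_tsum_sum_antidiagonal_of_summable_norm s1 s2
  have h4 := (summable_norm_sum_mul_antidiagonal_of_summable_norm s1 s2).of_norm.hasSum
  rw [← h3, h1.tsum_eq, h2.tsum_eq] at h4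
  refine h4.congr_fun fun M => ?_
  rw [Finset.Nat.sum_antidiagonal_eq_sum_range_succ_mk, Finset.smul_sum]
  refine Finset.sum_congr rfl fun i hi => ?_
  have hi := Finset.mem_range.1 hi
  have h5 : ((M - i : ℕ) : ℤ) = M - i := by omega
  rw [smul_mul_smul_comm, sphereOp_mul_sphereOp H.abs H.rep, ← Complex.cpow_add _ _ hq', h5]
  congr 2
  · push_cast; ring
  · congr 1; push_cast; ring

lemma hasSum_average_tail_mul_tail (hav : HasAverages q n N μ σ a b) {z : ℂ} (hz : 0 < z.re)
    (k : ℤ) :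
    HasSum (fun M : ℕ => ((n : ℂ) * ((M + 1) * (q : ℂ) ^ (-((M + 1 : ℂ) * z)) * a (M + 1))) •
        (1 : V →L[ℂ] V))
      (∑ r ∈ Finset.range n, tailSum q p ω (sphereOp q N μ σ) (1 - (k + r)) z *
        tailSum q p ω (sphereOp q N μ σ) (k + r) z) := by
  refine (hasSum_sum (s := Finset.range n)
    fun r _ => hasSum_tail_mul_tail H hz (k + (r : ℤ))).congr_fun fun M => ?_
  rw [← Finset.smul_sum, Finset.sum_comm]
  have h1 : ∀ i ∈ Finset.range (M + 1), ∑ r ∈ Finset.range n,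
      conjOp q N μ σ (1 - (k + r) + i) (sphereOp q N μ σ (M + 1 : ℕ)) =
      ((n : ℂ) * a (M + 1)) • (1 : V →L[ℂ] V) := by
    intro i _
    rw [← hav.sphere (1 - (k + (n - 1)) + i), ← Finset.sum_range_reflect]
    refine Finset.sum_congr rfl fun r hr => ?_
    have := Finset.mem_range.1 hr
    congr 1
    omega
  rw [Finset.sum_congr rfl h1, Finset.sum_const, Finset.card_range, ← Nat.cast_smul_eq_nsmul ℂ,
    smul_smul, smul_smul]
  congr 1
  push_cast
  ring

/-- The left side does not depend on the truncation level k. Summing `hasSum_composition` over n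
consecutive levels turns the far shells and the product of tails into the scalars nB and nS, and the
factor n is cancelled. -/
theorem regInt_composition (hav : HasAverages q n N μ σ a b)
    (H' : RegHyp q p ω n N μ (swapRep σ)) {B : ℂ} (hB : HasSum b B)
    (K : OpenSubgroup (GL2 D)) (g : GL2 D) :
    ∃ k₀ : ℤ, ∀ k ≥ k₀, ∀ (z : ℂ) (φ : GL2 D → V) (S : ℂ), 0 < z.re → φ ∈ ind n N σ z →
      (∀ g, ∀ k ∈ K, φ (g * k) = φ g) →
      (∀ k, tailSum q p ω (sphereOp q N μ (swapRep σ)) k (-z) =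
        -tailSum q p ω (sphereOp q N μ σ) (1 - k) z) →
      ω * (q : ℂ) ^ (-(p * -z)) ≠ 1 →
      HasSum (fun M : ℕ => (M + 1) * (q : ℂ) ^ (-((M + 1 : ℂ) * z)) * a (M + 1)) S →
      regInt q p ω n N μ (swapRep σ) k (-z)
          (fun g => regOp q p ω n N μ σ z φ (weylSwap D * g)) (weylSwap D * g) =
        (B - S) • φ g := by
  obtain ⟨k₀, hk₀⟩ := hasSum_composition H K g
  obtain ⟨k₁, hk₁⟩ := exists_isTailConst (V := V) H.abs K (weylSwap D * g)
  refine ⟨max k₀ k₁, fun k hk z φ S hz hφ hK hrefl hreg' hS => ?_⟩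
  have hreg := mul_cpow_ne_one H.abs.one_lt_q hz H.pos H.norm_le
  have hn : (n : ℂ) ≠ 0 := by exact_mod_cast H.abs.n_pos.ne'
  set Ψ : GL2 D → V := fun g => regOp q p ω n N μ σ z φ (weylSwap D * g) with hΨ
  have hΨK : ∀ g, ∀ k ∈ K, Ψ (g * k) = Ψ g := by
    intro g k hk
    simp only [hΨ, ← mul_assoc]
    exact regOp_mul_of_invariant H (fun g => hK g k hk) _
  have hΨind : Ψ ∈ ind n N (swapRep σ) (-z) :=
    comp_weylSwap_mem_ind.2 (regOp_mem_indBar H hreg hφ)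
  have htc : IsTailConst q N Ψ (weylSwap D * g) k :=
    (hk₁ Ψ hΨK).mono H.abs (by omega)
  set J := regInt q p ω n N μ (swapRep σ) k (-z) Ψ (weylSwap D * g) with hJ
  -- By `regInt_eq` the same vector J appears for every level k + r.
  have h1 : ∀ r ∈ Finset.range n,
      HasSum (fun L : ℕ => conjOp q N μ σ (-(k + r) - L) (ballOp q N μ σ L) (φ g))
        (J + (tailSum q p ω (sphereOp q N μ σ) (1 - (k + r)) z *
            tailSum q p ω (sphereOp q N μ σ) (k + r) z) (φ g)) := by
    intro r _
    have h2 := hk₀ (k + r) (by omega) z φ hz hφ hK (hrefl _)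
    rw [regInt_eq H'.abs H'.rep H'.periodic hreg' hΨind (htc.mono H.abs (by omega : k ≤ k + r)) htc]
      at h2
    exact h2
  have h3 := hasSum_sum h1
  have h4 : ∀ L : ℕ, ∑ r ∈ Finset.range n, conjOp q N μ σ (-(k + r) - L) (ballOp q N μ σ L) (φ g) =
      ((n : ℂ) * b L) • φ g := by
    intro L
    have := congrArg (fun T : V →L[ℂ] V => T (φ g)) (hav.ball_neg k L)
    simpa [sum_apply] using this
  simp only [h4] at h3
  have h5 := ((hB.mul_left (n : ℂ)).smul_const (φ g)).unique h3
  have h6 := (hasSum_average_tail_mul_tail H hav hz k).unique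
    ((hS.mul_left (n : ℂ)).smul_const (1 : V →L[ℂ] V))
  have h7 := congrArg (fun T : V →L[ℂ] V => T (φ g)) h6
  simp only [sum_apply, smul_apply, one_apply_eq_self] at h7
  rw [Finset.sum_add_distrib, h7, Finset.sum_const, Finset.card_range,
    ← Nat.cast_smul_eq_nsmul ℂ, mul_smul, mul_smul, ← smul_add] at h5
  have h8 := smul_right_injective V hn h5
  rw [sub_smul, h8, add_sub_cancel_right]

end Scalar

/-! ### Flat sections -/

section Height

variable {D : Type*} [DivisionRing D]

/-- The function with `height (p k) = N a / N b` for `p` upper triangular with diagonal `(a, b)`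
and `k` in the maximal compact subgroup. -/
def height (N : D → ℝ) (g : GL2 D) : ℝ :=
  (max (N ((g⁻¹ : GL2 D).val 0 0)) (N ((g⁻¹ : GL2 D).val 1 0)) *
    max (N (g.val 1 0)) (N (g.val 1 1)))⁻¹

/-- The matrices that are integral together with their inverses. -/
def integralMatrices (N : D → ℝ) : Set (GL2 D) :=
  {g | (∀ i j, N (g.val i j) ≤ 1) ∧ ∀ i j, N ((g⁻¹ : GL2 D).val i j) ≤ 1}

lemma val_mul_apply (g k : GL2 D) (i j : Fin 2) :
    (g * k).val i j = g.val i 0 * k.val 0 j + g.val i 1 * k.val 1 j := by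
  rw [Units.val_mul, Matrix.mul_apply, Fin.sum_univ_two]

lemma inv_val_upper {p : GL2 D} {a b : Dˣ} {x : D}
    (hp : (p : Matrix (Fin 2) (Fin 2) D) = !![(a : D), x; 0, (b : D)]) :
    (p⁻¹ : GL2 D).val = !![((a⁻¹ : Dˣ) : D), -((a⁻¹ : Dˣ) * x * (b⁻¹ : Dˣ)); 0,
      ((b⁻¹ : Dˣ) : D)] := by
  refine Units.inv_eq_of_mul_eq_one_left ?_
  rw [hp]
  simp [Matrix.one_fin_two, mul_assoc]

lemma entry_mul_inv (g : GL2 D) (i j : Fin 2) :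
    g.val i 0 * (g⁻¹ : GL2 D).val 0 j + g.val i 1 * (g⁻¹ : GL2 D).val 1 j =
      (1 : Matrix (Fin 2) (Fin 2) D) i j := by
  rw [← val_mul_apply, mul_inv_cancel, Units.val_one]

lemma entry_inv_mul (g : GL2 D) (i j : Fin 2) :
    (g⁻¹ : GL2 D).val i 0 * g.val 0 j + (g⁻¹ : GL2 D).val i 1 * g.val 1 j =
      (1 : Matrix (Fin 2) (Fin 2) D) i j := by
  rw [← val_mul_apply, inv_mul_cancel, Units.val_one]

lemma inv_mem_integralMatrices {N : D → ℝ} {g : GL2 D} (hg : g ∈ integralMatrices N) :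
    g⁻¹ ∈ integralMatrices N := ⟨hg.2, by rw [inv_inv]; exact hg.1⟩

variable [TopologicalSpace D] [MeasurableSpace D] {q : ℝ} {n : ℕ} {N : D → ℝ} {μ : Measure Dˣ}
  (h : IsNormalizedAbs q n N μ)
include h

lemma row_mul_le {g k : GL2 D} (hk : k ∈ integralMatrices N) (i : Fin 2) :
    max (N ((g * k).val i 0)) (N ((g * k).val i 1)) ≤ max (N (g.val i 0)) (N (g.val i 1)) := by
  have : ∀ j, N ((g * k).val i j) ≤ max (N (g.val i 0)) (N (g.val i 1)) := by
    intro j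
    rw [val_mul_apply]
    refine (h.add_le _ _).trans (max_le_max ?_ ?_) <;> rw [h.map_mul]
    · exact mul_le_of_le_one_right (h.nonneg _) (hk.1 _ _)
    · exact mul_le_of_le_one_right (h.nonneg _) (hk.1 _ _)
  exact max_le (this 0) (this 1)

lemma row_mul_eq {g k : GL2 D} (hk : k ∈ integralMatrices N) (i : Fin 2) :
    max (N ((g * k).val i 0)) (N ((g * k).val i 1)) = max (N (g.val i 0)) (N (g.val i 1)) := by
  refine le_antisymm (row_mul_le h hk i) ?_
  have := row_mul_le h (g := g * k) (inv_mem_integralMatrices hk) i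
  rwa [mul_inv_cancel_right] at this

lemma col_mul_le {g k : GL2 D} (hk : k ∈ integralMatrices N) (j : Fin 2) :
    max (N ((k * g).val 0 j)) (N ((k * g).val 1 j)) ≤ max (N (g.val 0 j)) (N (g.val 1 j)) := by
  have : ∀ i, N ((k * g).val i j) ≤ max (N (g.val 0 j)) (N (g.val 1 j)) := by
    intro i
    rw [val_mul_apply]
    refine (h.add_le _ _).trans (max_le_max ?_ ?_) <;> rw [h.map_mul]
    · exact mul_le_of_le_one_left (h.nonneg _) (hk.1 _ _)
    · exact mul_le_of_le_one_left (h.nonneg _) (hk.1 _ _)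
  exact max_le (this 0) (this 1)

lemma col_mul_eq {g k : GL2 D} (hk : k ∈ integralMatrices N) (j : Fin 2) :
    max (N ((k * g).val 0 j)) (N ((k * g).val 1 j)) = max (N (g.val 0 j)) (N (g.val 1 j)) := by
  refine le_antisymm (col_mul_le h hk j) ?_
  have := col_mul_le h (g := k * g) (inv_mem_integralMatrices hk) j
  rwa [inv_mul_cancel_left] at this

/-- The height is built from the bottom row of g and the first column of g⁻¹; right multiplication
by GL₂(O_D) preserves the maximum norm of both. -/
lemma height_mul_right {g k : GL2 D} (hk : k ∈ integralMatrices N) :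
    height N (g * k) = height N g := by
  rw [height, height, row_mul_eq h hk, mul_inv_rev g k, col_mul_eq h (inv_mem_integralMatrices hk)]

lemma height_mul_left {p : GL2 D} {a b : Dˣ} {x : D}
    (hp : (p : Matrix (Fin 2) (Fin 2) D) = !![(a : D), x; 0, (b : D)]) (g : GL2 D) :
    height N (p * g) = N (a : D) / N (b : D) * height N g := by
  have h1 : ∀ i, ((p * g)⁻¹ : GL2 D).val i 0 = (g⁻¹ : GL2 D).val i 0 * ((a⁻¹ : Dˣ) : D) := by
    intro i
    rw [mul_inv_rev, val_mul_apply, inv_val_upper hp]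
    simp
  have h2 : ∀ j, (p * g).val 1 j = b * g.val 1 j := by
    intro j
    rw [val_mul_apply, hp]
    simp
  rw [height, height, h1, h1, h2, h2, h.map_mul, h.map_mul, h.map_mul, h.map_mul, h.map_inv,
    ← max_mul_of_nonneg _ _ (inv_nonneg.2 (h.nonneg _)), ← mul_max_of_nonneg _ _ (h.nonneg _)]
  have ha := (h.units_pos a).ne'
  have hb := (h.units_pos b).ne'
  rw [mul_inv, mul_inv, mul_inv, mul_inv, inv_inv, div_eq_mul_inv]
  ring

lemma one_mem_integralMatrices : (1 : GL2 D) ∈ integralMatrices N := by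
  have h1 : ∀ i j, N ((1 : Matrix (Fin 2) (Fin 2) D) i j) ≤ 1 := by
    intro i j
    rw [Matrix.one_apply]
    split_ifs
    · rw [h.map_one]
    · rw [h.map_zero]; exact zero_le_one
  exact ⟨h1, by rw [inv_one]; exact h1⟩

lemma height_one : height N (1 : GL2 D) = 1 := by
  simp [height, h.map_one, h.map_zero]

lemma height_of_mem {k : GL2 D} (hk : k ∈ integralMatrices N) : height N k = 1 := by
  rw [← one_mul k, height_mul_right h hk, height_one h]

lemma lowerUnip_mem_integralMatrices {y : D} (hy : N y ≤ 1) :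
    lowerUnip y ∈ integralMatrices N := by
  have h1 : ∀ y, N y ≤ 1 → ∀ i j, N ((lowerUnip y).val i j) ≤ 1 := by
    intro y hy i j
    fin_cases i <;> fin_cases j <;> simp [lowerUnip, h.map_one, h.map_zero, hy]
  exact ⟨h1 y hy, by rw [coe_inv_lowerUnip]; exact h1 _ (by rwa [h.map_neg])⟩

lemma weylSwap_mem_integralMatrices : weylSwap D ∈ integralMatrices N := by
  have h1 : ∀ i j, N ((weylSwap D).val i j) ≤ 1 := by
    intro i j
    fin_cases i <;> fin_cases j <;> simp [weylSwap, h.map_one, h.map_zero]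
  exact ⟨h1, by rw [inv_eq_of_mul_eq_one_left weylSwap_mul_self]; exact h1⟩

lemma mul_mem_integralMatrices {g k : GL2 D} (hg : g ∈ integralMatrices N)
    (hk : k ∈ integralMatrices N) : g * k ∈ integralMatrices N := by
  have key : ∀ g k : GL2 D, g ∈ integralMatrices N → k ∈ integralMatrices N →
      ∀ i j, N ((g * k).val i j) ≤ 1 := by
    intro g k hg hk i j
    rw [val_mul_apply]
    refine (h.add_le _ _).trans (max_le ?_ ?_) <;> rw [h.map_mul] <;>
      exact mul_le_one₀ (hg.1 _ _) (h.nonneg _) (hk.1 _ _)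
  refine ⟨key g k hg hk, ?_⟩
  rw [mul_inv_rev]
  exact key _ _ (inv_mem_integralMatrices hk) (inv_mem_integralMatrices hg)

/-- The Iwasawa decomposition. -/
lemma exists_iwasawa (g : GL2 D) : ∃ (p k : GL2 D) (a b : Dˣ) (x : D),
    (p : Matrix (Fin 2) (Fin 2) D) = !![(a : D), x; 0, (b : D)] ∧ k ∈ integralMatrices N ∧
      g = p * k := by
  have upper : ∀ g : GL2 D, g.val 1 0 = 0 → ∃ (a b : Dˣ) (x : D),
      (g : Matrix (Fin 2) (Fin 2) D) = !![(a : D), x; 0, (b : D)] := by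
    intro g hg
    have h1 := entry_inv_mul g 0 0
    have h2 := entry_mul_inv g 1 1
    rw [hg, mul_zero, add_zero] at h1
    rw [hg, zero_mul, zero_add] at h2
    have ha : g.val 0 0 ≠ 0 := by
      intro h0; rw [h0] at h1; simp at h1
    have hb : g.val 1 1 ≠ 0 := by
      intro h0; rw [h0] at h2; simp at h2
    refine ⟨Units.mk0 _ ha, Units.mk0 _ hb, g.val 0 1, ?_⟩
    ext i j
    fin_cases i <;> fin_cases j <;> simp [hg]
  have main : ∀ g : GL2 D, N (g.val 1 0) ≤ N (g.val 1 1) → ∃ (p k : GL2 D) (a b : Dˣ) (x : D),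
      (p : Matrix (Fin 2) (Fin 2) D) = !![(a : D), x; 0, (b : D)] ∧ k ∈ integralMatrices N ∧
      g = p * k := by
    intro g hg
    have hd : g.val 1 1 ≠ 0 := by
      intro h0
      rw [h0, h.map_zero] at hg
      have h2 : g.val 1 0 = 0 := by
        by_contra h3
        exact absurd (h.pos h3) (not_lt.2 hg)
      have h3 := entry_mul_inv g 1 1
      rw [h0, h2] at h3
      simp at h3
    set y := (g.val 1 1)⁻¹ * g.val 1 0 with hy
    have hyN : N y ≤ 1 := by
      rw [hy, h.map_mul, h.map_inv₀ _ hd]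
      exact inv_mul_le_one_of_le₀ hg (h.nonneg _)
    obtain ⟨a, b, x, hp⟩ := upper (g * lowerUnip (-y)) (by
      rw [val_mul_apply]
      simp [lowerUnip, hy, hd])
    refine ⟨g * lowerUnip (-y), lowerUnip y, a, b, x, hp,
      lowerUnip_mem_integralMatrices h hyN, ?_⟩
    rw [mul_assoc, ← lowerUnip_add, neg_add_cancel, lowerUnip_zero, mul_one]
  rcases le_total (N (g.val 1 0)) (N (g.val 1 1)) with h1 | h1
  · exact main g h1
  · obtain ⟨p, k, a, b, x, hp, hk, hg⟩ := main (g * weylSwap D) (by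
      rw [val_mul_apply, val_mul_apply]
      simpa [weylSwap] using h1)
    refine ⟨p, k * weylSwap D, a, b, x, hp,
      mul_mem_integralMatrices h hk (weylSwap_mem_integralMatrices h), ?_⟩
    rw [← mul_assoc, ← hg, mul_assoc, weylSwap_mul_self, mul_one]

lemma height_pos (g : GL2 D) : 0 < height N g := by
  obtain ⟨p, k, a, b, x, hp, hk, rfl⟩ := exists_iwasawa h g
  rw [height_mul_left h hp, height_of_mem h hk, mul_one]
  exact div_pos (h.units_pos _) (h.units_pos _)

lemma isOpen_integralMatrices [IsTopologicalRing D] [T2Space D] [ContinuousInv₀ D] :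
    IsOpen (integralMatrices N) := by
  have h1 : ∀ i j, IsOpen {g : GL2 D | N (g.val i j) ≤ 1} := by
    intro i j
    have : Continuous fun g : GL2 D => g.val i j := by
      exact Units.continuous_val.matrix_elem i j
    have h2 := (h.isOpen_le 0).preimage this
    simpa using h2
  have h2 : integralMatrices N = (⋂ i, ⋂ j, {g : GL2 D | N (g.val i j) ≤ 1}) ∩
      (⋂ i, ⋂ j, {g : GL2 D | N (g.val i j) ≤ 1})⁻¹ := by
    ext g
    simp [integralMatrices]
  have h3 : IsOpen (⋂ i, ⋂ j, {g : GL2 D | N (g.val i j) ≤ 1}) :=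
    isOpen_iInter_of_finite fun i => isOpen_iInter_of_finite fun j => h1 i j
  rw [h2]
  exact h3.inter h3.inv

/-- The maximal compact subgroup as an open subgroup. -/
def integralSubgroup [IsTopologicalRing D] [T2Space D] [ContinuousInv₀ D] :
    OpenSubgroup (GL2 D) where
  carrier := integralMatrices N
  mul_mem' := mul_mem_integralMatrices h
  one_mem' := one_mem_integralMatrices h
  inv_mem' := inv_mem_integralMatrices
  isOpen' := isOpen_integralMatrices h

end Height

section Flat

variable {D : Type*} [DivisionRing D] [TopologicalSpace D] [MeasurableSpace D]
  {q : ℝ} {n : ℕ} {N : D → ℝ} {μ : Measure Dˣ} (h : IsNormalizedAbs q n N μ)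
  {V : Type*} [NormedAddCommGroup V] [NormedSpace ℂ V] {σ : Dˣ × Dˣ →* (V →L[ℂ] V)}

/-- The value at `z` of the flat section through the element `φ` of the induced representation
with parameter `s`. -/
def flat (N : D → ℝ) (s : ℂ) (φ : GL2 D → V) (z : ℂ) (g : GL2 D) : V :=
  ((height N g : ℝ) : ℂ) ^ ((z - s) / 2) • φ g

include h in
lemma flat_of_mem (s : ℂ) (φ : GL2 D → V) (z : ℂ) {k : GL2 D} (hk : k ∈ integralMatrices N) :
    flat N s φ z k = φ k := by
  rw [flat, height_of_mem h hk, Complex.ofReal_one, Complex.one_cpow, one_smul]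

include h in
lemma flat_self (s : ℂ) (φ : GL2 D → V) : flat N s φ s = φ := by
  funext g
  rw [flat, sub_self, zero_div, Complex.cpow_zero, one_smul]

include h in
lemma flat_mul_right (s : ℂ) {φ : GL2 D → V} (z : ℂ) {k : GL2 D} (hk : k ∈ integralMatrices N)
    (hφ : ∀ g, φ (g * k) = φ g) (g : GL2 D) : flat N s φ z (g * k) = flat N s φ z g := by
  rw [flat, flat, height_mul_right h hk, hφ]

include h in
lemma flat_mem_ind [IsTopologicalRing D] [T2Space D] [ContinuousInv₀ D] {s : ℂ}
    {φ : GL2 D → V} (hφ : φ ∈ ind n N σ s) (z : ℂ) :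
    flat N s φ z ∈ ind n N σ z := by
  refine ⟨?_, fun p a b x hp g => ?_⟩
  · obtain ⟨K, hK⟩ := hφ.1
    exact ⟨K ⊓ integralSubgroup h, fun g k hk =>
      flat_mul_right h s z hk.2 (fun g => hK g k hk.1) g⟩
  · have hr : 0 < N (a : D) / N (b : D) := div_pos (h.units_pos a) (h.units_pos b)
    have hr' : ((N (a : D) / N (b : D) : ℝ) : ℂ) ≠ 0 := by exact_mod_cast hr.ne'
    rw [flat, flat, hφ.2 p a b x hp, height_mul_left h hp, Complex.ofReal_mul,
      Complex.mul_cpow_ofReal_nonneg hr.le (height_pos h g).le, map_smul, smul_smul, smul_smul,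
      mul_right_comm, ← Complex.cpow_add _ _ hr']
    congr 3
    ring

include h in
lemma ind_eq_of_eqOn {z : ℂ} {φ ψ : GL2 D → V} (hφ : φ ∈ ind n N σ z) (hψ : ψ ∈ ind n N σ z)
    (heq : ∀ k ∈ integralMatrices N, φ k = ψ k) : φ = ψ := by
  funext g
  obtain ⟨p, k, a, b, x, hp, hk, rfl⟩ := exists_iwasawa h g
  rw [hφ.2 p a b x hp, hψ.2 p a b x hp, heq k hk]

end Flat

/-! ### Meromorphic continuation -/

section Mero

open Filter Topology

variable {E : Type*} [NormedAddCommGroup E] [NormedSpace ℂ E] [CompleteSpace E]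

/-- The order of d is infinite at the point 1 of the half-plane, hence everywhere, since ℂ is
connected. -/
lemma eventually_nhdsNE_eq_zero_of_re_pos {d : ℂ → E} (hd : MeromorphicOn d Set.univ)
    (h0 : ∀ z : ℂ, 0 < z.re → d z = 0) (s : ℂ) : ∀ᶠ z in 𝓝[≠] s, d z = 0 := by
  rw [← meromorphicOrderAt_eq_top_iff]
  have h1 : meromorphicOrderAt d 1 = ⊤ := by
    rw [meromorphicOrderAt_eq_top_iff]
    have : {z : ℂ | 0 < z.re} ∈ 𝓝 (1 : ℂ) :=
      (isOpen_lt continuous_const Complex.continuous_re).mem_nhds (by simp)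
    filter_upwards [mem_nhdsWithin_of_mem_nhds this] with z hz
    exact h0 z hz
  by_contra h2
  exact (hd.exists_meromorphicOrderAt_ne_top_iff_forall isConnected_univ).1
    ⟨⟨s, trivial⟩, h2⟩ ⟨1, trivial⟩ h1

/-- The identity theorem for meromorphic functions. -/
lemma eq_zero_of_re_pos {d : ℂ → E} (hd : MeromorphicOn d Set.univ)
    (h0 : ∀ z : ℂ, 0 < z.re → d z = 0) {s : ℂ} (hs : ContinuousAt d s) : d s = 0 := by
  have h1 := eventually_nhdsNE_eq_zero_of_re_pos hd h0 s
  have h2 : Tendsto d (𝓝[≠] s) (𝓝 0) :=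
    tendsto_const_nhds.congr' (h1.mono fun z hz => hz.symm)
  exact tendsto_nhds_unique (hs.tendsto.mono_left nhdsWithin_le_nhds) h2

/-- Two continuations agree on a punctured neighbourhood of each point, and the normal form
determines the value at the point itself. -/
lemma IsMeroCont.unique {f h₁ h₂ : ℂ → E} (hh₁ : IsMeroCont f h₁) (hh₂ : IsMeroCont f h₂) :
    h₁ = h₂ := by
  funext s
  have h1 := eventually_nhdsNE_eq_zero_of_re_pos (d := h₁ - h₂)
    (hh₁.1.meromorphicOn.sub hh₂.1.meromorphicOn)
    (fun z hz => by rw [Pi.sub_apply, hh₁.2 z hz, hh₂.2 z hz, sub_self]) s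
  have h2 : h₁ =ᶠ[𝓝[≠] s] h₂ := h1.mono fun z hz => sub_eq_zero.1 hz
  exact ((hh₁.1 (Set.mem_univ s)).eventuallyEq_nhdsNE_iff_eventuallyEq_nhds
    (hh₂.1 (Set.mem_univ s))).1 h2 |>.eq_of_nhds

/-- A meromorphic function that is an analytic extension of `f` from the right half-plane
computes the meromorphic continuation of `f`. -/
theorem meroCont_eq {F f : ℂ → E} (hF : MeromorphicOn F Set.univ)
    (hf : ∀ z : ℂ, 0 < z.re → AnalyticAt ℂ F z ∧ F z = f z) :
    (∃ h, IsMeroCont f h) ∧ ∀ s, AnalyticAt ℂ F s → meroCont f s = F s := by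
  have h1 : ∀ s, AnalyticAt ℂ F s → toMeromorphicNFOn F Set.univ s = F s := fun s hs => by
    rw [toMeromorphicNFOn_eq_toMeromorphicNFAt hF (Set.mem_univ s),
      toMeromorphicNFAt_eq_self.2 hs.meromorphicNFAt]
  have h2 : IsMeroCont f (toMeromorphicNFOn F Set.univ) :=
    ⟨meromorphicNFOn_toMeromorphicNFOn F Set.univ, fun z hz => by
      rw [h1 z (hf z hz).1, (hf z hz).2]⟩
  refine ⟨⟨_, h2⟩, fun s hs => ?_⟩
  have h3 : IsMeroCont f (meroCont f) := Classical.epsilon_spec ⟨_, h2⟩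
  rw [h3.unique h2, h1 s hs]

lemma meromorphicAt_clm_comp {E' : Type*} [NormedAddCommGroup E'] [NormedSpace ℂ E']
    (T : E →L[ℂ] E') {f : ℂ → E} {s : ℂ} (hf : MeromorphicAt f s) :
    MeromorphicAt (fun z => T (f z)) s := by
  obtain ⟨m, hm⟩ := hf
  refine ⟨m, ?_⟩
  have : AnalyticAt ℂ (fun z => T ((z - s) ^ m • f z)) s := (T.analyticAt _).comp hm
  refine this.congr (Eventually.of_forall fun z => ?_)
  simp

lemma analyticAt_const_cpow {q : ℝ} (hq : 0 < q) {f : ℂ → ℂ} {s : ℂ} (hf : AnalyticAt ℂ f s) :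
    AnalyticAt ℂ (fun z => (q : ℂ) ^ (f z)) s :=
  analyticAt_const.cpow hf (by simp [Complex.slitPlane, hq])

/-- At a solution the derivative is -p log q, which is nonzero, so the poles of the tail are
isolated. -/
lemma eventually_mul_cpow_ne_one {q : ℝ} (hq : 1 < q) {p : ℕ} (hp : 0 < p) (ω : ℂ) (s : ℂ) :
    ∀ᶠ z : ℂ in 𝓝[≠] s, ω * (q : ℂ) ^ (-(p * z)) ≠ 1 := by
  have hq0 := zero_lt_one.trans hq
  by_cases h1 : ω * (q : ℂ) ^ (-(p * s)) = 1
  · have hq' : (q : ℂ) ≠ 0 := by exact_mod_cast hq0.ne'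
    have h2 : HasDerivAt (fun z : ℂ => -(p * z)) (-(p : ℂ)) s := by
      simpa using ((hasDerivAt_id' s).const_mul (p : ℂ)).fun_neg
    have h3 := (h2.const_cpow (c := (q : ℂ)) (Or.inl hq')).const_mul ω
    refine h3.eventually_ne ?_
    rw [mul_assoc, ← mul_assoc, h1, one_mul]
    refine mul_ne_zero ?_ (neg_ne_zero.2 (by exact_mod_cast hp.ne'))
    rw [← Complex.ofReal_log hq0.le]
    exact_mod_cast (Real.log_pos hq).ne'
  · have : ContinuousAt (fun z : ℂ => ω * (q : ℂ) ^ (-(p * z))) s :=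
      (analyticAt_const.mul (analyticAt_const_cpow hq0 (by fun_prop))).continuousAt
    exact (this.eventually_ne h1).filter_mono nhdsWithin_le_nhds

lemma tailSum_apply {V : Type*} [NormedAddCommGroup V] [NormedSpace ℂ V] (q : ℝ) (p : ℕ) (ω : ℂ)
    (a : ℤ → V →L[ℂ] V) (k : ℤ) (z : ℂ) (v : V) :
    tailSum q p ω a k z v = (1 - ω * (q : ℂ) ^ (-(p * z)))⁻¹ •
      ∑ j ∈ Finset.range p, (q : ℂ) ^ (-((k + j : ℤ) * z)) • a (k + j) v := by
  rw [tailSum, smul_apply, sum_apply]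
  rfl

end Mero

/-! ### Meromorphic dependence of the regularized operators on the parameter -/

section Continuation

open Filter Topology

variable {D : Type*} [DivisionRing D] [TopologicalSpace D] [IsTopologicalRing D] [T2Space D]
  [ContinuousInv₀ D] [MeasurableSpace D] [BorelSpace D] [BorelSpace Dˣ]
  [SecondCountableTopology D] [SecondCountableTopology Dˣ]
  {q : ℝ} {n : ℕ} {N : D → ℝ} {μ : Measure Dˣ}
  {V : Type*} [NormedAddCommGroup V] [NormedSpace ℂ V] [CompleteSpace V]
  {σ : Dˣ × Dˣ →* (V →L[ℂ] V)} {p : ℕ} {ω : ℂ}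

/-- Nodes and weights do not depend on z, so the analytic properties of the integral follow from
those of the values z ↦ Φ z g. -/
lemma exists_setIntegral_family_eq_sum (h : IsNormalizedAbs q n N μ) {K : OpenSubgroup (GL2 D)}
    {Φ : ℂ → GL2 D → V} (hK : ∀ z g, ∀ k ∈ K, Φ z (g * k) = Φ z g) (k : ℤ) (g : GL2 D) :
    ∃ (t : Finset D) (c : D → ℝ), ∀ z,
      ∫ x in {x | N x < q ^ k}, Φ z (lowerUnip x * g) ∂(unitsAddMeasure n N μ) =
        ∑ y ∈ t, (c y : ℂ) • Φ z (lowerUnip y * g) := by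
  obtain ⟨j, hj⟩ := h.exists_lowerUnip_mem K g
  obtain ⟨t, c, hc⟩ := h.exists_setIntegral_eq_sum (E := V) k j
  refine ⟨t, c, fun z => ?_⟩
  rw [hc _ fun x e he => ?_]
  · rfl
  · rw [← hK z (lowerUnip x * g) _ (hj e he), lowerUnip_add]
    congr 1
    group

lemma analyticAt_regInt (h : IsNormalizedAbs q n N μ) {K : OpenSubgroup (GL2 D)}
    {Φ : ℂ → GL2 D → V} (hK : ∀ z g, ∀ k ∈ K, Φ z (g * k) = Φ z g) {s : ℂ}
    (hΦ : ∀ g, AnalyticAt ℂ (fun z => Φ z g) s) {u : ℂ → ℂ} (hu : AnalyticAt ℂ u s)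
    (hreg : ω * (q : ℂ) ^ (-(p * u s)) ≠ 1) (k : ℤ) (g : GL2 D) :
    AnalyticAt ℂ (fun z => regInt q p ω n N μ σ k (u z) (Φ z) g) s := by
  obtain ⟨t, c, hc⟩ := exists_setIntegral_family_eq_sum h hK k g
  simp only [regInt, hc, tailSum_apply]
  refine AnalyticAt.add (Finset.analyticAt_fun_sum _ fun y _ => analyticAt_const.smul (hΦ _)) ?_
  refine AnalyticAt.smul (AnalyticAt.inv ?_ (sub_ne_zero.2 hreg.symm)) ?_
  · exact analyticAt_const.sub (analyticAt_const.mul (analyticAt_const_cpow h.q_pos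
      (analyticAt_const.mul hu).neg))
  · exact Finset.analyticAt_fun_sum _ fun j _ => (analyticAt_const_cpow h.q_pos
      (analyticAt_const.mul hu).neg).smul ((ContinuousLinearMap.analyticAt _ _).comp (hΦ _))

lemma meromorphicAt_regInt (h : IsNormalizedAbs q n N μ) {K : OpenSubgroup (GL2 D)}
    {Φ : ℂ → GL2 D → V} (hK : ∀ z g, ∀ k ∈ K, Φ z (g * k) = Φ z g) {s : ℂ}
    (hΦ : ∀ g, MeromorphicAt (fun z => Φ z g) s) {u : ℂ → ℂ} (hu : AnalyticAt ℂ u s)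
    (k : ℤ) (g : GL2 D) :
    MeromorphicAt (fun z => regInt q p ω n N μ σ k (u z) (Φ z) g) s := by
  obtain ⟨t, c, hc⟩ := exists_setIntegral_family_eq_sum h hK k g
  simp only [regInt, hc, tailSum_apply]
  refine MeromorphicAt.add (MeromorphicAt.fun_sum fun y _ =>
    (MeromorphicAt.const _ s).smul (hΦ _)) ?_
  refine MeromorphicAt.smul (MeromorphicAt.inv ?_) ?_
  · exact (analyticAt_const.sub (analyticAt_const.mul (analyticAt_const_cpow h.q_pos
      (analyticAt_const.mul hu).neg))).meromorphicAt
  · exact MeromorphicAt.fun_sum fun j _ => (analyticAt_const_cpow h.q_pos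
      (analyticAt_const.mul hu).neg).meromorphicAt.smul (meromorphicAt_clm_comp _ (hΦ _))

lemma analyticAt_flat (h : IsNormalizedAbs q n N μ) (s : ℂ) (φ : GL2 D → V) (g : GL2 D) (z : ℂ) :
    AnalyticAt ℂ (fun z => flat N s φ z g) z := by
  refine (analyticAt_const_cpow (height_pos h g) ?_).smul analyticAt_const
  fun_prop

lemma exists_flat_invariant (h : IsNormalizedAbs q n N μ) {s : ℂ} {φ : GL2 D → V}
    (hφ : φ ∈ ind n N σ s) :
    ∃ K : OpenSubgroup (GL2 D), ∀ z g, ∀ k ∈ K, flat N s φ z (g * k) = flat N s φ z g := by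
  obtain ⟨K, hK⟩ := hφ.1
  exact ⟨K ⊓ integralSubgroup h, fun z g k hk =>
    flat_mul_right h s z hk.2 (fun g => hK g k hk.1) g⟩

variable (H : RegHyp q p ω n N μ σ)
include H

lemma analyticAt_regOp_flat {s : ℂ} {φ : GL2 D → V} (hφ : φ ∈ ind n N σ s) (g : GL2 D) {z : ℂ}
    (hz : ω * (q : ℂ) ^ (-(p * z)) ≠ 1) :
    AnalyticAt ℂ (fun z => regOp q p ω n N μ σ z (flat N s φ z) g) z := by
  obtain ⟨K, hK⟩ := exists_flat_invariant H.abs hφ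
  obtain ⟨k, hk⟩ := exists_isTailConst (V := V) H.abs K g
  have h1 : ContinuousAt (fun z : ℂ => ω * (q : ℂ) ^ (-(p * z))) z :=
    (analyticAt_const.mul (analyticAt_const_cpow H.abs.q_pos (by fun_prop))).continuousAt
  refine (analyticAt_regInt (σ := σ) H.abs hK (fun g => analyticAt_flat H.abs s φ g z)
    analyticAt_id hz k g).congr ?_
  filter_upwards [h1.eventually_ne hz] with w hw
  exact (regOp_eq H hw (flat_mem_ind H.abs hφ w) (hk _ (hK w))).symm

lemma meromorphicAt_regOp_flat {s : ℂ} {φ : GL2 D → V} (hφ : φ ∈ ind n N σ s) (g : GL2 D)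
    (z : ℂ) : MeromorphicAt (fun z => regOp q p ω n N μ σ z (flat N s φ z) g) z := by
  obtain ⟨K, hK⟩ := exists_flat_invariant H.abs hφ
  obtain ⟨k, hk⟩ := exists_isTailConst (V := V) H.abs K g
  refine (meromorphicAt_regInt (p := p) (ω := ω) (σ := σ) H.abs hK
    (fun g => (analyticAt_flat H.abs s φ g z).meromorphicAt) analyticAt_id k g).congr ?_
  filter_upwards [eventually_mul_cpow_ne_one H.abs.one_lt_q H.pos ω z] with w hw
  exact (regOp_eq H hw (flat_mem_ind H.abs hφ w) (hk _ (hK w))).symm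

/-- The meromorphic continuation of the intertwining integral along a flat section is the
regularized operator. -/
theorem meroCont_integral_flat {s : ℂ} {φ : GL2 D → V} (hφ : φ ∈ ind n N σ s) (g : GL2 D) :
    (∃ f, IsMeroCont (fun z => ∫ x, flat N s φ z (lowerUnip x * g) ∂(unitsAddMeasure n N μ)) f) ∧
    ∀ z : ℂ, ω * (q : ℂ) ^ (-(p * z)) ≠ 1 →
      meroCont (fun z => ∫ x, flat N s φ z (lowerUnip x * g) ∂(unitsAddMeasure n N μ)) z =
        regOp q p ω n N μ σ z (flat N s φ z) g := by
  obtain ⟨h1, h2⟩ := meroCont_eq (f := fun z => ∫ x, flat N s φ z (lowerUnip x * g)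
    ∂(unitsAddMeasure n N μ)) (fun z _ => meromorphicAt_regOp_flat H hφ g z) (fun z hz =>
      ⟨analyticAt_regOp_flat H hφ g (mul_cpow_ne_one H.abs.one_lt_q hz H.pos H.norm_le),
        (regOp_eq_integral H hz (flat_mem_ind H.abs hφ z) g).2⟩)
  exact ⟨h1, fun z hz => h2 z (analyticAt_regOp_flat H hφ g hz)⟩

/-- The scalar by which the composition of the two intertwining operators acts. -/
theorem regOp_regOp {a b : ℕ → ℂ} (hav : HasAverages q n N μ σ a b)
    (H' : RegHyp q p ω n N μ (swapRep σ))
    (hrefl : ∀ k z, tailSum q p ω (sphereOp q N μ (swapRep σ)) k (-z) =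
        -tailSum q p ω (sphereOp q N μ σ) (1 - k) z)
    (hreg : ∀ z : ℂ, 0 < z.re → ω * (q : ℂ) ^ (-(p * -z)) ≠ 1)
    {c : ℂ → ℂ} (hc : MeromorphicOn c Set.univ) {B : ℂ} (hB : HasSum b B)
    (hS : ∀ z : ℂ, 0 < z.re →
      HasSum (fun M : ℕ => (M + 1) * (q : ℂ) ^ (-((M + 1 : ℂ) * z)) * a (M + 1)) (B - c z))
    {s : ℂ} (hcs : AnalyticAt ℂ c s) (hs : ω * (q : ℂ) ^ (-(p * s)) ≠ 1)
    (hs' : ω * (q : ℂ) ^ (-(p * -s)) ≠ 1) {φ : GL2 D → V} (hφ : φ ∈ ind n N σ s) (g : GL2 D) :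
    regOp q p ω n N μ (swapRep σ) (-s)
      (fun g => regOp q p ω n N μ σ s φ (weylSwap D * g)) (weylSwap D * g) = c s • φ g := by
  obtain ⟨K, hK⟩ := exists_flat_invariant H.abs hφ
  obtain ⟨k₀, hk₀⟩ := regInt_composition H hav H' hB K g
  obtain ⟨k₁, hk₁⟩ := exists_isTailConst (V := V) H.abs K (weylSwap D * g)
  set k := max k₀ k₁
  set Ψ : ℂ → GL2 D → V := fun z g =>
    regOp q p ω n N μ σ z (flat N s φ z) (weylSwap D * g) with hΨ
  have hΨK : ∀ z g, ∀ k ∈ K, Ψ z (g * k) = Ψ z g := by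
    intro z g k hk
    simp only [hΨ, ← mul_assoc]
    exact regOp_mul_of_invariant H (fun g => hK z g k hk) _
  -- The difference of the two sides along the flat section, truncated at a level k common to all z.
  -- It is meromorphic, vanishes for Re z > 0 and is analytic at s.
  set d : ℂ → V := fun z => regInt q p ω n N μ (swapRep σ) k (-z) (Ψ z) (weylSwap D * g) -
    c z • flat N s φ z g with hd
  have hdm : MeromorphicOn d Set.univ := fun z _ =>
    (meromorphicAt_regInt H.abs hΨK (fun g => meromorphicAt_regOp_flat H hφ _ z)
      analyticAt_id.neg k _).sub ((hc z trivial).smul (analyticAt_flat H.abs s φ g z).meromorphicAt)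
  have hds : AnalyticAt ℂ d s :=
    (analyticAt_regInt H.abs hΨK (fun g => analyticAt_regOp_flat H hφ _ hs)
      analyticAt_id.neg hs' k _).sub (hcs.smul (analyticAt_flat H.abs s φ g s))
  have h0 : ∀ z : ℂ, 0 < z.re → d z = 0 := by
    intro z hz
    have := hk₀ k (le_max_left _ _) z (flat N s φ z) (B - c z) hz (flat_mem_ind H.abs hφ z) (hK z)
      (fun k => hrefl k z) (hreg z hz) (hS z hz)
    rw [sub_sub_cancel] at this
    simp only [hd, hΨ]
    rw [this, sub_self]
  have h1 := eq_zero_of_re_pos hdm h0 hds.continuousAt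
  have hΨs : Ψ s = fun g => regOp q p ω n N μ σ s φ (weylSwap D * g) := by
    simp only [hΨ, flat_self H.abs]
  simp only [hd, sub_eq_zero, flat_self H.abs, hΨs] at h1
  rw [← h1]
  have htc := hk₁ (Ψ s) (hΨK s)
  rw [hΨs] at htc
  exact regOp_eq H' hs' (comp_weylSwap_mem_ind.2 (regOp_mem_indBar H hs hφ))
    (htc.mono H.abs (le_max_right _ _))

end Continuation

/-! ### Representations of the unit group -/

section Rep

variable {D : Type*} [DivisionRing D]
  {V V₁ V₂ : Type*}
  [NormedAddCommGroup V] [InnerProductSpace ℂ V] [FiniteDimensional ℂ V]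
  [NormedAddCommGroup V₁] [InnerProductSpace ℂ V₁] [FiniteDimensional ℂ V₁]
  [NormedAddCommGroup V₂] [InnerProductSpace ℂ V₂] [FiniteDimensional ℂ V₂]

/-- A representation on a finite-dimensional space as a homomorphism to continuous operators. -/
def repCLM (π : Representation ℂ Dˣ V) : Dˣ →* (V →L[ℂ] V) where
  toFun g := LinearMap.toContinuousLinearMap (π g)
  map_one' := by ext; simp
  map_mul' a b := by ext; simp

@[simp] lemma repCLM_apply (π : Representation ℂ Dˣ V) (g : Dˣ) (v : V) :
    repCLM π g v = π g v := rfl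

/-- The tensor product of two continuous operators. -/
def tensorCLM (A : V₁ →L[ℂ] V₁) (B : V₂ →L[ℂ] V₂) : V₁ ⊗[ℂ] V₂ →L[ℂ] V₁ ⊗[ℂ] V₂ :=
  LinearMap.toContinuousLinearMap (TensorProduct.map (A : V₁ →ₗ[ℂ] V₁) (B : V₂ →ₗ[ℂ] V₂))

@[simp] lemma tensorCLM_tmul (A : V₁ →L[ℂ] V₁) (B : V₂ →L[ℂ] V₂) (x : V₁) (y : V₂) :
    tensorCLM A B (x ⊗ₜ y) = A x ⊗ₜ B y := rfl

lemma clm_tensor_ext {E : Type*} [NormedAddCommGroup E] [NormedSpace ℂ E]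
    {S T : V₁ ⊗[ℂ] V₂ →L[ℂ] E} (h : ∀ x y, S (x ⊗ₜ y) = T (x ⊗ₜ y)) : S = T := by
  apply ContinuousLinearMap.coe_injective
  exact TensorProduct.ext' h

lemma tensorCLM_mul (A A' : V₁ →L[ℂ] V₁) (B B' : V₂ →L[ℂ] V₂) :
    tensorCLM A B * tensorCLM A' B' = tensorCLM (A * A') (B * B') :=
  clm_tensor_ext fun _ _ => rfl

lemma tensorCLM_one : tensorCLM (1 : V₁ →L[ℂ] V₁) (1 : V₂ →L[ℂ] V₂) = 1 :=
  clm_tensor_ext fun _ _ => rfl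

/-- The external tensor product of two representations. -/
def tensorRep (π₁ : Representation ℂ Dˣ V₁) (π₂ : Representation ℂ Dˣ V₂) :
    Dˣ × Dˣ →* (V₁ ⊗[ℂ] V₂ →L[ℂ] V₁ ⊗[ℂ] V₂) where
  toFun g := tensorCLM (repCLM π₁ g.1) (repCLM π₂ g.2)
  map_one' := by
    rw [Prod.fst_one, Prod.snd_one, map_one, map_one, tensorCLM_one]
  map_mul' a b := by
    rw [tensorCLM_mul, ← map_mul, ← map_mul, Prod.fst_mul, Prod.snd_mul]

lemma tensorRep_apply (π₁ : Representation ℂ Dˣ V₁) (π₂ : Representation ℂ Dˣ V₂) (a b : Dˣ) :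
    tensorRep π₁ π₂ (a, b) = tensorCLM (repCLM π₁ a) (repCLM π₂ b) := rfl

/-- The trace as a continuous functional. -/
def traceCLM (V : Type*) [NormedAddCommGroup V] [InnerProductSpace ℂ V] [FiniteDimensional ℂ V] :
    (V →L[ℂ] V) →L[ℂ] ℂ :=
  LinearMap.toContinuousLinearMap
    { toFun := fun A => LinearMap.trace ℂ V (A : V →ₗ[ℂ] V)
      map_add' := fun A B => by simp
      map_smul' := fun c A => by simp }

lemma traceCLM_apply (A : V →L[ℂ] V) : traceCLM V A = LinearMap.trace ℂ V (A : V →ₗ[ℂ] V) := rfl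

/-- The character of a representation. -/
def chi (π : Representation ℂ Dˣ V) (g : Dˣ) : ℂ := LinearMap.trace ℂ V (π g)

lemma chi_eq (π : Representation ℂ Dˣ V) (g : Dˣ) : chi π g = traceCLM V (repCLM π g) := rfl

lemma chi_conj (π : Representation ℂ Dˣ V) (g w : Dˣ) : chi π (g * w * g⁻¹) = chi π w := by
  rw [chi, map_mul, LinearMap.trace_mul_comm, ← map_mul, inv_mul_cancel_left]
  rfl

variable [TopologicalSpace D]

lemma IsIrredUnitary.nontrivial {π : Representation ℂ Dˣ V} (hπ : IsIrredUnitary π) :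
    Nontrivial V := by
  have := hπ.irreducible
  by_contra h0
  rw [not_nontrivial_iff_subsingleton] at h0
  obtain ⟨a, b, hab⟩ := (inferInstance : Nontrivial (Subrepresentation π))
  refine hab ?_
  apply Subrepresentation.toSubmodule_injective
  exact Subsingleton.elim _ _

/-- Schur's lemma. -/
lemma IsIrredUnitary.exists_eq_smul {π : Representation ℂ Dˣ V} (hπ : IsIrredUnitary π)
    {T : V →L[ℂ] V} (hT : ∀ g, T * repCLM π g = repCLM π g * T) : ∃ c : ℂ, T = c • 1 := by
  have := hπ.irreducible
  let f : Representation.IntertwiningMap π π :=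
    LinearMap.intertwiningMap_of_isIntertwiningMap (ρ := π) (σ := π) (f := (T : V →ₗ[ℂ] V))
      fun g v => congrArg (fun S : V →L[ℂ] V => S v) (hT g)
  obtain ⟨c, hc⟩ :=
    (Representation.IsIrreducible.algebraMap_intertwiningMap_bijective_of_isAlgClosed (ρ := π)).2 f
  refine ⟨c, ?_⟩
  ext v
  have h1 : f v = T v := rfl
  rw [← h1, ← hc]
  rfl

lemma IsIrredUnitary.eq_bot_or_eq_top {π : Representation ℂ Dˣ V} (hπ : IsIrredUnitary π)
    (W : Submodule ℂ V) (hW : ∀ g, ∀ v ∈ W, π g v ∈ W) : W = ⊥ ∨ W = ⊤ := by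
  have := hπ.irreducible
  rcases IsSimpleOrder.eq_bot_or_eq_top (⟨W, fun g v hv => hW g v hv⟩ : Subrepresentation π) with h0 | h0
  · left
    exact congrArg Subrepresentation.toSubmodule h0
  · right
    exact congrArg Subrepresentation.toSubmodule h0

end Rep

/-! ### Smoothness and central characters -/

section Smooth

variable {D : Type*} [DivisionRing D] [TopologicalSpace D] [IsTopologicalRing D] [T2Space D]
  [ContinuousInv₀ D] [MeasurableSpace D]
  {q : ℝ} {n : ℕ} {N : D → ℝ} {μ : Measure Dˣ} (h : IsNormalizedAbs q n N μ)
  {V V₁ V₂ : Type*}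
  [NormedAddCommGroup V] [InnerProductSpace ℂ V] [FiniteDimensional ℂ V]
  [NormedAddCommGroup V₁] [InnerProductSpace ℂ V₁] [FiniteDimensional ℂ V₁]
  [NormedAddCommGroup V₂] [InnerProductSpace ℂ V₂] [FiniteDimensional ℂ V₂]
  {π : Representation ℂ Dˣ V} (hπ : IsIrredUnitary π)
  {π₁ : Representation ℂ Dˣ V₁} {π₂ : Representation ℂ Dˣ V₂}
include h

omit [FiniteDimensional ℂ V] in
lemma exists_open_subgroup_level (K : OpenSubgroup Dˣ) :
    ∃ m : ℕ, ∀ a : Dˣ, N ((a : D) - 1) ≤ q ^ (-(m : ℤ)) → a ∈ K := by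
  have h1 := (isOpenEmbedding_unitsVal D).image_mem_nhds.2 (K.isOpen.mem_nhds K.one_mem)
  rw [Units.val_one] at h1
  have h2 : Filter.Tendsto (fun x : D => x + 1) (nhds 0) (nhds 1) := by
    have : Filter.Tendsto (fun x : D => x + 1) (nhds 0) (nhds (0 + 1)) :=
      (continuous_id.add continuous_const).tendsto 0
    rwa [zero_add] at this
  obtain ⟨k, -, hk⟩ := h.hasBasis.mem_iff.1 (h2 h1)
  refine ⟨(-k).toNat, fun a ha => ?_⟩
  have h3 : (a : D) - 1 ∈ {x | N x ≤ q ^ k} :=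
    ha.trans (zpow_le_zpow_right₀ h.one_lt_q.le (by omega))
  have h4 := hk h3
  rw [Set.mem_preimage, sub_add_cancel] at h4
  obtain ⟨b, hb, hba⟩ := h4
  rwa [← Units.ext hba]

include hπ in
lemma IsIrredUnitary.exists_level :
    ∃ m : ℕ, ∀ a : Dˣ, N ((a : D) - 1) ≤ q ^ (-(m : ℤ)) → repCLM π a = 1 := by
  let b := Module.finBasis ℂ V
  choose K hK using fun i => hπ.smooth (b i)
  choose m hm using fun i => exists_open_subgroup_level h (K i)
  refine ⟨∑ i, m i, fun a ha => ?_⟩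
  apply ContinuousLinearMap.coe_injective
  refine b.ext fun i => ?_
  refine hK i a (hm i a (ha.trans (zpow_le_zpow_right₀ h.one_lt_q.le ?_)))
  have : m i ≤ ∑ i, m i := Finset.single_le_sum (f := m) (fun _ _ => Nat.zero_le _) (Finset.mem_univ i)
  omega

include hπ in
lemma continuous_repCLM : Continuous (repCLM π) := by
  obtain ⟨m, hm⟩ := hπ.exists_level h
  refine IsLocallyConstant.continuous ((IsLocallyConstant.iff_eventually_eq _).2 fun a => ?_)
  have h1 : {x : Dˣ | N ((a⁻¹ * x : Dˣ) - 1 : D) ≤ q ^ (-(m : ℤ))} ∈ nhds a := by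
    have h2 : Continuous fun x : Dˣ => ((a⁻¹ * x : Dˣ) - 1 : D) :=
      (Units.continuous_val.comp (continuous_const.mul continuous_id)).sub continuous_const
    refine ((h.isOpen_le _).preimage h2).mem_nhds ?_
    simp [h.map_zero, (pow_pos h.q_pos _).le]
  filter_upwards [h1] with x hx
  have h3 := map_mul (repCLM π) a (a⁻¹ * x)
  rwa [hm _ hx, mul_one, mul_inv_cancel_left] at h3

include hπ in
lemma continuous_chi : Continuous (chi π) :=
  (traceCLM V).continuous.comp (continuous_repCLM h hπ)

lemma isSmoothIsometric_tensorRep (hπ₁ : IsIrredUnitary π₁) (hπ₂ : IsIrredUnitary π₂) :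
    IsSmoothIsometric q N (tensorRep π₁ π₂) := by
  refine ⟨fun ⟨a, b⟩ v => ?_, ?_⟩
  · let f : V₁ →ₗᵢ[ℂ] V₁ := ⟨π₁ a, hπ₁.unitary a⟩
    let g : V₂ →ₗᵢ[ℂ] V₂ := ⟨π₂ b, hπ₂.unitary b⟩
    exact TensorProduct.norm_map f g v
  · obtain ⟨m₁, h₁⟩ := hπ₁.exists_level h
    obtain ⟨m₂, h₂⟩ := hπ₂.exists_level h
    refine ⟨m₁ + m₂, fun a b ha hb => ?_⟩
    rw [tensorRep_apply, h₁ a (ha.trans (zpow_le_zpow_right₀ h.one_lt_q.le (by omega))),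
      h₂ b (hb.trans (zpow_le_zpow_right₀ h.one_lt_q.le (by omega))), tensorCLM_one]

omit h [MeasurableSpace D] [IsTopologicalRing D] [T2Space D] [ContinuousInv₀ D] in
lemma IsIrredUnitary.exists_central_eq_smul (hπ : IsIrredUnitary π) {u : Dˣ}
    (hu : ∀ x, u * x = x * u) :
    ∃ c : ℂ, ‖c‖ = 1 ∧ repCLM π u = c • 1 ∧ repCLM π u⁻¹ = c⁻¹ • 1 := by
  obtain ⟨c, hc⟩ := hπ.exists_eq_smul (T := repCLM π u) fun g => by rw [← map_mul, ← map_mul, hu]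
  have := hπ.nontrivial
  obtain ⟨v, hv⟩ := exists_ne (0 : V)
  have h1 := hπ.unitary u v
  have h2 : π u v = c • v := congrArg (fun S : V →L[ℂ] V => S v) hc
  rw [h2, norm_smul] at h1
  have h3 : ‖c‖ = 1 := by
    have := norm_pos_iff.2 hv
    field_simp at h1
    exact h1
  have hc0 : c ≠ 0 := by
    rintro rfl
    simp at h3
  refine ⟨c, h3, hc, ?_⟩
  have h4 := map_mul (repCLM π) u u⁻¹
  rw [mul_inv_cancel, map_one, hc, smul_mul_assoc, one_mul] at h4
  rw [h4, smul_smul, inv_mul_cancel₀ hc0, one_smul]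

end Smooth

/-! ### Periodicity of the sphere operators -/

section Periodic

variable {D : Type*} [DivisionRing D] [TopologicalSpace D] [IsTopologicalRing D] [T2Space D]
  [ContinuousInv₀ D] [MeasurableSpace D] [BorelSpace D] [BorelSpace Dˣ]
  [SecondCountableTopology D] [SecondCountableTopology Dˣ]
  {q : ℝ} {n : ℕ} {N : D → ℝ} {μ : Measure Dˣ} (h : IsNormalizedAbs q n N μ)
  {V₁ V₂ : Type*}
  [NormedAddCommGroup V₁] [InnerProductSpace ℂ V₁] [FiniteDimensional ℂ V₁]
  [NormedAddCommGroup V₂] [InnerProductSpace ℂ V₂] [FiniteDimensional ℂ V₂]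
  {π₁ : Representation ℂ Dˣ V₁} {π₂ : Representation ℂ Dˣ V₂}
  (hπ₁ : IsIrredUnitary π₁) (hπ₂ : IsIrredUnitary π₂)
include h

lemma sphereOp_add_of_eq_smul {V : Type*} [NormedAddCommGroup V] [NormedSpace ℂ V]
    [CompleteSpace V] {σ : Dˣ × Dˣ →* (V →L[ℂ] V)}
    {u : Dˣ} {j : ℤ} (hu : u ∈ sphere q N j) {ω : ℂ} (hω : σ (u, u⁻¹) = ω • 1)
    (hcomm : ∀ x, u * x = x * u) (k : ℤ) :
    sphereOp q N μ σ (k + j) = ω • sphereOp q N μ σ k := by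
  rw [sphereOp, add_comm k j, ← h.integral_sphere_mul_left _ hu, sphereOp, ← integral_smul]
  refine setIntegral_congr_fun (h.measurableSet_sphere k) fun w _ => ?_
  have h1 : tau σ (u * w) = σ (u, u⁻¹) * tau σ w := by
    rw [tau, tau, rep_mul]
    congr 2
    rw [mul_inv_rev, ← inv_inj, mul_inv_rev, mul_inv_rev, inv_inv, inv_inv, hcomm]
  rw [h1, hω, smul_mul_assoc, one_mul]

include hπ₁ hπ₂ in
-- A central element of valuation n acts by scalars of modulus 1, so the period n is available for
-- any π₁ and π₂. This suffices for convergence and continuation; the two cases use finer periods.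
lemma exists_regHyp : ∃ ω ω' : ℂ, RegHyp q n ω n N μ (tensorRep π₁ π₂) ∧
    RegHyp q n ω' n N μ (swapRep (tensorRep π₁ π₂)) := by
  obtain ⟨u, hcomm, hu⟩ := h.exists_central
  have hu' : u ∈ sphere q N n := hu
  obtain ⟨c₁, hc₁, h1, h1'⟩ := hπ₁.exists_central_eq_smul hcomm
  obtain ⟨c₂, hc₂, h2, h2'⟩ := hπ₂.exists_central_eq_smul hcomm
  have hσ := isSmoothIsometric_tensorRep h hπ₁ hπ₂
  have key : ∀ (c d : ℂ), tensorCLM (c • (1 : V₁ →L[ℂ] V₁)) (d • (1 : V₂ →L[ℂ] V₂)) =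
      (c * d) • 1 := by
    intro c d
    refine clm_tensor_ext fun x y => ?_
    simp [TensorProduct.smul_tmul', TensorProduct.tmul_smul, smul_smul, mul_comm]
  have hcomplete : CompleteSpace (V₁ ⊗[ℂ] V₂) := FiniteDimensional.complete ℂ _
  refine ⟨c₁ * c₂⁻¹, c₁⁻¹ * c₂, ⟨h, hσ, h.n_pos, by simp [hc₁, hc₂], fun k => ?_⟩,
    ⟨h, hσ.swap, h.n_pos, by simp [hc₁, hc₂], fun k => ?_⟩⟩
  · refine sphereOp_add_of_eq_smul h hu' ?_ hcomm k
    rw [tensorRep_apply, h1, h2', key]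
  · refine sphereOp_add_of_eq_smul h hu' ?_ hcomm k
    rw [swapRep_apply, tensorRep_apply, h1', h2, key]

end Periodic

/-! ### Averages over conjugates -/

lemma sum_range_shift_of_periodic {E : Type*} [AddCommGroup E] {f : ℤ → E} {n : ℕ}
    (hf : ∀ k, f (k + n) = f k) (k : ℤ) :
    ∑ i ∈ Finset.range n, f (k + i) = ∑ i ∈ Finset.range n, f i := by
  have h1 : ∀ k : ℤ, ∑ i ∈ Finset.range n, f (k + 1 + i) = ∑ i ∈ Finset.range n, f (k + i) := by
    intro k
    have h1 := Finset.sum_range_succ (fun i : ℕ => f (k + i)) n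
    rw [Finset.sum_range_succ', hf] at h1
    simp only [Nat.cast_zero, add_zero] at h1
    rw [← add_right_cancel h1]
    refine Finset.sum_congr rfl fun i _ => ?_
    congr 1
    push_cast
    ring
  induction k using Int.induction_on with
  | zero => simp only [zero_add]
  | succ k ih => rw [h1, ih]
  | pred k ih => rw [← ih, ← h1]; simp only [sub_add_cancel]

section Averages

variable {D : Type*} [DivisionRing D] [TopologicalSpace D] [IsTopologicalRing D] [T2Space D]
  [ContinuousInv₀ D] [MeasurableSpace D] [BorelSpace D] [BorelSpace Dˣ]
  [SecondCountableTopology D] [SecondCountableTopology Dˣ]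
  {q : ℝ} {n : ℕ} {N : D → ℝ} {μ : Measure Dˣ} (h : IsNormalizedAbs q n N μ)
  {V V₁ V₂ E : Type*}
  [NormedAddCommGroup E] [NormedSpace ℂ E] [FiniteDimensional ℂ E]
  [NormedAddCommGroup V] [InnerProductSpace ℂ V] [FiniteDimensional ℂ V]
  [NormedAddCommGroup V₁] [InnerProductSpace ℂ V₁] [FiniteDimensional ℂ V₁]
  [NormedAddCommGroup V₂] [InnerProductSpace ℂ V₂] [FiniteDimensional ℂ V₂]
  {π : Representation ℂ Dˣ V} (hπ : IsIrredUnitary π)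
  {π₁ : Representation ℂ Dˣ V₁} {π₂ : Representation ℂ Dˣ V₂}
  (hπ₁ : IsIrredUnitary π₁) (hπ₂ : IsIrredUnitary π₂)

lemma traceCLM_one : traceCLM V 1 = Module.finrank ℂ V := LinearMap.trace_one ℂ V

lemma traceCLM_mul_comm (A B : V →L[ℂ] V) : traceCLM V (A * B) = traceCLM V (B * A) :=
  LinearMap.trace_mul_comm ℂ _ _

include hπ in
lemma IsIrredUnitary.finrank_ne_zero : (Module.finrank ℂ V : ℂ) ≠ 0 := by
  have := hπ.nontrivial
  exact_mod_cast Module.finrank_pos.ne'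

include hπ in
lemma IsIrredUnitary.eq_trace_smul {T : V →L[ℂ] V}
    (hT : ∀ g, repCLM π g * T * repCLM π g⁻¹ = T) :
    T = (traceCLM V T / Module.finrank ℂ V) • 1 := by
  obtain ⟨c, hc⟩ := hπ.exists_eq_smul (T := T) fun g => by
    conv_lhs => rw [← hT g]
    rw [mul_assoc, ← map_mul, inv_mul_cancel, map_one, mul_one]
  have h1 : traceCLM V T = c * Module.finrank ℂ V := by
    conv_lhs => rw [hc]
    rw [map_smul, traceCLM_one, smul_eq_mul]
  rw [h1, mul_div_cancel_right₀ _ hπ.finrank_ne_zero]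
  exact hc

/-- Conjugation by a fixed operator and its inverse, as an operator. -/
def conjCLM (π : Representation ℂ Dˣ V) (g : Dˣ) : (V →L[ℂ] V) →L[ℂ] (V →L[ℂ] V) :=
  LinearMap.toContinuousLinearMap
    { toFun := fun T => repCLM π g * T * repCLM π g⁻¹
      map_add' := fun A B => by rw [mul_add, add_mul]
      map_smul' := fun c A => by simp }

lemma conjCLM_apply (π : Representation ℂ Dˣ V) (g : Dˣ) (T : V →L[ℂ] V) :
    conjCLM π g T = repCLM π g * T * repCLM π g⁻¹ := rfl

include h hπ in
lemma continuous_conjCLM_apply (Y : V →L[ℂ] V) : Continuous fun u => conjCLM π u Y := by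
  simp only [conjCLM_apply]
  have h1 := continuous_repCLM h hπ
  exact (h1.mul continuous_const).mul (h1.comp continuous_inv)

lemma conjCLM_conjCLM (π : Representation ℂ Dˣ V) (g u : Dˣ) (T : V →L[ℂ] V) :
    conjCLM π g (conjCLM π u T) = conjCLM π (g * u) T := by
  simp only [conjCLM_apply, mul_inv_rev, map_mul, mul_assoc]

lemma traceCLM_conjCLM (π : Representation ℂ Dˣ V) (u : Dˣ) (T : V →L[ℂ] V) :
    traceCLM V (conjCLM π u T) = traceCLM V T := by
  rw [conjCLM_apply, traceCLM_mul_comm, ← mul_assoc, ← map_mul, inv_mul_cancel, map_one, one_mul]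

include h in
lemma measureReal_sphere (k : ℤ) : μ.real (sphere q N k) = 1 := by
  rw [Measure.real, h.measure_sphere, ENNReal.toReal_one]

include h hπ in
/-- The orthogonality relations. -/
lemma sum_integral_conjCLM (Y : V →L[ℂ] V) (k : ℤ) :
    ∑ i ∈ Finset.range n, ∫ u in sphere q N (k + i), conjCLM π u Y ∂μ =
      (n * traceCLM V Y / Module.finrank ℂ V) • 1 := by
  set f : ℤ → V →L[ℂ] V := fun k => ∫ u in sphere q N k, conjCLM π u Y ∂μ with hf
  set G : ℤ → V →L[ℂ] V := fun k => ∑ i ∈ Finset.range n, f (k + i) with hG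
  have hint : ∀ k, IntegrableOn (fun u => conjCLM π u Y) (sphere q N k) μ := fun k =>
    h.integrableOn_of_continuous (continuous_conjCLM_apply h hπ Y) le_rfl
  have hshift : ∀ (g : Dˣ) (j k : ℤ), g ∈ sphere q N j → conjCLM π g (f k) = f (j + k) := by
    intro g j k hg
    rw [hf]
    dsimp only
    rw [← h.integral_sphere_mul_left _ hg, ← ContinuousLinearMap.integral_comp_comm _ (hint k)]
    simp only [conjCLM_conjCLM]
  obtain ⟨c, hcomm, hc⟩ := h.exists_central
  -- Conjugation by a central element is trivial, so n consecutive spheres represent all of D^*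
  -- modulo that element, and their sum G commutes with π.
  have hper : ∀ k, f (k + n) = f k := by
    intro k
    rw [add_comm, ← hshift c n k hc, conjCLM_apply]
    obtain ⟨z, hz, h1, h2⟩ := hπ.exists_central_eq_smul hcomm
    have hz0 : z ≠ 0 := by
      rintro rfl
      simp at hz
    rw [h1, h2, smul_mul_assoc, one_mul, mul_smul_comm, mul_one, smul_smul, inv_mul_cancel₀ hz0,
      one_smul]
  have hGk : ∀ j k, G (j + k) = G k := fun j k =>
    (sum_range_shift_of_periodic hper (j + k)).trans (sum_range_shift_of_periodic hper k).symm
  have hcomm : ∀ g, repCLM π g * G k * repCLM π g⁻¹ = G k := by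
    intro g
    obtain ⟨j, hj⟩ := h.exists_mem_sphere g
    rw [← conjCLM_apply, hG]
    dsimp only
    rw [map_sum]
    simp only [hshift g j _ hj]
    simp only [← add_assoc]
    exact hGk j k
  change G k = _
  rw [hπ.eq_trace_smul hcomm]
  congr 2
  rw [hG]
  dsimp only
  rw [map_sum]
  have h3 : ∀ k, traceCLM V (f k) = traceCLM V Y := by
    intro k
    rw [hf]
    dsimp only
    rw [← ContinuousLinearMap.integral_comp_comm _ (hint k)]
    simp only [traceCLM_conjCLM]
    rw [setIntegral_const, measureReal_sphere h, one_smul]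
  simp [h3]

/-- The operation `conjOp` on operators on a finite-dimensional space. -/
lemma exists_conjOp_eq_clm {V : Type*} [NormedAddCommGroup V] [NormedSpace ℂ V]
    [FiniteDimensional ℂ V] (h : IsNormalizedAbs q n N μ) {σ : Dˣ × Dˣ →* (V →L[ℂ] V)}
    (hσ : IsSmoothIsometric q N σ) (k : ℤ) :
    ∃ K : (V →L[ℂ] V) →L[ℂ] (V →L[ℂ] V), ∀ X, conjOp q N μ σ k X = K X := by
  have : CompleteSpace V := FiniteDimensional.complete ℂ _
  have hint : ∀ X, IntegrableOn (fun u => σ (u, 1) * X * σ (u⁻¹, 1)) (sphere q N k) μ :=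
    fun X => h.integrableOn_of_continuous (continuous_conj h hσ X) le_rfl
  refine ⟨LinearMap.toContinuousLinearMap
    { toFun := conjOp q N μ σ k
      map_add' := fun A B => ?_
      map_smul' := fun c A => ?_ }, fun X => rfl⟩
  · simp only [conjOp]
    rw [← integral_add (hint A) (hint B)]
    simp only [mul_add, add_mul]
  · simp only [conjOp, RingHom.id_apply]
    rw [← integral_smul]
    simp only [mul_smul_comm, smul_mul_assoc]

variable {σ : Dˣ × Dˣ →* (E →L[ℂ] E)} (hσ : IsSmoothIsometric q N σ)
  {Θ : (V₁ →L[ℂ] V₁) → (V₂ →L[ℂ] V₂) → E →L[ℂ] E}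

/-- The representation `σ` is an external tensor product of `π₁` and `π₂`, with `Θ` the tensor
product of operators. -/
structure IsExternalProduct (π₁ : Representation ℂ Dˣ V₁) (π₂ : Representation ℂ Dˣ V₂)
    (σ : Dˣ × Dˣ →* (E →L[ℂ] E)) (Θ : (V₁ →L[ℂ] V₁) → (V₂ →L[ℂ] V₂) → E →L[ℂ] E) : Prop where
  add_left : ∀ A A' B, Θ (A + A') B = Θ A B + Θ A' B
  smul_left : ∀ (c : ℂ) A B, Θ (c • A) B = c • Θ A B
  add_right : ∀ A B B', Θ A (B + B') = Θ A B + Θ A B'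
  smul_right : ∀ (c : ℂ) A B, Θ A (c • B) = c • Θ A B
  mul : ∀ A A' B B', Θ A B * Θ A' B' = Θ (A * A') (B * B')
  one : Θ 1 1 = 1
  rep : ∀ a b, σ (a, b) = Θ (repCLM π₁ a) (repCLM π₂ b)

lemma IsExternalProduct.exists_left (hΘ : IsExternalProduct π₁ π₂ σ Θ) (B : V₂ →L[ℂ] V₂) :
    ∃ T : (V₁ →L[ℂ] V₁) →L[ℂ] (E →L[ℂ] E), ∀ A, Θ A B = T A :=
  ⟨LinearMap.toContinuousLinearMap
    { toFun := fun A => Θ A B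
      map_add' := fun A A' => hΘ.add_left A A' B
      map_smul' := fun c A => hΘ.smul_left c A B }, fun _ => rfl⟩

lemma IsExternalProduct.exists_right (hΘ : IsExternalProduct π₁ π₂ σ Θ) (A : V₁ →L[ℂ] V₁) :
    ∃ T : (V₂ →L[ℂ] V₂) →L[ℂ] (E →L[ℂ] E), ∀ B, Θ A B = T B :=
  ⟨LinearMap.toContinuousLinearMap
    { toFun := fun B => Θ A B
      map_add' := fun B B' => hΘ.add_right A B B'
      map_smul' := fun c B => hΘ.smul_right c A B }, fun _ => rfl⟩

variable (hΘ : IsExternalProduct π₁ π₂ σ Θ)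

include h hπ₁ hΘ in
lemma sum_conjOp_externalProduct (Y : V₁ →L[ℂ] V₁) (Z : V₂ →L[ℂ] V₂) (k : ℤ) :
    ∑ i ∈ Finset.range n, conjOp q N μ σ (k + i) (Θ Y Z) =
      (n * traceCLM V₁ Y / Module.finrank ℂ V₁) • Θ 1 Z := by
  have : CompleteSpace E := FiniteDimensional.complete ℂ _
  obtain ⟨T, hT⟩ := hΘ.exists_left Z
  have h1 : ∀ k, conjOp q N μ σ k (Θ Y Z) = T (∫ u in sphere q N k, conjCLM π₁ u Y ∂μ) := by
    intro k
    rw [← ContinuousLinearMap.integral_comp_comm _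
      (h.integrableOn_of_continuous (continuous_conjCLM_apply h hπ₁ Y) le_rfl), conjOp]
    refine setIntegral_congr_fun (h.measurableSet_sphere _) fun u _ => ?_
    rw [hΘ.rep, hΘ.rep, hΘ.mul, hΘ.mul, map_one, one_mul, mul_one, hT]
    rfl
  simp only [h1]
  rw [← map_sum, sum_integral_conjCLM h hπ₁, map_smul, hT]

include h hσ hπ₁ hπ₂ hΘ in
-- Averaging in the first factor replaces π₁(w) by the scalar χ₁(w)/d₁. The remaining integral of
-- χ₁(w)π₂(w⁻¹) commutes with π₂ because S is stable under conjugation, so Schur's lemma applies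
-- again.
lemma sum_conjOp_integral {S : Set Dˣ} (hS : MeasurableSet S) {m : ℤ} (hSm : S ⊆ sphere q N m)
    (hconj : ∀ g w, g * w * g⁻¹ ∈ S ↔ w ∈ S) (k : ℤ) :
    ∑ i ∈ Finset.range n, conjOp q N μ σ (k + i) (∫ w in S, tau σ w ∂μ) =
      (n * ((∫ w in S, chi π₁ w * chi π₂ w⁻¹ ∂μ) /
        (Module.finrank ℂ V₁ * Module.finrank ℂ V₂))) • 1 := by
  have hcomplete : CompleteSpace E := FiniteDimensional.complete ℂ _
  obtain ⟨T, hT⟩ := hΘ.exists_right 1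
  choose K hK using fun i : ℕ => exists_conjOp_eq_clm h hσ (k + i)
  have hc1 := continuous_chi h hπ₁
  have hc2 := (continuous_repCLM h hπ₂).comp (continuous_inv (G := Dˣ))
  have hintτ : IntegrableOn (tau σ) S μ :=
    h.integrableOn_of_continuous (continuous_tau h hσ) hSm
  have hint : IntegrableOn (fun w => chi π₁ w • repCLM π₂ w⁻¹) S μ :=
    h.integrableOn_of_continuous (hc1.smul hc2) hSm
  have h1 : ∑ i ∈ Finset.range n, conjOp q N μ σ (k + i) (∫ w in S, tau σ w ∂μ) =
      ∫ w in S, (n / Module.finrank ℂ V₁ : ℂ) • T (chi π₁ w • repCLM π₂ w⁻¹) ∂μ := by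
    simp only [hK]
    simp only [← sum_apply]
    rw [← ContinuousLinearMap.integral_comp_comm _ hintτ]
    refine setIntegral_congr_fun hS fun w _ => ?_
    simp only [sum_apply, ← hK]
    rw [tau, hΘ.rep, sum_conjOp_externalProduct h hπ₁ hΘ, map_smul, smul_smul, ← chi_eq, hT]
    congr 1
    ring
  set C := ∫ w in S, chi π₁ w • repCLM π₂ w⁻¹ ∂μ with hC
  rw [h1, integral_smul, ContinuousLinearMap.integral_comp_comm _ hint, ← hC]
  have hcomm : ∀ g, repCLM π₂ g * C * repCLM π₂ g⁻¹ = C := by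
    intro g
    rw [← conjCLM_apply, hC, ← ContinuousLinearMap.integral_comp_comm _ hint]
    have h2 := h.setIntegral_mul_left (fun w => chi π₁ (w * g⁻¹) • repCLM π₂ (w * g⁻¹)⁻¹) g
      ((· * g⁻¹) ⁻¹' S)
    rw [h.setIntegral_mul_right (fun w => chi π₁ w • repCLM π₂ w⁻¹) g⁻¹] at h2
    rw [← h2]
    have h3 : (g * ·) ⁻¹' ((· * g⁻¹) ⁻¹' S) = S := by
      ext w
      exact hconj g w
    rw [h3]
    refine setIntegral_congr_fun hS fun w _ => ?_
    rw [chi_conj, map_smul, conjCLM_apply]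
    simp only [mul_inv_rev, inv_inv, map_mul, mul_assoc]
  have h4 := hπ₂.eq_trace_smul hcomm
  have h5 : traceCLM V₂ C = ∫ w in S, chi π₁ w * chi π₂ w⁻¹ ∂μ := by
    rw [hC, ← ContinuousLinearMap.integral_comp_comm _ hint]
    refine setIntegral_congr_fun hS fun w _ => ?_
    rw [map_smul, ← chi_eq, smul_eq_mul]
  have h6 : T C = (traceCLM V₂ C / Module.finrank ℂ V₂) • (1 : E →L[ℂ] E) := by
    conv_lhs => rw [h4]
    rw [map_smul, ← hT, hΘ.one]
  rw [← h5, h6, smul_smul]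
  congr 1
  rw [div_mul_div_comm, mul_div_assoc]

/-- The integral of `χ₁(w) χ₂(w⁻¹)` over a sphere. -/
def sphereChi (q : ℝ) (N : D → ℝ) (μ : Measure Dˣ) (π₁ : Representation ℂ Dˣ V₁)
    (π₂ : Representation ℂ Dˣ V₂) (k : ℤ) : ℂ :=
  ∫ w in sphere q N k, chi π₁ w * chi π₂ w⁻¹ ∂μ

/-- The integral of `χ₁(w) χ₂(w⁻¹)` over a congruence subgroup. -/
def ballChi (q : ℝ) (N : D → ℝ) (μ : Measure Dˣ) (π₁ : Representation ℂ Dˣ V₁)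
    (π₂ : Representation ℂ Dˣ V₂) (L : ℕ) : ℂ :=
  ∫ w in congrBall q N L, chi π₁ w * chi π₂ w⁻¹ ∂μ

include h in
lemma conj_mem_sphere_iff {k : ℤ} (g w : Dˣ) : g * w * g⁻¹ ∈ sphere q N k ↔ w ∈ sphere q N k := by
  obtain ⟨j, hj⟩ := h.exists_mem_sphere g
  rw [h.mul_mem_sphere_iff' (h.inv_mem_sphere hj), h.mul_mem_sphere_iff hj]
  ring_nf

include h in
lemma conj_mem_congrBall_iff {L : ℕ} (g w : Dˣ) :
    g * w * g⁻¹ ∈ congrBall q N L ↔ w ∈ congrBall q N L := by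
  have h1 : ((g * w * g⁻¹ : Dˣ) : D) - 1 = g * ((w : D) - 1) * (g⁻¹ : Dˣ) := by
    rw [mul_sub, sub_mul, mul_one, Units.mul_inv]
    rfl
  have h2 : N (((g * w * g⁻¹ : Dˣ) : D) - 1) = N ((w : D) - 1) := by
    rw [h1, h.map_mul, h.map_mul, mul_right_comm, ← h.map_mul, Units.mul_inv, h.map_one, one_mul]
  change N _ < _ ↔ N _ < _
  rw [h2]

include h hσ hπ₁ hπ₂ hΘ in
theorem hasAverages : HasAverages q n N μ σ
    (fun m => sphereChi q N μ π₁ π₂ m / (Module.finrank ℂ V₁ * Module.finrank ℂ V₂))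
    (fun L => ballChi q N μ π₁ π₂ L / (Module.finrank ℂ V₁ * Module.finrank ℂ V₂)) where
  sphere k m := sum_conjOp_integral h hπ₁ hπ₂ hσ hΘ (h.measurableSet_sphere m) le_rfl
    (conj_mem_sphere_iff h) k
  ball k L := sum_conjOp_integral h hπ₁ hπ₂ hσ hΘ (measurableSet_congrBall h L)
    (congrBall_subset_sphere h L) (conj_mem_congrBall_iff h) k

end Averages

section TensorProduct

variable {D : Type*} [DivisionRing D] {V₁ V₂ : Type*}
  [NormedAddCommGroup V₁] [InnerProductSpace ℂ V₁] [FiniteDimensional ℂ V₁]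
  [NormedAddCommGroup V₂] [InnerProductSpace ℂ V₂] [FiniteDimensional ℂ V₂]

theorem isExternalProduct_tensorRep (π₁ : Representation ℂ Dˣ V₁) (π₂ : Representation ℂ Dˣ V₂) :
    IsExternalProduct π₁ π₂ (tensorRep π₁ π₂) tensorCLM where
  add_left _ _ _ := clm_tensor_ext fun _ _ => TensorProduct.add_tmul _ _ _
  smul_left _ _ _ := clm_tensor_ext fun _ _ => TensorProduct.smul_tmul' _ _ _
  add_right _ _ _ := clm_tensor_ext fun _ _ => TensorProduct.tmul_add _ _ _
  smul_right _ _ _ := clm_tensor_ext fun _ _ => TensorProduct.tmul_smul _ _ _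
  mul := tensorCLM_mul
  one := tensorCLM_one
  rep := tensorRep_apply π₁ π₂

end TensorProduct

/-! ### The integral `ι` as a sum over congruence subgroups -/

section Iota

variable {D : Type*} [DivisionRing D] [TopologicalSpace D] [IsTopologicalRing D] [T2Space D]
  [ContinuousInv₀ D] [MeasurableSpace D] [BorelSpace D] [BorelSpace Dˣ]
  [SecondCountableTopology D] [SecondCountableTopology Dˣ]
  {q : ℝ} {n : ℕ} {N : D → ℝ} {μ : Measure Dˣ} (h : IsNormalizedAbs q n N μ)
include h

/-- On the congruence subgroups N = 1, so both measures agree up to translation by 1, and the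
additive measure of a ball scales by q^(-n). -/
lemma measureReal_congrBall (L : ℕ) :
    μ.real (congrBall q N L) = μ.real (congrBall q N 0) * ((q ^ n)⁻¹) ^ L := by
  have h1 : ∀ L : ℕ, μ.real (congrBall q N L) =
      ∫ x in {x | N x < q ^ (-(L : ℤ))}, (1 : ℝ) ∂(unitsAddMeasure n N μ) := by
    intro L
    have hm : MeasurableSet {x : D | N (x - 1) < q ^ (-(L : ℤ))} :=
      ((h.isOpen_lt _).preimage (continuous_id.sub continuous_const)).measurableSet
    have h2 := h.setIntegral_add_left (fun _ => (1 : ℝ)) 1 {x : D | N (x - 1) < q ^ (-(L : ℤ))}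
    have h3 : ((1 : D) + ·) ⁻¹' {x : D | N (x - 1) < q ^ (-(L : ℤ))} =
        {x | N x < q ^ (-(L : ℤ))} := by
      ext x
      simp
    rw [h3] at h2
    rw [h2, h.setIntegral_unitsAddMeasure _ hm]
    have h4 : ∫ w in congrBall q N L, N (w : D) ^ n • (1 : ℝ) ∂μ = ∫ w in congrBall q N L, 1 ∂μ := by
      refine setIntegral_congr_fun (measurableSet_congrBall h L) fun w hw => ?_
      have h5 : N (w : D) = 1 := by simpa [sphere] using congrBall_subset_sphere h L hw
      simp [h5]
    rw [setIntegral_const, smul_eq_mul, mul_one] at h4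
    exact h4.symm
  obtain ⟨a, ha⟩ := h.exists_mem_sphere_index L
  have ha' : N (a : D) = q ^ (-(L : ℤ)) := ha
  have hm : MeasurableSet {x : D | N x < q ^ (-(L : ℤ))} := (h.isOpen_lt _).measurableSet
  have h2 := h.setIntegral_unit_mul (fun _ => (1 : ℝ)) a hm
  have h3 : (fun x => (a : D) * x) ⁻¹' {x | N x < q ^ (-(L : ℤ))} =
      {x | N x < q ^ (-((0 : ℕ) : ℤ))} := by
    ext x
    rw [Set.mem_preimage, Set.mem_ofPred_eq, Set.mem_ofPred_eq, h.map_mul, ha']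
    simp only [Nat.cast_zero, neg_zero, zpow_zero]
    exact mul_lt_iff_lt_one_right (zpow_pos h.q_pos _)
  rw [h3, ← h1, ← h1, ha', smul_eq_mul] at h2
  have h4 := h.q_pos
  rw [h2]
  have h5 : (q ^ (-(L : ℤ))) ^ n = ((q ^ n)⁻¹) ^ L := by
    rw [zpow_neg, zpow_natCast, inv_pow, inv_pow, ← pow_mul, ← pow_mul, mul_comm]
  rw [h5]
  have h6 : ((q ^ n)⁻¹) ^ L ≠ 0 := by positivity
  field_simp

lemma measure_singleton_one : μ {1} = 0 := by
  have hfin : ∀ L, μ (congrBall q N L) ≠ ⊤ := fun L => by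
    refine ((measure_mono (congrBall_subset_sphere h L)).trans_lt ?_).ne
    rw [h.measure_sphere]
    exact ENNReal.one_lt_top
  have h1 : ∀ L : ℕ, μ.real {1} ≤ μ.real (congrBall q N 0) * ((q ^ n)⁻¹) ^ L := by
    intro L
    rw [← measureReal_congrBall h L]
    refine measureReal_mono (fun w hw => ?_) (hfin L)
    rw [Set.mem_singleton_iff.1 hw]
    change N _ < _
    rw [Units.val_one, sub_self, h.map_zero]
    exact zpow_pos h.q_pos _
  have h2 : (q ^ n)⁻¹ < 1 := inv_lt_one_of_one_lt₀ (one_lt_pow₀ h.one_lt_q h.n_pos.ne')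
  have h3 := (tendsto_pow_atTop_nhds_zero_of_lt_one
    (inv_nonneg.2 (pow_pos h.q_pos n).le) h2).const_mul (μ.real (congrBall q N 0))
  rw [mul_zero] at h3
  have h4 : μ.real {1} = 0 :=
    le_antisymm (ge_of_tendsto' h3 h1) measureReal_nonneg
  have h5 : μ {(1 : Dˣ)} ≠ ⊤ := by
    refine ((measure_mono (fun w hw => ?_)).trans_lt (hfin 0).lt_top).ne
    rw [Set.mem_singleton_iff.1 hw]
    change N _ < _
    rw [Units.val_one, sub_self, h.map_zero]
    exact zpow_pos h.q_pos _
  exact (measureReal_eq_zero_iff h5).1 h4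

/-- Away from `1`, the function `max(v(g - 1), 0)` is the sum of the indicator functions of the
congruence subgroups. -/
lemma hasSum_indicator_congrBall (c : Dˣ → ℂ) {g : Dˣ} (hg : g ≠ 1) :
    HasSum (fun L => (congrBall q N L).indicator c g)
      (((max (-Real.logb q (N ((g : D) - 1))) 0 : ℝ) : ℂ) * c g) := by
  have hg' : (g : D) - 1 ≠ 0 := by
    rw [sub_ne_zero]
    exact fun h0 => hg (Units.ext h0)
  obtain ⟨j, hj⟩ := h.exists_zpow _ hg'
  have hq : q ≠ 1 := h.one_lt_q.ne'
  have h1 : Real.logb q (N ((g : D) - 1)) = j := by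
    rw [hj, ← Real.rpow_intCast, Real.logb_rpow h.q_pos hq]
  have h2 : ∀ L : ℕ, g ∈ congrBall q N L ↔ L < (-j).toNat := by
    intro L
    change N _ < _ ↔ _
    rw [hj, zpow_lt_zpow_iff_right₀ h.one_lt_q]
    omega
  have h3 : (max (-(j : ℝ)) 0 : ℝ) = (-j).toNat := by
    have : (((-j).toNat : ℤ) : ℝ) = ((max (-j) 0 : ℤ) : ℝ) := by rw [Int.toNat_eq_max]
    rw [Int.cast_natCast] at this
    rw [this]
    push_cast
    rfl
  rw [h1, h3]
  have h4 : HasSum (fun L => (congrBall q N L).indicator c g)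
      (∑ L ∈ Finset.range (-j).toNat, (congrBall q N L).indicator c g) :=
    hasSum_sum_of_ne_finset_zero fun L hL => by
      refine Set.indicator_of_notMem ?_ _
      rw [h2]
      simpa using hL
  convert h4 using 1
  rw [Finset.sum_congr rfl (g := fun _ => c g) (fun L hL => by
    refine Set.indicator_of_mem ?_ _
    rw [h2]
    simpa using hL), Finset.sum_const, Finset.card_range, nsmul_eq_mul]
  push_cast
  rfl

/-- The function c is bounded on the compact group of units of norm 1, and the congruence subgroups
have geometrically decreasing volume, so summation and integration commute. -/
lemma integrable_and_hasSum_congrBall {c : Dˣ → ℂ} (hc : Continuous c) :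
    Integrable (fun g : Dˣ => ((max (-Real.logb q (N ((g : D) - 1))) 0 : ℝ) : ℂ) * c g) μ ∧
    HasSum (fun L => ∫ g in congrBall q N L, c g ∂μ)
      (∫ g : Dˣ, ((max (-Real.logb q (N ((g : D) - 1))) 0 : ℝ) : ℂ) * c g ∂μ) := by
  -- At g = 1 the logarithm takes the default value 0 while g lies in every congruence subgroup; the
  -- point must be discarded as a null set.
  have hae : ∀ᵐ g ∂μ, g ≠ (1 : Dˣ) := by
    rw [ae_iff]
    simpa using measure_singleton_one h
  obtain ⟨C, hC⟩ := (h.isCompact_sphere 0).exists_bound_of_continuousOn hc.continuousOn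
  have hfin : ∀ L, μ (congrBall q N L) < ⊤ := fun L => by
    refine (measure_mono (congrBall_subset_sphere h L)).trans_lt ?_
    rw [h.measure_sphere]
    exact ENNReal.one_lt_top
  have hm := fun L => measurableSet_congrBall h L
  have hint : ∀ L, Integrable ((congrBall q N L).indicator c) μ := fun L =>
    (integrable_indicator_iff (hm L)).2
      (h.integrableOn_of_continuous hc (congrBall_subset_sphere h L))
  have hnorm : ∀ L, ∫ g, ‖(congrBall q N L).indicator c g‖ ∂μ = ∫ g in congrBall q N L, ‖c g‖ ∂μ := by
    intro L
    simp only [norm_indicator_eq_indicator_norm]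
    exact integral_indicator (hm L)
  have hsum : Summable fun L => ∫ g, ‖(congrBall q N L).indicator c g‖ ∂μ := by
    have h2 : (q ^ n)⁻¹ < 1 := inv_lt_one_of_one_lt₀ (one_lt_pow₀ h.one_lt_q h.n_pos.ne')
    refine Summable.of_nonneg_of_le (fun L => integral_nonneg fun _ => norm_nonneg _) (fun L => ?_)
      ((summable_geometric_of_lt_one (inv_nonneg.2 (pow_pos h.q_pos n).le) h2).mul_left
        (C * μ.real (congrBall q N 0)))
    rw [hnorm, mul_assoc, ← measureReal_congrBall h L]
    refine (Real.le_norm_self _).trans (norm_setIntegral_le_of_norm_le_const (hfin L) fun g hg => ?_)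
    rw [norm_norm]
    exact hC g (congrBall_subset_sphere h L hg)
  have hs := hasSum_integral_of_summable_integral_norm hint hsum
  have heq : ∀ᵐ g ∂μ, ∑' L, (congrBall q N L).indicator c g =
      ((max (-Real.logb q (N ((g : D) - 1))) 0 : ℝ) : ℂ) * c g := by
    filter_upwards [hae] with g hg
    exact (hasSum_indicator_congrBall h c hg).tsum_eq
  rw [integral_congr_ae heq] at hs
  simp only [integral_indicator (hm _)] at hs
  refine ⟨⟨?_, ?_⟩, hs⟩
  · have h1 : Measurable fun g : Dˣ => N ((g : D) - 1) :=
      h.measurable.comp (Units.continuous_val.sub continuous_const).measurable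
    have h2 : Measurable fun g : Dˣ => ((max (-Real.logb q (N ((g : D) - 1))) 0 : ℝ) : ℂ) := by
      have h3 : Measurable fun x : ℝ => Real.logb q x := Real.measurable_log.div_const _
      exact Complex.measurable_ofReal.comp (((h3.comp h1).neg).max measurable_const)
    exact (h2.mul hc.measurable).aestronglyMeasurable
  · rw [HasFiniteIntegral]
    have h1 : ∫⁻ g : Dˣ, ‖((max (-Real.logb q (N ((g : D) - 1))) 0 : ℝ) : ℂ) * c g‖ₑ ∂μ ≤
        ∫⁻ g, ∑' L, ‖(congrBall q N L).indicator c g‖ₑ ∂μ := by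
      refine lintegral_mono_ae ?_
      filter_upwards [heq] with g hg
      rw [← hg]
      exact enorm_tsum_le_tsum_enorm
    refine h1.trans_lt ?_
    rw [lintegral_tsum fun L => (hint L).1.enorm]
    simp only [← ofReal_integral_norm_eq_lintegral_enorm (hint _)]
    rw [← ENNReal.ofReal_tsum_of_nonneg (fun L => integral_nonneg fun _ => norm_nonneg _) hsum]
    exact ENNReal.ofReal_lt_top

end Iota

/-! ### Integrals of matrix coefficients -/

section Coefficients

variable {D : Type*} [DivisionRing D] [TopologicalSpace D] [IsTopologicalRing D] [T2Space D]
  [ContinuousInv₀ D] [MeasurableSpace D] [BorelSpace D] [BorelSpace Dˣ]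
  [SecondCountableTopology D] [SecondCountableTopology Dˣ]
  {q : ℝ} {n : ℕ} {N : D → ℝ} {μ : Measure Dˣ} (h : IsNormalizedAbs q n N μ)
  {V V₁ V₂ E : Type*}
  [NormedAddCommGroup E] [NormedSpace ℂ E] [FiniteDimensional ℂ E]
  [NormedAddCommGroup V] [InnerProductSpace ℂ V] [FiniteDimensional ℂ V]
  [NormedAddCommGroup V₁] [InnerProductSpace ℂ V₁] [FiniteDimensional ℂ V₁]
  [NormedAddCommGroup V₂] [InnerProductSpace ℂ V₂] [FiniteDimensional ℂ V₂]
  {π : Representation ℂ Dˣ V} (hπ : IsIrredUnitary π)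
  {π₁ : Representation ℂ Dˣ V₁} {π₂ : Representation ℂ Dˣ V₂}
  (hπ₁ : IsIrredUnitary π₁) (hπ₂ : IsIrredUnitary π₂)
  {σ : Dˣ × Dˣ →* (E →L[ℂ] E)} (hσ : IsSmoothIsometric q N σ)
  {Θ : (V₁ →L[ℂ] V₁) → (V₂ →L[ℂ] V₂) → E →L[ℂ] E} (hΘ : IsExternalProduct π₁ π₂ σ Θ)

/-- The integral of a matrix coefficient of `π₁` against `π₂(w⁻¹)` over a sphere. -/
def coefOp (q : ℝ) (N : D → ℝ) (μ : Measure Dˣ) (π₁ : Representation ℂ Dˣ V₁)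
    (π₂ : Representation ℂ Dˣ V₂) (k : ℤ) (f : V₁ →L[ℂ] ℂ) (v : V₁) : V₂ →L[ℂ] V₂ :=
  ∫ w in sphere q N k, f (π₁ w v) • repCLM π₂ w⁻¹ ∂μ

include h hπ₁ hπ₂ in
lemma integrableOn_coef (k : ℤ) (f : V₁ →L[ℂ] ℂ) (v : V₁) :
    IntegrableOn (fun w => f (π₁ w v) • repCLM π₂ w⁻¹) (sphere q N k) μ := by
  have h1 : Continuous fun w => f (repCLM π₁ w v) :=
    f.continuous.comp ((continuous_repCLM h hπ₁).clm_apply continuous_const)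
  have h2 := (continuous_repCLM h hπ₂).comp (continuous_inv (G := Dˣ))
  exact h.integrableOn_of_continuous (h1.smul h2) le_rfl

include h hπ₁ hπ₂ in
-- By w ↦ wg, the map v ↦ `coefOp` intertwines π₁ and π₂ up to a shift of the sphere; it intertwines
-- exactly for O_D^*.
lemma coefOp_rep {g : Dˣ} {j : ℤ} (hg : g ∈ sphere q N j) (k : ℤ) (f : V₁ →L[ℂ] ℂ) (v : V₁) :
    coefOp q N μ π₁ π₂ k f (π₁ g v) = repCLM π₂ g * coefOp q N μ π₁ π₂ (k + j) f v := by
  have h1 := (ContinuousLinearMap.mul ℂ (V₂ →L[ℂ] V₂) (repCLM π₂ g)).integral_comp_comm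
    (integrableOn_coef h hπ₁ hπ₂ (k + j) f v)
  refine Eq.trans ?_ h1
  rw [coefOp, ← h.integral_sphere_mul_right _ hg k]
  refine setIntegral_congr_fun (h.measurableSet_sphere k) fun w _ => ?_
  rw [ContinuousLinearMap.mul_apply', mul_smul_comm, ← map_mul, mul_inv_rev, mul_inv_cancel_left,
    map_mul, Module.End.mul_apply]

include h hπ₁ hπ₂ in
/-- The map `v ↦ ∫ f(π₁(w) v) π₂(w⁻¹) v₂`. -/
lemma exists_coefOp_eq_linear (k : ℤ) (f : V₁ →L[ℂ] ℂ) (v₂ : V₂) :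
    ∃ T : V₁ →ₗ[ℂ] V₂, ∀ v, T v = coefOp q N μ π₁ π₂ k f v v₂ := by
  refine ⟨{ toFun := fun v => coefOp q N μ π₁ π₂ k f v v₂
            map_add' := fun v v' => ?_
            map_smul' := fun c v => ?_ }, fun _ => rfl⟩
  · rw [← add_apply]
    congr 1
    simp only [coefOp]
    rw [← integral_add (integrableOn_coef h hπ₁ hπ₂ k f v) (integrableOn_coef h hπ₁ hπ₂ k f v')]
    simp only [map_add, add_smul]
  · rw [RingHom.id_apply, ← smul_apply]
    congr 1
    simp only [coefOp]
    rw [← integral_smul]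
    simp only [map_smul, smul_assoc]

/-- The coordinate functionals of the standard basis. -/
def coordCLM (V : Type*) [NormedAddCommGroup V] [InnerProductSpace ℂ V] [FiniteDimensional ℂ V]
    (i : Fin (Module.finrank ℂ V)) : V →L[ℂ] ℂ :=
  LinearMap.toContinuousLinearMap ((Module.finBasis ℂ V).coord i)

/-- The matrix units of the standard basis. -/
def matUnit (V : Type*) [NormedAddCommGroup V] [InnerProductSpace ℂ V] [FiniteDimensional ℂ V]
    (i j : Fin (Module.finrank ℂ V)) : V →L[ℂ] V :=
  (coordCLM V j).smulRight (Module.finBasis ℂ V i)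

lemma coordCLM_basis (i j : Fin (Module.finrank ℂ V)) :
    coordCLM V i (Module.finBasis ℂ V j) = if j = i then 1 else 0 := by
  simp [coordCLM, Finsupp.single_apply]

lemma sum_coordCLM_smul (v : V) : ∑ i, coordCLM V i v • Module.finBasis ℂ V i = v :=
  (Module.finBasis ℂ V).sum_repr v

lemma sum_smul_matUnit (A : V →L[ℂ] V) :
    ∑ i, ∑ j, coordCLM V i (A (Module.finBasis ℂ V j)) • matUnit V i j = A := by
  apply ContinuousLinearMap.coe_injective
  refine (Module.finBasis ℂ V).ext fun j => ?_
  simp only [ContinuousLinearMap.coe_coe, sum_apply, smul_apply, matUnit,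
    ContinuousLinearMap.smulRight_apply, coordCLM_basis, ite_smul, one_smul, zero_smul, smul_ite,
    smul_zero, Finset.sum_ite_eq, Finset.mem_univ, if_true]
  exact sum_coordCLM_smul _

lemma traceCLM_eq_sum (A : V →L[ℂ] V) :
    traceCLM V A = ∑ i, coordCLM V i (A (Module.finBasis ℂ V i)) := by
  rw [traceCLM_apply, LinearMap.trace_eq_matrix_trace ℂ (Module.finBasis ℂ V), Matrix.trace]
  refine Finset.sum_congr rfl fun i _ => ?_
  rw [Matrix.diag_apply, LinearMap.toMatrix_apply]
  rfl

include h hσ hπ₁ hπ₂ hΘ in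
/-- The operators `sphereOp` in terms of integrals of matrix coefficients. -/
lemma exists_sphereOp_eq_sum_coefOp :
    ∃ T : Fin (Module.finrank ℂ V₁) → Fin (Module.finrank ℂ V₁) →
      (V₂ →L[ℂ] V₂) →L[ℂ] (E →L[ℂ] E),
      ∀ k, sphereOp q N μ σ k = ∑ i, ∑ j, T i j
        (coefOp q N μ π₁ π₂ k (coordCLM V₁ i) (Module.finBasis ℂ V₁ j)) := by
  have hcomplete : CompleteSpace E := FiniteDimensional.complete ℂ _
  choose T hT using fun A => hΘ.exists_right A
  refine ⟨fun i j => T (matUnit V₁ i j), fun k => ?_⟩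
  have hint := fun i j => integrableOn_coef h hπ₁ hπ₂ k (coordCLM V₁ i) (Module.finBasis ℂ V₁ j)
  have h1 : ∀ w, tau σ w = ∑ i, ∑ j, T (matUnit V₁ i j)
      (coordCLM V₁ i (π₁ w (Module.finBasis ℂ V₁ j)) • repCLM π₂ w⁻¹) := by
    intro w
    obtain ⟨S, hS⟩ := hΘ.exists_left (repCLM π₂ w⁻¹)
    rw [tau, hΘ.rep]
    conv_lhs => rw [hS, ← sum_smul_matUnit (repCLM π₁ w)]
    rw [map_sum]
    refine Finset.sum_congr rfl fun i _ => ?_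
    rw [map_sum]
    refine Finset.sum_congr rfl fun j _ => ?_
    rw [map_smul, map_smul, ← hS, ← hT]
    rfl
  rw [sphereOp]
  simp only [h1]
  rw [integral_finsetSum _ fun i _ => integrable_finsetSum _ fun j _ =>
    (T (matUnit V₁ i j)).integrable_comp (hint i j)]
  refine Finset.sum_congr rfl fun i _ => ?_
  rw [integral_finsetSum _ fun j _ => (T (matUnit V₁ i j)).integrable_comp (hint i j)]
  refine Finset.sum_congr rfl fun j _ => ?_
  exact (T (matUnit V₁ i j)).integral_comp_comm (hint i j)

include h hπ₁ hπ₂ in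
lemma sphereChi_eq_sum_coefOp (k : ℤ) :
    sphereChi q N μ π₁ π₂ k = ∑ i, traceCLM V₂
      (coefOp q N μ π₁ π₂ k (coordCLM V₁ i) (Module.finBasis ℂ V₁ i)) := by
  have hint := fun i => integrableOn_coef h hπ₁ hπ₂ k (coordCLM V₁ i) (Module.finBasis ℂ V₁ i)
  have h1 : ∀ w, chi π₁ w * chi π₂ w⁻¹ = ∑ i, traceCLM V₂
      (coordCLM V₁ i (π₁ w (Module.finBasis ℂ V₁ i)) • repCLM π₂ w⁻¹) := by
    intro w
    rw [chi_eq, traceCLM_eq_sum, Finset.sum_mul]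
    refine Finset.sum_congr rfl fun i _ => ?_
    rw [map_smul, smul_eq_mul, ← chi_eq]
    rfl
  rw [sphereChi]
  simp only [h1]
  rw [integral_finsetSum _ fun i _ => (traceCLM V₂).integrable_comp (hint i)]
  refine Finset.sum_congr rfl fun i _ => ?_
  exact (traceCLM V₂).integral_comp_comm (hint i)

include h hπ₁ hπ₂ in
-- On the unit sphere the coefficients define O_D^*-homomorphisms from π₁ to π₂, hence vanish;
-- `coefOp_rep` moves this to the other spheres.
lemma coefOp_eq_zero (hhom : ∀ T : V₁ →ₗ[ℂ] V₂,
    (∀ g ∈ sphere q N 0, ∀ v, T (π₁ g v) = π₂ g (T v)) → T = 0)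
    (k : ℤ) (f : V₁ →L[ℂ] ℂ) (v : V₁) : coefOp q N μ π₁ π₂ k f v = 0 := by
  have h0 : ∀ v, coefOp q N μ π₁ π₂ 0 f v = 0 := by
    intro v
    ext v₂
    obtain ⟨T, hT⟩ := exists_coefOp_eq_linear h hπ₁ hπ₂ 0 f v₂
    have h1 := hhom T fun g hg v => by
      rw [hT, hT, coefOp_rep h hπ₁ hπ₂ hg, add_zero]
      rfl
    rw [← hT, h1]
    rfl
  obtain ⟨g, hg⟩ := h.exists_mem_sphere_index k
  have h1 := coefOp_rep h hπ₁ hπ₂ hg 0 f v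
  rw [h0, zero_add] at h1
  have h2 := congrArg (fun A => repCLM π₂ g⁻¹ * A) h1
  rwa [mul_zero, ← mul_assoc, ← map_mul, inv_mul_cancel, map_one, one_mul, eq_comm] at h2

include h hπ in
/-- The sum over `n` consecutive spheres of the integral of `χ(w) χ(w⁻¹)`. -/
lemma sum_sphereChi : ∑ m ∈ Finset.range n, sphereChi q N μ π π m = n := by
  let ev : Fin (Module.finrank ℂ V) → Fin (Module.finrank ℂ V) → (V →L[ℂ] V) →L[ℂ] ℂ := fun i j =>
    (coordCLM V i).comp (ContinuousLinearMap.apply ℂ V (Module.finBasis ℂ V j))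
  -- The (i, j) entry of π(w)E_ij π(w⁻¹) is π(w)_ii π(w⁻¹)_jj, so the orthogonality relations for
  -- the matrix units E_ij apply.
  have h1 : ∀ w, chi π w * chi π w⁻¹ = ∑ i, ∑ j, ev i j (conjCLM π w (matUnit V i j)) := by
    intro w
    rw [chi_eq, chi_eq, traceCLM_eq_sum, traceCLM_eq_sum, Finset.sum_mul_sum]
    refine Finset.sum_congr rfl fun i _ => Finset.sum_congr rfl fun j _ => ?_
    rw [conjCLM_apply]
    change _ = coordCLM V i (repCLM π w (coordCLM V j _ • _))
    rw [map_smul, map_smul, smul_eq_mul, mul_comm]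
    rfl
  have hint : ∀ (m : ℤ) i j, IntegrableOn (fun w => conjCLM π w (matUnit V i j))
      (sphere q N m) μ := fun m i j =>
    h.integrableOn_of_continuous (continuous_conjCLM_apply h hπ _) le_rfl
  have h2 : ∀ m : ℤ, sphereChi q N μ π π m =
      ∑ i, ∑ j, ev i j (∫ w in sphere q N m, conjCLM π w (matUnit V i j) ∂μ) := by
    intro m
    rw [sphereChi]
    simp only [h1]
    rw [integral_finsetSum _ fun i _ => integrable_finsetSum _ fun j _ =>
      (ev i j).integrable_comp (hint m i j)]
    refine Finset.sum_congr rfl fun i _ => ?_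
    rw [integral_finsetSum _ fun j _ => (ev i j).integrable_comp (hint m i j)]
    refine Finset.sum_congr rfl fun j _ => ?_
    exact (ev i j).integral_comp_comm (hint m i j)
  simp only [h2]
  rw [Finset.sum_comm]
  have h3 : ∀ i, ∑ m ∈ Finset.range n, ∑ j, ev i j
      (∫ w in sphere q N (m : ℤ), conjCLM π w (matUnit V i j) ∂μ) = n / Module.finrank ℂ V := by
    intro i
    rw [Finset.sum_comm]
    have h4 : ∀ j, ∑ m ∈ Finset.range n, ev i j
        (∫ w in sphere q N (m : ℤ), conjCLM π w (matUnit V i j) ∂μ) =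
        if j = i then (n / Module.finrank ℂ V : ℂ) else 0 := by
      intro j
      rw [← map_sum]
      have h5 := sum_integral_conjCLM h hπ (matUnit V i j) 0
      simp only [zero_add] at h5
      rw [h5, map_smul]
      have h6 : ev i j 1 = if j = i then 1 else 0 := coordCLM_basis i j
      have h7 : traceCLM V (matUnit V i j) = if j = i then 1 else 0 := by
        rw [traceCLM_eq_sum]
        simp only [matUnit, ContinuousLinearMap.smulRight_apply, map_smul, coordCLM_basis,
          smul_eq_mul]
        simp [eq_comm]
      rw [h6, h7]
      split_ifs <;> simp
    simp only [h4]
    simp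
  rw [Finset.sum_congr rfl fun i _ => h3 i, Finset.sum_const, Finset.card_univ, Fintype.card_fin,
    nsmul_eq_mul, mul_div_cancel₀ _ hπ.finrank_ne_zero]

end Coefficients

/-- A sequence of length `n` is determined by its Fourier transform. -/
lemma eq_zero_of_fourier_eq_zero {E : Type*} [NormedAddCommGroup E] [NormedSpace ℂ E]
    {n : ℕ} (hn : 0 < n) {A : ℕ → E}
    (hA : ∀ ζ : ℂ, ζ ^ n = 1 → ∑ m ∈ Finset.range n, ζ ^ m • A m = 0) {m : ℕ} (hm : m < n) :
    A m = 0 := by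
  by_contra h0
  obtain ⟨f, hf⟩ := SeparatingDual.exists_ne_zero (R := ℂ) h0
  -- A polynomial of degree less than n that vanishes at all n-th roots of unity.
  let P : Polynomial ℂ := ∑ m ∈ Finset.range n, Polynomial.monomial m (f (A m))
  have hP : P = 0 := by
    refine Polynomial.eq_zero_of_degree_lt_of_eval_finset_eq_zero
      (Polynomial.nthRootsFinset n (1 : ℂ)) ?_ fun ζ hζ => ?_
    · rw [(Complex.isPrimitiveRoot_exp n hn.ne').card_nthRootsFinset]
      refine (Polynomial.degree_sum_le _ _).trans_lt ?_
      refine (Finset.sup_lt_iff (WithBot.bot_lt_coe n)).2 fun m hm => ?_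
      refine (Polynomial.degree_monomial_le _ _).trans_lt ?_
      exact WithBot.coe_lt_coe.2 (Finset.mem_range.1 hm)
    · rw [Polynomial.mem_nthRootsFinset hn] at hζ
      have := congrArg f (hA ζ hζ)
      rw [map_sum, map_zero] at this
      rw [Polynomial.eval_finsetSum, ← this]
      refine Finset.sum_congr rfl fun m _ => ?_
      rw [Polynomial.eval_monomial, map_smul, smul_eq_mul, mul_comm]
  refine hf ?_
  have h1 := congrArg (fun Q : Polynomial ℂ => Q.coeff m) hP
  simpa [P, Polynomial.finsetSum_coeff, Polynomial.coeff_monomial, hm] using h1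

/-! ### Unramified twists -/

section Twists

variable {D : Type*} [DivisionRing D]
  {V : Type*} [NormedAddCommGroup V] [InnerProductSpace ℂ V]

/-- The group of unramified characters `ω` with `π ⊗ ω ≃ π`. -/
def twists (N : D → ℝ) (π : Representation ℂ Dˣ V) : Subgroup (Dˣ →* ℂˣ) where
  carrier := {ω | (∀ u : Dˣ, N (u : D) = 1 → ω u = 1) ∧
    ∃ T : V ≃ₗ[ℂ] V, ∀ g v, T ((ω g : ℂ) • π g v) = π g (T v)}
  one_mem' := ⟨fun _ _ => rfl, LinearEquiv.refl ℂ V, fun g v => by simp⟩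
  mul_mem' := by
    rintro ω ω' ⟨h1, T, hT⟩ ⟨h2, T', hT'⟩
    refine ⟨fun u hu => by rw [MonoidHom.mul_apply, h1 u hu, h2 u hu, one_mul],
      T'.trans T, fun g v => ?_⟩
    rw [LinearEquiv.trans_apply, LinearEquiv.trans_apply, MonoidHom.mul_apply, Units.val_mul,
      mul_smul, map_smul, hT', hT]
  inv_mem' := by
    rintro ω ⟨h1, T, hT⟩
    refine ⟨fun u hu => by rw [MonoidHom.inv_apply, h1 u hu, inv_one], T.symm, fun g v => ?_⟩
    rw [LinearEquiv.symm_apply_eq]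
    have h2 := hT g (T.symm v)
    rw [map_smul, LinearEquiv.apply_symm_apply] at h2
    rw [← h2, smul_smul, MonoidHom.inv_apply, Units.inv_mul, one_smul]

variable [TopologicalSpace D] [IsTopologicalRing D] [T2Space D]
  [ContinuousInv₀ D] [MeasurableSpace D] [BorelSpace D] [BorelSpace Dˣ]
  [SecondCountableTopology D] [SecondCountableTopology Dˣ] [FiniteDimensional ℂ V]
  {q : ℝ} {n : ℕ} {N : D → ℝ} {μ : Measure Dˣ} (h : IsNormalizedAbs q n N μ)
  {π : Representation ℂ Dˣ V} (hπ : IsIrredUnitary π)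
include h

lemma exists_unramified (ζ : ℂˣ) : ∃ ω : Dˣ →* ℂˣ, ∀ k, ∀ g ∈ sphere q N k, ω g = ζ ^ k := by
  choose o ho using h.exists_mem_sphere
  have h1 : ∀ (g : Dˣ) (k : ℤ), g ∈ sphere q N k → o g = k := fun g k hk =>
    h.sphere_index_inj (ho g) hk
  refine ⟨{ toFun := fun g => ζ ^ o g
            map_one' := ?_
            map_mul' := fun a b => ?_ }, fun k g hg => ?_⟩
  · rw [h1 1 0 h.one_mem_sphere, zpow_zero]
  · rw [h1 (a * b) _ (h.mul_mem_sphere (ho a) (ho b)), zpow_add]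
  · exact congrArg (ζ ^ ·) (h1 g k hg)

lemma twists_apply {ω : Dˣ →* ℂˣ} (hω : ω ∈ twists N π) {u : Dˣ} (hu : u ∈ sphere q N 1)
    {g : Dˣ} {k : ℤ} (hg : g ∈ sphere q N k) : ω g = ω u ^ k := by
  have h1 : g * (u ^ k)⁻¹ ∈ sphere q N 0 := by
    have := h.mul_mem_sphere hg (h.inv_mem_sphere (h.zpow_mem_sphere hu k))
    rwa [mul_one, add_neg_cancel] at this
  have h2 := hω.1 (g * (u ^ k)⁻¹) (by simpa [sphere] using h1)
  rw [map_mul, map_inv, map_zpow, mul_inv_eq_one] at h2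
  exact h2

include hπ

/-- A central c of valuation n acts by a nonzero scalar, which an isomorphic twist cannot change; so
ω(c) = ω(u)ⁿ = 1. -/
lemma pow_eq_one_of_mem_twists {ω : Dˣ →* ℂˣ} (hω : ω ∈ twists N π) {u : Dˣ}
    (hu : u ∈ sphere q N 1) : ω u ^ n = 1 := by
  obtain ⟨c, hcomm, hc⟩ := h.exists_central
  have h1 := twists_apply h hω hu (g := c) (k := n) hc
  rw [zpow_natCast] at h1
  rw [← h1]
  obtain ⟨z, hz, h2, -⟩ := hπ.exists_central_eq_smul hcomm
  obtain ⟨-, T, hT⟩ := hω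
  have := hπ.nontrivial
  obtain ⟨v, hv⟩ := exists_ne (0 : V)
  have h3 : ∀ v, π c v = z • v := fun v => congrArg (fun S : V →L[ℂ] V => S v) h2
  have h4 := hT c v
  have hz0 : z ≠ 0 := by
    rintro rfl
    simp at hz
  have hTv : z • T v ≠ 0 := smul_ne_zero hz0 (T.map_ne_zero_iff.2 hv)
  rw [h3, h3, map_smul, map_smul] at h4
  have h5 : ((ω c : ℂ) - 1) • z • T v = 0 := by rw [sub_smul, h4, one_smul, sub_self]
  have h6 := (smul_eq_zero.1 h5).resolve_right hTv
  exact Units.ext (sub_eq_zero.1 h6)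

/-- Evaluation at a uniformizer embeds the twists in the n-th roots of unity, and a subgroup of
order t of ℂ^* consists of all t-th roots of unity. -/
lemma card_twists_spec : 0 < Nat.card (twists N π) ∧ Nat.card (twists N π) ∣ n ∧
    ∀ (ω : Dˣ →* ℂˣ) (ζ : ℂˣ), (∀ k, ∀ g ∈ sphere q N k, ω g = ζ ^ k) →
      (ω ∈ twists N π ↔ ζ ^ Nat.card (twists N π) = 1) := by
  obtain ⟨u, hu⟩ := h.exists_mem_sphere_index 1
  have hn := h.n_pos
  have : NeZero n := ⟨hn.ne'⟩
  let e : (Dˣ →* ℂˣ) →* ℂˣ := MonoidHom.eval u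
  set R : Subgroup ℂˣ := (twists N π).map e with hR
  have hRn : R ≤ rootsOfUnity n ℂ := by
    rintro _ ⟨ω, hω, rfl⟩
    exact (mem_rootsOfUnity _ _).2 (pow_eq_one_of_mem_twists h hπ hω hu)
  have hfin : Finite R := Finite.of_injective _ (Subgroup.inclusion_injective hRn)
  have hinj : Set.InjOn e (twists N π) := by
    intro ω hω ω' hω' heq
    ext g
    obtain ⟨k, hk⟩ := h.exists_mem_sphere g
    have heq' : ω u = ω' u := heq
    rw [twists_apply h hω hu hk, twists_apply h hω' hu hk, heq']
  have hcard : Nat.card (twists N π) = Nat.card R := (Nat.card_image_of_injOn hinj).symm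
  rw [hcard]
  have hpos : 0 < Nat.card R := Nat.card_pos
  have : NeZero (Nat.card R) := ⟨hpos.ne'⟩
  have hRt : R = rootsOfUnity (Nat.card R) ℂ := by
    refine Subgroup.eq_of_le_of_card_ge (fun ζ hζ => ?_) ?_
    · have h1 := pow_card_eq_one' (x := (⟨ζ, hζ⟩ : R))
      exact (mem_rootsOfUnity _ _).2 (congrArg Subtype.val h1)
    · rw [Complex.card_rootsOfUnity]
  refine ⟨hpos, ?_, fun ω ζ hω => ?_⟩
  · have h1 := Subgroup.card_dvd_of_le hRn
    rwa [Complex.card_rootsOfUnity] at h1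
  · rw [← mem_rootsOfUnity, ← hRt]
    have hωu : ω u = ζ := by rw [hω 1 u hu, zpow_one]
    refine ⟨fun hmem => ⟨ω, hmem, hωu⟩, ?_⟩
    rintro ⟨ω', hω', h1⟩
    have h2 : ω' = ω := by
      ext g
      obtain ⟨k, hk⟩ := h.exists_mem_sphere g
      have h3 : ω' u = ζ := h1
      rw [twists_apply h hω' hu hk, h3, hω k g hk]
    rwa [← h2]

lemma coefOp_periodic (k : ℤ) (f : V →L[ℂ] ℂ) (v : V) :
    coefOp q N μ π π (k + n) f v = coefOp q N μ π π k f v := by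
  obtain ⟨c, hcomm, hc⟩ := h.exists_central
  obtain ⟨z, hz, h2, -⟩ := hπ.exists_central_eq_smul hcomm
  have hz0 : z ≠ 0 := by
    rintro rfl
    simp at hz
  have h3 : π c v = z • v := congrArg (fun S : V →L[ℂ] V => S v) h2
  have h1 := coefOp_rep h hπ hπ (j := n) hc k f v
  rw [h2, h3, smul_mul_assoc, one_mul] at h1
  refine smul_right_injective _ hz0 (h1.symm.trans ?_)
  ext v₂
  obtain ⟨T, hT⟩ := exists_coefOp_eq_linear (μ := μ) h hπ hπ k f v₂
  rw [smul_apply, ← hT, ← hT, map_smul]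

/-- The Fourier coefficient at ζ intertwines π with its twist by the unramified character that takes
the value ζ on uniformizers. If it were nonzero, irreducibility would make it injective and the
character would be a twist of π. -/
lemma fourier_coefOp_eq_zero {ζ : ℂˣ} (hζn : ζ ^ n = 1)
    (hζ : ζ ^ Nat.card (twists N π) ≠ 1) (f : V →L[ℂ] ℂ) (v : V) :
    ∑ m ∈ Finset.range n, (ζ : ℂ) ^ m • coefOp q N μ π π m f v = 0 := by
  ext v₂
  choose T hT using fun m : ℤ => exists_coefOp_eq_linear (μ := μ) h hπ hπ m f v₂
  set B : V →ₗ[ℂ] V := ∑ m ∈ Finset.range n, (ζ : ℂ) ^ m • T m with hB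
  have hBv : ∀ v, B v = ∑ m ∈ Finset.range n, ((ζ ^ (m : ℤ) : ℂˣ) : ℂ) • T m v := by
    intro v
    simp [hB]
  have hrep : ∀ (g : Dˣ) (j : ℤ), g ∈ sphere q N j → ∀ v,
      ((ζ ^ j : ℂˣ) : ℂ) • B (π g v) = π g (B v) := by
    intro g j hg v
    rw [hBv, hBv, ← sum_range_shift_of_periodic (f := fun m => ((ζ ^ (m : ℤ) : ℂˣ) : ℂ) • T m v)
      (fun k => by
        rw [hT, hT, coefOp_periodic h hπ, zpow_add, zpow_natCast, hζn, mul_one]) j, map_sum,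
      Finset.smul_sum]
    refine Finset.sum_congr rfl fun m _ => ?_
    rw [hT, coefOp_rep h hπ hπ hg, map_smul, smul_smul, hT, add_comm j, zpow_add, mul_comm,
      Units.val_mul]
    rfl
  by_contra h0
  have hB0 : B ≠ 0 := by
    intro hB0
    refine h0 ?_
    have h1 := hBv v
    rw [hB0] at h1
    simpa [sum_apply, hT] using h1.symm
  have hker : LinearMap.ker B = ⊥ := by
    refine (hπ.eq_bot_or_eq_top (LinearMap.ker B) fun g v hv => ?_).resolve_right
      fun htop => hB0 (LinearMap.ker_eq_top.1 htop)
    obtain ⟨j, hj⟩ := h.exists_mem_sphere g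
    have h1 := hrep g j hj v
    rw [LinearMap.mem_ker.1 hv, map_zero] at h1
    exact LinearMap.mem_ker.2 ((smul_eq_zero.1 h1).resolve_left (Units.ne_zero _))
  obtain ⟨ω, hω⟩ := exists_unramified h ζ
  refine hζ (((card_twists_spec h hπ).2.2 ω ζ hω).1 ⟨fun u hu => ?_,
    LinearEquiv.ofInjectiveEndo B (LinearMap.ker_eq_bot.1 hker), fun g v => ?_⟩)
  · rw [hω 0 u (by simpa [sphere] using hu), zpow_zero]
  · obtain ⟨j, hj⟩ := h.exists_mem_sphere g
    rw [LinearEquiv.coe_ofInjectiveEndo, map_smul, hω j g hj, hrep g j hj]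

/-- The difference under a shift by t has zero Fourier transform: where ζ^t = 1 the shift does not
change the transform, and elsewhere the transform vanishes. -/
lemma coefOp_add_card_twists (k : ℤ) (f : V →L[ℂ] ℂ) (v : V) :
    coefOp q N μ π π (k + Nat.card (twists N π)) f v = coefOp q N μ π π k f v := by
  set t := Nat.card (twists N π) with ht
  set A : ℤ → V →L[ℂ] V := fun m => coefOp q N μ π π (m + t) f v - coefOp q N μ π π m f v with hA
  have hper : ∀ m, A (m + n) = A m := by
    intro m
    simp only [hA]
    rw [add_right_comm, coefOp_periodic h hπ, coefOp_periodic h hπ]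
  have h0 : ∀ m : ℕ, m < n → A m = 0 := by
    intro m hm
    refine eq_zero_of_fourier_eq_zero (A := fun m : ℕ => A m) h.n_pos (fun ζ hζ => ?_) hm
    have hζ0 : ζ ≠ 0 := by
      rintro rfl
      rw [zero_pow h.n_pos.ne'] at hζ
      exact zero_ne_one hζ
    set z : ℂˣ := Units.mk0 ζ hζ0 with hz
    have hzn : z ^ n = 1 := Units.ext (by simpa [hz] using hζ)
    simp only [hA, smul_sub, Finset.sum_sub_distrib]
    have h1 := sum_range_shift_of_periodic
      (f := fun m => ((z ^ (m : ℤ) : ℂˣ) : ℂ) • coefOp q N μ π π m f v)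
      (fun k => by
        rw [coefOp_periodic h hπ, zpow_add, zpow_natCast, hzn, mul_one]) t
    have h2 : ∑ m ∈ Finset.range n, ((z ^ ((t : ℤ) + m) : ℂˣ) : ℂ) •
        coefOp q N μ π π (t + m) f v = ζ ^ t • ∑ m ∈ Finset.range n, ζ ^ m •
        coefOp q N μ π π (m + t) f v := by
      rw [Finset.smul_sum]
      refine Finset.sum_congr rfl fun m _ => ?_
      rw [smul_smul, ← pow_add, add_comm (t : ℤ) m]
      congr 1
      rw [← Nat.cast_add, zpow_natCast, Units.val_pow_eq_pow_val, add_comm]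
      rfl
    have h3 : ∀ m : ℕ, ((z ^ (m : ℤ) : ℂˣ) : ℂ) = ζ ^ m := by
      intro m
      rw [zpow_natCast, Units.val_pow_eq_pow_val]
      rfl
    rw [h2] at h1
    simp only [h3] at h1
    by_cases hzt : z ^ t = 1
    · have h4 : ζ ^ t = 1 := by
        have := congrArg Units.val hzt
        simpa [hz] using this
      rw [h4, one_smul] at h1
      rw [h1, sub_self]
    · have h4 := fourier_coefOp_eq_zero (μ := μ) h hπ hzn hzt f v
      have h5 : (z : ℂ) = ζ := rfl
      rw [h5] at h4
      rw [h4] at h1 ⊢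
      rw [(smul_eq_zero.1 h1).resolve_left (pow_ne_zero _ hζ0), sub_zero]
  have h1 : A k = A (k % n) := by
    have h2 : Function.Periodic A (n : ℤ) := hper
    have h3 := h2.int_mul (k / n) (k % n)
    rwa [Int.cast_id, mul_comm, Int.emod_add_mul_ediv] at h3
  have hn : (n : ℤ) ≠ 0 := by exact_mod_cast h.n_pos.ne'
  have h2 : ((k % n).toNat : ℤ) = k % n := Int.toNat_of_nonneg (Int.emod_nonneg _ hn)
  have h3 := h0 (k % n).toNat (by
    have := Int.emod_lt_of_pos k (by exact_mod_cast h.n_pos : (0 : ℤ) < n)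
    omega)
  rw [h2, ← h1] at h3
  exact sub_eq_zero.1 h3

/-- If t does not divide k, a twist of order t gives χ(w) = ζ^k χ(w) with ζ^k ≠ 1, so χ vanishes on
the sphere. The n/t spheres that remain among n consecutive ones have equal integrals with total n,
hence t each. -/
lemma sphereChi_eq (k : ℕ) : sphereChi q N μ π π k =
    if Nat.card (twists N π) ∣ k then (Nat.card (twists N π) : ℂ) else 0 := by
  obtain ⟨hpos, hdvd, hspec⟩ := card_twists_spec h hπ
  have hper : ∀ k : ℤ, sphereChi q N μ π π (k + Nat.card (twists N π)) =
      sphereChi q N μ π π k := by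
    intro k
    rw [sphereChi_eq_sum_coefOp h hπ hπ, sphereChi_eq_sum_coefOp h hπ hπ]
    simp only [coefOp_add_card_twists h hπ]
  have hzero : ∀ k : ℕ, ¬ Nat.card (twists N π) ∣ k → sphereChi q N μ π π k = 0 := by
    intro k hk
    have hprim := Complex.isPrimitiveRoot_exp _ hpos.ne'
    set ζ : ℂˣ := (hprim.isUnit hpos.ne').unit with hζ
    obtain ⟨ω, hω⟩ := exists_unramified h ζ
    obtain ⟨-, T, hT⟩ := (hspec ω ζ hω).2 (Units.ext (by
      rw [Units.val_pow_eq_pow_val]; exact hprim.pow_eq_one))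
    have hne : (ζ : ℂ) ^ k ≠ 1 := fun h1 => hk ((hprim.pow_eq_one_iff_dvd k).1 h1)
    rw [sphereChi, ← integral_zero Dˣ ℂ (μ := μ.restrict (sphere q N k))]
    refine setIntegral_congr_fun (h.measurableSet_sphere k) fun w hw => ?_
    have h1 : T.conj ((ω w : ℂ) • π w) = π w := by
      ext v
      rw [LinearEquiv.conj_apply_apply, LinearMap.smul_apply, hT, LinearEquiv.apply_symm_apply]
    have h2 : (ω w : ℂ) * chi π w = chi π w := by
      have := LinearMap.trace_conj' ((ω w : ℂ) • π w) T
      rw [h1, map_smul] at this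
      exact this.symm
    rw [hω k w hw, zpow_natCast, Units.val_pow_eq_pow_val] at h2
    have h3 : ((ζ : ℂ) ^ k - 1) * chi π w = 0 := by rw [sub_mul, h2, one_mul, sub_self]
    have h4 := (mul_eq_zero.1 h3).resolve_left (sub_ne_zero.2 hne)
    simp [h4]
  have hper' : ∀ r i : ℕ, sphereChi q N μ π π (Nat.card (twists N π) * r + i : ℕ) =
      sphereChi q N μ π π i := by
    intro r i
    induction r with
    | zero => simp
    | succ r ih =>
      rw [← ih, ← hper (Nat.card (twists N π) * r + i : ℕ)]
      congr 1
      push_cast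
      ring
  have hsum : ∀ r : ℕ, ∑ m ∈ Finset.range (Nat.card (twists N π) * r),
      sphereChi q N μ π π m = r * sphereChi q N μ π π 0 := by
    intro r
    induction r with
    | zero => simp
    | succ r ih =>
      rw [mul_add, mul_one, Finset.sum_range_add, ih]
      simp only [hper']
      rw [Finset.sum_eq_single 0 (fun i hi hi0 => hzero i fun hd =>
        hi0 (Nat.eq_zero_of_dvd_of_lt hd (Finset.mem_range.1 hi))) (by simp [hpos.ne'])]
      push_cast
      ring
  obtain ⟨r, hr⟩ := hdvd
  have h1 := sum_sphereChi h hπ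
  conv_lhs at h1 => rw [hr]
  rw [hsum r, hr] at h1
  have hr0 : (r : ℂ) ≠ 0 := by
    intro h0
    have : r = 0 := by exact_mod_cast h0
    rw [this, mul_zero] at hr
    exact h.n_pos.ne' hr
  have h2 : sphereChi q N μ π π 0 = Nat.card (twists N π) := by
    push_cast at h1
    rw [mul_comm] at h1
    exact mul_right_cancel₀ hr0 h1
  split_ifs with hd
  · obtain ⟨j, rfl⟩ := hd
    rw [← h2]
    exact hper' j 0
  · exact hzero k hd

end Twists

/-! ### The scalar by which the composition acts in the two cases -/

section Cases

variable {D : Type*} [DivisionRing D] [TopologicalSpace D] [IsTopologicalRing D] [T2Space D]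
  [ContinuousInv₀ D] [MeasurableSpace D] [BorelSpace D] [BorelSpace Dˣ]
  [SecondCountableTopology D] [SecondCountableTopology Dˣ]
  {q : ℝ} {n : ℕ} {N : D → ℝ} {μ : Measure Dˣ} (h : IsNormalizedAbs q n N μ)
  {V V₁ V₂ E : Type*}
  [NormedAddCommGroup E] [NormedSpace ℂ E] [FiniteDimensional ℂ E] [CompleteSpace E]
  [NormedAddCommGroup V] [InnerProductSpace ℂ V] [FiniteDimensional ℂ V]
  [NormedAddCommGroup V₁] [InnerProductSpace ℂ V₁] [FiniteDimensional ℂ V₁]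
  [NormedAddCommGroup V₂] [InnerProductSpace ℂ V₂] [FiniteDimensional ℂ V₂]

/-- The integral `ι`, with `-log_q N` in place of the valuation. -/
def iotaAbs (q : ℝ) (N : D → ℝ) (μ : Measure Dˣ) (π₁ : Representation ℂ Dˣ V₁)
    (π₂ : Representation ℂ Dˣ V₂) : ℂ :=
  ∫ g : Dˣ, ((max (-Real.logb q (N ((g : D) - 1))) 0 : ℝ) : ℂ) * (chi π₁ g * chi π₂ g⁻¹) ∂μ

/-- The regularized operators compose to the scalar `c`, and are regular at `s` and `-s`. -/
structure CompositionScalar (q : ℝ) (p : ℕ) (ω : ℂ) (n : ℕ) (N : D → ℝ) (μ : Measure Dˣ)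
    (σ : Dˣ × Dˣ →* (E →L[ℂ] E)) (s c : ℂ) : Prop where
  hyp : RegHyp q p ω n N μ σ
  hyp_swap : RegHyp q p ω n N μ (swapRep σ)
  regular : ω * (q : ℂ) ^ (-(p * s)) ≠ 1
  regular_neg : ω * (q : ℂ) ^ (-(p * -s)) ≠ 1
  comp : ∀ φ ∈ ind n N σ s, ∀ g, regOp q p ω n N μ (swapRep σ) (-s)
    (fun g => regOp q p ω n N μ σ s φ (weylSwap D * g)) (weylSwap D * g) = c • φ g

variable {π : Representation ℂ Dˣ V} (hπ : IsIrredUnitary π)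
  {π₁ : Representation ℂ Dˣ V₁} {π₂ : Representation ℂ Dˣ V₂}
  (hπ₁ : IsIrredUnitary π₁) (hπ₂ : IsIrredUnitary π₂)
  {σ : Dˣ × Dˣ →* (E →L[ℂ] E)} (hσ : IsSmoothIsometric q N σ)
include h

include hπ₁ hπ₂ in
lemma integrable_and_hasSum_ballChi :
    Integrable (fun g : Dˣ => ((max (-Real.logb q (N ((g : D) - 1))) 0 : ℝ) : ℂ) *
      (chi π₁ g * chi π₂ g⁻¹)) μ ∧
    HasSum (ballChi q N μ π₁ π₂) (iotaAbs q N μ π₁ π₂) :=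
  integrable_and_hasSum_congrBall h
    ((continuous_chi h hπ₁).mul ((continuous_chi h hπ₂).comp continuous_inv))

include hσ hπ₁ hπ₂ in
-- All sphere operators vanish, so there are no tails. Period 1 with multiplier ω = 0 is then
-- admissible and makes every s regular.
theorem compositionScalar_of_hom_eq_zero {Θ : (V₁ →L[ℂ] V₁) → (V₂ →L[ℂ] V₂) → E →L[ℂ] E}
    (hΘ : IsExternalProduct π₁ π₂ σ Θ)
    (hhom : ∀ T : V₁ →ₗ[ℂ] V₂, (∀ g ∈ sphere q N 0, ∀ v, T (π₁ g v) = π₂ g (T v)) → T = 0)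
    (s : ℂ) : CompositionScalar q 1 0 n N μ σ s
      (iotaAbs q N μ π₁ π₂ / (Module.finrank ℂ V₁ * Module.finrank ℂ V₂)) := by
  have hcoef := coefOp_eq_zero (μ := μ) h hπ₁ hπ₂ hhom
  have hA : ∀ k, sphereOp q N μ σ k = 0 := by
    obtain ⟨T, hT⟩ := exists_sphereOp_eq_sum_coefOp (μ := μ) h hπ₁ hπ₂ hσ hΘ
    intro k
    rw [hT]
    simp [hcoef]
  have hA' : ∀ k, sphereOp q N μ (swapRep σ) k = 0 := fun k => by
    rw [sphereOp_swapRep h hσ, hA]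
  have hα : ∀ k, sphereChi q N μ π₁ π₂ k = 0 := by
    intro k
    rw [sphereChi_eq_sum_coefOp h hπ₁ hπ₂]
    simp [hcoef]
  have H : RegHyp q 1 0 n N μ σ := ⟨h, hσ, one_pos, by simp, fun k => by simp [hA]⟩
  have H' : RegHyp q 1 0 n N μ (swapRep σ) :=
    ⟨h, hσ.swap, one_pos, by simp, fun k => by simp [hA']⟩
  refine ⟨H, H', by simp, by simp, fun φ hφ g => ?_⟩
  refine regOp_regOp H (hasAverages h hπ₁ hπ₂ hσ hΘ) H' (fun k z => ?_) (fun z _ => by simp)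
    (c := fun _ => iotaAbs q N μ π₁ π₂ / (Module.finrank ℂ V₁ * Module.finrank ℂ V₂))
    (fun z _ => MeromorphicAt.const _ z)
    ((integrable_and_hasSum_ballChi h hπ₁ hπ₂).2.div_const _) (fun z _ => ?_)
    analyticAt_const (by simp) (by simp) hφ g
  · simp [tailSum, hA, hA']
  · have h1 : ∀ M : ℕ, sphereChi q N μ π₁ π₂ ((M + 1 : ℕ) : ℤ) = 0 := fun M => hα _
    simp only [h1, zero_div, mul_zero, sub_self]
    exact hasSum_zero

include hσ hπ in
-- The sphere operators have period t with multiplier 1, so the only excluded points are those with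
-- q^(ts) = 1. The period n would exclude more.
theorem compositionScalar_self {Θ : (V →L[ℂ] V) → (V →L[ℂ] V) → E →L[ℂ] E}
    (hΘ : IsExternalProduct π π σ Θ) {t : ℕ} (ht : t = Nat.card (twists N π)) {s : ℂ}
    (hs : (q : ℂ) ^ (t * s) ≠ 1) : CompositionScalar q t 1 n N μ σ s
      ((iotaAbs q N μ π π + (t : ℂ) ^ 2 / ((1 - (q : ℂ) ^ (t * s)) * (1 - (q : ℂ) ^ (-(t * s))))) /
        (Module.finrank ℂ V : ℂ) ^ 2) := by
  have htpos : 0 < t := ht ▸ (card_twists_spec h hπ).1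
  have hq' : (q : ℂ) ≠ 0 := by exact_mod_cast h.q_pos.ne'
  have hA : ∀ k, sphereOp q N μ σ (k + t) = sphereOp q N μ σ k := by
    obtain ⟨T, hT⟩ := exists_sphereOp_eq_sum_coefOp (μ := μ) h hπ hπ hσ hΘ
    intro k
    rw [hT, hT]
    simp only [ht, coefOp_add_card_twists h hπ]
  have hA' : sphereOp q N μ (swapRep σ) = fun k => sphereOp q N μ σ (-k) := by
    funext k
    exact sphereOp_swapRep h hσ k
  have H : RegHyp q t 1 n N μ σ := ⟨h, hσ, htpos, by simp, fun k => by rw [hA, one_smul]⟩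
  have H' : RegHyp q t 1 n N μ (swapRep σ) :=
    ⟨h, hσ.swap, htpos, by simp, fun k => by
      rw [hA', one_smul]
      dsimp only
      rw [← hA]
      congr 1
      ring⟩
  have hinv : ∀ z : ℂ, (q : ℂ) ^ (-(t * z)) = ((q : ℂ) ^ (t * z))⁻¹ := fun z =>
    Complex.cpow_neg _ _
  have hs1 : (1 : ℂ) * (q : ℂ) ^ (-(t * s)) ≠ 1 := by
    rw [one_mul, hinv, ne_eq, inv_eq_one]
    exact hs
  have hs2 : (1 : ℂ) * (q : ℂ) ^ (-(t * -s)) ≠ 1 := by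
    rw [one_mul, mul_neg, neg_neg]
    exact hs
  refine ⟨H, H', hs1, hs2, fun φ hφ g => ?_⟩
  have han : ∀ z : ℂ, AnalyticAt ℂ (fun z : ℂ => (q : ℂ) ^ (t * z)) z := fun z =>
    analyticAt_const_cpow h.q_pos (analyticAt_const.mul analyticAt_id)
  have han' : ∀ z : ℂ, AnalyticAt ℂ (fun z : ℂ => (q : ℂ) ^ (-(t * z))) z := fun z =>
    analyticAt_const_cpow h.q_pos (analyticAt_const.mul analyticAt_id).neg
  have hden : ∀ z : ℂ, AnalyticAt ℂ
      (fun z : ℂ => (1 - (q : ℂ) ^ (t * z)) * (1 - (q : ℂ) ^ (-(t * z)))) z := fun z =>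
    (analyticAt_const.sub (han z)).mul (analyticAt_const.sub (han' z))
  refine regOp_regOp H (hasAverages h hπ hπ hσ hΘ) H' (fun k z => ?_) (fun z hz => ?_)
    (c := fun z => (iotaAbs q N μ π π +
      (t : ℂ) ^ 2 / ((1 - (q : ℂ) ^ (t * z)) * (1 - (q : ℂ) ^ (-(t * z))))) /
        (Module.finrank ℂ V : ℂ) ^ 2)
    (fun z _ => ?_) ((integrable_and_hasSum_ballChi h hπ hπ).2.div_const _) (fun z hz => ?_)
    ?_ hs1 hs2 hφ g
  · rw [hA']
    exact tailSum_neg h.one_lt_q hA k z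
  · have h1 := mul_cpow_ne_one h.one_lt_q hz htpos (ω := 1) (by simp)
    rw [one_mul, hinv, ne_eq, inv_eq_one] at h1
    rwa [one_mul, mul_neg, neg_neg]
  · exact ((MeromorphicAt.const _ z).add
      ((MeromorphicAt.const _ z).div (hden z).meromorphicAt)).div (MeromorphicAt.const _ z)
  · set x : ℂ := (q : ℂ) ^ (-(t * z)) with hx
    have hx1 : ‖x‖ < 1 := by
      have := norm_cpow_lt_one h.one_lt_q hz htpos (ω := 1) (by simp)
      rwa [one_mul] at this
    have hx0 : x ≠ 0 := by
      rw [hx, hinv]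
      exact inv_ne_zero (by simp [Complex.cpow_eq_zero_iff, hq'])
    have hx2 : 1 - x ≠ 0 := by
      rw [sub_ne_zero]
      rintro h1
      rw [← h1, norm_one] at hx1
      exact lt_irrefl _ hx1
    have hqz : (q : ℂ) ^ (t * z) = x⁻¹ := by rw [hx, hinv, inv_inv]
    have htC : (t : ℂ) ≠ 0 := by exact_mod_cast htpos.ne'
    -- Only m = tj contributes, with coefficient t/d². The sum is t²/d² Σ j x^j = (t²/d²) x/(1 -
    -- x)², and -x/(1 - x)² = 1/((1 - x)(1 - x⁻¹)).
    let f : ℕ → ℂ := fun m => m * (q : ℂ) ^ (-(m * z)) *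
      (sphereChi q N μ π π m / (Module.finrank ℂ V * Module.finrank ℂ V))
    have h1 := (hasSum_coe_mul_geometric_of_norm_lt_one hx1).mul_left
      ((t : ℂ) ^ 2 / (Module.finrank ℂ V * Module.finrank ℂ V))
    have h2 : ∀ j : ℕ, f (t * j) =
        (t : ℂ) ^ 2 / (Module.finrank ℂ V * Module.finrank ℂ V) * (j * x ^ j) := by
      intro j
      have h3 : (q : ℂ) ^ (-(((t * j : ℕ) : ℂ) * z)) = x ^ j := by
        rw [hx, ← Complex.cpow_nat_mul]
        congr 1
        push_cast
        ring
      simp only [f]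
      rw [h3, sphereChi_eq h hπ, ← ht, if_pos (dvd_mul_right t j)]
      push_cast
      ring
    have h3 : HasSum f ((t : ℂ) ^ 2 / (Module.finrank ℂ V * Module.finrank ℂ V) *
        (x / (1 - x) ^ 2)) := by
      rw [← (mul_right_injective₀ htpos.ne').hasSum_iff (f := f) fun m hm => ?_]
      · exact h1.congr_fun h2
      · simp only [f]
        rw [sphereChi_eq h hπ, ← ht, if_neg, zero_div, mul_zero]
        rintro ⟨j, rfl⟩
        exact hm ⟨j, rfl⟩
    have h4 := (hasSum_nat_add_iff' 1).2 h3
    have h5 : f 0 = 0 := by simp [f]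
    rw [Finset.sum_range_one, h5, sub_zero] at h4
    have h6 : iotaAbs q N μ π π / (Module.finrank ℂ V * Module.finrank ℂ V) -
        (iotaAbs q N μ π π + (t : ℂ) ^ 2 / ((1 - (q : ℂ) ^ (t * z)) * (1 - x))) /
          (Module.finrank ℂ V : ℂ) ^ 2 =
        (t : ℂ) ^ 2 / (Module.finrank ℂ V * Module.finrank ℂ V) * (x / (1 - x) ^ 2) := by
      have h7 : (1 - (q : ℂ) ^ (t * z)) * (1 - x) = -((1 - x) ^ 2 / x) := by
        rw [hqz]
        field_simp
        ring
      rw [h7]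
      have hd := hπ.finrank_ne_zero
      field_simp
      ring
    rw [h6]
    refine h4.congr_fun fun M => ?_
    simp only [f]
    push_cast
    ring
  · have h1 : (1 - (q : ℂ) ^ (t * s)) * (1 - (q : ℂ) ^ (-(t * s))) ≠ 0 := by
      rw [one_mul] at hs1
      exact mul_ne_zero (sub_ne_zero.2 hs.symm) (sub_ne_zero.2 hs1.symm)
    exact (analyticAt_const.add (analyticAt_const.div (hden s) h1)).div analyticAt_const
      (pow_ne_zero 2 hπ.finrank_ne_zero)

end Cases

/-! ### Nonzero elements of induced representations -/

section Nonzero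

variable {D : Type*} [DivisionRing D] [TopologicalSpace D] [IsTopologicalRing D] [T2Space D]
  [ContinuousInv₀ D] [MeasurableSpace D]
  {q : ℝ} {n : ℕ} {N : D → ℝ} {μ : Measure Dˣ} (h : IsNormalizedAbs q n N μ)
  {E : Type*} [NormedAddCommGroup E] [NormedSpace ℂ E] {σ : Dˣ × Dˣ →* (E →L[ℂ] E)}
include h

lemma exists_congruence_subgroup (m : ℕ) : ∃ K : OpenSubgroup (GL2 D), ∀ k ∈ K, ∀ i j,
    N (k.val i j - (1 : Matrix (Fin 2) (Fin 2) D) i j) ≤ q ^ (-(m : ℤ)) := by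
  have hl : ∀ (k : GL2 D) (A : Matrix (Fin 2) (Fin 2) D), k ∈ integralMatrices N →
      (∀ i j, N (A i j) ≤ q ^ (-(m : ℤ))) → ∀ i j, N ((k.val * A) i j) ≤ q ^ (-(m : ℤ)) := by
    intro k A hk hA i j
    rw [Matrix.mul_apply, Fin.sum_univ_two]
    refine (h.add_le _ _).trans (max_le ?_ ?_) <;> rw [h.map_mul] <;>
      exact (mul_le_of_le_one_left (h.nonneg _) (hk.1 _ _)).trans (hA _ _)
  have h0 : ∀ i j, N (((1 : GL2 D).val - 1) i j) ≤ q ^ (-(m : ℤ)) := by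
    intro i j
    rw [Units.val_one, sub_self, Matrix.zero_apply, h.map_zero]
    exact (zpow_pos h.q_pos _).le
  let K : Subgroup (GL2 D) :=
    { carrier := {k | k ∈ integralMatrices N ∧ ∀ i j, N ((k.val - 1) i j) ≤ q ^ (-(m : ℤ))}
      one_mem' := ⟨one_mem_integralMatrices h, h0⟩
      mul_mem' := by
        rintro a b ⟨ha, ha'⟩ ⟨hb, hb'⟩
        refine ⟨mul_mem_integralMatrices h ha hb, fun i j => ?_⟩
        have h1 : (a * b).val - 1 = a.val * (b.val - 1) + (a.val - 1) := by
          rw [Units.val_mul, mul_sub, mul_one, sub_add_sub_cancel]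
        rw [h1, Matrix.add_apply]
        exact (h.add_le _ _).trans (max_le (hl a _ ha hb' i j) (ha' i j))
      inv_mem' := by
        rintro a ⟨ha, ha'⟩
        refine ⟨inv_mem_integralMatrices ha, fun i j => ?_⟩
        have h1 : (a⁻¹).val - 1 = -((a⁻¹).val * (a.val - 1)) := by
          rw [mul_sub, mul_one, Units.inv_mul, neg_sub]
        rw [h1, Matrix.neg_apply, h.map_neg]
        exact hl _ _ (inv_mem_integralMatrices ha) ha' i j }
  have hopen : IsOpen (K : Set (GL2 D)) := by
    have h1 : (K : Set (GL2 D)) = integralMatrices N ∩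
        ⋂ i, ⋂ j, {g : GL2 D | N ((g.val - 1) i j) ≤ q ^ (-(m : ℤ))} := by
      ext g
      simp only [Set.mem_inter_iff, Set.mem_iInter]
      exact Iff.rfl
    rw [h1]
    refine (isOpen_integralMatrices h).inter (isOpen_iInter_of_finite fun i =>
      isOpen_iInter_of_finite fun j => (h.isOpen_le _).preimage ?_)
    exact (Units.continuous_val.sub continuous_const).matrix_elem i j
  exact ⟨⟨K, hopen⟩, fun k hk => hk.2⟩

/-- The induced representation of a nonzero representation is nonzero. -/
theorem exists_mem_ind_apply_one (hσ : IsSmoothIsometric q N σ) (s : ℂ) (v : E) :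
    ∃ φ ∈ ind n N σ s, φ 1 = v := by
  classical
  obtain ⟨m, hm⟩ := hσ.exists_level
  -- Level m + 1 instead of m keeps the radius below 1 even for m = 0, so that diagonal entries of
  -- elements of K have norm 1.
  obtain ⟨K, hK⟩ := exists_congruence_subgroup h (m + 1)
  let W : Dˣ → Dˣ → E →L[ℂ] E := fun a b =>
    ((N (a : D) / N (b : D) : ℝ) : ℂ) ^ ((s + n) / 2) • σ (a, b)
  have hW1 : W 1 1 = 1 := by
    simp only [W, ← Prod.one_eq_mk]
    simp [h.map_one]
  have hWmul : ∀ a b a' b', W (a * a') (b * b') = W a b * W a' b' := by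
    intro a b a' b'
    simp only [W]
    rw [smul_mul_smul_comm, ← map_mul, Prod.mk_mul_mk, ← Complex.mul_cpow_ofReal_nonneg
      (div_pos (h.units_pos _) (h.units_pos _)).le (div_pos (h.units_pos _) (h.units_pos _)).le,
      ← Complex.ofReal_mul, Units.val_mul, Units.val_mul, h.map_mul, h.map_mul, mul_div_mul_comm]
  have hWK : ∀ (p : GL2 D) (a b : Dˣ) (x : D),
      (p : Matrix (Fin 2) (Fin 2) D) = !![(a : D), x; 0, (b : D)] → p ∈ K → W a b = 1 := by
    intro p a b x hp hpK
    have ha := hK p hpK 0 0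
    have hb := hK p hpK 1 1
    rw [hp] at ha hb
    simp only [Matrix.of_apply, Matrix.cons_val', Matrix.cons_val_zero, Matrix.cons_val_one,
      Matrix.cons_val_fin_one, Matrix.one_apply_eq] at ha hb
    have hle : q ^ (-((m + 1 : ℕ) : ℤ)) ≤ q ^ (-(m : ℤ)) :=
      zpow_le_zpow_right₀ h.one_lt_q.le (by omega)
    have hlt : q ^ (-((m + 1 : ℕ) : ℤ)) < 1 :=
      zpow_lt_one_of_neg₀ h.one_lt_q (by omega)
    have hN : ∀ c : Dˣ, N ((c : D) - 1) ≤ q ^ (-((m + 1 : ℕ) : ℤ)) → N (c : D) = 1 := by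
      intro c hc
      have h1 := h.add_eq_of_lt (x := 1) (e := (c : D) - 1)
        (by rw [h.map_one]; exact hc.trans_lt hlt)
      rwa [add_sub_cancel, h.map_one] at h1
    simp only [W]
    rw [hN a ha, hN b hb, hm a b (ha.trans hle) (hb.trans hle)]
    simp
  have hupper : ∀ (p p' : GL2 D) (a b a' b' : Dˣ) (x x' : D),
      (p : Matrix (Fin 2) (Fin 2) D) = !![(a : D), x; 0, (b : D)] →
      (p' : Matrix (Fin 2) (Fin 2) D) = !![(a' : D), x'; 0, (b' : D)] →
      ((p * p' : GL2 D) : Matrix (Fin 2) (Fin 2) D) =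
        !![((a * a' : Dˣ) : D), a * x' + x * b'; 0, ((b * b' : Dˣ) : D)] := by
    intro p p' a b a' b' x x' hp hp'
    rw [Units.val_mul, hp, hp']
    simp
  -- The function is supported on PK with value W(a, b)v at pk. It is well defined because W is
  -- trivial on P ∩ K.
  let R : GL2 D → E → Prop := fun g w => ∃ (p : GL2 D) (a b : Dˣ) (x : D) (k : GL2 D),
    (p : Matrix (Fin 2) (Fin 2) D) = !![(a : D), x; 0, (b : D)] ∧ k ∈ K ∧ g = p * k ∧ w = W a b v
  have huniq : ∀ g w w', R g w → R g w' → w = w' := by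
    rintro g w w' ⟨p, a, b, x, k, hp, hk, rfl, rfl⟩ ⟨p', a', b', x', k', hp', hk', heq, rfl⟩
    have h1 : p'⁻¹ * p ∈ K := by
      have : p'⁻¹ * p = k' * k⁻¹ := by
        rw [eq_mul_inv_iff_mul_eq, mul_assoc, heq, inv_mul_cancel_left]
      rw [this]
      exact K.mul_mem hk' (K.inv_mem hk)
    have h2 := hWK _ _ _ _ (hupper _ _ _ _ _ _ _ _ (inv_val_upper hp') hp) h1
    have h3 := hWmul a' b' (a'⁻¹ * a) (b'⁻¹ * b)
    rw [h2, mul_one, mul_inv_cancel_left, mul_inv_cancel_left] at h3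
    rw [h3]
  have hleft : ∀ (p : GL2 D) (a b : Dˣ) (x : D),
      (p : Matrix (Fin 2) (Fin 2) D) = !![(a : D), x; 0, (b : D)] → ∀ g w, R g w →
      R (p * g) (W a b w) := by
    rintro p a b x hp g w ⟨p', a', b', x', k, hp', hk, rfl, rfl⟩
    exact ⟨p * p', _, _, _, k, hupper _ _ _ _ _ _ _ _ hp hp', hk, (mul_assoc _ _ _).symm, by
      rw [hWmul]; rfl⟩
  have hright : ∀ g w, ∀ k ∈ K, R g w → R (g * k) w := by
    rintro g w k hk ⟨p, a, b, x, k', hp, hk', rfl, rfl⟩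
    exact ⟨p, a, b, x, k' * k, hp, K.mul_mem hk' hk, mul_assoc _ _ _, rfl⟩
  let φ : GL2 D → E := fun g => if hg : ∃ w, R g w then hg.choose else 0
  have hφ : ∀ g w, R g w → φ g = w := fun g w hg => by
    have h1 : ∃ w, R g w := ⟨w, hg⟩
    simp only [φ, dif_pos h1]
    exact huniq g _ _ h1.choose_spec hg
  have hφ0 : ∀ g, (¬ ∃ w, R g w) → φ g = 0 := fun g hg => by
    simp only [φ, dif_neg hg]
  refine ⟨φ, ⟨⟨K, fun g k hk => ?_⟩, fun p a b x hp g => ?_⟩, ?_⟩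
  · by_cases hg : ∃ w, R g w
    · obtain ⟨w, hw⟩ := hg
      rw [hφ _ _ hw, hφ _ _ (hright g w k hk hw)]
    · rw [hφ0 g hg, hφ0]
      rintro ⟨w, hw⟩
      have := hright _ w k⁻¹ (K.inv_mem hk) hw
      rw [mul_inv_cancel_right] at this
      exact hg ⟨w, this⟩
  · by_cases hg : ∃ w, R g w
    · obtain ⟨w, hw⟩ := hg
      rw [hφ _ _ hw, hφ _ _ (hleft p a b x hp g w hw)]
      rfl
    · rw [hφ0 g hg, hφ0, map_zero, smul_zero]
      rintro ⟨w, hw⟩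
      have := hleft _ _ _ _ (inv_val_upper hp) _ w hw
      rw [inv_mul_cancel_left] at this
      exact hg ⟨_, this⟩
  · refine hφ 1 v ⟨1, 1, 1, 0, 1, ?_, K.one_mem, (mul_one 1).symm, by rw [hW1]; rfl⟩
    simp [Matrix.one_fin_two]

end Nonzero

/-! ### The intertwining operators -/

section Intertwining

variable {D : Type*} [DivisionRing D] [TopologicalSpace D] [MeasurableSpace D]
  {E : Type*} [NormedAddCommGroup E] [NormedSpace ℂ E]

/-- The flat section through an element of an induced representation. -/
def flatInd (n : ℕ) (N : D → ℝ) (σ : Dˣ × Dˣ →* (E →L[ℂ] E)) (z : ℂ) (φ : GL2 D → E) :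
    GL2 D → E :=
  Classical.epsilon fun ψ => ψ ∈ ind n N σ z ∧ ∀ k ∈ integralMatrices N, ψ k = φ k

/-- The flat section through an element of an opposite induced representation. -/
def flatIndBar (n : ℕ) (N : D → ℝ) (σ : Dˣ × Dˣ →* (E →L[ℂ] E)) (z : ℂ) (φ : GL2 D → E) :
    GL2 D → E :=
  Classical.epsilon fun ψ => ψ ∈ indBar n N σ z ∧ ∀ k ∈ integralMatrices N, ψ k = φ k

/-- The intertwining integral along a flat section. -/
def flatIntegral (n : ℕ) (N : D → ℝ) (μ : Measure Dˣ) (σ : Dˣ × Dˣ →* (E →L[ℂ] E))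
    (φ : GL2 D → E) (g : GL2 D) (z : ℂ) : E :=
  ∫ x, flatInd n N σ z φ (lowerUnip x * g) ∂(unitsAddMeasure n N μ)

/-- The opposite intertwining integral along a flat section. -/
def flatIntegralBar (n : ℕ) (N : D → ℝ) (μ : Measure Dˣ) (σ : Dˣ × Dˣ →* (E →L[ℂ] E))
    (φ : GL2 D → E) (g : GL2 D) (z : ℂ) : E :=
  ∫ x, flatIndBar n N σ z φ (upperUnip x * g) ∂(unitsAddMeasure n N μ)

variable [IsTopologicalRing D] [T2Space D]
  [ContinuousInv₀ D] [BorelSpace D] [BorelSpace Dˣ]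
  [SecondCountableTopology D] [SecondCountableTopology Dˣ] [CompleteSpace E]
  {q : ℝ} {n : ℕ} {N : D → ℝ} {μ : Measure Dˣ} {σ : Dˣ × Dˣ →* (E →L[ℂ] E)} {p : ℕ} {ω : ℂ}

/-- The power of the height provides a flat section, and the Iwasawa decomposition makes it unique,
so the choice operator has no freedom. -/
lemma flatInd_eq (h : IsNormalizedAbs q n N μ) {s : ℂ} {φ : GL2 D → E} (hφ : φ ∈ ind n N σ s)
    (z : ℂ) : flatInd n N σ z φ = flat N s φ z := by
  have h1 : flat N s φ z ∈ ind n N σ z ∧ ∀ k ∈ integralMatrices N, flat N s φ z k = φ k :=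
    ⟨flat_mem_ind h hφ z, fun k hk => flat_of_mem h s φ z hk⟩
  have h2 : flatInd n N σ z φ ∈ ind n N σ z ∧
      ∀ k ∈ integralMatrices N, flatInd n N σ z φ k = φ k :=
    Classical.epsilon_spec (p := fun ψ => ψ ∈ ind n N σ z ∧ ∀ k ∈ integralMatrices N, ψ k = φ k)
      ⟨_, h1⟩
  exact ind_eq_of_eqOn h h2.1 h1.1 fun k hk => (h2.2 k hk).trans (h1.2 k hk).symm

lemma flatIndBar_eq (h : IsNormalizedAbs q n N μ) {s : ℂ} {φ : GL2 D → E}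
    (hφ : φ ∈ indBar n N σ s) (z : ℂ) (g : GL2 D) : flatIndBar n N σ z φ g =
      flat N s (fun g => φ (weylSwap D * g)) z (weylSwap D * g) := by
  set Ψ : GL2 D → E := fun g => φ (weylSwap D * g) with hΨ
  have hw := weylSwap_mem_integralMatrices h
  have hΨs : Ψ ∈ ind n N (swapRep σ) s := comp_weylSwap_mem_ind.2 hφ
  have h1 : (fun g => flat N s Ψ z (weylSwap D * g)) ∈ indBar n N σ z ∧
      ∀ k ∈ integralMatrices N, flat N s Ψ z (weylSwap D * k) = φ k := by
    refine ⟨comp_weylSwap_mem_ind.1 ?_, fun k hk => ?_⟩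
    · simp only [weylSwap_mul_cancel]
      exact flat_mem_ind h hΨs z
    · rw [flat_of_mem h s Ψ z (mul_mem_integralMatrices h hw hk), hΨ]
      dsimp only
      rw [weylSwap_mul_cancel]
  have h2 : flatIndBar n N σ z φ ∈ indBar n N σ z ∧
      ∀ k ∈ integralMatrices N, flatIndBar n N σ z φ k = φ k :=
    Classical.epsilon_spec
      (p := fun ψ => ψ ∈ indBar n N σ z ∧ ∀ k ∈ integralMatrices N, ψ k = φ k) ⟨_, h1⟩
  have h3 := ind_eq_of_eqOn h (comp_weylSwap_mem_ind.2 h2.1) (flat_mem_ind h hΨs z)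
    fun k hk => by
      rw [h2.2 _ (mul_mem_integralMatrices h hw hk), flat_of_mem h s Ψ z hk]
  have h4 := congrFun h3 (weylSwap D * g)
  rwa [weylSwap_mul_cancel] at h4

lemma weylSwap_upperUnip (x : D) (g : GL2 D) :
    weylSwap D * (upperUnip x * g) = lowerUnip x * (weylSwap D * g) := by
  rw [← mul_assoc, weylSwap_mul_upperUnip, mul_assoc]

lemma flatIntegral_eq (h : IsNormalizedAbs q n N μ) {s : ℂ} {φ : GL2 D → E}
    (hφ : φ ∈ ind n N σ s) (g : GL2 D) : flatIntegral n N μ σ φ g = fun z =>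
      ∫ x, flat N s φ z (lowerUnip x * g) ∂(unitsAddMeasure n N μ) := by
  funext z
  rw [flatIntegral, flatInd_eq h hφ]

lemma flatIntegralBar_eq (h : IsNormalizedAbs q n N μ) {s : ℂ} {φ : GL2 D → E}
    (hφ : φ ∈ indBar n N σ s) (g : GL2 D) : flatIntegralBar n N μ σ φ g = fun z =>
      ∫ x, flat N s (fun g => φ (weylSwap D * g)) z (lowerUnip x * (weylSwap D * g))
        ∂(unitsAddMeasure n N μ) := by
  funext z
  rw [flatIntegralBar]
  simp only [flatIndBar_eq h hφ, weylSwap_upperUnip]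

theorem meroCont_flatIntegral (H : RegHyp q p ω n N μ σ) {s : ℂ} {φ : GL2 D → E}
    (hφ : φ ∈ ind n N σ s) (g : GL2 D) :
    (∃ f, IsMeroCont (flatIntegral n N μ σ φ g) f) ∧
    (ω * (q : ℂ) ^ (-(p * s)) ≠ 1 →
      meroCont (flatIntegral n N μ σ φ g) s = regOp q p ω n N μ σ s φ g) := by
  rw [flatIntegral_eq H.abs hφ]
  obtain ⟨h1, h2⟩ := meroCont_integral_flat H hφ g
  refine ⟨h1, fun hs => ?_⟩
  rw [h2 s hs, flat_self H.abs]

theorem meroCont_flatIntegralBar (H : RegHyp q p ω n N μ (swapRep σ)) {s : ℂ} {φ : GL2 D → E}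
    (hφ : φ ∈ indBar n N σ s) (g : GL2 D) :
    (∃ f, IsMeroCont (flatIntegralBar n N μ σ φ g) f) ∧
    (ω * (q : ℂ) ^ (-(p * s)) ≠ 1 → meroCont (flatIntegralBar n N μ σ φ g) s =
      regOp q p ω n N μ (swapRep σ) s (fun g => φ (weylSwap D * g)) (weylSwap D * g)) := by
  rw [flatIntegralBar_eq H.abs hφ]
  obtain ⟨h1, h2⟩ := meroCont_integral_flat H (comp_weylSwap_mem_ind.2 hφ) (weylSwap D * g)
  refine ⟨h1, fun hs => ?_⟩
  rw [h2 s hs, flat_self H.abs]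

lemma integrable_of_mem_ind (H : RegHyp q p ω n N μ σ) {s : ℂ} (hs : 0 < s.re) {φ : GL2 D → E}
    (hφ : φ ∈ ind n N σ s) (g : GL2 D) :
    Integrable (fun x : D => φ (lowerUnip x * g)) (unitsAddMeasure n N μ) :=
  (regOp_eq_integral H hs hφ g).1

lemma integrable_of_mem_indBar (H : RegHyp q p ω n N μ (swapRep σ)) {s : ℂ} (hs : 0 < s.re)
    {φ : GL2 D → E} (hφ : φ ∈ indBar n N σ s) (g : GL2 D) :
    Integrable (fun x : D => φ (upperUnip x * g)) (unitsAddMeasure n N μ) := by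
  have h1 := (regOp_eq_integral H hs (comp_weylSwap_mem_ind.2 hφ) (weylSwap D * g)).1
  simpa only [← weylSwap_upperUnip, weylSwap_mul_cancel] using h1

variable {s c : ℂ}

lemma CompositionScalar.meroCont_eq (hc : CompositionScalar q p ω n N μ σ s c)
    {φ : GL2 D → E} (hφ : φ ∈ ind n N σ s) :
    (fun g => meroCont (flatIntegral n N μ σ φ g) s) = regOp q p ω n N μ σ s φ :=
  funext fun g => (meroCont_flatIntegral hc.hyp hφ g).2 hc.regular

theorem CompositionScalar.acts (hc : CompositionScalar q p ω n N μ σ s c)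
    {φ : GL2 D → E} (hφ : φ ∈ ind n N σ s) :
    (fun g => meroCont (flatIntegral n N μ σ φ g) s) ∈ indBar n N σ (-s) ∧
    (fun g => meroCont (flatIntegralBar n N μ σ
      (fun g => meroCont (flatIntegral n N μ σ φ g) s) g) (-s)) = c • φ := by
  rw [hc.meroCont_eq hφ]
  have h1 := regOp_mem_indBar hc.hyp hc.regular hφ
  refine ⟨h1, funext fun g => ?_⟩
  rw [(meroCont_flatIntegralBar hc.hyp_swap h1 g).2 hc.regular_neg]
  exact hc.comp φ hφ g

/-- The scalar is determined by the action of the composition. -/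
theorem CompositionScalar.iff_eq [Nontrivial E] (hc : CompositionScalar q p ω n N μ σ s c)
    (c' : ℂ) : (∀ φ ∈ ind n N σ s,
      (fun g => meroCont (flatIntegral n N μ σ φ g) s) ∈ indBar n N σ (-s) ∧
      (fun g => meroCont (flatIntegralBar n N μ σ
        (fun g => meroCont (flatIntegral n N μ σ φ g) s) g) (-s)) = c' • φ) ↔ c' = c := by
  refine ⟨fun h1 => ?_, fun h1 φ hφ => h1 ▸ hc.acts hφ⟩
  obtain ⟨v, hv⟩ := exists_ne (0 : E)
  -- Evaluating at 1 a function with φ(1) = v ≠ 0 separates two scalars.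
  obtain ⟨φ, hφ, hφ1⟩ := exists_mem_ind_apply_one hc.hyp.abs hc.hyp.rep s v
  have h2 := congrFun ((h1 φ hφ).2.symm.trans (hc.acts hφ).2) 1
  rw [Pi.smul_apply, Pi.smul_apply, hφ1] at h2
  exact smul_left_injective ℂ hv h2

end Intertwining

/-! ### Translation of the invariants of D to the axiomatic setting -/

section DivisionAlgebra

variable (F : Type*) [Field F] [ValuativeRel F] [TopologicalSpace F]
  [IsNonarchimedeanLocalField F]
  {D : Type*} [DivisionRing D] [Algebra F D] [TopologicalSpace D]
  {V V₁ V₂ : Type*}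
  [NormedAddCommGroup V] [InnerProductSpace ℂ V]
  [NormedAddCommGroup V₁] [InnerProductSpace ℂ V₁]
  [NormedAddCommGroup V₂] [InnerProductSpace ℂ V₂]

lemma twistNumber_eq_card_twists [Algebra.IsCentral F D] [FiniteDimensional F D]
    [IsModuleTopology F D] [MeasurableSpace D] [BorelSpace D] (n : ℕ) (π : Representation ℂ Dˣ V) :
    twistNumber F n π = Nat.card (twists (absNrd F n (D := D)) π) := by
  refine Nat.card_congr (Equiv.subtypeEquivRight fun ω => and_congr_left' ?_)
  exact forall_congr' fun u => imp_congr_left (mem_U_zero F u)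

/-- Positive distance means that there are no intertwining operators for the units of `O_D`. -/
lemma eq_zero_of_distRep_pos {n : ℕ} {π₁ : Representation ℂ Dˣ V₁} {π₂ : Representation ℂ Dˣ V₂}
    (hd : 0 < distRep F n π₁ π₂) (T : V₁ →ₗ[ℂ] V₂)
    (hT : ∀ g ∈ U (D := D) F n 0, ∀ v, T (π₁ g v) = π₂ g (T v)) : T = 0 := by
  by_contra hT0
  exact hd.ne' (Nat.le_zero.1 (Nat.sInf_le ⟨T, hT0, hT⟩))

end DivisionAlgebra

end DivAlg

theorem proposition4p1
    -- a non-archimedean local field `F`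
    {F : Type*} [Field F] [ValuativeRel F] [TopologicalSpace F] [IsNonarchimedeanLocalField F]
    -- a central division algebra `D` of degree `n` over `F`, with its natural topology
    {D : Type*} [DivisionRing D] [Algebra F D] [Algebra.IsCentral F D] [FiniteDimensional F D]
    (n : ℕ) (hn : Module.finrank F D = n ^ 2)
    [TopologicalSpace D] [IsModuleTopology F D] [MeasurableSpace D] [BorelSpace D]
    -- the Haar measure on `D^*` with `vol(O_D^*) = 1`
    (μ : MeasureTheory.Measure Dˣ) [μ.IsHaarMeasure] (hμ : μ (DivAlg.U F n 0) = 1)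
    -- irreducible unitary representations `π₁`, `π₂` of `D^*`
    {V₁ V₂ : Type*}
    [NormedAddCommGroup V₁] [InnerProductSpace ℂ V₁] [FiniteDimensional ℂ V₁]
    [NormedAddCommGroup V₂] [InnerProductSpace ℂ V₂] [FiniteDimensional ℂ V₂]
    (π₁ : Representation ℂ Dˣ V₁) (π₂ : Representation ℂ Dˣ V₂)
    (hπ₁ : DivAlg.IsIrredUnitary π₁) (hπ₂ : DivAlg.IsIrredUnitary π₂) :
    -- the objects are well defined
    DivAlg.IntertwiningWellDefined F n μ π₁ π₂ ∧
    MeasureTheory.Integrable (DivAlg.iotaIntegrand F n π₁ π₂) μ ∧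
    -- the case `dist(π₁, π₂) > 0`
    (0 < DivAlg.distRep F n π₁ π₂ → ∀ s c : ℂ,
      DivAlg.IsInvMu F n μ π₁ π₂ s c ↔
        c = DivAlg.iota F n μ π₁ π₂ / (Module.finrank ℂ V₁ * Module.finrank ℂ V₂)) ∧
    -- the case `π₁ = π₂ = π`, for `s` away from the poles `q^{ts} = 1`
    (∀ s c : ℂ,
      (DivAlg.resCard F : ℂ) ^ ((DivAlg.twistNumber F n π₁ : ℂ) * s) ≠ 1 →
      (DivAlg.IsInvMu F n μ π₁ π₁ s c ↔
        c = (DivAlg.iota F n μ π₁ π₁ +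
          (DivAlg.twistNumber F n π₁ : ℂ) ^ 2 /
            ((1 - (DivAlg.resCard F : ℂ) ^ ((DivAlg.twistNumber F n π₁ : ℂ) * s)) *
              (1 - (DivAlg.resCard F : ℂ) ^ (-((DivAlg.twistNumber F n π₁ : ℂ) * s))))) /
          (Module.finrank ℂ V₁ : ℂ) ^ 2)) := by
  have := IsModuleTopology.isTopologicalRing F D
  have := DivAlg.t2Space F (D := D)
  have := DivAlg.locallyCompactSpace F (D := D)
  have := DivAlg.continuousInv₀ F hn
  have := DivAlg.secondCountableTopology F D hn
  have : SecondCountableTopology Dˣ :=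
    (DivAlg.isOpenEmbedding_unitsVal D).isEmbedding.secondCountableTopology
  have := DivAlg.borelSpace_units (D := D)
  have h := DivAlg.isNormalizedAbs F hn μ hμ
  have := hπ₁.nontrivial
  have := hπ₂.nontrivial
  have hq : (((DivAlg.resCard F : ℕ) : ℝ) : ℂ) = (DivAlg.resCard F : ℂ) :=
    Complex.ofReal_natCast _
  refine ⟨?_, (DivAlg.integrable_and_hasSum_ballChi h hπ₁ hπ₂).1, fun hd s c => ?_,
    fun s c hs => ?_⟩
  · have : CompleteSpace (V₁ ⊗[ℂ] V₂) := FiniteDimensional.complete ℂ _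
    -- Well-definedness needs no relation between π₁ and π₂; the period n from the centre is enough.
    obtain ⟨ω, ω', H, H'⟩ := DivAlg.exists_regHyp h hπ₁ hπ₂
    exact ⟨fun s hs φ hφ g => DivAlg.integrable_of_mem_ind H hs hφ g,
      fun s hs φ hφ g => DivAlg.integrable_of_mem_indBar H' hs hφ g,
      fun s φ hφ g => (DivAlg.meroCont_flatIntegral H hφ g).1,
      fun s φ hφ g => (DivAlg.meroCont_flatIntegralBar H' hφ g).1⟩
  · have : CompleteSpace (V₁ ⊗[ℂ] V₂) := FiniteDimensional.complete ℂ _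
    have hc := DivAlg.compositionScalar_of_hom_eq_zero h hπ₁ hπ₂
      (DivAlg.isSmoothIsometric_tensorRep h hπ₁ hπ₂) (DivAlg.isExternalProduct_tensorRep π₁ π₂)
      (fun T hT => DivAlg.eq_zero_of_distRep_pos F hd T fun g hg => hT g (by
        change _ = _
        rw [neg_zero, zpow_zero]
        exact (DivAlg.mem_U_zero F g).1 hg)) s
    -- With N = `absNrd F n` and σ = `tensorRep π₁ π₂`, unfolding `IsInvMu` and `iota` gives exactly
    -- this equivalence.
    exact hc.iff_eq c
  · have : CompleteSpace (V₁ ⊗[ℂ] V₁) := FiniteDimensional.complete ℂ _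
    have hc := DivAlg.compositionScalar_self h hπ₁
      (DivAlg.isSmoothIsometric_tensorRep h hπ₁ hπ₁) (DivAlg.isExternalProduct_tensorRep π₁ π₁)
      (DivAlg.twistNumber_eq_card_twists F n π₁) (s := s) (by rwa [hq])
    rw [hq] at hc
    exact hc.iff_eq c
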